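/- Let $T$ be a complex torus of dimension $n$ with character lattice $M\simeq\mathbb Z^n$ and dual lattice $N$, and let $\Sigma$ be a smooth complete (finite, rational polyhedral) fan in $N_{\mathbb R}$. For cones write $\tau\le\sigma$ if $\tau$ is a face of $\sigma$, and give $\Sigma$ the topology whose open sets are the subsets closed under taking faces; $[\sigma]$ is the open set of all faces of $\sigma$. Let $\mathcal A_\Sigma$ be the sheaf of $M$-graded algebras on $\Sigma$ with stalks $\mathcal A_{\Sigma,\sigma}=\mathbb C[M\cap\sigma^\vee]$ and the inclusions $\mathcal A_{\Sigma,\sigma}\subset\mathcal A_{\Sigma,\tau}$, $\tau\le\sigma$, as restriction maps. *Sheaves and cosheaves.* $\mathcal A_\Sigma\text{-Mod}$ is the category of sheaves of $M$-graded $\mathcal A_\Sigma$-modules, and $\mathcal A_\Sigma\text{-mod}$ its full subcategory of sheaves all of whose stalks are finitely generated. A cosheaf of $\mathcal A_\Sigma$-modules consists of $M$-graded $\mathcal A_{\Sigma,\sigma}$-modules $C_\sigma$ and compatible graded $\mathcal A_{\Sigma,\sigma}$-linear maps $C_\tau\to C_\sigma$ for $\tau\le\sigma$; it belongs to $\text{co-}\mathcal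 A_\Sigma\text{-tcf}$ if, for each $\sigma$, the module $A(X_\sigma)\otimes_{\mathcal A_{\Sigma,\sigma}}C_\sigma$ is torsion cofinite, that is, each element is killed by a power of $I_\sigma$ and the elements killed by $I_\sigma$ form a finite dimensional space. Here $A(X_\sigma)$ is the semigroup algebra over $\mathbb C$ of the image of $M\cap\sigma^\vee$ in $M/(M\cap\sigma^\perp)$, and $I_\sigma$ is its maximal graded ideal. For a sheaf $F$ let $F^\vee$ be the cosheaf of graded duals, $(F^\vee)_\sigma^m=\mathrm{Hom}_{\mathbb C}(F_\sigma^{-m},\mathbb C)$. *The functor $\mathbf K$.* Fix an orientation of each cone. Put $\mathcal K_\sigma=(\mathcal A_{[\sigma]})^\vee$, where $\mathcal A_{[\sigma]}$ is the extension by zero of $\mathcal A_\Sigma|_{[\sigma]}$; for $\tau\le\sigma$ the inclusion $\mathcal A_{[\tau]}\to\mathcal A_{[\sigma]}$ induces $\mathcal K_\sigma\to\mathcal K_\tau$. For $F\in\mathcal A_\Sigma\text{-mod}$ let $C^\bullet(\mathcal K\otimes F)$ be the cellular complex of cosheaves with term $\bigoplus_{\dim\sigma=-i}\mathcal K_\sigma\otimes_{\mathcal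 A_{\Sigma,\sigma}}F_\sigma$ in degree $i$, whose differential is the sum, over the facets $\tau$ of $\sigma$, of the natural maps from the $\sigma$-term to the $\tau$-term with sign $\pm1$ according to whether the orientations of $\sigma$ and $\tau$ agree. For a bounded complex $F^\bullet$ in $\mathcal A_\Sigma\text{-mod}$, $\mathbf K(F^\bullet)$ is the totalization of the double complex $C^\bullet(\mathcal K\otimes P^\bullet)$, where $P^\bullet\to F^\bullet$ is a finite projective resolution (a quasi-isomorphism from a bounded complex of projective objects lying in $\mathcal A_\Sigma\text{-mod}$). **Proposition.** The sheaf $\mathcal A_\Sigma$ has a finite projective resolution, and for any choice of the orientations and any such resolution $P^\bullet\to\mathcal A_\Sigma$ the complex $\mathbf K(\mathcal A_\Sigma)$ computed from $P^\bullet$ is a bounded complex of objects of $\text{co-}\mathcal A_\Sigma\text{-tcf}$ and $$\mathbf K(\mathcal A_\Sigma)\simeq\mathcal A_\Sigma^\vee[n]$$ in $D^b(\text{co-}\mathcal A_\Sigma\text{-tcf})$, where $\mathcal A_\Sigma^\vee[n]$ is $\mathcal A_\Sigma^\vee$ placed in degree $-n$. -/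

import Mathlib

open CategoryTheory CategoryTheory.Limits
open scoped TensorProduct DirectSum

noncomputable section

namespace KoszulFan

/-! ### Smooth complete fans -/

/-- The lattice `N = ℤⁿ` sits in `N_ℝ = ℝⁿ`; this is the inclusion. -/
def latticeVec {n : ℕ} (v : Fin n → ℤ) : Fin n → ℝ := fun i => (v i : ℝ)

/-- A (finite) rational polyhedral fan in `N_ℝ = ℝⁿ`, consisting of strongly convex cones.
`PointedCone.IsFaceOf` is the notion of a face of a cone (for polyhedral cones these are exactly
the sets `σ ∩ m^⊥` with `m` nonnegative on `σ`). -/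
structure Fan (n : ℕ) where
  cones : Set (PointedCone ℝ (Fin n → ℝ))
  finite : cones.Finite
  rational : ∀ σ ∈ cones, ∃ s : Finset (Fin n → ℤ), σ = PointedCone.hull ℝ (latticeVec '' s)
  salient : ∀ σ ∈ cones, ∀ v ∈ σ, -v ∈ σ → v = 0
  face_mem : ∀ σ ∈ cones, ∀ τ : PointedCone ℝ (Fin n → ℝ), τ.IsFaceOf σ → τ ∈ cones
  inf_face : ∀ σ ∈ cones, ∀ τ ∈ cones, (σ ⊓ τ).IsFaceOf σ

variable {n : ℕ}

namespace Fan

/-- The fan is smooth: every cone is generated by part of a `ℤ`-basis of the lattice `N`. -/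
def IsSmooth (Δ : Fan n) : Prop :=
  ∀ σ ∈ Δ.cones, ∃ (b : Module.Basis (Fin n) ℤ (Fin n → ℤ)) (I : Finset (Fin n)),
    σ = PointedCone.hull ℝ ((fun i => latticeVec (b i)) '' I)

/-- The fan is complete: its cones cover `N_ℝ`. -/
def IsComplete (Δ : Fan n) : Prop := ∀ v : Fin n → ℝ, ∃ σ ∈ Δ.cones, v ∈ σ

/-- The finite set of cones of the fan, ordered by inclusion (`τ ≤ σ` iff `τ` is a face of `σ`). -/
def Cone (Δ : Fan n) : Type := {σ : PointedCone ℝ (Fin n → ℝ) // σ ∈ Δ.cones}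

instance (Δ : Fan n) : PartialOrder Δ.Cone :=
  inferInstanceAs (PartialOrder {σ : PointedCone ℝ (Fin n → ℝ) // σ ∈ Δ.cones})

instance (Δ : Fan n) : Finite Δ.Cone := Δ.finite.to_subtype

variable {Δ : Fan n}

/-- The linear span of a cone. -/
def Cone.span (σ : Δ.Cone) : Submodule ℝ (Fin n → ℝ) :=
  Submodule.span ℝ (σ.1 : Set (Fin n → ℝ))

/-- The dimension of a cone. -/
def Cone.dim (σ : Δ.Cone) : ℕ := Module.finrank ℝ σ.span

/-- The pairing `⟨m, v⟩` of a character `m ∈ M = ℤⁿ` with `v ∈ N_ℝ`. -/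
def pairing (m : Fin n → ℤ) (v : Fin n → ℝ) : ℝ := ∑ i, (m i : ℝ) * v i

/-- The semigroup `M ∩ σ^∨`. -/
def Cone.semigroup (σ : Δ.Cone) : AddSubmonoid (Fin n → ℤ) where
  carrier := {m | ∀ v ∈ σ.1, 0 ≤ pairing m v}
  zero_mem' v _ := by simp [pairing]
  add_mem' {a b} ha hb v hv := by
    have : pairing (a + b) v = pairing a v + pairing b v := by
      simp [pairing, add_mul, Finset.sum_add_distrib]
    rw [this]
    exact add_nonneg (ha v hv) (hb v hv)

/-- The subgroup `M ∩ σ^⊥`. -/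
def Cone.perp (σ : Δ.Cone) : AddSubgroup (Fin n → ℤ) where
  carrier := {m | ∀ v ∈ σ.1, pairing m v = 0}
  zero_mem' v _ := by simp [pairing]
  add_mem' {a b} ha hb v hv := by
    have : pairing (a + b) v = pairing a v + pairing b v := by
      simp [pairing, add_mul, Finset.sum_add_distrib]
    rw [this, ha v hv, hb v hv, add_zero]
  neg_mem' {a} ha v hv := by
    have : pairing (-a) v = - pairing a v := by simp [pairing]
    rw [this, ha v hv, neg_zero]

lemma Cone.semigroup_anti {τ σ : Δ.Cone} (h : τ ≤ σ) : σ.semigroup ≤ τ.semigroup :=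
  fun _ hm v hv => hm v (h hv)

end Fan

/-! ### Graded modules over semigroup algebras -/

section Graded

variable {M : Type} [AddCommGroup M]

/-- The group `M` with the preorder `m ≤ m'` iff `m' - m ∈ S`. -/
@[ext] structure Deg (S : AddSubmonoid M) where
  deg : M

instance (S : AddSubmonoid M) : Preorder (Deg S) where
  le p q := q.deg - p.deg ∈ S
  le_refl p := by simp
  le_trans p q r h h' := by
    have := S.add_mem h h'
    rwa [show q.deg - p.deg + (r.deg - q.deg) = r.deg - p.deg by abel] at this

/-- An `M`-graded module over the semigroup algebra `ℂ[S]`, `S ⊆ M`: complex vector spaces `X^m`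
for `m ∈ M` and linear maps `x^a : X^m → X^(m+a)` for `a ∈ S` with `x^0 = id` and
`x^a x^b = x^(a+b)`.  The monomials `x^a` being a basis of `ℂ[S]`, this is the same thing as an
`M`-graded `ℂ[S]`-module; the underlying `ℂ[S]`-module is `GrMod.Total` below. -/
abbrev GrMod (S : AddSubmonoid M) : Type 1 := Deg S ⥤ ModuleCat.{0} ℂ

variable {S : AddSubmonoid M}

/-- Multiplication by the monomial `x^a`. -/
def GrMod.mulMonomial (X : GrMod S) (a : S) (m : M) : X.obj ⟨m⟩ →ₗ[ℂ] X.obj ⟨m + a⟩ :=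
  (X.map (homOfLE (show (⟨m⟩ : Deg S) ≤ ⟨m + a⟩ by
    show m + a - m ∈ S
    rw [add_sub_cancel_left]; exact a.2))).hom

open Classical in
/-- The underlying vector space `⨁ m, X^m` of a graded module. -/
def GrMod.Total (X : GrMod S) : Type := ⨁ m : M, X.obj ⟨m⟩

instance (X : GrMod S) : AddCommGroup X.Total :=
  inferInstanceAs (AddCommGroup (⨁ m : M, X.obj ⟨m⟩))

instance (X : GrMod S) : Module ℂ X.Total :=
  inferInstanceAs (Module ℂ (⨁ m : M, X.obj ⟨m⟩))

open Classical in
/-- The inclusion of the component of degree `m`. -/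
def GrMod.ofDeg (X : GrMod S) (m : M) : X.obj ⟨m⟩ →ₗ[ℂ] X.Total :=
  DirectSum.lof ℂ M (fun m => X.obj ⟨m⟩) m

open Classical in
lemma GrMod.total_hom_ext (X : GrMod S) {f g : X.Total →ₗ[ℂ] X.Total}
    (h : ∀ m, f ∘ₗ X.ofDeg m = g ∘ₗ X.ofDeg m) : f = g :=
  DirectSum.linearMap_ext ℂ h

open Classical in
/-- Multiplication by `x^a` on `⨁ m, X^m`. -/
def GrMod.monomialEnd (X : GrMod S) (a : S) : X.Total →ₗ[ℂ] X.Total :=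
  DirectSum.toModule ℂ M _ (fun m => X.ofDeg (m + a) ∘ₗ X.mulMonomial a m)

lemma GrMod.monomialEnd_ofDeg (X : GrMod S) (a : S) (m : M) (x : X.obj ⟨m⟩) :
    X.monomialEnd a (X.ofDeg m x) = X.ofDeg (m + a) (X.mulMonomial a m x) := by
  classical
  exact DirectSum.toModule_lof (R := ℂ) (M := fun m => X.obj (⟨m⟩ : Deg S)) m x

lemma GrMod.ofDeg_map (X : GrMod S) {m m₁ m₂ : M} (h : m₁ = m₂)
    (f : (⟨m⟩ : Deg S) ⟶ ⟨m₁⟩) (g : (⟨m⟩ : Deg S) ⟶ ⟨m₂⟩) (x : X.obj ⟨m⟩) :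
    X.ofDeg m₁ ((X.map f).hom x) = X.ofDeg m₂ ((X.map g).hom x) := by
  subst h
  rw [Subsingleton.elim f g]

lemma GrMod.monomialEnd_zero (X : GrMod S) : X.monomialEnd 0 = LinearMap.id := by
  apply X.total_hom_ext
  intro m
  ext x
  rw [LinearMap.comp_apply, X.monomialEnd_ofDeg]
  have := X.ofDeg_map (m := m) (add_zero m)
    (homOfLE (by show m + (0 : M) - m ∈ S; simp)) (𝟙 _) x
  rw [X.map_id] at this
  exact this

lemma GrMod.monomialEnd_add (X : GrMod S) (a b : S) :
    X.monomialEnd (a + b) = X.monomialEnd a ∘ₗ X.monomialEnd b := by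
  apply X.total_hom_ext
  intro m
  ext x
  simp only [LinearMap.comp_apply, X.monomialEnd_ofDeg]
  have h : m + ((a + b : S) : M) = m + b + a := by push_cast; abel
  unfold GrMod.mulMonomial
  rw [← LinearMap.comp_apply (X.map _).hom (X.map _).hom, ← ModuleCat.hom_comp, ← X.map_comp]
  exact X.ofDeg_map h _ _ x

/-- The action of the algebra `ℂ[S]` on `⨁ m, X^m`. -/
def GrMod.action (X : GrMod S) : AddMonoidAlgebra ℂ S →ₐ[ℂ] Module.End ℂ X.Total :=
  AddMonoidAlgebra.lift ℂ (Module.End ℂ X.Total) S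
    { toFun := fun a => X.monomialEnd a.toAdd
      map_one' := X.monomialEnd_zero
      map_mul' := fun a b => X.monomialEnd_add a.toAdd b.toAdd }

instance (X : GrMod S) : Module (AddMonoidAlgebra ℂ S) X.Total :=
  Module.compHom X.Total X.action.toRingHom

end Graded

end KoszulFan
namespace KoszulFan

/-! ### Sheaves and cosheaves of graded modules on a fan -/

section Sheaves

variable {n : ℕ} {Δ : Fan n}

/-- Pairs (cone, degree), preordered by `(σ, m) ≤ (τ, m')` iff `τ` is a face of `σ` and
`m' - m ∈ M ∩ τ^∨`. -/
@[ext] structure SheafIdx (Δ : Fan n) where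
  cone : Δ.Cone
  deg : Fin n → ℤ

instance : Preorder (SheafIdx Δ) where
  le p q := q.cone ≤ p.cone ∧ q.deg - p.deg ∈ q.cone.semigroup
  le_refl p := ⟨le_refl _, by simp⟩
  le_trans p q r h h' := by
    refine ⟨h'.1.trans h.1, ?_⟩
    have := r.cone.semigroup.add_mem (Fan.Cone.semigroup_anti h'.1 h.2) h'.2
    rwa [show q.deg - p.deg + (r.deg - q.deg) = r.deg - p.deg by abel] at this

/-- Pairs (cone, degree), preordered by `(τ, m) ≤ (σ, m')` iff `τ` is a face of `σ` and
`m' - m ∈ M ∩ τ^∨`. -/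
@[ext] structure CosheafIdx (Δ : Fan n) where
  cone : Δ.Cone
  deg : Fin n → ℤ

instance : Preorder (CosheafIdx Δ) where
  le p q := p.cone ≤ q.cone ∧ q.deg - p.deg ∈ p.cone.semigroup
  le_refl p := ⟨le_refl _, by simp⟩
  le_trans p q r h h' := by
    refine ⟨h.1.trans h'.1, ?_⟩
    have := p.cone.semigroup.add_mem h.2 (Fan.Cone.semigroup_anti h.1 h'.2)
    rwa [show q.deg - p.deg + (r.deg - q.deg) = r.deg - p.deg by abel] at this

/-- The category of sheaves of `M`-graded modules over the sheaf of rings `𝒜_Δ` on the fan,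
`𝒜_{Δ,σ} = ℂ[M ∩ σ^∨]`.  Such a sheaf consists of an `M`-graded `ℂ[M ∩ σ^∨]`-module `F_σ` for
each cone `σ` and compatible graded `ℂ[M ∩ σ^∨]`-linear maps `F_σ → F_τ` for `τ ≤ σ`.
In terms of the graded components `F_σ^m` this is a functor: the
morphism `(σ, m) ≤ (τ, m + a)` with `a ∈ M ∩ τ^∨` acts as the restriction `F_σ^m → F_τ^m` followed
by multiplication by the monomial `x^a ∈ ℂ[M ∩ τ^∨]`. -/
abbrev Sheaf (Δ : Fan n) : Type 1 := SheafIdx Δ ⥤ ModuleCat.{0} ℂ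

/-- The category of cosheaves of `M`-graded `𝒜_Δ`-modules: an `M`-graded `ℂ[M ∩ σ^∨]`-module `C_σ`
for each cone `σ`, and compatible graded `ℂ[M ∩ σ^∨]`-linear maps `C_τ → C_σ` for `τ ≤ σ`.
The morphism `(τ, m) ≤ (σ, m + a)` with `a ∈ M ∩ τ^∨` acts as multiplication by `x^a` on `C_τ`
followed by the corestriction `C_τ^(m+a) → C_σ^(m+a)`. -/
abbrev Cosheaf (Δ : Fan n) : Type 1 := CosheafIdx Δ ⥤ ModuleCat.{0} ℂ

/-- The stalk `F_σ`, a graded module over `ℂ[M ∩ σ^∨]`. -/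
def Sheaf.stalk (F : Sheaf Δ) (σ : Δ.Cone) : GrMod σ.semigroup :=
  Monotone.functor (f := fun d : Deg σ.semigroup => (⟨σ, d.deg⟩ : SheafIdx Δ))
    (fun _ _ h => And.intro (le_refl σ) h) ⋙ F

/-- The stalk `C_σ`, a graded module over `ℂ[M ∩ σ^∨]`. -/
def Cosheaf.stalk (C : Cosheaf Δ) (σ : Δ.Cone) : GrMod σ.semigroup :=
  Monotone.functor (f := fun d : Deg σ.semigroup => (⟨σ, d.deg⟩ : CosheafIdx Δ))
    (fun _ _ h => And.intro (le_refl σ) h) ⋙ C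

/-- Objects of `𝒜_Δ-mod`: every stalk is a finitely generated `ℂ[M ∩ σ^∨]`-module. -/
def Sheaf.IsFG (F : Sheaf Δ) : Prop :=
  ∀ σ : Δ.Cone, Module.Finite (AddMonoidAlgebra ℂ σ.semigroup) (F.stalk σ).Total

/-! ### Torsion cofinite cosheaves -/

/-- The semigroup `σ^∨ ∩ M_σ`, where `M_σ = M / (M ∩ σ^⊥)` is the lattice of characters of the
torus `T_σ`. -/
def Fan.Cone.redSemigroup (σ : Δ.Cone) : AddSubmonoid ((Fin n → ℤ) ⧸ σ.perp) :=
  σ.semigroup.map (QuotientAddGroup.mk' σ.perp)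

/-- The coordinate ring `A(X_σ) = ℂ[σ^∨ ∩ M_σ]` of the `T_σ`-toric variety `X_σ`. -/
abbrev Fan.Cone.redRing (σ : Δ.Cone) : Type := AddMonoidAlgebra ℂ σ.redSemigroup

/-- The natural surjection `r : ℂ[M ∩ σ^∨] → A(X_σ)`. -/
def Fan.Cone.red (σ : Δ.Cone) : AddMonoidAlgebra ℂ σ.semigroup →+* σ.redRing :=
  AddMonoidAlgebra.mapDomainRingHom ℂ
    ((QuotientAddGroup.mk' σ.perp).addSubmonoidMap σ.semigroup)

/-- The maximal graded ideal `I_σ ⊆ A(X_σ)`, spanned by the monomials of nonzero degree. -/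
def Fan.Cone.maxIdeal (σ : Δ.Cone) : Ideal σ.redRing :=
  Ideal.span {f | ∃ s : σ.redSemigroup, s ≠ 0 ∧ f = AddMonoidAlgebra.single s 1}

/-- The socle `{x ∈ N | I x = 0}` of a module `N`. -/
def socle {R : Type} [CommRing R] (I : Ideal R) (N : Type) [AddCommGroup N] [Module R N] :
    Submodule R N where
  carrier := {x | ∀ a ∈ I, a • x = 0}
  zero_mem' a _ := smul_zero a
  add_mem' hx hy a ha := by rw [smul_add, hx a ha, hy a ha, add_zero]
  smul_mem' c x hx a ha := by rw [smul_comm, hx a ha, smul_zero]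

/-- A module is torsion cofinite with respect to `I` if each of its elements is killed by a power
of `I`, and its socle is a finite dimensional complex vector space. -/
def IsTorsionCofinite {R : Type} [CommRing R] [Algebra ℂ R] (I : Ideal R)
    (N : Type) [AddCommGroup N] [Module R N] : Prop :=
  (∀ x : N, ∃ k : ℕ, ∀ a ∈ I ^ k, a • x = 0) ∧
    Module.Finite ℂ (RestrictScalars ℂ R (socle I N))

/-- Objects of `co-𝒜_Δ-tcf`: for every cone the extension of scalars `r^* C_σ` of the stalk is a
torsion cofinite `A(X_σ)`-module. -/
def Cosheaf.IsTcf (C : Cosheaf Δ) : Prop :=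
  ∀ σ : Δ.Cone, IsTorsionCofinite σ.maxIdeal
    ((ModuleCat.extendScalars σ.red).obj
      (ModuleCat.of (AddMonoidAlgebra ℂ σ.semigroup) (C.stalk σ).Total))

/-! ### Extensions by zero of the structure sheaf, duality, and the Koszul kernel -/

/-- The component of cone `τ` and degree `m` of the extension by zero `𝒜_U` of `𝒜_Δ|_U`, for `U` an
open subset of the fan: the line `ℂ x^m` if `τ ∈ U` and `m ∈ M ∩ τ^∨`, and `0` otherwise. -/
def piece (U : LowerSet Δ.Cone) (p : SheafIdx Δ) : Submodule ℂ ℂ where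
  carrier := {c | c ≠ 0 → p.cone ∈ U ∧ p.deg ∈ p.cone.semigroup}
  zero_mem' h := absurd rfl h
  add_mem' {a b} ha hb h := by
    by_cases h0 : a = 0
    · exact hb (fun h1 => h (by rw [h0, h1, add_zero]))
    · exact ha h0
  smul_mem' c x hx h := hx (fun h1 => h (by rw [h1, smul_zero]))

lemma piece_le {U U' : LowerSet Δ.Cone} (hU : U ≤ U') {p q : SheafIdx Δ} (h : p ≤ q) :
    piece U p ≤ piece U' q := by
  intro c hc h0
  obtain ⟨h1, h2⟩ := hc h0
  refine ⟨hU (U.lower h.1 h1), ?_⟩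
  have := q.cone.semigroup.add_mem (Fan.Cone.semigroup_anti h.1 h2) h.2
  rwa [show p.deg + (q.deg - p.deg) = q.deg by abel] at this

/-- The extension by zero `𝒜_U` to the fan of the restriction of `𝒜_Δ` to the open subset `U`.
(A subset of the fan is open iff it is closed under passing to faces.)  The restriction maps are the
inclusions `x^m ↦ x^m`, and `x^a` sends `x^m` to `x^(m+a)`. -/
def extZero (U : LowerSet Δ.Cone) : Sheaf Δ where
  obj p := ModuleCat.of ℂ (piece U p)
  map f := ModuleCat.ofHom (Submodule.inclusion (piece_le le_rfl (leOfHom f)))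

/-- The inclusion `𝒜_U → 𝒜_{U'}` for `U ⊆ U'`. -/
def extZeroMap {U U' : LowerSet Δ.Cone} (h : U ≤ U') : extZero U ⟶ extZero U' where
  app _ := ModuleCat.ofHom (Submodule.inclusion (piece_le h le_rfl))

variable (Δ) in
/-- The structure sheaf `𝒜_Δ`, with stalks `ℂ[M ∩ σ^∨]`. -/
def structureSheaf : Sheaf Δ := extZero ⊤

/-- The degree `-m` component of `F_σ`, of which the degree `m` component of `F_σ^∨` is the dual. -/
def CosheafIdx.neg (p : CosheafIdx Δ) : SheafIdx Δ := ⟨p.cone, -p.deg⟩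

lemma CosheafIdx.neg_le {p q : CosheafIdx Δ} (h : p ≤ q) : q.neg ≤ p.neg := by
  refine ⟨h.1, ?_⟩
  show -p.deg - -q.deg ∈ p.cone.semigroup
  rw [show -p.deg - -q.deg = q.deg - p.deg by abel]
  exact h.2

/-- The graded dual `F^∨` of a sheaf of graded modules: `(F^∨)_σ^m = Hom(F_σ^(-m), ℂ)`. -/
def dual (F : Sheaf Δ) : Cosheaf Δ where
  obj p := ModuleCat.of ℂ (Module.Dual ℂ (F.obj p.neg))
  map f := ModuleCat.ofHom (F.map (homOfLE (CosheafIdx.neg_le (leOfHom f)))).hom.dualMap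
  map_id p := by
    rw [show homOfLE (CosheafIdx.neg_le (leOfHom (𝟙 p))) = 𝟙 p.neg from rfl, F.map_id]
    rfl
  map_comp {p q r} f g := by
    rw [show homOfLE (CosheafIdx.neg_le (leOfHom (f ≫ g))) =
      homOfLE (CosheafIdx.neg_le (leOfHom g)) ≫ homOfLE (CosheafIdx.neg_le (leOfHom f)) from rfl,
      F.map_comp]
    rfl

/-- The cosheaf morphism dual to a morphism of sheaves. -/
def dualMap {F G : Sheaf Δ} (f : F ⟶ G) : dual G ⟶ dual F where
  app p := ModuleCat.ofHom (f.app p.neg).hom.dualMap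
  naturality p q g := by
    have := f.naturality (homOfLE (CosheafIdx.neg_le (leOfHom g)))
    apply ModuleCat.hom_ext
    refine LinearMap.ext fun (φ : Module.Dual ℂ (G.obj p.neg)) => LinearMap.ext fun x => ?_
    exact congrArg φ (congrArg (fun k => k.hom x) this).symm

/-- The Koszul kernel `𝒦_σ = (𝒜_[σ])^∨`, where `[σ]` is the open set of faces of `σ`. -/
def kernel (σ : Δ.Cone) : Cosheaf Δ := dual (extZero (LowerSet.Iic σ))

/-- The natural projection `𝒦_σ → 𝒦_ρ` for `ρ ≤ σ`, dual to the inclusion `𝒜_[ρ] → 𝒜_[σ]`. -/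
def kernelMap {ρ σ : Δ.Cone} (h : ρ ≤ σ) : kernel σ ⟶ kernel ρ :=
  dualMap (extZeroMap (LowerSet.Iic_le.2 h))

end Sheaves
end KoszulFan
namespace KoszulFan
section Tensor
variable {n : ℕ} {Δ : Fan n}

/-! ### The tensor products `𝒦_σ ⊗ N_σ` -/

/-- Multiplication by the monomial of degree `i' - i ∈ M ∩ σ^∨` on `𝒦_σ`; thus each
`𝒦_{σ,τ}` is an `M`-graded `ℂ[M ∩ σ^∨]`-module.  For `τ ≤ σ` this is the restriction of the
`ℂ[M ∩ τ^∨]`-module structure on the stalk, and for other `τ` the stalk vanishes. -/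
def kernelAct (σ τ : Δ.Cone) {i i' : Fin n → ℤ} (h : i' - i ∈ σ.semigroup) :
    (kernel σ).obj ⟨τ, i⟩ →ₗ[ℂ] (kernel σ).obj ⟨τ, i'⟩ :=
  (Submodule.inclusion (show piece (LowerSet.Iic σ) (⟨τ, -i'⟩ : SheafIdx Δ) ≤
      piece (LowerSet.Iic σ) ⟨τ, -i⟩ from fun c hc h0 => by
    obtain ⟨h1, h2⟩ := hc h0
    refine ⟨h1, ?_⟩
    have := τ.semigroup.add_mem h2 (Fan.Cone.semigroup_anti h1 h)
    rwa [show (-i' + (i' - i)) = -i by abel] at this)).dualMap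

/-- `⨁_j 𝒦_{σ,τ}^(m-j) ⊗_ℂ N_σ^j`, for `p = (τ, m)`. -/
abbrev TensorSum (σ : Δ.Cone) (N : Sheaf Δ) (p : CosheafIdx Δ) : Type :=
  ⨁ j : Fin n → ℤ, ((kernel σ).obj ⟨p.cone, p.deg - j⟩ ⊗[ℂ] N.obj ⟨σ, j⟩)

/-- The summand of index `j`. -/
def tensorOf (σ : Δ.Cone) (N : Sheaf Δ) (p : CosheafIdx Δ) (j : Fin n → ℤ) :
    ((kernel σ).obj ⟨p.cone, p.deg - j⟩ ⊗[ℂ] N.obj ⟨σ, j⟩) →ₗ[ℂ] TensorSum σ N p :=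
  DirectSum.lof ℂ (Fin n → ℤ)
    (fun j => ((kernel σ).obj ⟨p.cone, p.deg - j⟩ ⊗[ℂ] N.obj ⟨σ, j⟩)) j

lemma tensor_deg {m j j' : Fin n → ℤ} {S : AddSubmonoid (Fin n → ℤ)} (h : j' - j ∈ S) :
    (m - j) - (m - j') ∈ S := by
  rwa [show (m - j) - (m - j') = j' - j by abel]

/-- The relations `(x^a k) ⊗ y = k ⊗ (x^a y)`, for `a = j' - j ∈ M ∩ σ^∨`. -/
def tensorRel (σ : Δ.Cone) (N : Sheaf Δ) (p : CosheafIdx Δ) : Submodule ℂ (TensorSum σ N p) :=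
  Submodule.span ℂ {z | ∃ (j j' : Fin n → ℤ) (h : j' - j ∈ σ.semigroup)
    (k : (kernel σ).obj ⟨p.cone, p.deg - j'⟩) (y : N.obj ⟨σ, j⟩),
    z = tensorOf σ N p j (kernelAct σ p.cone (tensor_deg h) k ⊗ₜ y) -
      tensorOf σ N p j' (k ⊗ₜ (N.map (homOfLE (show (⟨σ, j⟩ : SheafIdx Δ) ≤ ⟨σ, j'⟩ from
        ⟨le_refl σ, h⟩))).hom y)}

/-- The map `𝒦_{σ,τ}^i → 𝒦_{ρ,τ'}^(i')`, for `ρ ≤ σ`, `τ ≤ τ'` and `i' - i ∈ M ∩ τ^∨`: the projection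
`𝒦_σ → 𝒦_ρ` combined with the structure map of the cosheaf. -/
def kernelBimap {ρ σ : Δ.Cone} (h : ρ ≤ σ) {p q : CosheafIdx Δ} (hpq : p ≤ q) :
    (kernel σ).obj p →ₗ[ℂ] (kernel ρ).obj q :=
  ((kernelMap h).app p ≫ (kernel ρ).map (homOfLE hpq)).hom

/-- The map `N_σ^j → N'_ρ^j` given by a morphism of sheaves `N → N'` and restriction to `ρ ≤ σ`. -/
def sheafBimap {ρ σ : Δ.Cone} (h : ρ ≤ σ) {N N' : Sheaf Δ} (g : N ⟶ N') (j : Fin n → ℤ) :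
    N.obj ⟨σ, j⟩ →ₗ[ℂ] N'.obj ⟨ρ, j⟩ :=
  (g.app ⟨σ, j⟩ ≫ N'.map (homOfLE (show (⟨σ, j⟩ : SheafIdx Δ) ≤ ⟨ρ, j⟩ from
    ⟨h, by simp⟩))).hom

lemma shift_le {p q : CosheafIdx Δ} (hpq : p ≤ q) (j : Fin n → ℤ) :
    (⟨p.cone, p.deg - j⟩ : CosheafIdx Δ) ≤ ⟨q.cone, q.deg - j⟩ := by
  refine ⟨hpq.1, ?_⟩
  show q.deg - j - (p.deg - j) ∈ p.cone.semigroup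
  rw [sub_sub_sub_cancel_right]
  exact hpq.2

/-- The map induced on `⨁_j 𝒦_{σ,τ}^(m-j) ⊗ N_σ^j`. -/
def tensorSumMap {ρ σ : Δ.Cone} (h : ρ ≤ σ) {N N' : Sheaf Δ} (g : N ⟶ N')
    {p q : CosheafIdx Δ} (hpq : p ≤ q) : TensorSum σ N p →ₗ[ℂ] TensorSum ρ N' q :=
  DirectSum.toModule ℂ _ _ fun j => tensorOf ρ N' q j ∘ₗ
    TensorProduct.map (kernelBimap h (shift_le hpq j)) (sheafBimap h g j)

lemma tensorSumMap_of {ρ σ : Δ.Cone} (h : ρ ≤ σ) {N N' : Sheaf Δ} (g : N ⟶ N')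
    {p q : CosheafIdx Δ} (hpq : p ≤ q) (j : Fin n → ℤ)
    (k : (kernel σ).obj ⟨p.cone, p.deg - j⟩) (y : N.obj ⟨σ, j⟩) :
    tensorSumMap h g hpq (tensorOf σ N p j (k ⊗ₜ y)) =
      tensorOf ρ N' q j (kernelBimap h (shift_le hpq j) k ⊗ₜ sheafBimap h g j y) := by
  unfold tensorSumMap
  conv_lhs => enter [2]; unfold tensorOf
  rw [DirectSum.toModule_lof]
  simp

lemma kernelBimap_act {ρ σ τ τ' : Δ.Cone} (h : ρ ≤ σ) {i i' l l' : Fin n → ℤ}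
    (hi : i' - i ∈ σ.semigroup) (hl : l' - l ∈ ρ.semigroup)
    (h1 : (⟨τ, i⟩ : CosheafIdx Δ) ≤ ⟨τ', l⟩) (h2 : (⟨τ, i'⟩ : CosheafIdx Δ) ≤ ⟨τ', l'⟩)
    (k : (kernel σ).obj ⟨τ, i⟩) :
    kernelBimap h h2 (kernelAct σ τ hi k) = kernelAct ρ τ' hl (kernelBimap h h1 k) := rfl

lemma sheafBimap_map {ρ σ : Δ.Cone} (h : ρ ≤ σ) {N N' : Sheaf Δ} (g : N ⟶ N') {j j' : Fin n → ℤ}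
    (f : (⟨σ, j⟩ : SheafIdx Δ) ⟶ ⟨σ, j'⟩) (f' : (⟨ρ, j⟩ : SheafIdx Δ) ⟶ ⟨ρ, j'⟩)
    (y : N.obj ⟨σ, j⟩) :
    sheafBimap h g j' ((N.map f).hom y) = (N'.map f').hom (sheafBimap h g j y) := by
  unfold sheafBimap
  simp only [← LinearMap.comp_apply, ← ModuleCat.hom_comp]
  congr 2
  rw [← Category.assoc, g.naturality, Category.assoc, Category.assoc, ← N'.map_comp, ← N'.map_comp]
  rfl

lemma tensorRel_le {ρ σ : Δ.Cone} (h : ρ ≤ σ) {N N' : Sheaf Δ} (g : N ⟶ N')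
    {p q : CosheafIdx Δ} (hpq : p ≤ q) :
    tensorRel σ N p ≤ (tensorRel ρ N' q).comap (tensorSumMap h g hpq) := by
  refine Submodule.span_le.2 ?_
  rintro _ ⟨j, j', hj, k, y, rfl⟩
  refine Submodule.subset_span ⟨j, j', Fan.Cone.semigroup_anti h hj,
    kernelBimap h (shift_le hpq j') k, sheafBimap h g j y, ?_⟩
  rw [map_sub, tensorSumMap_of, tensorSumMap_of,
    kernelBimap_act h (tensor_deg hj) (tensor_deg (Fan.Cone.semigroup_anti h hj))
      (shift_le hpq j') (shift_le hpq j), sheafBimap_map]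

/-- The degree `m` component of the graded tensor product `𝒦_{σ,τ} ⊗_{ℂ[M ∩ σ^∨]} N_σ`,
for `p = (τ, m)`. -/
abbrev TensorObj (σ : Δ.Cone) (N : Sheaf Δ) (p : CosheafIdx Δ) : Type :=
  TensorSum σ N p ⧸ tensorRel σ N p

/-- Functoriality of `TensorObj` in all three variables. -/
def tensorMap {ρ σ : Δ.Cone} (h : ρ ≤ σ) {N N' : Sheaf Δ} (g : N ⟶ N')
    {p q : CosheafIdx Δ} (hpq : p ≤ q) : TensorObj σ N p →ₗ[ℂ] TensorObj ρ N' q :=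
  Submodule.mapQ _ _ (tensorSumMap h g hpq) (tensorRel_le h g hpq)

lemma tensorObj_hom_ext {σ : Δ.Cone} {N : Sheaf Δ} {p : CosheafIdx Δ} {V : Type} [AddCommGroup V]
    [Module ℂ V] {f g : TensorObj σ N p →ₗ[ℂ] V}
    (h : ∀ j k y, f ((tensorRel σ N p).mkQ (tensorOf σ N p j (k ⊗ₜ y))) =
      g ((tensorRel σ N p).mkQ (tensorOf σ N p j (k ⊗ₜ y)))) : f = g := by
  apply Submodule.linearMap_qext
  apply DirectSum.linearMap_ext
  intro j
  apply TensorProduct.ext'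
  intro k y
  exact h j k y

lemma tensorMap_of {ρ σ : Δ.Cone} (h : ρ ≤ σ) {N N' : Sheaf Δ} (g : N ⟶ N')
    {p q : CosheafIdx Δ} (hpq : p ≤ q) (j : Fin n → ℤ)
    (k : (kernel σ).obj ⟨p.cone, p.deg - j⟩) (y : N.obj ⟨σ, j⟩) :
    tensorMap h g hpq ((tensorRel σ N p).mkQ (tensorOf σ N p j (k ⊗ₜ y))) =
      (tensorRel ρ N' q).mkQ
        (tensorOf ρ N' q j (kernelBimap h (shift_le hpq j) k ⊗ₜ sheafBimap h g j y)) := by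
  show (tensorRel ρ N' q).mkQ (tensorSumMap h g hpq _) = _
  rw [tensorSumMap_of]

lemma tensorMap_id (σ : Δ.Cone) (N : Sheaf Δ) (p : CosheafIdx Δ) :
    tensorMap (le_refl σ) (𝟙 N) (le_refl p) = LinearMap.id := by
  apply tensorObj_hom_ext
  intro j k y
  rw [tensorMap_of]
  have : sheafBimap (le_refl σ) (𝟙 N) j y = y := by
    unfold sheafBimap
    rw [show homOfLE _ = 𝟙 (⟨σ, j⟩ : SheafIdx Δ) from rfl, N.map_id]
    rfl
  rw [this]
  rfl

lemma tensorMap_comp {ξ ρ σ : Δ.Cone} (h : ρ ≤ σ) (h' : ξ ≤ ρ) {N N' N'' : Sheaf Δ} (g : N ⟶ N')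
    (g' : N' ⟶ N'') {p q r : CosheafIdx Δ} (hpq : p ≤ q) (hqr : q ≤ r) :
    tensorMap (h'.trans h) (g ≫ g') (hpq.trans hqr) = tensorMap h' g' hqr ∘ₗ tensorMap h g hpq := by
  apply tensorObj_hom_ext
  intro j k y
  rw [LinearMap.comp_apply, tensorMap_of, tensorMap_of, tensorMap_of]
  have : sheafBimap (h'.trans h) (g ≫ g') j y = sheafBimap h' g' j (sheafBimap h g j y) := by
    unfold sheafBimap
    simp only [← LinearMap.comp_apply, ← ModuleCat.hom_comp]
    congr 2
    rw [NatTrans.comp_app, Category.assoc, Category.assoc, g'.naturality_assoc, ← N''.map_comp]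
    rfl
  rw [this]
  rfl

/-- The cosheaf `𝒦_σ ⊗_{ℂ[M ∩ σ^∨]} N_σ`. -/
def tensorCosheaf (σ : Δ.Cone) (N : Sheaf Δ) : Cosheaf Δ where
  obj p := ModuleCat.of ℂ (TensorObj σ N p)
  map f := ModuleCat.ofHom (tensorMap (le_refl σ) (𝟙 N) (leOfHom f))
  map_id p := by
    apply ModuleCat.hom_ext
    exact tensorMap_id σ N p
  map_comp {p q r} f f' := by
    apply ModuleCat.hom_ext
    have := tensorMap_comp (le_refl σ) (le_refl σ) (𝟙 N) (𝟙 N) (leOfHom f) (leOfHom f')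
    rw [Category.comp_id] at this
    exact this

/-- The morphism of cosheaves `𝒦_σ ⊗ N_σ → 𝒦_ρ ⊗ N'_ρ`. -/
def tensorCosheafMap {ρ σ : Δ.Cone} (h : ρ ≤ σ) {N N' : Sheaf Δ} (g : N ⟶ N') :
    tensorCosheaf σ N ⟶ tensorCosheaf ρ N' where
  app p := ModuleCat.ofHom (tensorMap h g (le_refl p))
  naturality p q f := by
    apply ModuleCat.hom_ext
    have h1 := tensorMap_comp (le_refl σ) h (𝟙 N) g (leOfHom f) (le_refl q)
    have h2 := tensorMap_comp h (le_refl ρ) g (𝟙 N') (le_refl p) (leOfHom f)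
    rw [Category.id_comp] at h1
    rw [Category.comp_id] at h2
    exact h1.symm.trans h2

open Opposite in
/-- The `Δ`-diagram of cosheaves `𝒦 ⊗ N = {𝒦_σ ⊗ N_σ}`, functorially in the sheaf `N`. -/
def tensorDiagram : Sheaf Δ ⥤ (Δ.Coneᵒᵖ ⥤ Cosheaf Δ) where
  obj N :=
    { obj := fun σ => tensorCosheaf σ.unop N
      map := fun f => tensorCosheafMap (leOfHom f.unop) (𝟙 N)
      map_id := fun σ => by
        ext p : 2
        apply ModuleCat.hom_ext
        exact tensorMap_id σ.unop N p
      map_comp := fun f f' => by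
        ext p : 2
        apply ModuleCat.hom_ext
        have := tensorMap_comp (leOfHom f.unop) (leOfHom f'.unop) (𝟙 N) (𝟙 N) (le_refl p) (le_refl p)
        rw [Category.comp_id] at this
        exact this }
  map g :=
    { app := fun σ => tensorCosheafMap (le_refl σ.unop) g
      naturality := fun σ ρ f => by
        ext p : 2
        apply ModuleCat.hom_ext
        have h1 := tensorMap_comp (leOfHom f.unop) (le_refl ρ.unop) (𝟙 _) g (le_refl p) (le_refl p)
        have h2 := tensorMap_comp (le_refl σ.unop) (leOfHom f.unop) g (𝟙 _) (le_refl p) (le_refl p)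
        rw [Category.id_comp] at h1
        rw [Category.comp_id] at h2
        exact h1.symm.trans h2 }
  map_id N := by
    ext σ p : 4
    apply ModuleCat.hom_ext
    exact tensorMap_id σ.unop N p
  map_comp g g' := by
    ext σ p : 4
    apply ModuleCat.hom_ext
    exact tensorMap_comp (le_refl σ.unop) (le_refl σ.unop) g g' (le_refl p) (le_refl p)

end Tensor
end KoszulFan
namespace KoszulFan

/-! ### Orientations and incidence signs -/

section Incidence

variable {V : Type} [AddCommGroup V] [Module ℝ V]

/-- An ordered basis `b` of `W'` and an ordered basis `c` of `W`, where `dim W = dim W' + 1`, are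
compatible (relative to a cone `C`) if `c = (v, b)` for a vector `v ∈ C`. -/
def BasesCompat (C : Set V) {W' W : Submodule ℝ V} {k' k : ℕ}
    (b : Module.Basis (Fin k') ℝ W') (c : Module.Basis (Fin k) ℝ W) : Prop :=
  (∀ j : Fin k, (j : ℕ) = 0 → (c j : V) ∈ C) ∧
    ∀ (i : Fin k') (j : Fin k), (j : ℕ) = i + 1 → (c j : V) = b i

open Classical in
/-- The sign `±1` comparing an orientation `o'` of `W'` with an orientation `o` of `W`, where `W'` and
`W` are spanned by a facet of the cone `C` and by `C`: it is `1` iff, for compatible bases `b` of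
`W'` and `(v, b)` of `W`, the basis `b` is positive exactly if `(v, b)` is positive. -/
def incidenceSign (C : Set V) {W' W : Submodule ℝ V} {k' k : ℕ}
    (o' : Orientation ℝ W' (Fin k')) (o : Orientation ℝ W (Fin k)) : ℤ :=
  if ∃ (b : Module.Basis (Fin k') ℝ W') (c : Module.Basis (Fin k) ℝ W),
    BasesCompat C b c ∧ (b.orientation = o' ↔ c.orientation = o) then 1 else -1

open Classical in
/-- The sign of a basis with respect to an orientation. -/
def basisSign {W : Submodule ℝ V} {k : ℕ} (b : Module.Basis (Fin k) ℝ W)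
    (o : Orientation ℝ W (Fin k)) : ℤ := if b.orientation = o then 1 else -1

lemma basisSign_iff {W : Submodule ℝ V} {k : ℕ} (b b' : Module.Basis (Fin k) ℝ W)
    (o : Orientation ℝ W (Fin k)) :
    (b.orientation = o ↔ b'.orientation = o) ↔ 0 < b.det b' := by
  rw [← Module.Basis.orientation_eq_iff_det_pos]
  constructor
  · intro h
    by_cases hb : b.orientation = o
    · rw [hb, h.1 hb]
    · have hb' : ¬ b'.orientation = o := fun h' => hb (h.2 h')
      have h1 := (b.orientation_ne_iff_eq_neg o).1 (fun h => hb h.symm)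
      have h2 := (b'.orientation_ne_iff_eq_neg o).1 (fun h => hb' h.symm)
      rw [h1] at h2
      exact neg_injective h2
  · intro h
    rw [h]

lemma det_compat {C : Set V} {W' W : Submodule ℝ V} {k : ℕ} (ℓ : V →ₗ[ℝ] ℝ)
    (hC : ∀ v ∈ C, 0 ≤ ℓ v) (hW' : ∀ v ∈ W', ℓ v = 0) (hW : ∃ v ∈ W, ℓ v ≠ 0)
    {b b' : Module.Basis (Fin k) ℝ W'} {c c' : Module.Basis (Fin (k + 1)) ℝ W}
    (h : BasesCompat C b c) (h' : BasesCompat C b' c') :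
    0 < c.det c' ↔ 0 < b.det b' := by
  have key : ∀ (b : Module.Basis (Fin k) ℝ W') (c : Module.Basis (Fin (k + 1)) ℝ W),
      BasesCompat C b c → 0 < ℓ (c 0) ∧ ∀ x : W, ℓ x = c.repr x 0 * ℓ (c 0) := by
    intro b c h
    have hx : ∀ x : W, ℓ x = c.repr x 0 * ℓ (c 0) := by
      intro x
      conv_lhs => rw [← c.sum_repr x]
      rw [Fin.sum_univ_succ]
      simp only [Submodule.coe_add, map_add, Submodule.coe_smul, map_smul, smul_eq_mul,
        AddSubmonoidClass.coe_finsetSum, map_sum]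
      rw [Finset.sum_eq_zero, add_zero]
      intro i _
      rw [h.2 i i.succ (by simp), hW' _ (b i).2, mul_zero]
    refine ⟨lt_of_le_of_ne (hC _ (h.1 0 rfl)) ?_, hx⟩
    intro h0
    obtain ⟨v, hv, hne⟩ := hW
    apply hne
    have := hx ⟨v, hv⟩
    rw [← h0, mul_zero] at this
    exact this
  obtain ⟨hpos, hx⟩ := key b c h
  obtain ⟨hpos', -⟩ := key b' c' h'
  have hle : ∀ i, (b i : V) ∈ W := fun i => by
    rw [← h.2 i i.succ (by simp)]; exact (c i.succ).2
  have hc0 : ∀ i : Fin k, c.repr (c' i.succ) 0 = 0 := by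
    intro i
    have h1 := hx (c' i.succ)
    rw [h'.2 i i.succ (by simp), hW' _ (b' i).2] at h1
    exact (mul_eq_zero.1 h1.symm).resolve_right hpos.ne'
  have hcs : ∀ i j : Fin k, c.repr (c' j.succ) i.succ = b.repr (b' j) i := by
    intro i j
    have : c' j.succ = ∑ l : Fin k, (b.repr (b' j) l) • c l.succ := by
      apply Subtype.ext
      rw [h'.2 j j.succ (by simp)]
      simp only [AddSubmonoidClass.coe_finsetSum, Submodule.coe_smul]
      conv_lhs => rw [← b.sum_repr (b' j)]
      simp only [AddSubmonoidClass.coe_finsetSum, Submodule.coe_smul]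
      exact Finset.sum_congr rfl fun l _ => by rw [h.2 l l.succ (by simp)]
    rw [this]
    simp [Finsupp.single_apply, Fin.succ_inj]
  have hdet : c.det c' = c.repr (c' 0) 0 * b.det b' := by
    rw [Module.Basis.det_apply, Module.Basis.det_apply, Matrix.det_succ_row_zero,
      Fin.sum_univ_succ, Finset.sum_eq_zero]
    · simp only [Fin.val_zero, pow_zero, one_mul, add_zero]
      congr 1
      congr 1
      ext i j
      simpa [Module.Basis.toMatrix_apply] using hcs i j
    · intro i _
      rw [Module.Basis.toMatrix_apply, hc0]
      simp
  rw [hdet]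
  have : 0 < c.repr (c' 0) 0 := by
    have h1 := hx (c' 0)
    rw [h1] at hpos'
    exact (pos_iff_pos_of_mul_pos hpos').2 hpos
  exact mul_pos_iff_of_pos_left this

/-- The incidence sign can be computed with any pair of compatible bases. -/
lemma incidenceSign_eq {C : Set V} {W' W : Submodule ℝ V} {k' k : ℕ} (hk : k = k' + 1)
    (ℓ : V →ₗ[ℝ] ℝ)
    (hC : ∀ v ∈ C, 0 ≤ ℓ v) (hW' : ∀ v ∈ W', ℓ v = 0) (hW : ∃ v ∈ W, ℓ v ≠ 0)
    (o' : Orientation ℝ W' (Fin k')) (o : Orientation ℝ W (Fin k))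
    {b : Module.Basis (Fin k') ℝ W'} {c : Module.Basis (Fin k) ℝ W} (h : BasesCompat C b c) :
    incidenceSign C o' o = basisSign b o' * basisSign c o := by
  classical
  subst hk
  have : (∃ (b : Module.Basis (Fin k') ℝ W') (c : Module.Basis (Fin (k' + 1)) ℝ W),
    BasesCompat C b c ∧ (b.orientation = o' ↔ c.orientation = o)) ↔
      (b.orientation = o' ↔ c.orientation = o) := by
    constructor
    · rintro ⟨b', c', h', hbc⟩
      have h1 := det_compat ℓ hC hW' hW h h'
      rw [← basisSign_iff c c' o, ← basisSign_iff b b' o'] at h1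
      tauto
    · intro hbc
      exact ⟨b, c, h, hbc⟩
  unfold incidenceSign basisSign
  simp only [this]
  by_cases h1 : b.orientation = o' <;> by_cases h2 : c.orientation = o <;> simp [h1, h2]

lemma basisSign_mul_self {W : Submodule ℝ V} {k : ℕ} (b : Module.Basis (Fin k) ℝ W)
    (o : Orientation ℝ W (Fin k)) : basisSign b o * basisSign b o = 1 := by
  unfold basisSign; split_ifs <;> rfl

lemma basisSign_swap {W : Submodule ℝ V} {k : ℕ} {b b' : Module.Basis (Fin k) ℝ W} {i j : Fin k}
    (hij : i ≠ j) (h : ∀ l, b' l = b (Equiv.swap i j l)) (o : Orientation ℝ W (Fin k)) :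
    basisSign b' o = - basisSign b o := by
  have hdet : b.det b' = -1 := by
    have : (b' : Fin k → W) = b ∘ Equiv.swap i j := funext h
    rw [this, AlternatingMap.map_swap _ _ hij, Module.Basis.det_self]
  have h1 := basisSign_iff b b' o
  rw [hdet] at h1
  have h2 : ¬ (b.orientation = o ↔ b'.orientation = o) := by
    rw [h1]; norm_num
  unfold basisSign
  by_cases hb : b.orientation = o <;> by_cases hb' : b'.orientation = o <;> simp_all

end Incidence

end KoszulFan
namespace KoszulFan
section Diamond
variable {n : ℕ} {Δ : Fan n}

/-- A choice of an orientation of (the linear span of) each cone. -/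
abbrev Fan.Orientations (Δ : Fan n) : Type :=
  ∀ σ : Δ.Cone, Orientation ℝ σ.span (Fin σ.dim)

/-- The sign `±1` depending on whether the orientations of `σ` and of its facet `τ` agree. -/
def incidence (o : Δ.Orientations) (σ τ : Δ.Cone) : ℤ :=
  incidenceSign (σ.1 : Set (Fin n → ℝ)) (o τ) (o σ)

section Faces
variable (B : Module.Basis (Fin n) ℝ (Fin n → ℝ))

/-- The cone generated by the basis vectors with indices in `I`. -/
def coneOf (I : Finset (Fin n)) : PointedCone ℝ (Fin n → ℝ) := PointedCone.hull ℝ (B '' I)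

lemma mem_coneOf {I : Finset (Fin n)} {x : Fin n → ℝ} :
    x ∈ coneOf B I ↔ (∀ i, 0 ≤ B.repr x i) ∧ ∀ i ∉ I, B.repr x i = 0 := by
  constructor
  · intro hx
    induction hx using Submodule.span_induction with
    | mem x hx =>
      obtain ⟨j, hj, rfl⟩ := hx
      refine ⟨fun i => ?_, fun i hi => ?_⟩
      · rw [B.repr_self, Finsupp.single_apply]; split_ifs <;> norm_num
      · rw [B.repr_self, Finsupp.single_apply, if_neg]
        rintro rfl
        exact hi hj
    | zero => simp
    | add x y _ _ hx hy =>
      refine ⟨fun i => ?_, fun i hi => ?_⟩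
      · rw [map_add]; exact add_nonneg (hx.1 i) (hy.1 i)
      · rw [map_add, Finsupp.add_apply, hx.2 i hi, hy.2 i hi, add_zero]
    | smul c x _ hx =>
      have : ∀ i, B.repr (c • x) i = (c : ℝ) * B.repr x i := fun i => by
        rw [show c • x = (c : ℝ) • x from rfl, map_smul]; rfl
      refine ⟨fun i => ?_, fun i hi => ?_⟩
      · rw [this]; exact mul_nonneg c.2 (hx.1 i)
      · rw [this, hx.2 i hi, mul_zero]
  · rintro ⟨h1, h2⟩
    rw [← B.sum_repr x]
    refine Submodule.sum_mem _ fun i _ => ?_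
    by_cases hi : i ∈ I
    · exact PointedCone.smul_mem _ (h1 i) (PointedCone.subset_hull ⟨i, hi, rfl⟩)
    · rw [h2 i hi, zero_smul]; exact Submodule.zero_mem _

lemma basis_mem_coneOf {I : Finset (Fin n)} {i : Fin n} : B i ∈ coneOf B I ↔ i ∈ I := by
  constructor
  · intro h
    by_contra hi
    have := ((mem_coneOf B).1 h).2 i hi
    simp at this
  · intro h
    exact PointedCone.subset_hull ⟨i, h, rfl⟩

lemma coneOf_le {I J : Finset (Fin n)} : coneOf B J ≤ coneOf B I ↔ J ⊆ I := by
  constructor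
  · intro h i hi
    exact (basis_mem_coneOf B).1 (h ((basis_mem_coneOf B).2 hi))
  · intro h
    exact Submodule.span_mono (Set.image_mono h)

lemma coneOf_face {I J : Finset (Fin n)} (h : J ⊆ I) :
    (coneOf B J).IsFaceOf (coneOf B I) := by
  refine ⟨(coneOf_le B).2 h, ?_⟩
  intro x y a hx hy ha hxy
  rw [mem_coneOf] at hx hy hxy ⊢
  refine ⟨hx.1, fun i hi => ?_⟩
  have := hxy.2 i hi
  rw [map_add, map_smul, Finsupp.add_apply, Finsupp.smul_apply, smul_eq_mul] at this
  have h1 := mul_nonneg ha.le (hx.1 i)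
  have h2 := hy.1 i
  have h3 : a * B.repr x i = 0 := by linarith
  exact (mul_eq_zero.1 h3).resolve_left ha.ne'

lemma face_coneOf {I : Finset (Fin n)} {τ : PointedCone ℝ (Fin n → ℝ)}
    (h : τ.IsFaceOf (coneOf B I)) : ∃ J ⊆ I, τ = coneOf B J := by
  classical
  refine ⟨I.filter (fun i => B i ∈ τ), Finset.filter_subset _ _, le_antisymm ?_ ?_⟩
  · intro x hx
    have hxI := (mem_coneOf B).1 (h.le hx)
    rw [mem_coneOf]
    refine ⟨hxI.1, fun i hi => ?_⟩
    by_contra h0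
    have hiI : i ∈ I := by
      by_contra hiI
      exact h0 (hxI.2 i hiI)
    apply hi
    rw [Finset.mem_filter]
    refine ⟨hiI, ?_⟩
    have hpos : 0 < B.repr x i := lt_of_le_of_ne (hxI.1 i) (Ne.symm h0)
    refine h.mem_of_smul_add_mem ((basis_mem_coneOf B).2 hiI)
      (y := x - B.repr x i • B i) ?_ hpos (by simpa using hx)
    rw [mem_coneOf]
    refine ⟨fun j => ?_, fun j hj => ?_⟩
    · rw [map_sub, map_smul, B.repr_self, Finsupp.sub_apply, Finsupp.smul_apply,
        Finsupp.single_apply]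
      split_ifs with hij
      · subst hij; simp
      · simpa using hxI.1 j
    · rw [map_sub, map_smul, B.repr_self, Finsupp.sub_apply, Finsupp.smul_apply,
        Finsupp.single_apply, if_neg, hxI.2 j hj]
      · simp
      · rintro rfl; exact hj hiI
  · refine Submodule.span_le.2 ?_
    rintro _ ⟨i, hi, rfl⟩
    exact (Finset.mem_filter.1 hi).2

lemma span_coneOf (I : Finset (Fin n)) :
    Submodule.span ℝ (coneOf B I : Set (Fin n → ℝ)) = Submodule.span ℝ (B '' I) := by
  apply le_antisymm
  · exact Submodule.span_le.2 (PointedCone.hull_le_span ℝ (B '' I))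
  · exact Submodule.span_mono PointedCone.subset_hull

lemma finrank_coneOf (I : Finset (Fin n)) :
    Module.finrank ℝ (Submodule.span ℝ (coneOf B I : Set (Fin n → ℝ))) = I.card := by
  classical
  rw [span_coneOf, ← Finset.coe_image, finrank_span_finset_eq_card,
    Finset.card_image_of_injective _ B.injective]
  have := (B.linearIndependent.linearIndepOn_id).mono
    (show ((I.image B : Finset _) : Set (Fin n → ℝ)) ⊆ Set.range B by
      rw [Finset.coe_image]; exact Set.image_subset_range _ _)
  exact this

lemma exists_basis_coneOf {I : Finset (Fin n)} {k : ℕ} {f : Fin k → Fin n}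
    (hf : Function.Injective f) (hI : ∀ i, i ∈ I ↔ ∃ j, f j = i) {W : Submodule ℝ (Fin n → ℝ)}
    (hW : W = Submodule.span ℝ (coneOf B I : Set (Fin n → ℝ))) :
    ∃ b : Module.Basis (Fin k) ℝ W, ∀ i, (b i : Fin n → ℝ) = B (f i) := by
  have hli : LinearIndependent ℝ (fun i => B (f i)) := B.linearIndependent.comp f hf
  have hspan : Submodule.span ℝ (Set.range fun i => B (f i)) = W := by
    rw [hW, span_coneOf]
    congr 1
    ext x
    constructor
    · rintro ⟨j, rfl⟩
      exact ⟨f j, (hI _).2 ⟨j, rfl⟩, rfl⟩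
    · rintro ⟨i, hi, rfl⟩
      obtain ⟨j, rfl⟩ := (hI i).1 hi
      exact ⟨j, rfl⟩
  subst hspan
  exact ⟨Module.Basis.span hli, fun i => congrArg Subtype.val (Module.Basis.span_apply hli i)⟩

end Faces

lemma Fan.Cone.exists_basis (hs : Δ.IsSmooth) (σ : Δ.Cone) :
    ∃ (B : Module.Basis (Fin n) ℝ (Fin n → ℝ)) (I : Finset (Fin n)), σ.1 = coneOf B I := by
  obtain ⟨b, I, h⟩ := hs σ.1 σ.2
  have hdet : IsUnit ((Pi.basisFun ℤ (Fin n)).det b) := (Pi.basisFun ℤ (Fin n)).isUnit_det b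
  let A : Matrix (Fin n) (Fin n) ℤ := Matrix.of fun i j => b i j
  have hA : IsUnit A.det := by
    rw [Module.Basis.det_apply] at hdet
    rw [← Matrix.det_transpose]
    convert hdet using 2
    ext i j
    simp [A, Module.Basis.toMatrix_apply]
  have hA' : IsUnit (A.map (Int.castRingHom ℝ)).det := by
    have := hA.map (Int.castRingHom ℝ)
    rwa [RingHom.map_det] at this
  have hli : LinearIndependent ℝ (fun i => latticeVec (b i)) :=
    Matrix.linearIndependent_rows_iff_isUnit.2 ((Matrix.isUnit_iff_isUnit_det _).2 hA')
  refine ⟨basisOfLinearIndependentOfCardEqFinrank' _ hli (by simp), I, ?_⟩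
  rw [h, coneOf]
  simp

lemma incidence_eq (o : Δ.Orientations) (B : Module.Basis (Fin n) ℝ (Fin n → ℝ))
    {σ τ : Δ.Cone} {I J : Finset (Fin n)} {p : Fin n} (hpI : p ∈ I) (hpJ : p ∉ J)
    (hτ : τ.1 = coneOf B J) (hσ : σ.1 = coneOf B I) (hdim : σ.dim = τ.dim + 1)
    {f : Fin τ.dim → Fin n} {g : Fin σ.dim → Fin n}
    {b : Module.Basis (Fin τ.dim) ℝ τ.span} {c : Module.Basis (Fin σ.dim) ℝ σ.span}
    (hb : ∀ i, (b i : Fin n → ℝ) = B (f i)) (hc : ∀ i, (c i : Fin n → ℝ) = B (g i))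
    (hg0 : ∀ j : Fin σ.dim, (j : ℕ) = 0 → g j = p)
    (hg : ∀ (i : Fin τ.dim) (j : Fin σ.dim), (j : ℕ) = i + 1 → g j = f i) :
    incidence o σ τ = basisSign b (o τ) * basisSign c (o σ) := by
  refine incidenceSign_eq hdim (B.coord p) ?_ ?_ ?_ _ _ ⟨?_, ?_⟩
  · intro v hv
    have hv : v ∈ σ.1 := hv
    rw [hσ, mem_coneOf] at hv
    exact hv.1 p
  · intro v hv
    have : τ.span ≤ LinearMap.ker (B.coord p) := by
      refine Submodule.span_le.2 fun w hw => ?_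
      have hw : w ∈ τ.1 := hw
      rw [hτ, mem_coneOf] at hw
      exact hw.2 p hpJ
    exact this hv
  · refine ⟨B p, Submodule.subset_span ?_, by simp⟩
    show B p ∈ σ.1
    rw [hσ]
    exact (basis_mem_coneOf B).2 hpI
  · intro j hj
    show (c j : Fin n → ℝ) ∈ σ.1
    rw [hc, hg0 j hj, hσ]
    exact (basis_mem_coneOf B).2 hpI
  · intro i j hij
    rw [hb, hc, hg i j hij]

lemma diamond (hs : Δ.IsSmooth) (o : Δ.Orientations) {ξ σ : Δ.Cone} (hle : ξ ≤ σ)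
    (hd : σ.dim = ξ.dim + 2) :
    ∃ τ₁ τ₂ : Δ.Cone, τ₁ ≠ τ₂ ∧
      (∀ τ : Δ.Cone, (ξ ≤ τ ∧ τ ≤ σ ∧ τ.dim = ξ.dim + 1) ↔ τ = τ₁ ∨ τ = τ₂) ∧
      incidence o σ τ₁ * incidence o τ₁ ξ + incidence o σ τ₂ * incidence o τ₂ ξ = 0 := by
  classical
  obtain ⟨B, I, hσ⟩ := σ.exists_basis hs
  have hface : ∀ τ : Δ.Cone, τ ≤ σ → ∃ J ⊆ I, τ.1 = coneOf B J := by
    intro τ hτ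
    apply face_coneOf
    rw [← hσ]
    have := Δ.inf_face σ.1 σ.2 τ.1 τ.2
    rwa [inf_eq_right.2 hτ] at this
  obtain ⟨J, hJI, hξ⟩ := hface ξ hle
  have hdimeq : ∀ (τ : Δ.Cone) (K : Finset (Fin n)), τ.1 = coneOf B K → τ.dim = K.card := by
    intro τ K h
    unfold Fan.Cone.dim Fan.Cone.span
    rw [h]
    exact finrank_coneOf B K
  have hdξ := hdimeq ξ J hξ
  have hdσ := hdimeq σ I hσ
  have hcard : (I \ J).card = 2 := by
    rw [Finset.card_sdiff_of_subset hJI]; omega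
  obtain ⟨p, q, hpq, hIJ⟩ := Finset.card_eq_two.1 hcard
  have hp : p ∈ I ∧ p ∉ J := Finset.mem_sdiff.1 (by rw [hIJ]; simp)
  have hq : q ∈ I ∧ q ∉ J := Finset.mem_sdiff.1 (by rw [hIJ]; simp)
  have hI : ∀ i, i ∈ I ↔ i = q ∨ i = p ∨ i ∈ J := by
    intro i
    constructor
    · intro hi
      by_cases hiJ : i ∈ J
      · exact Or.inr (Or.inr hiJ)
      · have : i ∈ I \ J := Finset.mem_sdiff.2 ⟨hi, hiJ⟩
        rw [hIJ] at this
        simp only [Finset.mem_insert, Finset.mem_singleton] at this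
        tauto
    · rintro (rfl | rfl | h)
      · exact hq.1
      · exact hp.1
      · exact hJI h
  have hsub : ∀ r ∈ I, insert r J ⊆ I := fun r hr => Finset.insert_subset hr hJI
  have hmem : ∀ r ∈ I, coneOf B (insert r J) ∈ Δ.cones := by
    intro r hr
    refine Δ.face_mem σ.1 σ.2 _ ?_
    rw [hσ]
    exact coneOf_face B (hsub r hr)
  let τ : ∀ r ∈ I, Δ.Cone := fun r hr => ⟨coneOf B (insert r J), hmem r hr⟩
  -- enumeration of the generators
  obtain ⟨f, hf, hfJ⟩ : ∃ f : Fin ξ.dim → Fin n, Function.Injective f ∧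
      ∀ i, i ∈ J ↔ ∃ j, f j = i := by
    refine ⟨fun j => (J.equivFinOfCardEq hdξ.symm).symm j, ?_, ?_⟩
    · exact Subtype.val_injective.comp (Equiv.injective _)
    · intro i
      constructor
      · intro hi
        exact ⟨J.equivFinOfCardEq hdξ.symm ⟨i, hi⟩, by simp⟩
      · rintro ⟨j, rfl⟩
        exact Subtype.coe_prop _
  have hcons : ∀ {k : ℕ} {g : Fin k → Fin n} {r : Fin n}, Function.Injective g →
      (∀ j, g j ≠ r) → Function.Injective (Fin.cons r g : Fin (k + 1) → Fin n) := by
    intro k g r hg hr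
    rw [Fin.cons_injective_iff]
    exact ⟨fun ⟨j, hj⟩ => hr j hj, hg⟩
  have hrange : ∀ {k : ℕ} {g : Fin k → Fin n} {r i : Fin n},
      (∃ j, (Fin.cons r g : Fin (k + 1) → Fin n) j = i) ↔ i = r ∨ ∃ j, g j = i := by
    intro k g r i
    constructor
    · rintro ⟨j, hj⟩
      refine Fin.cases (fun h => ?_) (fun j h => ?_) j hj
      · exact Or.inl h.symm
      · exact Or.inr ⟨j, h⟩
    · rintro (rfl | ⟨j, rfl⟩)
      · exact ⟨0, rfl⟩
      · exact ⟨j.succ, rfl⟩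
  obtain ⟨b, hb⟩ := exists_basis_coneOf B hf hfJ (W := ξ.span)
    (by unfold Fan.Cone.span; rw [hξ])
  have hdτ : ∀ r (hr : r ∈ I), r ∉ J → (τ r hr).dim = ξ.dim + 1 := by
    intro r hr hrJ
    rw [hdimeq (τ r hr) _ rfl, Finset.card_insert_of_notMem hrJ, hdξ]
  have hkey : ∀ r s (hr : r ∈ I) (_hs : s ∈ I) (_hrJ : r ∉ J) (_hsJ : s ∉ J), r ≠ s →
      (∀ i, i ∈ I ↔ i = s ∨ i = r ∨ i ∈ J) →
      ∃ d : Module.Basis (Fin σ.dim) ℝ σ.span,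
        (∀ i, (d i : Fin n → ℝ) =
          B ((Fin.cons s (Fin.cons r f : Fin (ξ.dim + 1) → Fin n) : Fin (ξ.dim + 2) → Fin n)
            (Fin.cast hd i))) ∧
        incidence o σ (τ r hr) * incidence o (τ r hr) ξ = basisSign b (o ξ) * basisSign d (o σ) := by
    intro r s hr hs' hrJ hsJ hrs hI'
    have hdr := hdτ r hr hrJ
    have hinj1 : Function.Injective (Fin.cons r f : Fin (ξ.dim + 1) → Fin n) :=
      hcons hf (fun j hj => hrJ ((hfJ r).2 ⟨j, hj⟩))
    have hinj2 : Function.Injective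
        (Fin.cons s (Fin.cons r f : Fin (ξ.dim + 1) → Fin n) : Fin (ξ.dim + 2) → Fin n) := by
      refine hcons hinj1 (fun j hj => ?_)
      rcases hrange.1 ⟨j, hj⟩ with h | h
      · exact hrs h.symm
      · exact hsJ ((hfJ s).2 h)
    obtain ⟨c, hc⟩ := exists_basis_coneOf B (I := insert r J) (k := (τ r hr).dim)
      (f := fun i => (Fin.cons r f : Fin (ξ.dim + 1) → Fin n) (Fin.cast hdr i))
      (fun i j hij => Fin.cast_injective _ (hinj1 hij))
      (fun i => by
        rw [Finset.mem_insert, hfJ, ← hrange (g := f)]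
        constructor
        · rintro ⟨j, hj⟩; exact ⟨Fin.cast hdr.symm j, by simpa using hj⟩
        · rintro ⟨j, hj⟩; exact ⟨_, hj⟩)
      (W := (τ r hr).span) rfl
    obtain ⟨d, hdd⟩ := exists_basis_coneOf B (I := I) (k := σ.dim)
      (f := fun i => (Fin.cons s (Fin.cons r f : Fin (ξ.dim + 1) → Fin n) :
        Fin (ξ.dim + 2) → Fin n) (Fin.cast hd i))
      (fun i j hij => Fin.cast_injective _ (hinj2 hij))
      (fun i => by
        rw [hI', hfJ, ← hrange (g := f), ← hrange]
        constructor
        · rintro ⟨j, hj⟩; exact ⟨Fin.cast hd.symm j, by simpa using hj⟩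
        · rintro ⟨j, hj⟩; exact ⟨_, hj⟩)
      (W := σ.span) (by unfold Fan.Cone.span; rw [hσ])
    refine ⟨d, hdd, ?_⟩
    rw [incidence_eq o B (σ := σ) (τ := τ r hr) (p := s) hs' (J := insert r J)
        (by simp [hsJ, hrs.symm]) rfl hσ (by omega) hc hdd
        (fun j hj => by
          rw [show Fin.cast hd j = 0 from Fin.ext hj]; rfl)
        (fun i j hij => by
          rw [show Fin.cast hd j = (Fin.cast hdr i).succ from Fin.ext hij]; rfl),
      incidence_eq o B (σ := τ r hr) (τ := ξ) (p := r) (I := insert r J)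
        (Finset.mem_insert_self _ _) hrJ hξ rfl hdr hb hc
        (fun j hj => by
          rw [show Fin.cast hdr j = 0 from Fin.ext hj]; rfl)
        (fun i j hij => by
          rw [show Fin.cast hdr j = i.succ from Fin.ext hij]; rfl)]
    have := basisSign_mul_self c (o (τ r hr))
    linear_combination (basisSign b (o ξ) * basisSign d (o σ)) * this
  obtain ⟨d₁, hd₁, he₁⟩ := hkey p q hp.1 hq.1 hp.2 hq.2 hpq hI
  obtain ⟨d₂, hd₂, he₂⟩ := hkey q p hq.1 hp.1 hq.2 hp.2 hpq.symm
    (fun i => by rw [hI]; tauto)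
  refine ⟨τ p hp.1, τ q hq.1, ?_, ?_, ?_⟩
  · intro h
    have h1 : coneOf B (insert p J) = coneOf B (insert q J) := congrArg Subtype.val h
    have h2 : p ∈ insert q J := (coneOf_le B).1 h1.le (Finset.mem_insert_self _ _)
    rcases Finset.mem_insert.1 h2 with h3 | h3
    · exact hpq h3
    · exact hp.2 h3
  · intro ρ
    constructor
    · rintro ⟨h1, h2, h3⟩
      obtain ⟨K, hKI, hρ⟩ := hface ρ h2
      have hJK : J ⊆ K := by
        have h1 : ξ.1 ≤ ρ.1 := h1
        rw [hξ, hρ, coneOf_le] at h1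
        exact h1
      have hKc : (K \ J).card = 1 := by
        have := hdimeq ρ K hρ
        rw [Finset.card_sdiff_of_subset hJK]; omega
      obtain ⟨r, hr⟩ := Finset.card_eq_one.1 hKc
      have hK : K = insert r J := by
        rw [← Finset.union_sdiff_of_subset hJK, hr, Finset.union_comm]; rfl
      have hr' : r ∈ K ∧ r ∉ J := Finset.mem_sdiff.1 (by rw [hr]; simp)
      rcases (hI r).1 (hKI hr'.1) with h | h | h
      · right; apply Subtype.ext; rw [hρ, hK, h]
      · left; apply Subtype.ext; rw [hρ, hK, h]
      · exact absurd h hr'.2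
    · have : ∀ r (hr : r ∈ I), r ∉ J →
          ξ ≤ τ r hr ∧ τ r hr ≤ σ ∧ (τ r hr).dim = ξ.dim + 1 := by
        intro r hr hrJ
        refine ⟨?_, ?_, hdτ r hr hrJ⟩
        · show ξ.1 ≤ coneOf B (insert r J)
          rw [hξ, coneOf_le]; exact Finset.subset_insert _ _
        · show coneOf B (insert r J) ≤ σ.1
          rw [hσ, coneOf_le]; exact hsub r hr
      rintro (rfl | rfl)
      · exact this p hp.1 hp.2
      · exact this q hq.1 hq.2
  · rw [he₁, he₂]
    have hswap : basisSign d₂ (o σ) = - basisSign d₁ (o σ) := by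
      refine basisSign_swap (i := Fin.cast hd.symm 0) (j := Fin.cast hd.symm 1) ?_ ?_ _
      · intro h
        have := congrArg Fin.val h
        simp at this
      · intro l
        apply Subtype.ext
        rw [hd₁, hd₂]
        congr 1
        obtain ⟨l, rfl⟩ : ∃ l' : Fin (ξ.dim + 2), Fin.cast hd.symm l' = l :=
          ⟨Fin.cast hd l, by simp⟩
        refine Fin.cases ?_ (fun l => Fin.cases ?_ (fun l => ?_) l) l
        · rw [Equiv.swap_apply_left]; rfl
        · rw [show (Fin.succ 0 : Fin (ξ.dim + 2)) = 1 from rfl, Equiv.swap_apply_right]; rfl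
        · rw [Equiv.swap_apply_of_ne_of_ne]
          · rfl
          · intro h
            have := congrArg Fin.val h
            simp at this
          · intro h
            have := congrArg Fin.val h
            simp at this
    rw [hswap]
    ring

end Diamond
end KoszulFan
namespace KoszulFan

/-! ### Cellular complexes -/

section Cellular
open Opposite
variable {n : ℕ} {Δ : Fan n} {C : Type 1} [Category.{0} C] [Preadditive C]

/-- The cones of dimension `-i`. -/
abbrev Fan.ConesOfDim (Δ : Fan n) (i : ℤ) : Type := {σ : Δ.Cone // (σ.dim : ℤ) = -i}

open Classical in
/-- The matrix entry `± p_{σ τ} : M_σ → M_τ` (zero if `τ` is not a face of `σ`) of the cellular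
differential, for cones with `dim σ = dim τ + 1`. -/
def cellularEntry (o : Δ.Orientations) (𝓜 : Δ.Coneᵒᵖ ⥤ C) (σ τ : Δ.Cone) :
    𝓜.obj (op σ) ⟶ 𝓜.obj (op τ) :=
  if h : τ ≤ σ then incidence o σ τ • 𝓜.map (homOfLE h).op else 0

lemma cellularEntry_comp (hs : Δ.IsSmooth) (o : Δ.Orientations) (𝓜 : Δ.Coneᵒᵖ ⥤ C)
    {i : ℤ} {σ ξ : Δ.Cone} (hσ : (σ.dim : ℤ) = -i) (hξ : (ξ.dim : ℤ) = -(i + 1 + 1))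
    [Fintype (Δ.ConesOfDim (i + 1))] :
    ∑ τ : Δ.ConesOfDim (i + 1), cellularEntry o 𝓜 σ τ.1 ≫ cellularEntry o 𝓜 τ.1 ξ = 0 := by
  classical
  by_cases hle : ξ ≤ σ
  · obtain ⟨τ₁, τ₂, hne, hiff, hsum⟩ := diamond hs o hle (by omega)
    have h1 := (hiff τ₁).2 (Or.inl rfl)
    have h2 := (hiff τ₂).2 (Or.inr rfl)
    have key : ∀ τ : Δ.Cone, ξ ≤ τ ∧ τ ≤ σ →
        cellularEntry o 𝓜 σ τ ≫ cellularEntry o 𝓜 τ ξ =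
          (incidence o σ τ * incidence o τ ξ) • 𝓜.map (homOfLE hle).op := by
      rintro τ ⟨ha, hb⟩
      unfold cellularEntry
      rw [dif_pos ha, dif_pos hb, Preadditive.zsmul_comp, Preadditive.comp_zsmul, smul_smul,
        ← 𝓜.map_comp]
      rfl
    let t₁ : Δ.ConesOfDim (i + 1) := ⟨τ₁, by have := h1.2.2; omega⟩
    let t₂ : Δ.ConesOfDim (i + 1) := ⟨τ₂, by have := h2.2.2; omega⟩
    have hne' : t₁ ≠ t₂ := fun h => hne (congrArg Subtype.val h)
    rw [← Finset.sum_subset (Finset.subset_univ {t₁, t₂}), Finset.sum_pair hne',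
      key τ₁ ⟨h1.1, h1.2.1⟩, key τ₂ ⟨h2.1, h2.2.1⟩, ← add_smul, hsum, zero_smul]
    intro τ _ hτ
    by_cases ha : ξ ≤ τ.1
    · by_cases hb : τ.1 ≤ σ
      · exfalso
        apply hτ
        have := τ.2
        rcases (hiff τ.1).1 ⟨ha, hb, by omega⟩ with h | h
        · rw [Finset.mem_insert]; exact Or.inl (Subtype.ext h)
        · rw [Finset.mem_insert, Finset.mem_singleton]; exact Or.inr (Subtype.ext h)
      · rw [cellularEntry, dif_neg hb, zero_comp]
    · rw [cellularEntry, cellularEntry, dif_neg ha, comp_zero]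
  · refine Finset.sum_eq_zero fun τ _ => ?_
    by_cases ha : ξ ≤ τ.1
    · have hb : ¬ τ.1 ≤ σ := fun hb => hle (ha.trans hb)
      rw [cellularEntry, dif_neg hb, zero_comp]
    · rw [cellularEntry, cellularEntry, dif_neg ha, comp_zero]

variable [HasFiniteBiproducts C]

open Classical in
/-- The cellular differential in degrees `i` and `j` (zero unless `j = i + 1`). -/
def cellularD (o : Δ.Orientations) (𝓜 : Δ.Coneᵒᵖ ⥤ C) (i j : ℤ) :
    (⨁ fun σ : Δ.ConesOfDim i => 𝓜.obj (op σ.1)) ⟶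
      (⨁ fun τ : Δ.ConesOfDim j => 𝓜.obj (op τ.1)) :=
  if i + 1 = j then biproduct.matrix fun σ τ => cellularEntry o 𝓜 σ.1 τ.1 else 0

/-- The cellular complex of a `Δ`-diagram `𝓜`: the term in degree `i` is the direct sum of the
`M_σ` with `dim σ = -i`. -/
def cellularComplex (hs : Δ.IsSmooth) (o : Δ.Orientations) (𝓜 : Δ.Coneᵒᵖ ⥤ C) :
    CochainComplex C ℤ where
  X i := ⨁ fun σ : Δ.ConesOfDim i => 𝓜.obj (op σ.1)
  d i j := cellularD o 𝓜 i j
  shape i j h := if_neg h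
  d_comp_d' i j k hij hjk := by
    classical
    have hij : i + 1 = j := hij
    have hjk : j + 1 = k := hjk
    subst hij
    subst hjk
    unfold cellularD
    rw [if_pos rfl, if_pos rfl]
    have : Fintype (Δ.ConesOfDim (i + 1)) := Fintype.ofFinite _
    ext ξ σ
    rw [Category.assoc, biproduct.matrix_π, biproduct.ι_matrix_assoc, biproduct.lift_desc,
      zero_comp, comp_zero]
    exact cellularEntry_comp hs o 𝓜 σ.2 ξ.2

lemma biproductMap_id {J : Type} [Finite J] (F : J → C) :
    biproduct.map (fun j => 𝟙 (F j)) = 𝟙 (⨁ F) := by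
  ext; simp

lemma biproductMap_comp {J : Type} [Finite J] {F G H : J → C} (f : ∀ j, F j ⟶ G j)
    (g : ∀ j, G j ⟶ H j) :
    biproduct.map (fun j => f j ≫ g j) = biproduct.map f ≫ biproduct.map g := by
  ext; simp

lemma biproductMap_zero {J : Type} [Finite J] {F G : J → C} (f : ∀ j, F j ⟶ G j)
    (h : ∀ j, f j = 0) : biproduct.map f = 0 := by
  ext; simp [h]

/-- The cellular complex is functorial. -/
def cellularFunctor (hs : Δ.IsSmooth) (o : Δ.Orientations) :
    (Δ.Coneᵒᵖ ⥤ C) ⥤ CochainComplex C ℤ where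
  obj 𝓜 := cellularComplex hs o 𝓜
  map {𝓜 𝓝} f :=
    { f := fun i => biproduct.map fun σ => f.app (op σ.1)
      comm' := fun i j hij => by
        show biproduct.map _ ≫ cellularD o 𝓝 i j = cellularD o 𝓜 i j ≫ biproduct.map _
        have hij : i + 1 = j := hij
        unfold cellularD
        rw [if_pos hij, if_pos hij]
        ext σ τ
        simp only [biproduct.ι_map_assoc, biproduct.ι_matrix_assoc, Category.assoc,
          biproduct.matrix_π, biproduct.map_π, biproduct.ι_desc, biproduct.lift_π_assoc]
        unfold cellularEntry
        split_ifs with h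
        · rw [Preadditive.comp_zsmul, Preadditive.zsmul_comp, f.naturality]
        · rw [comp_zero, zero_comp] }
  map_id 𝓜 := by
    ext i : 1
    exact biproductMap_id (fun σ : Δ.ConesOfDim i => 𝓜.obj (op σ.1))
  map_comp f g := by
    ext i : 1
    exact biproductMap_comp (fun σ : Δ.ConesOfDim i => f.app (op σ.1)) (fun σ => g.app (op σ.1))

end Cellular

/-! ### The Koszul dual and the derived category of torsion cofinite cosheaves -/

section Koszul
variable {n : ℕ} {Δ : Fan n}

instance : HasFiniteBiproducts (Cosheaf Δ) := HasFiniteBiproducts.of_hasFiniteProducts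

/-- The functor `N ↦ C^•(𝒦 ⊗ N)` from sheaves of modules to complexes of cosheaves of modules. -/
def koszulFunctor (hs : Δ.IsSmooth) (o : Δ.Orientations) :
    Sheaf Δ ⥤ CochainComplex (Cosheaf Δ) ℤ :=
  tensorDiagram ⋙ cellularFunctor hs o

lemma tensorMap_zero (σ : Δ.Cone) (N N' : Sheaf Δ) (p : CosheafIdx Δ) :
    tensorMap (le_refl σ) (0 : N ⟶ N') (le_refl p) = 0 := by
  apply tensorObj_hom_ext
  intro j k y
  rw [tensorMap_of]
  have : sheafBimap (le_refl σ) (0 : N ⟶ N') j y = 0 := by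
    unfold sheafBimap
    simp
  rw [this, TensorProduct.tmul_zero, map_zero, map_zero]
  rfl

instance (hs : Δ.IsSmooth) (o : Δ.Orientations) : (koszulFunctor hs o).PreservesZeroMorphisms where
  map_zero N N' := by
    ext i : 1
    exact biproductMap_zero
      (fun σ : Δ.ConesOfDim i => tensorCosheafMap (le_refl σ.1) (0 : N ⟶ N')) fun σ => by
        ext p : 2
        apply ModuleCat.hom_ext
        exact tensorMap_zero σ.1 N N' p

/-- The totalization of the double complex `C^•(𝒦 ⊗ P^•)`, for a complex of sheaves `P^•`. -/
def koszulComplex (hs : Δ.IsSmooth) (o : Δ.Orientations) (P : CochainComplex (Sheaf Δ) ℤ) :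
    CochainComplex (Cosheaf Δ) ℤ :=
  HomologicalComplex₂.total
    (((koszulFunctor hs o).mapHomologicalComplex (ComplexShape.up ℤ)).obj P :
      HomologicalComplex₂ (Cosheaf Δ) (ComplexShape.up ℤ) (ComplexShape.up ℤ))
    (ComplexShape.up ℤ)

/-- A complex is bounded if all but finitely many of its terms vanish. -/
def IsBounded {C : Type 1} [Category.{0} C] [HasZeroMorphisms C] (K : CochainComplex C ℤ) : Prop :=
  ∃ a b : ℤ, ∀ i : ℤ, (i < a ∨ b < i) → IsZero (K.X i)

/-- A finite projective resolution `P^• → N^•` of a complex of sheaves: a quasi-isomorphism from a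
bounded complex of projective objects which belong to `𝒜_Δ-mod`. -/
structure FiniteProjectiveResolution (N : CochainComplex (Sheaf Δ) ℤ) where
  complex : CochainComplex (Sheaf Δ) ℤ
  bounded : IsBounded complex
  fg : ∀ i, (complex.X i).IsFG
  projective : ∀ i, Projective (complex.X i)
  π : complex ⟶ N
  quasiIso : QuasiIso π

variable (Δ) in
/-- The bounded complexes of objects of `co-𝒜_Δ-tcf`. -/
def boundedTcf : ObjectProperty (CochainComplex (Cosheaf Δ) ℤ) :=
  fun K => IsBounded K ∧ ∀ i, (K.X i).IsTcf

variable (Δ) in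
/-- The quasi-isomorphisms between bounded complexes of objects of `co-𝒜_Δ-tcf`. -/
def tcfQuasiIso : MorphismProperty (boundedTcf Δ).FullSubcategory :=
  (HomologicalComplex.quasiIso (Cosheaf Δ) (ComplexShape.up ℤ)).inverseImage (boundedTcf Δ).ι

variable (Δ) in
/-- The bounded derived category `D^b(co-𝒜_Δ-tcf)`: the localization of the category of bounded
complexes at the quasi-isomorphisms. -/
abbrev DbTcf : Type 1 := (tcfQuasiIso Δ).Localization

/-- A bounded complex of objects of `co-𝒜_Δ-tcf`, as an object of `D^b(co-𝒜_Δ-tcf)`. -/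
def toDbTcf (K : CochainComplex (Cosheaf Δ) ℤ) (hK : boundedTcf Δ K) : DbTcf Δ :=
  (tcfQuasiIso Δ).Q.obj ⟨K, hK⟩

end Koszul

end KoszulFan

end

noncomputable section

namespace KoszulFan

/-! ### Ungraded complexes given by a square matrix of square zero -/

section MatrixComplex

variable {X K : Type} [Fintype X] [Field K]

open Classical in
/-- The differential of the subquotient, spanned by the basis elements in `S`, of the differential module
given by the matrix `A`. -/
def resD (A : X → X → K) (S : Set X) : (X → K) →ₗ[K] (X → K) where
  toFun f y := if y ∈ S then ∑ x, (if x ∈ S then f x * A x y else 0) else 0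
  map_add' f g := by
    ext y
    by_cases hy : y ∈ S
    · simp only [hy, if_true, Pi.add_apply, ← Finset.sum_add_distrib]
      refine Finset.sum_congr rfl fun x _ => ?_
      split_ifs <;> ring
    · simp [hy]
  map_smul' c f := by
    ext y
    by_cases hy : y ∈ S
    · simp only [hy, if_true, Pi.smul_apply, RingHom.id_apply, smul_eq_mul]
      rw [Finset.mul_sum]
      refine Finset.sum_congr rfl fun x _ => ?_
      split_ifs <;> ring
    · simp [hy]

variable {A : X → X → K} {S S' S'' : Set X}

open Classical in
lemma resD_apply (f : X → K) (y : X) :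
    resD A S f y = if y ∈ S then ∑ x, (if x ∈ S then f x * A x y else 0) else 0 := rfl

lemma resD_of_notMem (f : X → K) {y : X} (hy : y ∉ S) : resD A S f y = 0 := by
  rw [resD_apply, if_neg hy]

lemma resD_congr {f g : X → K} (h : ∀ x ∈ S, f x = g x) : resD A S f = resD A S g := by
  ext y
  rw [resD_apply, resD_apply]
  split_ifs with hy
  · refine Finset.sum_congr rfl fun x _ => ?_
    split_ifs with hx
    · rw [h x hx]
    · rfl
  · rfl

variable (A) in
/-- The basis elements in `S` span a complex. -/
def SquareZero (S : Set X) : Prop := ∀ f : X → K, resD A S (resD A S f) = 0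

variable (A) in
/-- The homology of the subquotient spanned by `S` is spanned by the class of `z`. -/
def SpannedBy (S : Set X) (z : X → K) : Prop :=
  ∀ f : X → K, (∀ x ∉ S, f x = 0) → resD A S f = 0 → ∃ (c : K) (g : X → K), f = c • z + resD A S g

variable (A) in
/-- The subquotient spanned by `S` is acyclic. -/
def AcyclicOn (S : Set X) : Prop := SpannedBy A S 0

lemma AcyclicOn.exists (h : AcyclicOn A S) {f : X → K} (hf : ∀ x ∉ S, f x = 0)
    (hd : resD A S f = 0) : ∃ g, resD A S g = f := by
  obtain ⟨c, g, hg⟩ := h f hf hd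
  exact ⟨g, by rw [hg, smul_zero, zero_add]⟩

lemma squareZero_of_convex (hA : ∀ x z, ∑ y, A x y * A y z = 0)
    (hS : ∀ x ∈ S, ∀ z ∈ S, ∀ y, A x y ≠ 0 → A y z ≠ 0 → y ∈ S) : SquareZero A S := by
  classical
  intro f
  ext z
  rw [resD_apply, Pi.zero_apply]
  split_ifs with hz
  · have : ∀ y, (if y ∈ S then resD A S f y * A y z else 0) =
        ∑ x, (if x ∈ S then f x * (A x y * A y z) else 0) := by
      intro y
      split_ifs with hy
      · rw [resD_apply, if_pos hy, Finset.sum_mul]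
        refine Finset.sum_congr rfl fun x _ => ?_
        split_ifs <;> ring
      · refine (Finset.sum_eq_zero fun x _ => ?_).symm
        split_ifs with hx
        · by_cases h1 : A x y = 0
          · simp [h1]
          · by_cases h2 : A y z = 0
            · simp [h2]
            · exact absurd (hS x hx z hz y h1 h2) hy
        · rfl
    simp only [this]
    rw [Finset.sum_comm]
    refine Finset.sum_eq_zero fun x _ => ?_
    split_ifs
    · rw [← Finset.mul_sum, hA, mul_zero]
    · exact Finset.sum_const_zero
  · rfl

/-- `S` is the disjoint union of a subcomplex `S'` and of the quotient `S''`. -/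
structure IsExtension (A : X → X → K) (S S' S'' : Set X) : Prop where
  mem_iff : ∀ x, x ∈ S ↔ x ∈ S' ∨ x ∈ S''
  disjoint : ∀ x ∈ S', x ∉ S''
  sub : ∀ x ∈ S', ∀ y ∈ S'', A x y = 0

namespace IsExtension

variable (h : IsExtension A S S' S'')
include h

lemma resD_sub {f : X → K} (hf : ∀ x ∉ S', f x = 0) : resD A S f = resD A S' f := by
  ext y
  rw [resD_apply, resD_apply]
  by_cases hy : y ∈ S'
  · rw [if_pos hy, if_pos ((h.mem_iff y).2 (Or.inl hy))]
    refine Finset.sum_congr rfl fun x _ => ?_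
    by_cases hx : x ∈ S'
    · rw [if_pos hx, if_pos ((h.mem_iff x).2 (Or.inl hx))]
    · rw [if_neg hx, hf x hx, zero_mul, ite_self]
  · rw [if_neg hy]
    split_ifs with hyS
    · have hy'' := ((h.mem_iff y).1 hyS).resolve_left hy
      refine Finset.sum_eq_zero fun x _ => ?_
      by_cases hx : x ∈ S'
      · rw [h.sub x hx y hy'', mul_zero, ite_self]
      · rw [hf x hx, zero_mul, ite_self]
    · rfl

lemma resD_quot (f : X → K) {y : X} (hy : y ∈ S'') : resD A S f y = resD A S'' f y := by
  rw [resD_apply, resD_apply, if_pos hy, if_pos ((h.mem_iff y).2 (Or.inr hy))]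
  refine Finset.sum_congr rfl fun x _ => ?_
  by_cases hx : x ∈ S''
  · rw [if_pos hx, if_pos ((h.mem_iff x).2 (Or.inr hx))]
  · rw [if_neg hx]
    split_ifs with hxS
    · rw [h.sub x (((h.mem_iff x).1 hxS).resolve_right hx) y hy, mul_zero]
    · rfl

lemma notMem {x : X} (hx : x ∉ S') (hx' : x ∉ S'') : x ∉ S := fun hS =>
  ((h.mem_iff x).1 hS).elim hx hx'

/-- If the whole complex is acyclic then the connecting homomorphism is surjective. -/
lemma spannedBy_sub (hS : SquareZero A S) (hac : AcyclicOn A S) {z : X → K}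
    (hz : SpannedBy A S'' z) : ∃ z', SpannedBy A S' z' ∧ (z = 0 → z' = 0) := by
  classical
  refine ⟨S'.indicator (resD A S (S''.indicator z)), ?_, ?_⟩
  · intro f hf hd
    have hdS : resD A S f = 0 := by rw [h.resD_sub hf, hd]
    obtain ⟨g, hg⟩ := hac.exists (f := f)
      (fun x hx => hf x fun hx' => hx ((h.mem_iff x).2 (Or.inl hx'))) hdS
    have hg'' : resD A S'' (S''.indicator g) = 0 := by
      ext y
      by_cases hy : y ∈ S''
      · rw [resD_congr (g := g) (fun x hx => Set.indicator_of_mem hx g), ← h.resD_quot g hy, hg]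
        exact hf y fun h' => h.disjoint y h' hy
      · exact resD_of_notMem _ hy
    obtain ⟨c, g₂, hg₂⟩ := hz (S''.indicator g) (fun x hx => Set.indicator_of_notMem hx g) hg''
    set r : X → K := S'.indicator (g - c • S''.indicator z - resD A S (S''.indicator g₂)) with hr
    have hfr : f = c • resD A S (S''.indicator z) + resD A S r := by
      have : resD A S r = resD A S (g - c • S''.indicator z - resD A S (S''.indicator g₂)) := by
        apply resD_congr
        intro x hx
        rcases (h.mem_iff x).1 hx with hx' | hx'
        · rw [hr, Set.indicator_of_mem hx']
        · rw [hr, Set.indicator_of_notMem fun h' => h.disjoint x h' hx']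
          have h1 := congrFun hg₂ x
          rw [Set.indicator_of_mem hx', Pi.add_apply, Pi.smul_apply] at h1
          rw [Pi.sub_apply, Pi.sub_apply, Pi.smul_apply, Set.indicator_of_mem hx', h1,
            h.resD_quot _ hx', resD_congr (g := g₂) (fun x hx => Set.indicator_of_mem hx g₂)]
          simp
      rw [this, map_sub, map_sub, hS, hg, map_smul]
      simp
    refine ⟨c, r, ?_⟩
    rw [← h.resD_sub (f := r) (fun x hx => Set.indicator_of_notMem hx _)]
    ext x
    by_cases hx : x ∈ S'
    · have := congrFun hfr x
      rw [this]
      simp [Set.indicator_of_mem hx]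
    · rw [hf x hx, Pi.add_apply, Pi.smul_apply, Set.indicator_of_notMem hx,
        h.resD_sub (f := r) (fun x hx => Set.indicator_of_notMem hx _), resD_of_notMem _ hx]
      simp
  · rintro rfl
    simp

lemma spannedBy_of_sub (hS : SquareZero A S) (hac : AcyclicOn A S'') {z : X → K}
    (hz : SpannedBy A S' z) : SpannedBy A S z := by
  classical
  intro f hf hd
  obtain ⟨g, hg⟩ := hac.exists (f := S''.indicator f) (fun x hx => Set.indicator_of_notMem hx _) (by
    ext y
    by_cases hy : y ∈ S''
    · rw [resD_congr (g := f) (fun x hx => Set.indicator_of_mem hx f), ← h.resD_quot f hy, hd]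
    · exact resD_of_notMem _ hy)
  set r := f - resD A S (S''.indicator g) with hr
  have hr' : ∀ x ∉ S', r x = 0 := by
    intro x hx
    by_cases hx'' : x ∈ S''
    · rw [hr, Pi.sub_apply, h.resD_quot _ hx'',
        resD_congr (g := g) (fun x hx => Set.indicator_of_mem hx g), hg, Set.indicator_of_mem hx'',
        sub_self]
    · have hxS := h.notMem hx hx''
      rw [hr, Pi.sub_apply, hf x hxS, resD_of_notMem _ hxS, sub_self]
  obtain ⟨c, g', hg'⟩ := hz r hr' (by rw [← h.resD_sub hr', hr, map_sub, hS, hd, sub_zero])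
  refine ⟨c, S''.indicator g + S'.indicator g', ?_⟩
  rw [map_add, h.resD_sub (f := S'.indicator g') (fun x hx => Set.indicator_of_notMem hx _),
    resD_congr (f := S'.indicator g') (g := g') (fun x hx => Set.indicator_of_mem hx g')]
  have : f = r + resD A S (S''.indicator g) := by rw [hr]; abel
  rw [this, hg']
  abel

lemma acyclicOn_sub (hS : SquareZero A S) (hac : AcyclicOn A S) (hac'' : AcyclicOn A S'') :
    AcyclicOn A S' := by
  obtain ⟨z', h1, h2⟩ := h.spannedBy_sub hS hac hac''
  rw [h2 rfl] at h1
  exact h1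

end IsExtension

lemma acyclicOn_empty : AcyclicOn A (∅ : Set X) := by
  intro f hf _
  refine ⟨0, 0, ?_⟩
  ext x
  simp [hf x]

/-- A complex filtered with acyclic graded pieces is acyclic. -/
lemma acyclicOn_of_filtration {Y : Type} (key : X → Y) (δ : Y → ℝ) (S : Set X)
    (hsq : ∀ T ⊆ S, (∀ x ∈ S, ∀ t ∈ T, key x = key t → x ∈ T) →
      (∀ x ∈ S, ∀ t ∈ T, δ (key x) < δ (key t) → x ∈ T) → SquareZero A T)
    (hA : ∀ x ∈ S, ∀ y ∈ S, A x y ≠ 0 → key x = key y ∨ δ (key x) < δ (key y))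
    (hfib : ∀ x ∈ S, AcyclicOn A {x' ∈ S | key x' = key x}) : AcyclicOn A S := by
  classical
  induction hn : Set.ncard S using Nat.strong_induction_on generalizing S with
  | _ n ih =>
    rcases S.eq_empty_or_nonempty with rfl | hne
    · exact acyclicOn_empty
    · obtain ⟨m, hm, hmax⟩ := Set.exists_max_image S (fun x => δ (key x)) S.toFinite hne
      have hext : IsExtension A S {x' ∈ S | key x' = key m} {x' ∈ S | key x' ≠ key m} := by
        refine ⟨fun x => ?_, fun x hx hx' => hx'.2 hx.2, fun x hx y hy => ?_⟩
        · simp only [Set.mem_ofPred_eq]; tauto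
        · by_contra hne
          rcases hA x hx.1 y hy.1 hne with h1 | h1
          · exact hy.2 (h1.symm.trans hx.2)
          · rw [hx.2] at h1
            exact absurd (hmax y hy.1) (not_le.2 h1)
      refine hext.spannedBy_of_sub (hsq S le_rfl (fun x hx _ _ _ => hx) (fun x hx _ _ _ => hx)) ?_
        (hfib m hm)
      refine ih _ ?_ _ ?_ ?_ ?_ rfl
      · rw [← hn]
        refine Set.ncard_lt_ncard ⟨fun x hx => hx.1, fun hsub => (hsub hm).2 rfl⟩ S.toFinite
      · intro T hT h1 h2
        refine hsq T (fun x hx => (hT hx).1) (fun x hx t ht hxt => ?_) (fun x hx t ht hxt => ?_)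
        · exact h1 x ⟨hx, fun h => (hT ht).2 (hxt ▸ h)⟩ t ht hxt
        · refine h2 x ⟨hx, fun h => ?_⟩ t ht hxt
          rw [h] at hxt
          exact absurd (hmax t (hT ht).1) (not_le.2 hxt)
      · exact fun x hx y hy => hA x hx.1 y hy.1
      · intro x hx
        convert hfib x hx.1 using 1
        ext x'
        simp only [Set.mem_ofPred_eq]
        constructor
        · rintro ⟨⟨h1, _⟩, h3⟩; exact ⟨h1, h3⟩
        · rintro ⟨h1, h2⟩; exact ⟨⟨h1, fun h => hx.2 (h2 ▸ h)⟩, h2⟩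

/-- Adding one basis element to a complex with at most one-dimensional homology kills the homology, if
this element is the boundary of another basis element. -/
lemma acyclicOn_insert {t s : X} (hext : IsExtension A S {t} S'') (hS : SquareZero A S)
    {z : X → K} (hz : SpannedBy A S'' z) (hs : s ∈ S'') (hst : A s t ≠ 0)
    (hsy : ∀ y ∈ S'', A s y = 0) : AcyclicOn A S := by
  classical
  have hsS : s ∈ S := (hext.mem_iff s).2 (Or.inr hs)
  have htS : t ∈ S := (hext.mem_iff t).2 (Or.inl rfl)
  have hne : s ≠ t := fun h => hext.disjoint t rfl (h ▸ hs)
  have hsingle : ∀ (T : Set X) (_ : s ∈ T) (c : K) (y : X), resD A T (Pi.single s c) y =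
      if y ∈ T then c * A s y else 0 := by
    intro T hT c y
    rw [resD_apply]
    congr 1
    rw [Finset.sum_eq_single s]
    · simp [hT]
    · intro x _ hx; simp [Pi.single_eq_of_ne hx]
    · simp
  have hrest : ∀ f : X → K, resD A S'' (S''.indicator f) = resD A S'' f := fun f =>
    resD_congr (fun x hx => Set.indicator_of_mem hx f)
  have hquot : ∀ g : X → K, ∃ a : K, resD A S (S''.indicator g) = resD A S'' g + Pi.single t a := by
    intro g
    refine ⟨resD A S (S''.indicator g) t, ?_⟩
    ext y
    by_cases hy : y ∈ S''
    · have : y ≠ t := fun h => hext.disjoint t rfl (h ▸ hy)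
      rw [hext.resD_quot _ hy, hrest, Pi.add_apply, Pi.single_eq_of_ne this, add_zero]
    · by_cases hyt : y = t
      · subst hyt
        rw [Pi.add_apply, Pi.single_eq_same, resD_of_notMem _ hy, zero_add]
      · rw [resD_of_notMem _ (hext.notMem hyt hy), Pi.add_apply, Pi.single_eq_of_ne hyt,
          resD_of_notMem _ hy, add_zero]
  have hdt : ∀ a : K, resD A S (Pi.single t a) = Pi.single t (a * A t t) := by
    intro a
    rw [hext.resD_sub (fun x hx => Pi.single_eq_of_ne hx _)]
    ext y
    rw [resD_apply]
    split_ifs with hy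
    · have hy : y = t := hy
      subst hy
      rw [Pi.single_eq_same, Finset.sum_eq_single y]
      · simp
      · intro x _ hx; simp [hx]
      · simp
    · rw [Pi.single_eq_of_ne hy]
  have htt : A t t = 0 := by
    have := hS (Pi.single t 1)
    rw [hdt, hdt] at this
    have := congrFun this t
    simpa using this
  have hss : resD A S (Pi.single s 1) = Pi.single t (A s t) := by
    ext y
    rw [hsingle S hsS]
    by_cases hyt : y = t
    · subst hyt; simp [htS]
    · rw [Pi.single_eq_of_ne hyt]
      split_ifs with hy
      · rw [hsy y (((hext.mem_iff y).1 hy).resolve_left hyt), mul_zero]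
      · rfl
  obtain ⟨c', g', hg'⟩ := hz (Pi.single s 1)
    (fun x hx => Pi.single_eq_of_ne (fun h : x = s => hx (h.symm ▸ hs)) _) (by
      ext y
      rw [hsingle S'' hs]
      split_ifs with hy
      · rw [hsy y hy]; simp
      · rfl)
  have key : ∀ (c : K) (g : X → K), resD A S (c • Pi.single s 1 + resD A S'' g) = 0 → c = 0 := by
    intro c g h0
    obtain ⟨a, ha⟩ := hquot g
    have : resD A S'' g = resD A S (S''.indicator g) - Pi.single t a := by rw [ha]; abel
    rw [this, map_add, map_sub, hS, map_smul, hss, hdt, htt] at h0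
    have := congrFun h0 t
    simpa [hst] using this
  have hc' : c' ≠ 0 := by
    rintro rfl
    rw [zero_smul, zero_add] at hg'
    refine one_ne_zero (key (1 : K) (-g') ?_)
    rw [hg', map_neg, one_smul, add_neg_cancel, map_zero]
  intro F hF hdF
  obtain ⟨c, g, hg⟩ := hz (S''.indicator F) (fun x hx => Set.indicator_of_notMem hx _) (by
    rw [hrest]
    ext y
    by_cases hy : y ∈ S''
    · rw [← hext.resD_quot F hy, hdF]
    · exact resD_of_notMem _ hy)
  have hF' : ∃ (e : K) (g₁ : X → K) (b : K),
      F = e • Pi.single s 1 + resD A S'' g₁ + Pi.single t b := by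
    refine ⟨c * c'⁻¹, g - (c * c'⁻¹) • g', F t, ?_⟩
    have h1 : F = S''.indicator F + Pi.single t (F t) := by
      ext x
      by_cases hx : x ∈ S''
      · have : x ≠ t := fun h => hext.disjoint t rfl (h ▸ hx)
        simp [hx, this]
      · by_cases hxt : x = t
        · subst hxt; simp [hx]
        · simp [hx, hxt, hF x (hext.notMem hxt hx)]
    rw [hg] at h1
    conv_lhs => rw [h1]
    congr 1
    rw [hg', map_sub, map_smul, smul_add, smul_smul, mul_assoc, inv_mul_cancel₀ hc', mul_one]
    abel
  obtain ⟨e, g₁, b, rfl⟩ := hF'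
  have he : e = 0 := by
    apply key e g₁
    rw [map_add, hdt, htt] at hdF
    simpa using hdF
  subst he
  obtain ⟨a, ha⟩ := hquot g₁
  refine ⟨0, S''.indicator g₁ + Pi.single s ((b - a) * (A s t)⁻¹), ?_⟩
  have h3 : resD A S (Pi.single s ((b - a) * (A s t)⁻¹)) = Pi.single t (b - a) := by
    rw [show Pi.single s ((b - a) * (A s t)⁻¹) =
      ((b - a) * (A s t)⁻¹) • (Pi.single s 1 : X → K) from by simp [← Pi.single_smul], map_smul, hss,
      ← Pi.single_smul, smul_eq_mul, mul_assoc, inv_mul_cancel₀ hst, mul_one]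
  rw [map_add, ha, h3, Pi.single_sub]
  simp

end MatrixComplex

end KoszulFan
end

noncomputable section

namespace KoszulFan

/-! ### Geometry of the cones of a smooth complete fan -/

section Geometry

variable {n : ℕ} {Δ : Fan n}

lemma Fan.Cone.isFaceOf {τ σ : Δ.Cone} (h : τ ≤ σ) : τ.1.IsFaceOf σ.1 := by
  have := Δ.inf_face σ.1 σ.2 τ.1 τ.2
  rwa [inf_eq_right.2 h] at this

/-- The point `x` lies in the relative interior of the cone `c`: the cones containing `x` are those of
which `c` is a face. -/
def Fan.Cone.RelInt (c : Δ.Cone) (x : Fin n → ℝ) : Prop := ∀ σ : Δ.Cone, x ∈ σ.1 ↔ c ≤ σ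

lemma Fan.Cone.RelInt.mem {c : Δ.Cone} {x : Fin n → ℝ} (h : c.RelInt x) : x ∈ c.1 := (h c).2 le_rfl

lemma exists_relInt_of_mem {x : Fin n → ℝ} {σ : Δ.Cone} (hx : x ∈ σ.1) : ∃ c : Δ.Cone, c.RelInt x := by
  obtain ⟨m, hm⟩ := (Set.toFinite {σ : Δ.Cone | x ∈ σ.1}).exists_minimal ⟨σ, hx⟩
  refine ⟨m, fun ρ => ⟨fun hρ => ?_, fun h => h hm.1⟩⟩
  let ξ : Δ.Cone := ⟨m.1 ⊓ ρ.1, Δ.face_mem m.1 m.2 _ (Δ.inf_face m.1 m.2 ρ.1 ρ.2)⟩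
  have h1 : ξ ≤ m := show m.1 ⊓ ρ.1 ≤ m.1 from inf_le_left
  have h2 : m ≤ ξ := hm.2 (show x ∈ m.1 ⊓ ρ.1 from ⟨hm.1, hρ⟩) h1
  exact h2.trans (show m.1 ⊓ ρ.1 ≤ ρ.1 from inf_le_right)

lemma exists_relInt (hc : Δ.IsComplete) (x : Fin n → ℝ) : ∃ c : Δ.Cone, c.RelInt x := by
  obtain ⟨σ, hσ, hx⟩ := hc x
  exact exists_relInt_of_mem (σ := ⟨σ, hσ⟩) hx

lemma Fan.Cone.RelInt.exists_pos (hs : Δ.IsSmooth) {c : Δ.Cone} {x : Fin n → ℝ} (h : c.RelInt x)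
    {u : Fin n → ℝ} (hu : u ∈ c.span) : ∃ ε : ℝ, 0 < ε ∧ ∀ δ : ℝ, |δ| ≤ ε → x + δ • u ∈ c.1 := by
  classical
  obtain ⟨B, I, hB⟩ := c.exists_basis hs
  have hx := h.mem
  rw [hB, mem_coneOf] at hx
  have hpos : ∀ i ∈ I, 0 < B.repr x i := by
    intro i hi
    refine lt_of_le_of_ne (hx.1 i) fun h0 => ?_
    have hmem : coneOf B (I.erase i) ∈ Δ.cones := by
      refine Δ.face_mem c.1 c.2 _ ?_
      rw [hB]
      exact coneOf_face B (Finset.erase_subset _ _)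
    have h1 : c ≤ ⟨_, hmem⟩ := by
      refine (h _).1 ?_
      show x ∈ coneOf B (I.erase i)
      rw [mem_coneOf]
      refine ⟨hx.1, fun j hj => ?_⟩
      by_cases hji : j = i
      · rw [hji, ← h0]
      · exact hx.2 j fun hjI => hj (Finset.mem_erase.2 ⟨hji, hjI⟩)
    have h2 : c.1 ≤ coneOf B (I.erase i) := h1
    rw [hB, coneOf_le] at h2
    exact Finset.notMem_erase i I (h2 hi)
  have hu' : ∀ i ∉ I, B.repr u i = 0 := by
    intro i hi
    have : c.span ≤ LinearMap.ker (B.coord i) := by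
      refine Submodule.span_le.2 fun w hw => ?_
      have hw : w ∈ c.1 := hw
      rw [hB, mem_coneOf] at hw
      exact hw.2 i hi
    exact this hu
  have hev : ∀ᶠ δ : ℝ in nhds 0, ∀ i ∈ I, 0 < B.repr x i + δ * B.repr u i := by
    rw [Filter.eventually_all_finset]
    intro i hi
    have hcont : Continuous fun δ : ℝ => B.repr x i + δ * B.repr u i := by fun_prop
    have := hcont.tendsto 0
    exact this.eventually (lt_mem_nhds (by simpa using hpos i hi))
  obtain ⟨ε, hε, hball⟩ := Metric.eventually_nhds_iff.1 hev
  refine ⟨ε / 2, by positivity, fun δ hδ => ?_⟩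
  rw [hB, mem_coneOf]
  have := hball (y := δ) (by rw [Real.dist_eq, sub_zero]; linarith)
  simp only [map_add, map_smul, Finsupp.add_apply, Finsupp.smul_apply, smul_eq_mul]
  refine ⟨fun i => ?_, fun i hi => ?_⟩
  · by_cases hi : i ∈ I
    · exact (this i hi).le
    · rw [hx.2 i hi, hu' i hi]; simp
  · rw [hx.2 i hi, hu' i hi]; simp

lemma Fan.Cone.exists_relInt_point (hs : Δ.IsSmooth) (τ : Δ.Cone) : ∃ t, τ.RelInt t := by
  classical
  obtain ⟨B, I, hB⟩ := τ.exists_basis hs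
  have hrepr : ∀ i, B.repr (∑ j ∈ I, B j) i = if i ∈ I then 1 else 0 := by
    intro i
    simp [Finsupp.single_apply]
  have hmem : (∑ j ∈ I, B j) ∈ τ.1 := by
    rw [hB]
    exact Submodule.sum_mem _ fun i hi => (basis_mem_coneOf B).2 hi
  refine ⟨∑ j ∈ I, B j, fun σ => ⟨fun hσ => ?_, fun h => h hmem⟩⟩
  have hface := Δ.inf_face τ.1 τ.2 σ.1 σ.2
  have hin : (∑ j ∈ I, B j) ∈ τ.1 ⊓ σ.1 := ⟨hmem, hσ⟩
  have hface' := hface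
  rw [hB] at hface'
  obtain ⟨J, hJ, hJeq⟩ := face_coneOf B hface'
  rw [← hB] at hJeq
  rw [hJeq, mem_coneOf] at hin
  have hIJ : I ⊆ J := by
    intro i hi
    by_contra hiJ
    have := hin.2 i hiJ
    rw [hrepr, if_pos hi] at this
    exact one_ne_zero this
  have : τ.1 ≤ τ.1 ⊓ σ.1 := by
    rw [hJeq, hB, coneOf_le]; exact hIJ
  exact this.trans inf_le_right

lemma Fan.Cone.isClosed (hs : Δ.IsSmooth) (σ : Δ.Cone) : IsClosed (σ.1 : Set (Fin n → ℝ)) := by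
  obtain ⟨B, I, hB⟩ := σ.exists_basis hs
  have hcont : ∀ i, Continuous fun x => B.repr x i := fun i =>
    (B.coord i).continuous_of_finiteDimensional
  have : (σ.1 : Set (Fin n → ℝ)) =
      (⋂ i, {x | 0 ≤ B.repr x i}) ∩ ⋂ i, ⋂ (_ : i ∉ I), {x | B.repr x i = 0} := by
    ext x
    rw [hB, SetLike.mem_coe, mem_coneOf]
    simp
  rw [this]
  refine (isClosed_iInter fun i => isClosed_le continuous_const (hcont i)).inter
    (isClosed_iInter fun i => isClosed_iInter fun _ => isClosed_eq (hcont i) continuous_const)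

lemma Fan.Cone.RelInt.exists_ball (hs : Δ.IsSmooth) {τ : Δ.Cone} {t : Fin n → ℝ} (h : τ.RelInt t) :
    ∃ r : ℝ, 0 < r ∧ ∀ x, (x - t) ⬝ᵥ (x - t) < r → ∀ σ : Δ.Cone, x ∈ σ.1 → τ ≤ σ := by
  have hcl : IsClosed (⋃ σ : {σ : Δ.Cone // ¬ τ ≤ σ}, (σ.1.1 : Set (Fin n → ℝ))) :=
    isClosed_iUnion_of_finite fun σ => σ.1.isClosed hs
  have hmem : t ∈ (⋃ σ : {σ : Δ.Cone // ¬ τ ≤ σ}, (σ.1.1 : Set (Fin n → ℝ)))ᶜ := by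
    intro hmem
    obtain ⟨σ, hσ⟩ := Set.mem_iUnion.1 hmem
    exact σ.2 ((h σ.1).1 hσ)
  obtain ⟨ε, hε, hball⟩ := Metric.isOpen_iff.1 hcl.isOpen_compl t hmem
  refine ⟨ε ^ 2, by positivity, fun x hx σ hσ => ?_⟩
  by_contra hτσ
  refine hball (a := x) ?_ (Set.mem_iUnion.2 ⟨⟨σ, hτσ⟩, hσ⟩)
  rw [Metric.mem_ball, dist_pi_lt_iff hε]
  intro i
  rw [Real.dist_eq]
  have h1 : (x i - t i) * (x i - t i) ≤ (x - t) ⬝ᵥ (x - t) :=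
    Finset.single_le_sum (f := fun i => (x - t) i * (x - t) i) (fun i _ => mul_self_nonneg _)
      (Finset.mem_univ i)
  exact abs_lt_of_sq_lt_sq (by nlinarith) hε.le

lemma Fan.Cone.le_span (σ : Δ.Cone) {x : Fin n → ℝ} (hx : x ∈ σ.1) : x ∈ σ.span :=
  Submodule.subset_span hx

lemma Fan.Cone.span_mono {τ σ : Δ.Cone} (h : τ ≤ σ) : τ.span ≤ σ.span := Submodule.span_mono h

lemma Fan.Cone.mem_of_mem_span (hs : Δ.IsSmooth) {τ σ : Δ.Cone} (h : τ ≤ σ) {x : Fin n → ℝ}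
    (hx : x ∈ σ.1) (hxτ : x ∈ τ.span) : x ∈ τ.1 := by
  obtain ⟨t, ht⟩ := τ.exists_relInt_point hs
  obtain ⟨ε, hε, hmem⟩ := ht.exists_pos hs hxτ
  refine (Fan.Cone.isFaceOf h).mem_of_smul_add_mem hx (y := t + (-ε) • x) (a := ε) ?_ hε ?_
  · exact h (hmem _ (by rw [abs_neg, abs_of_pos hε]))
  · rw [show ε • x + (t + (-ε) • x) = t by rw [neg_smul]; abel]
    exact ht.mem

lemma Fan.Cone.dim_lt (hs : Δ.IsSmooth) {τ σ : Δ.Cone} (h : τ < σ) : τ.dim < σ.dim := by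
  refine lt_of_le_of_ne (Submodule.finrank_mono (Fan.Cone.span_mono h.le)) fun heq => ?_
  have hsp : τ.span = σ.span := Submodule.eq_of_le_of_finrank_eq (Fan.Cone.span_mono h.le) heq
  refine h.not_ge fun x hx => ?_
  exact Fan.Cone.mem_of_mem_span hs h.le hx (hsp ▸ σ.le_span hx)

lemma Fan.Cone.dim_le (σ : Δ.Cone) : σ.dim ≤ n := by
  have := Submodule.finrank_le σ.span
  rwa [Module.finrank_fin_fun] at this

/-- A proper face of a cone is a facet of another face. -/
lemma Fan.Cone.exists_dim_succ (hs : Δ.IsSmooth) {τ σ : Δ.Cone} (h : τ < σ) :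
    ∃ ρ : Δ.Cone, τ ≤ ρ ∧ ρ ≤ σ ∧ ρ.dim = τ.dim + 1 := by
  classical
  obtain ⟨B, I, hB⟩ := σ.exists_basis hs
  obtain ⟨J, hJ, hJτ⟩ := face_coneOf B (hB ▸ Fan.Cone.isFaceOf h.le)
  have hne : ∃ i ∈ I, i ∉ J := by
    by_contra! hcon
    exact h.not_ge (show σ.1 ≤ τ.1 by rw [hB, hJτ, coneOf_le]; exact hcon)
  obtain ⟨i, hi, hiJ⟩ := hne
  have hsub : insert i J ⊆ I := Finset.insert_subset hi hJ
  refine ⟨⟨coneOf B (insert i J), Δ.face_mem σ.1 σ.2 _ (hB ▸ coneOf_face B hsub)⟩, ?_, ?_, ?_⟩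
  · show τ.1 ≤ _
    rw [hJτ, coneOf_le]; exact Finset.subset_insert _ _
  · show coneOf B (insert i J) ≤ σ.1
    rw [hB, coneOf_le]; exact hsub
  · unfold Fan.Cone.dim Fan.Cone.span
    rw [hJτ, finrank_coneOf, finrank_coneOf, Finset.card_insert_of_notMem hiJ]

/-! ### Nearest points -/

/-- `y` is the point of the cone `K` nearest to `v`. -/
structure IsNearest (K : PointedCone ℝ (Fin n → ℝ)) (v y : Fin n → ℝ) : Prop where
  mem : y ∈ K
  orthogonal : (v - y) ⬝ᵥ y = 0
  le : ∀ x ∈ K, (v - y) ⬝ᵥ x ≤ 0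

lemma exists_isNearest {K : PointedCone ℝ (Fin n → ℝ)} (hK : IsClosed (K : Set (Fin n → ℝ)))
    (v : Fin n → ℝ) : ∃ y, IsNearest K v y := by
  let S : Set (EuclideanSpace ℝ (Fin n)) := (WithLp.ofLp : EuclideanSpace ℝ (Fin n) → _) ⁻¹' K
  have hS : IsClosed S := hK.preimage (PiLp.continuous_ofLp 2 _)
  have hconv : Convex ℝ S := by
    intro x hx y hy a b ha hb _
    exact K.add_mem (PointedCone.smul_mem _ ha hx) (PointedCone.smul_mem _ hb hy)
  obtain ⟨y, hyS, hy⟩ := exists_norm_eq_iInf_of_complete_convex (K := S) ⟨0, K.zero_mem⟩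
    hS.isComplete hconv (WithLp.toLp 2 v)
  rw [norm_eq_iInf_iff_real_inner_le_zero hconv hyS] at hy
  have hy' : ∀ w ∈ K, (v - y.ofLp) ⬝ᵥ (w - y.ofLp) ≤ 0 := by
    intro w hw
    have := hy (WithLp.toLp 2 w) hw
    rw [EuclideanSpace.inner_eq_star_dotProduct, dotProduct_comm] at this
    simpa using this
  have hyK : y.ofLp ∈ K := hyS
  have h0 : (v - y.ofLp) ⬝ᵥ y.ofLp = 0 := by
    have h1 := hy' 0 K.zero_mem
    have h2 := hy' (y.ofLp + y.ofLp) (K.add_mem hyK hyK)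
    rw [zero_sub, dotProduct_neg] at h1
    rw [add_sub_cancel_right] at h2
    linarith
  refine ⟨y.ofLp, hyK, h0, fun w hw => ?_⟩
  have := hy' w hw
  rw [dotProduct_sub, h0, sub_zero] at this
  exact this

lemma dotProduct_sub_self_nonneg (v y : Fin n → ℝ) : 0 ≤ (v - y) ⬝ᵥ (v - y) :=
  Finset.sum_nonneg fun _ _ => mul_self_nonneg _

/-- Shrinking the cone moves the nearest point away. -/
lemma IsNearest.eq_or_lt {K : PointedCone ℝ (Fin n → ℝ)} {v y y' : Fin n → ℝ}
    (h : IsNearest K v y) (hK : y' ∈ K) :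
    y = y' ∨ (v - y) ⬝ᵥ (v - y) < (v - y') ⬝ᵥ (v - y') := by
  by_cases hyy : y = y'
  · exact Or.inl hyy
  · right
    have h1 : 0 < (y - y') ⬝ᵥ (y - y') := by
      refine lt_of_le_of_ne (dotProduct_sub_self_nonneg y y') fun h0 => hyy ?_
      exact sub_eq_zero.1 (dotProduct_self_eq_zero.1 h0.symm)
    have h2 := h.le _ hK
    have h3 := h.orthogonal
    have : (v - y') ⬝ᵥ (v - y') =
        (v - y) ⬝ᵥ (v - y) + 2 * ((v - y) ⬝ᵥ y - (v - y) ⬝ᵥ y') + (y - y') ⬝ᵥ (y - y') := by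
      rw [← dotProduct_sub, show v - y' = (v - y) + (y - y') by abel]
      simp only [add_dotProduct, dotProduct_add]
      rw [dotProduct_comm (y - y') (v - y)]
      ring
    rw [this, h3]
    linarith

lemma IsNearest.unique {K : PointedCone ℝ (Fin n → ℝ)} {v y y' : Fin n → ℝ}
    (h : IsNearest K v y) (h' : IsNearest K v y') : y = y' := by
  rcases h.eq_or_lt h'.mem with h1 | h1
  · exact h1
  · rcases h'.eq_or_lt h.mem with h2 | h2
    · exact h2.symm
    · exact absurd h1 h2.not_gt

end Geometry

end KoszulFan
end

noncomputable section

namespace KoszulFan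

/-! ### The augmented boundary matrix of a fan -/

section Boundary

variable {n : ℕ} {Δ : Fan n}

/-- The determinant, as an alternating form in `k = n` vectors of `ℝⁿ`. -/
def topForm {k : ℕ} (h : k = n) : (Fin n → ℝ) [⋀^Fin k]→ₗ[ℝ] ℝ :=
  (Pi.basisFun ℝ (Fin n)).det.domDomCongr (finCongr h.symm)

lemma topForm_ne_zero {k : ℕ} (h : k = n) {g : Fin k → Fin n → ℝ} (hg : LinearIndependent ℝ g) :
    topForm h g ≠ 0 := by
  subst h
  have := ((Pi.basisFun ℝ (Fin k)).isUnit_det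
    (basisOfLinearIndependentOfCardEqFinrank' g hg (by simp))).ne_zero
  rw [coe_basisOfLinearIndependentOfCardEqFinrank'] at this
  exact this

lemma topForm_basis {k : ℕ} (h : k = n) {W : Submodule ℝ (Fin n → ℝ)} (c c' : Module.Basis (Fin k) ℝ W) :
    topForm h (fun i => (c' i : Fin n → ℝ)) = topForm h (fun i => (c i : Fin n → ℝ)) * c.det c' := by
  have := AlternatingMap.eq_smul_basis_det c ((topForm h).compLinearMap W.subtype)
  have := congrArg (fun f => f c') this
  exact this

lemma topForm_basis_ne_zero {k : ℕ} (h : k = n) {W : Submodule ℝ (Fin n → ℝ)}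
    (c : Module.Basis (Fin k) ℝ W) : topForm h (fun i => (c i : Fin n → ℝ)) ≠ 0 :=
  topForm_ne_zero h (c.linearIndependent.map' W.subtype (Submodule.ker_subtype W))

open Classical in
/-- The sign comparing the orientation of a cone of dimension `n` with the standard orientation. -/
def topSign (o : Δ.Orientations) (σ : Δ.Cone) : ℤ :=
  if ∃ (h : σ.dim = n) (c : Module.Basis (Fin σ.dim) ℝ σ.span),
    (0 < topForm h (fun i => (c i : Fin n → ℝ)) ↔ c.orientation = o σ) then 1 else -1

open Classical in
lemma topSign_eq (o : Δ.Orientations) (σ : Δ.Cone) (h : σ.dim = n)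
    (c : Module.Basis (Fin σ.dim) ℝ σ.span) :
    topSign o σ = basisSign c (o σ) * if 0 < topForm h (fun i => (c i : Fin n → ℝ)) then 1 else -1 := by
  have key : (∃ (h : σ.dim = n) (c : Module.Basis (Fin σ.dim) ℝ σ.span),
      (0 < topForm h (fun i => (c i : Fin n → ℝ)) ↔ c.orientation = o σ)) ↔
      (0 < topForm h (fun i => (c i : Fin n → ℝ)) ↔ c.orientation = o σ) := by
    refine ⟨?_, fun hc => ⟨h, c, hc⟩⟩
    rintro ⟨_, c', hc'⟩
    have h1 := topForm_basis h c c'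
    have h2 := basisSign_iff c c' (o σ)
    have h3 := topForm_basis_ne_zero h c
    have h4 : c.det c' ≠ 0 := (c.isUnit_det c').ne_zero
    by_cases hpos : 0 < c.det c'
    · rw [h1, mul_pos_iff_of_pos_right hpos] at hc'
      have := h2.2 hpos
      tauto
    · have hneg : c.det c' < 0 := lt_of_le_of_ne (not_lt.1 hpos) h4
      have h5 : 0 < topForm h (fun i => (c' i : Fin n → ℝ)) ↔
          ¬ 0 < topForm h (fun i => (c i : Fin n → ℝ)) := by
        rw [h1]
        constructor
        · intro h6 h7; nlinarith
        · intro h6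
          exact mul_pos_of_neg_of_neg (lt_of_le_of_ne (not_lt.1 h6) h3) hneg
      tauto
  unfold topSign
  simp only [key]
  unfold basisSign
  by_cases h1 : c.orientation = o σ <;>
    by_cases h2 : 0 < topForm h (fun i => (c i : Fin n → ℝ)) <;> simp [h1, h2]

lemma topSign_ne_zero (o : Δ.Orientations) (σ : Δ.Cone) : topSign o σ ≠ 0 := by
  unfold topSign; split_ifs <;> norm_num

lemma incidence_ne_zero (o : Δ.Orientations) (σ τ : Δ.Cone) : incidence o σ τ ≠ 0 := by
  unfold incidence incidenceSign; split_ifs <;> norm_num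

/-- A functional defining a facet. -/
lemma exists_facet_functional (hs : Δ.IsSmooth) {σ τ : Δ.Cone} (h : τ < σ) :
    ∃ ℓ : (Fin n → ℝ) →ₗ[ℝ] ℝ, (∀ x ∈ σ.1, 0 ≤ ℓ x) ∧ (∀ x ∈ τ.span, ℓ x = 0) ∧
      ∃ x ∈ σ.1, ℓ x ≠ 0 := by
  classical
  obtain ⟨B, I, hB⟩ := σ.exists_basis hs
  obtain ⟨J, hJ, hJτ⟩ := face_coneOf B (hB ▸ Fan.Cone.isFaceOf h.le)
  have hne : ∃ i ∈ I, i ∉ J := by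
    by_contra! hcon
    exact h.not_ge (show σ.1 ≤ τ.1 by rw [hB, hJτ, coneOf_le]; exact hcon)
  obtain ⟨i, hi, hiJ⟩ := hne
  refine ⟨B.coord i, fun x hx => ?_, fun x hx => ?_, B i, ?_, by simp⟩
  · rw [hB, mem_coneOf] at hx
    exact hx.1 i
  · have : τ.span ≤ LinearMap.ker (B.coord i) := by
      refine Submodule.span_le.2 fun w hw => ?_
      have hw : w ∈ τ.1 := hw
      rw [hJτ, mem_coneOf] at hw
      exact hw.2 i hiJ
    exact this hx
  · rw [hB]; exact (basis_mem_coneOf B).2 hi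

/-- Completing a basis of the span of a facet. -/
lemma exists_compat_basis {σ τ : Δ.Cone} (h : τ ≤ σ) (hd : σ.dim = τ.dim + 1)
    (b : Module.Basis (Fin τ.dim) ℝ τ.span) {v : Fin n → ℝ} (hv : v ∈ σ.1) (hv' : v ∉ τ.span) :
    ∃ c : Module.Basis (Fin σ.dim) ℝ σ.span, ∀ j, (c j : Fin n → ℝ) =
      (Fin.cons v (fun i => (b i : Fin n → ℝ)) : Fin (τ.dim + 1) → Fin n → ℝ) (Fin.cast hd j) := by
  have hli : LinearIndependent ℝ
      (Fin.cons v (fun i => (b i : Fin n → ℝ)) : Fin (τ.dim + 1) → Fin n → ℝ) := by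
    rw [linearIndependent_finCons]
    refine ⟨b.linearIndependent.map' τ.span.subtype (Submodule.ker_subtype _), fun hmem => hv' ?_⟩
    refine Submodule.span_le.2 ?_ hmem
    rintro _ ⟨i, rfl⟩
    exact (b i).2
  have hmem : ∀ j, (Fin.cons v (fun i => (b i : Fin n → ℝ)) : Fin (τ.dim + 1) → Fin n → ℝ) j ∈
      σ.span := by
    intro j
    refine Fin.cases ?_ (fun i => ?_) j
    · exact σ.le_span hv
    · exact Fan.Cone.span_mono h (b i).2
  have hli' : LinearIndependent ℝ (fun j : Fin σ.dim => (⟨_, hmem (Fin.cast hd j)⟩ : σ.span)) := by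
    apply LinearIndependent.of_comp σ.span.subtype
    exact hli.comp _ (Fin.cast_injective hd)
  have hcard : Fintype.card (Fin σ.dim) = Module.finrank ℝ σ.span := Fintype.card_fin _
  by_cases h0 : Nonempty (Fin σ.dim)
  · refine ⟨basisOfLinearIndependentOfCardEqFinrank hli' hcard, fun j => ?_⟩
    rw [coe_basisOfLinearIndependentOfCardEqFinrank]
  · exact absurd ⟨Fin.cast hd.symm 0⟩ h0

open Classical in
lemma topSign_mul_incidence (hs : Δ.IsSmooth) (o : Δ.Orientations) {σ τ : Δ.Cone} (h : τ ≤ σ)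
    (hd : τ.dim + 1 = n) (hσ : σ.dim = n) (b : Module.Basis (Fin τ.dim) ℝ τ.span)
    {v : Fin n → ℝ} (hv : v ∈ σ.1) (hv' : v ∉ τ.span) :
    topSign o σ * incidence o σ τ = basisSign b (o τ) *
      if 0 < topForm hd (Fin.cons v (fun i => (b i : Fin n → ℝ))) then 1 else -1 := by
  have hd' : σ.dim = τ.dim + 1 := hσ.trans hd.symm
  obtain ⟨c, hcc⟩ := exists_compat_basis h hd' b hv hv'
  have hlt : τ < σ := lt_of_le_of_ne h fun he => by rw [he] at hd'; omega
  obtain ⟨ℓ, h1, h2, x, hx, hx'⟩ := exists_facet_functional hs hlt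
  have hinc : incidence o σ τ = basisSign b (o τ) * basisSign c (o σ) := by
    refine incidenceSign_eq hd' ℓ h1 h2 ⟨x, σ.le_span hx, hx'⟩ _ _ ⟨fun j hj => ?_, fun i j hij => ?_⟩
    · rw [hcc, show Fin.cast hd' j = 0 from Fin.ext hj]
      exact hv
    · rw [hcc, show Fin.cast hd' j = i.succ from Fin.ext hij]
      rfl
  have htop : topForm hσ (fun i => (c i : Fin n → ℝ)) =
      topForm hd (Fin.cons v (fun i => (b i : Fin n → ℝ))) := by
    simp only [hcc]
    rfl
  rw [topSign_eq o σ hσ c, hinc, htop]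
  have := basisSign_mul_self c (o σ)
  linear_combination (basisSign b (o τ) * if 0 < topForm hd
    (Fin.cons v (fun i => (b i : Fin n → ℝ))) then 1 else -1) * this

/-- A cone of dimension `n - 1` separates exactly two cones of dimension `n`, whose induced
orientations are opposite. -/
lemma exists_two_chambers (hs : Δ.IsSmooth) (hc : Δ.IsComplete) (o : Δ.Orientations) {τ : Δ.Cone}
    (hd : τ.dim + 1 = n) : ∃ σ₁ σ₂ : Δ.Cone, σ₁ ≠ σ₂ ∧
      (∀ σ : Δ.Cone, (τ ≤ σ ∧ σ.dim = n) ↔ σ = σ₁ ∨ σ = σ₂) ∧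
      topSign o σ₁ * incidence o σ₁ τ + topSign o σ₂ * incidence o σ₂ τ = 0 := by
  classical
  let b : Module.Basis (Fin τ.dim) ℝ τ.span := Module.finBasis ℝ τ.span
  let ℓ : (Fin n → ℝ) →ₗ[ℝ] ℝ := (topForm hd).toMultilinearMap.toLinearMap
    (Fin.cons 0 (fun i => (b i : Fin n → ℝ))) 0
  have hℓ : ∀ v, ℓ v = topForm hd (Fin.cons v (fun i => (b i : Fin n → ℝ))) := by
    intro v
    show topForm hd (Function.update (Fin.cons 0 (fun i => (b i : Fin n → ℝ))) 0 v) = _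
    rw [Fin.update_cons_zero]
  have hbspan : Submodule.span ℝ (Set.range fun i => (b i : Fin n → ℝ)) = τ.span := by
    have := congrArg (Submodule.map τ.span.subtype) b.span_eq
    rw [Submodule.map_span, ← Set.range_comp, Submodule.map_subtype_top] at this
    exact this
  have hker : ∀ v, v ∉ τ.span → ℓ v ≠ 0 := by
    intro v hv
    rw [hℓ]
    refine topForm_ne_zero hd (linearIndependent_finCons.2
      ⟨b.linearIndependent.map' τ.span.subtype (Submodule.ker_subtype _), ?_⟩)
    change v ∉ Submodule.span ℝ (Set.range fun i => (b i : Fin n → ℝ))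
    rwa [hbspan]
  have hzero : ∀ v ∈ τ.span, ℓ v = 0 := by
    have hle : τ.span ≤ LinearMap.ker ℓ := by
      rw [← hbspan]
      refine Submodule.span_le.2 ?_
      rintro _ ⟨i, rfl⟩
      show ℓ (b i) = 0
      rw [hℓ]
      exact (topForm hd).map_eq_zero_of_eq _ (i := 0) (j := i.succ) (by simp) (Fin.succ_ne_zero i).symm
    exact fun v hv => hle hv
  obtain ⟨t, ht⟩ := τ.exists_relInt_point hs
  obtain ⟨r, hr, hball⟩ := ht.exists_ball hs
  have hdimn : ∀ σ : Δ.Cone, τ ≤ σ → ∀ x ∈ σ.1, x ∉ τ.span → σ.dim = n := by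
    intro σ hτσ x hx hx'
    have hlt : τ < σ := lt_of_le_of_ne hτσ fun he => hx' (he ▸ σ.le_span hx)
    have := Fan.Cone.dim_lt hs hlt
    have := σ.dim_le
    omega
  have hex : ∀ w : Fin n → ℝ, w ∉ τ.span → ∃ (σ : Δ.Cone) (a : ℝ), 0 < a ∧ τ ≤ σ ∧ t + a • w ∈ σ.1 := by
    intro w hw
    have hcont : Filter.Tendsto (fun a : ℝ => (t + a • w - t) ⬝ᵥ (t + a • w - t))
        (nhdsWithin 0 (Set.Ioi 0)) (nhds 0) := by
      have : Continuous fun a : ℝ => (t + a • w - t) ⬝ᵥ (t + a • w - t) := by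
        simp only [add_sub_cancel_left, smul_dotProduct, dotProduct_smul]
        fun_prop
      have h1 := (this.tendsto 0).mono_left (nhdsWithin_le_nhds (s := Set.Ioi 0))
      simpa using h1
    obtain ⟨a, ha, ha'⟩ := ((hcont.eventually (gt_mem_nhds hr)).and self_mem_nhdsWithin).exists
    obtain ⟨σ, hσ, hmem⟩ := hc (t + a • w)
    exact ⟨⟨σ, hσ⟩, a, ha', hball _ ha ⟨σ, hσ⟩ hmem, hmem⟩
  have htop : τ.span ≠ ⊤ := by
    intro h
    have h1 : τ.dim = n := by
      unfold Fan.Cone.dim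
      rw [h, finrank_top, Module.finrank_fin_fun]
    omega
  obtain ⟨w, -, hw⟩ := SetLike.exists_of_lt (lt_top_iff_ne_top.2 htop)
  wlog hwpos : 0 < ℓ w generalizing w
  · refine this (-w) (fun h => hw (by simpa using τ.span.neg_mem h)) ?_
    rw [map_neg]
    have := hker w hw
    have : ℓ w < 0 := lt_of_le_of_ne (not_lt.1 hwpos) this
    linarith
  have hw' : -w ∉ τ.span := fun h => hw (by simpa using τ.span.neg_mem h)
  have hout : ∀ a : ℝ, a ≠ 0 → ∀ u ∉ τ.span, t + a • u ∉ τ.span := by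
    intro a ha u hu hmem
    apply hu
    have h1 := τ.span.sub_mem hmem (τ.le_span ht.mem)
    rw [add_sub_cancel_left] at h1
    exact (Submodule.smul_mem_iff _ ha).1 h1
  have huniq : ∀ σ σ' : Δ.Cone, τ ≤ σ → τ ≤ σ' → σ.dim = n → ∀ v ∈ σ.1, ∀ v' ∈ σ'.1, v ∉ τ.span →
      v' ∉ τ.span → 0 < ℓ v * ℓ v' → σ ≤ σ' := by
    intro σ σ' hσ hσ' hσd v hv v' hv' hvτ hvτ' hpos
    -- `v = a v' + u` with `a > 0` and `u` in the span of `τ`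
    set a := ℓ v / ℓ v' with ha
    have hv'0 := hker v' hvτ'
    have hapos : 0 < a := by
      have : a = (ℓ v * ℓ v') / (ℓ v') ^ 2 := by rw [ha]; field_simp
      rw [this]; positivity
    have hu : v - a • v' ∈ τ.span := by
      by_contra hcon
      apply hker _ hcon
      rw [map_sub, map_smul, smul_eq_mul, ha, div_mul_cancel₀ _ hv'0, sub_self]
    obtain ⟨ε, hε, hmem⟩ := ht.exists_pos hs hu
    have hx : t + ε • v ∈ σ'.1 := by
      have h1 := hmem ε (by rw [abs_of_pos hε])
      have h2 : t + ε • v = (t + ε • (v - a • v')) + (ε * a) • v' := by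
        rw [smul_sub, smul_smul]; abel
      rw [h2]
      exact σ'.1.add_mem (hσ' h1) (PointedCone.smul_mem _ (by positivity) hv')
    have hx' : t + ε • v ∈ σ.1 :=
      σ.1.add_mem (hσ ht.mem) (PointedCone.smul_mem _ hε.le hv)
    let η : Δ.Cone := ⟨σ.1 ⊓ σ'.1, Δ.face_mem σ.1 σ.2 _ (Δ.inf_face σ.1 σ.2 σ'.1 σ'.2)⟩
    have hητ : τ ≤ η := le_inf (show τ.1 ≤ σ.1 from hσ) (show τ.1 ≤ σ'.1 from hσ')
    have hηn : η.dim = n := hdimn η hητ _ ⟨hx', hx⟩ (hout ε hε.ne' v hvτ)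
    have hησ : η ≤ σ := show σ.1 ⊓ σ'.1 ≤ σ.1 from inf_le_left
    have hησ' : η = σ := by
      by_contra hne
      have := Fan.Cone.dim_lt hs (lt_of_le_of_ne hησ hne)
      omega
    exact hησ' ▸ (show η ≤ σ' from show σ.1 ⊓ σ'.1 ≤ σ'.1 from inf_le_right)
  obtain ⟨σ₁, a₁, ha₁, hτ₁, hm₁⟩ := hex w hw
  obtain ⟨σ₂, a₂, ha₂, hτ₂, hm₂⟩ := hex (-w) hw'
  have hn₁ := hout a₁ ha₁.ne' w hw
  have hn₂ := hout a₂ ha₂.ne' (-w) hw'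
  have hd₁ := hdimn σ₁ hτ₁ _ hm₁ hn₁
  have hd₂ := hdimn σ₂ hτ₂ _ hm₂ hn₂
  have hp₁ : 0 < ℓ (t + a₁ • w) := by
    rw [map_add, hzero t (τ.le_span ht.mem), map_smul, zero_add, smul_eq_mul]
    positivity
  have hp₂ : ℓ (t + a₂ • -w) < 0 := by
    rw [map_add, hzero t (τ.le_span ht.mem), map_smul, zero_add, map_neg, smul_eq_mul]
    nlinarith
  have hs₁ := topSign_mul_incidence hs o hτ₁ hd hd₁ b hm₁ hn₁
  have hs₂ := topSign_mul_incidence hs o hτ₂ hd hd₂ b hm₂ hn₂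
  rw [← hℓ, if_pos hp₁] at hs₁
  rw [← hℓ, if_neg hp₂.not_gt] at hs₂
  refine ⟨σ₁, σ₂, ?_, fun σ => ⟨?_, ?_⟩, ?_⟩
  · rintro rfl
    rw [hs₁] at hs₂
    have := basisSign_mul_self b (o τ)
    have h0 : basisSign b (o τ) = 0 := by linarith
    rw [h0] at this
    norm_num at this
  · rintro ⟨hτσ, hdσ⟩
    have hv : ∃ v ∈ σ.1, v ∉ τ.span := by
      by_contra! hcon
      have h1 : σ.span ≤ τ.span := Submodule.span_le.2 hcon
      have h2 : σ.dim ≤ τ.dim := Submodule.finrank_mono h1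
      omega
    obtain ⟨v, hv, hvτ⟩ := hv
    rcases lt_or_gt_of_ne (hker v hvτ) with hneg | hpos
    · right
      have h1 : 0 < ℓ v * ℓ (t + a₂ • -w) := mul_pos_of_neg_of_neg hneg hp₂
      exact le_antisymm (huniq σ σ₂ hτσ hτ₂ hdσ v hv _ hm₂ hvτ hn₂ h1)
        (huniq σ₂ σ hτ₂ hτσ hd₂ _ hm₂ v hv hn₂ hvτ (by rwa [mul_comm]))
    · left
      have h1 : 0 < ℓ v * ℓ (t + a₁ • w) := mul_pos hpos hp₁
      exact le_antisymm (huniq σ σ₁ hτσ hτ₁ hdσ v hv _ hm₁ hvτ hn₁ h1)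
        (huniq σ₁ σ hτ₁ hτσ hd₁ _ hm₁ v hv hn₁ hvτ (by rwa [mul_comm]))
  · rintro (rfl | rfl)
    · exact ⟨hτ₁, hd₁⟩
    · exact ⟨hτ₂, hd₂⟩
  · rw [hs₁, hs₂]; ring

open Classical in
/-- The boundary matrix of the fan, augmented by a generator `⊤` whose boundary is the fundamental
chain. -/
def bdry (o : Δ.Orientations) : WithTop Δ.Cone → WithTop Δ.Cone → ℂ
  | _, none => 0
  | none, some σ => if σ.dim = n then (topSign o σ : ℂ) else 0
  | some σ, some τ => if τ ≤ σ ∧ σ.dim = τ.dim + 1 then (incidence o σ τ : ℂ) else 0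

@[simp] lemma bdry_top (o : Δ.Orientations) (x : WithTop Δ.Cone) : bdry o x ⊤ = 0 := by
  cases x <;> rfl

open Classical in
lemma bdry_top_coe (o : Δ.Orientations) (σ : Δ.Cone) :
    bdry o ⊤ σ = if σ.dim = n then (topSign o σ : ℂ) else 0 := rfl

open Classical in
lemma bdry_coe_coe (o : Δ.Orientations) (σ τ : Δ.Cone) :
    bdry o σ τ = if τ ≤ σ ∧ σ.dim = τ.dim + 1 then (incidence o σ τ : ℂ) else 0 := rfl

lemma bdry_lt (o : Δ.Orientations) {x y : WithTop Δ.Cone} (h : bdry o x y ≠ 0) : y < x := by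
  classical
  induction y with
  | top => simp at h
  | coe τ =>
    induction x with
    | top => exact WithTop.coe_lt_top τ
    | coe σ =>
      rw [bdry_coe_coe] at h
      have := (ite_ne_right_iff.1 h).1
      refine WithTop.coe_lt_coe.2 (lt_of_le_of_ne this.1 ?_)
      rintro rfl
      omega

instance : Fintype Δ.Cone := Fintype.ofFinite _

lemma bdry_bdry (hs : Δ.IsSmooth) (hc : Δ.IsComplete) (o : Δ.Orientations) (x z : WithTop Δ.Cone) :
    ∑ y, bdry o x y * bdry o y z = 0 := by
  classical
  have hsplit : ∑ y, bdry o x y * bdry o y z = ∑ τ : Δ.Cone, bdry o x τ * bdry o τ z := by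
    have : ∑ y, bdry o x y * bdry o y z = bdry o x ⊤ * bdry o ⊤ z +
      ∑ τ : Δ.Cone, bdry o x τ * bdry o τ z := Fintype.sum_option _
    rw [this, bdry_top, zero_mul, zero_add]
  rw [hsplit]
  induction z with
  | top => simp
  | coe ξ =>
    have hpair : ∀ τ₁ τ₂ : Δ.Cone, τ₁ ≠ τ₂ →
        (∀ τ : Δ.Cone, bdry o x τ * bdry o τ ξ ≠ 0 → τ = τ₁ ∨ τ = τ₂) →
        ∑ τ : Δ.Cone, bdry o x τ * bdry o τ ξ =
          bdry o x τ₁ * bdry o τ₁ ξ + bdry o x τ₂ * bdry o τ₂ ξ := by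
      intro τ₁ τ₂ hne h
      rw [← Finset.sum_pair hne (f := fun τ : Δ.Cone => bdry o x τ * bdry o τ ξ)]
      refine (Finset.sum_subset (Finset.subset_univ _) fun τ _ hτ => ?_).symm
      by_contra hne0
      apply hτ
      rw [Finset.mem_insert, Finset.mem_singleton]
      exact h τ hne0
    induction x with
    | top =>
      by_cases hd : ξ.dim + 1 = n
      · obtain ⟨σ₁, σ₂, hne, hiff, hsum⟩ := exists_two_chambers hs hc o hd
        rw [hpair σ₁ σ₂ hne]
        · have h1 := (hiff σ₁).2 (Or.inl rfl)
          have h2 := (hiff σ₂).2 (Or.inr rfl)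
          rw [bdry_top_coe, bdry_top_coe, bdry_coe_coe, bdry_coe_coe, if_pos h1.2, if_pos h2.2,
            if_pos ⟨h1.1, by omega⟩, if_pos ⟨h2.1, by omega⟩]
          exact_mod_cast hsum
        · intro τ hτ
          rw [bdry_top_coe, bdry_coe_coe] at hτ
          have h1 := (ite_ne_right_iff.1 (left_ne_zero_of_mul hτ)).1
          have h2 := (ite_ne_right_iff.1 (right_ne_zero_of_mul hτ)).1
          exact (hiff τ).1 ⟨h2.1, h1⟩
      · refine Finset.sum_eq_zero fun τ _ => ?_
        by_contra hτ
        rw [bdry_top_coe, bdry_coe_coe] at hτ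
        have h1 := (ite_ne_right_iff.1 (left_ne_zero_of_mul hτ)).1
        have h2 := (ite_ne_right_iff.1 (right_ne_zero_of_mul hτ)).1
        omega
    | coe σ =>
      by_cases hd : ξ ≤ σ ∧ σ.dim = ξ.dim + 2
      · obtain ⟨σ₁, σ₂, hne, hiff, hsum⟩ := diamond hs o hd.1 hd.2
        rw [hpair σ₁ σ₂ hne]
        · have h1 := (hiff σ₁).2 (Or.inl rfl)
          have h2 := (hiff σ₂).2 (Or.inr rfl)
          simp only [bdry_coe_coe]
          rw [if_pos ⟨h1.2.1, by omega⟩, if_pos ⟨h1.1, h1.2.2⟩, if_pos ⟨h2.2.1, by omega⟩,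
            if_pos ⟨h2.1, h2.2.2⟩]
          exact_mod_cast hsum
        · intro τ hτ
          rw [bdry_coe_coe, bdry_coe_coe] at hτ
          have h1 := (ite_ne_right_iff.1 (left_ne_zero_of_mul hτ)).1
          have h2 := (ite_ne_right_iff.1 (right_ne_zero_of_mul hτ)).1
          exact (hiff τ).1 ⟨h2.1, h1.1, h2.2⟩
      · refine Finset.sum_eq_zero fun τ _ => ?_
        by_contra hτ
        rw [bdry_coe_coe, bdry_coe_coe] at hτ
        have h1 := (ite_ne_right_iff.1 (left_ne_zero_of_mul hτ)).1
        have h2 := (ite_ne_right_iff.1 (right_ne_zero_of_mul hτ)).1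
        exact hd ⟨h2.1.trans h1.1, by omega⟩

lemma squareZero_of_ordConnected (hs : Δ.IsSmooth) (hc : Δ.IsComplete) (o : Δ.Orientations)
    {S : Set (WithTop Δ.Cone)} (hS : S.OrdConnected) : SquareZero (bdry o) S :=
  squareZero_of_convex (bdry_bdry hs hc o) fun _ hx _ hz _ h1 h2 =>
    hS.out hz hx ⟨(bdry_lt o h2).le, (bdry_lt o h1).le⟩

end Boundary

end KoszulFan
end

noncomputable section

namespace KoszulFan

/-! ### Acyclicity of the augmented star complexes of a complete fan -/

section Acyclicity

variable {n : ℕ} {Δ : Fan n}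

/-- The functional `x ↦ ⟨v, x⟩`. -/
def dotDual (v : Fin n → ℝ) : Module.Dual ℝ (Fin n → ℝ) where
  toFun x := v ⬝ᵥ x
  map_add' := dotProduct_add v
  map_smul' c x := dotProduct_smul c v x

@[simp] lemma dotDual_apply (v x : Fin n → ℝ) : dotDual v x = v ⬝ᵥ x := rfl

lemma exists_dotDual_eq (w : Module.Dual ℝ (Fin n → ℝ)) : ∃ v, dotDual v = w := by
  refine ⟨fun i => w (Pi.single i 1), ?_⟩
  ext i
  simp

/-- The orthogonal complement. -/
def dotPerp (L : Submodule ℝ (Fin n → ℝ)) : Submodule ℝ (Fin n → ℝ) where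
  carrier := {v | ∀ l ∈ L, v ⬝ᵥ l = 0}
  zero_mem' l _ := zero_dotProduct l
  add_mem' {a b} ha hb l hl := by rw [add_dotProduct, ha l hl, hb l hl, add_zero]
  smul_mem' c a ha l hl := by rw [smul_dotProduct, ha l hl, smul_zero]

lemma exists_sub_mem_dotPerp (L : Submodule ℝ (Fin n → ℝ)) (u : Fin n → ℝ) :
    ∃ l ∈ L, u - l ∈ dotPerp L := by
  obtain ⟨l, hl⟩ := exists_isNearest (K := PointedCone.ofSubmodule L)
    (by exact L.closed_of_finiteDimensional) u
  refine ⟨l, hl.mem, fun x hx => le_antisymm (hl.le x hx) ?_⟩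
  have := hl.le (-x) (L.neg_mem hx)
  rw [dotProduct_neg] at this
  linarith

/-- The part of the star of `τ` consisting of the cones meeting the subspace `H` in a point satisfying
`P`, together with the augmentation. -/
def starMeet (τ : Δ.Cone) (H : Submodule ℝ (Fin n → ℝ)) (P : (Fin n → ℝ) → Prop) :
    Set (WithTop Δ.Cone) :=
  {x | (τ : WithTop Δ.Cone) ≤ x ∧ ∀ σ : Δ.Cone, x = σ → ∃ u ∈ σ.1, u ∈ H ∧ P u}

/-- The part of the star of `τ` contained in the half-space `w ≤ 0`. -/
def starHalf (τ : Δ.Cone) (w : Module.Dual ℝ (Fin n → ℝ)) : Set (WithTop Δ.Cone) :=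
  {x | ∃ σ : Δ.Cone, x = σ ∧ τ ≤ σ ∧ ∀ v ∈ σ.1, w v ≤ 0}

lemma coe_mem_starMeet {τ σ : Δ.Cone} {H : Submodule ℝ (Fin n → ℝ)} {P : (Fin n → ℝ) → Prop} :
    (σ : WithTop Δ.Cone) ∈ starMeet τ H P ↔ τ ≤ σ ∧ ∃ u ∈ σ.1, u ∈ H ∧ P u := by
  constructor
  · rintro ⟨h1, h2⟩
    exact ⟨WithTop.coe_le_coe.1 h1, h2 σ rfl⟩
  · rintro ⟨h1, h2⟩
    refine ⟨WithTop.coe_le_coe.2 h1, fun σ' h => ?_⟩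
    rw [← WithTop.coe_eq_coe.1 h]
    exact h2

lemma top_mem_starMeet {τ : Δ.Cone} {H : Submodule ℝ (Fin n → ℝ)} {P : (Fin n → ℝ) → Prop} :
    (⊤ : WithTop Δ.Cone) ∈ starMeet τ H P :=
  ⟨le_top, fun _ h => absurd h (WithTop.coe_ne_top).symm⟩

lemma coe_mem_starHalf {τ σ : Δ.Cone} {w : Module.Dual ℝ (Fin n → ℝ)} :
    (σ : WithTop Δ.Cone) ∈ starHalf τ w ↔ τ ≤ σ ∧ ∀ v ∈ σ.1, w v ≤ 0 := by
  constructor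
  · rintro ⟨σ', h, h1⟩
    rw [WithTop.coe_eq_coe.1 h]
    exact h1
  · exact fun h => ⟨σ, rfl, h⟩

lemma top_notMem_starHalf {τ : Δ.Cone} {w : Module.Dual ℝ (Fin n → ℝ)} :
    (⊤ : WithTop Δ.Cone) ∉ starHalf τ w := by
  rintro ⟨σ, h, _⟩
  exact WithTop.coe_ne_top h.symm

lemma starMeet_upper (τ : Δ.Cone) (H : Submodule ℝ (Fin n → ℝ)) (P : (Fin n → ℝ) → Prop) :
    IsUpperSet (starMeet τ H P) := by
  intro x y hxy hx
  refine ⟨hx.1.trans hxy, fun σ hσ => ?_⟩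
  subst hσ
  induction x with
  | top => exact absurd (top_le_iff.1 hxy) WithTop.coe_ne_top
  | coe ρ =>
    obtain ⟨u, hu, h⟩ := hx.2 ρ rfl
    exact ⟨u, WithTop.coe_le_coe.1 hxy hu, h⟩

/-- The subspace `H` is transversal to the cones of the star of `τ`. -/
def Transversal (τ : Δ.Cone) (H : Submodule ℝ (Fin n → ℝ)) : Prop :=
  ∀ τ' : Δ.Cone, τ ≤ τ' → H ⊓ τ'.span ≤ τ.span ∨ H ⊔ τ'.span = ⊤

lemma dotProduct_add_self_le (a b : Fin n → ℝ) :
    (a + b) ⬝ᵥ (a + b) ≤ 2 * (a ⬝ᵥ a) + 2 * (b ⬝ᵥ b) := by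
  have := dotProduct_sub_self_nonneg a b
  simp only [add_dotProduct, dotProduct_add, sub_dotProduct, dotProduct_sub] at *
  linarith [dotProduct_comm a b]

lemma IsNearest.le_of_mem {K : PointedCone ℝ (Fin n → ℝ)} {v y x : Fin n → ℝ} (h : IsNearest K v y)
    (hx : x ∈ K) : (v - y) ⬝ᵥ (v - y) ≤ (v - x) ⬝ᵥ (v - x) := by
  rcases h.eq_or_lt hx with rfl | h
  · exact le_rfl
  · exact h.le

lemma dotProduct_self_pos {v : Fin n → ℝ} (hv : v ≠ 0) : 0 < v ⬝ᵥ v := by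
  have := dotProduct_sub_self_nonneg v 0
  rw [sub_zero] at this
  exact lt_of_le_of_ne this fun h => hv (dotProduct_self_eq_zero.1 h.symm)

/-- The cones of the star of `τ` which meet an open half-space of a transversal subspace form an acyclic
complex, by induction on the codimension of `τ`. -/
lemma acyclicOn_starMeet_pos (hs : Δ.IsSmooth) (hc : Δ.IsComplete) (o : Δ.Orientations) (τ : Δ.Cone)
    (hA : ∀ τ' : Δ.Cone, τ < τ' → AcyclicOn (bdry o) (Set.Ici (τ' : WithTop Δ.Cone)))
    (hB : ∀ τ' : Δ.Cone, τ < τ' → ∀ w : Module.Dual ℝ (Fin n → ℝ), (∀ x ∈ τ'.span, w x = 0) → w ≠ 0 →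
      AcyclicOn (bdry o) (starHalf τ' w))
    {H : Submodule ℝ (Fin n → ℝ)} (hLH : τ.span ≤ H) (hT : Transversal τ H) {v : Fin n → ℝ}
    (hvH : v ∈ H) (hvL : v ∈ dotPerp τ.span) (hv0 : v ≠ 0) :
    AcyclicOn (bdry o) (starMeet τ H (fun u => 0 < v ⬝ᵥ u)) := by
  classical
  obtain ⟨t, ht⟩ := τ.exists_relInt_point hs
  obtain ⟨r, hr, hball⟩ := ht.exists_ball hs
  have hvv := dotProduct_self_pos hv0
  obtain ⟨ε, hε, hεr⟩ : ∃ ε : ℝ, 0 < ε ∧ 4 * (ε ^ 2 * (v ⬝ᵥ v)) < r := by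
    have hcont : Filter.Tendsto (fun a : ℝ => 4 * (a ^ 2 * (v ⬝ᵥ v)))
        (nhdsWithin 0 (Set.Ioi 0)) (nhds 0) := by
      have : Continuous fun a : ℝ => 4 * (a ^ 2 * (v ⬝ᵥ v)) := by fun_prop
      have h1 := (this.tendsto 0).mono_left (nhdsWithin_le_nhds (s := Set.Ioi 0))
      simpa using h1
    obtain ⟨a, ha, ha'⟩ := ((hcont.eventually (gt_mem_nhds hr)).and self_mem_nhdsWithin).exists
    exact ⟨a, ha', ha⟩
  have htL : t ∈ τ.span := τ.le_span ht.mem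
  have htH : t ∈ H := hLH htL
  have hvt : v ⬝ᵥ t = 0 := hvL t htL
  set v₀ : Fin n → ℝ := t + ε • v with hv₀
  have hv₀H : v₀ ∈ H := H.add_mem htH (H.smul_mem _ hvH)
  have hv₀t : (v₀ - t) ⬝ᵥ (v₀ - t) = ε ^ 2 * (v ⬝ᵥ v) := by
    rw [hv₀, add_sub_cancel_left, smul_dotProduct, dotProduct_smul, smul_eq_mul, smul_eq_mul]; ring
  have hvv₀ : 0 < v ⬝ᵥ v₀ := by
    rw [hv₀, dotProduct_add, hvt, dotProduct_smul, zero_add, smul_eq_mul]; positivity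
  -- nearest points
  let K : Δ.Cone → PointedCone ℝ (Fin n → ℝ) := fun σ => σ.1 ⊓ PointedCone.ofSubmodule H
  have hK : ∀ σ x, x ∈ K σ ↔ x ∈ σ.1 ∧ x ∈ H := fun σ x => Iff.rfl
  have hKcl : ∀ σ, IsClosed (K σ : Set (Fin n → ℝ)) := fun σ =>
    (σ.isClosed hs).inter (H.closed_of_finiteDimensional)
  choose near hnear using fun σ => exists_isNearest (hKcl σ) v₀
  let key : WithTop Δ.Cone → (Fin n → ℝ) := fun x => match x with
    | none => v₀
    | some σ => near σ
  have hkey_top : key ⊤ = v₀ := rfl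
  have hkey : ∀ σ : Δ.Cone, key σ = near σ := fun _ => rfl
  have hself : ∀ σ : Δ.Cone, v₀ ∈ σ.1 → near σ = v₀ := by
    intro σ hσ
    refine (hnear σ).unique ⟨⟨hσ, hv₀H⟩, ?_, fun x _ => ?_⟩ <;> simp
  have hfar : ∀ σ : Δ.Cone, τ ≤ σ → (near σ - t) ⬝ᵥ (near σ - t) < r := by
    intro σ hσ
    have h1 := (hnear σ).le_of_mem (x := t) ⟨hσ ht.mem, htH⟩
    have h2 := dotProduct_add_self_le (near σ - v₀) (v₀ - t)
    rw [sub_add_sub_cancel, ← neg_sub v₀ (near σ), neg_dotProduct, dotProduct_neg, neg_neg] at h2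
    linarith
  set S := starMeet τ H (fun u => 0 < v ⬝ᵥ u) with hS
  have hmono : ∀ x ∈ S, ∀ y ∈ S, y ≤ x → key x = key y ∨
      (v₀ - key x) ⬝ᵥ (v₀ - key x) < (v₀ - key y) ⬝ᵥ (v₀ - key y) := by
    intro x _ y _ hyx
    induction y with
    | top => rw [top_le_iff.1 hyx]; exact Or.inl rfl
    | coe ρ =>
      induction x with
      | top =>
        by_cases h : v₀ = near ρ
        · exact Or.inl h
        · right
          rw [hkey_top, hkey, sub_self, zero_dotProduct]
          exact dotProduct_self_pos (sub_ne_zero.2 h)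
      | coe σ =>
        exact (hnear σ).eq_or_lt ⟨WithTop.coe_le_coe.1 hyx (hnear ρ).mem.1, (hnear ρ).mem.2⟩
  refine acyclicOn_of_filtration key (fun y => (v₀ - y) ⬝ᵥ (v₀ - y)) S ?_
    (fun x hx y hy h => hmono x hx y hy (bdry_lt o h).le) ?_
  · intro T hT h1 h2
    refine squareZero_of_ordConnected hs hc o ⟨fun z hz x hx y hy => ?_⟩
    have hyS : y ∈ S := starMeet_upper _ _ _ hy.1 (hT hz)
    rcases hmono y hyS z (hT hz) hy.1 with h | h
    · exact h1 y hyS z hz h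
    · exact h2 y hyS z hz h
  · intro x hx
    by_cases hxv : key x = v₀
    · obtain ⟨τ', hτ'⟩ := exists_relInt hc v₀
      have hττ' : τ ≤ τ' := hball v₀ (by rw [hv₀t]; nlinarith) τ' hτ'.mem
      have hlt : τ < τ' := by
        refine lt_of_le_of_ne hττ' fun h => hvv₀.ne' (hvL _ ?_)
        rw [h]
        exact τ'.le_span hτ'.mem
      convert hA τ' hlt using 1
      ext x'
      rw [hxv, Set.mem_ofPred_eq, Set.mem_Ici]
      induction x' with
      | top => exact ⟨fun _ => le_top, fun _ => ⟨top_mem_starMeet, rfl⟩⟩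
      | coe σ =>
        rw [hS, coe_mem_starMeet, hkey, WithTop.coe_le_coe]
        constructor
        · rintro ⟨-, h⟩
          refine (hτ' σ).1 ?_
          rw [← h]
          exact (hnear σ).mem.1
        · intro h
          have h1 := (hτ' σ).2 h
          exact ⟨⟨hττ'.trans h, v₀, h1, hv₀H, hvv₀⟩, hself σ h1⟩
    · induction x with
      | top => exact absurd rfl hxv
      | coe σ₀ =>
        rw [hkey] at hxv
        have hτσ₀ := (coe_mem_starMeet.1 hx).1
        rw [hkey]
        obtain ⟨y, hy⟩ : ∃ y, near σ₀ = y := ⟨_, rfl⟩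
        have hyn := hnear σ₀
        have hyfar := hfar σ₀ hτσ₀
        rw [hy] at hxv hyn hyfar ⊢
        obtain ⟨τ', hτ'⟩ := exists_relInt hc y
        have hττ' : τ ≤ τ' := hball y hyfar τ' hτ'.mem
        have hτ'σ₀ : τ' ≤ σ₀ := (hτ' σ₀).1 hyn.mem.1
        have hyH : y ∈ H := hyn.mem.2
        have horth : ∀ u ∈ H, u ∈ τ'.span → (v₀ - y) ⬝ᵥ u = 0 := by
          intro u hu hu'
          obtain ⟨e, he, hmem⟩ := hτ'.exists_pos hs hu'
          have h1 := hyn.le _ ⟨hτ'σ₀ (hmem e (by rw [abs_of_pos he])), H.add_mem hyH (H.smul_mem _ hu)⟩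
          have h2 := hyn.le _ ⟨hτ'σ₀ (hmem (-e) (by rw [abs_neg, abs_of_pos he])),
            H.add_mem hyH (H.smul_mem _ hu)⟩
          rw [dotProduct_add, hyn.orthogonal, dotProduct_smul, smul_eq_mul, zero_add] at h1 h2
          nlinarith
        have hlow : (y - t) ⬝ᵥ (y - t) ≤ ε * (v ⬝ᵥ y) := by
          have h1 := hyn.le t ⟨hτσ₀ ht.mem, htH⟩
          have h2 : (v₀ - y) ⬝ᵥ (y - t) = ε * (v ⬝ᵥ y) - (y - t) ⬝ᵥ (y - t) := by
            rw [show v₀ - y = ε • v - (y - t) by rw [hv₀]; abel, sub_dotProduct, smul_dotProduct,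
              dotProduct_sub v, hvt, sub_zero, smul_eq_mul]
          rw [dotProduct_sub, hyn.orthogonal] at h2
          linarith
        have hyt : y ≠ t := by
          rintro rfl
          obtain ⟨u, hu, huH, hpos⟩ := (coe_mem_starMeet.1 hx).2
          have h1 := hyn.le u ⟨hu, huH⟩
          rw [hv₀, add_sub_cancel_left, smul_dotProduct, smul_eq_mul] at h1
          nlinarith
        have hvy : 0 < v ⬝ᵥ y := by
          have := dotProduct_self_pos (sub_ne_zero.2 hyt)
          by_contra hcon
          nlinarith
        have hyL : y ∉ τ.span := fun h => hvy.ne' (hvL y h)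
        have hlt : τ < τ' := lt_of_le_of_ne hττ' fun h => hyL (h ▸ τ'.le_span hτ'.mem)
        have htop : H ⊔ τ'.span = ⊤ :=
          (hT τ' hττ').resolve_left fun h => hyL (h ⟨hyH, τ'.le_span hτ'.mem⟩)
        obtain ⟨w, hwτ', hwH⟩ : ∃ w : Module.Dual ℝ (Fin n → ℝ), (∀ x ∈ τ'.span, w x = 0) ∧
            ∀ x ∈ H, w x = (v₀ - y) ⬝ᵥ x := by
          have h1 : dotDual (v₀ - y) ∈ (H ⊓ τ'.span).dualAnnihilator := by
            rw [Submodule.mem_dualAnnihilator]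
            exact fun u hu => horth u hu.1 hu.2
          rw [Subspace.dualAnnihilator_inf_eq] at h1
          obtain ⟨a, ha, w, hw, haw⟩ := Submodule.mem_sup.1 h1
          rw [Submodule.mem_dualAnnihilator] at ha hw
          refine ⟨w, hw, fun x hx => ?_⟩
          rw [← dotDual_apply, ← haw, LinearMap.add_apply, ha x hx, zero_add]
        have hw0 : w ≠ 0 := by
          rintro rfl
          have h1 := hwH v₀ hv₀H
          have h2 := dotProduct_self_pos (sub_ne_zero.2 (Ne.symm hxv))
          rw [dotProduct_sub, hyn.orthogonal, ← h1] at h2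
          simp at h2
        convert hB τ' hlt w hwτ' hw0 using 1
        ext x'
        rw [Set.mem_ofPred_eq]
        induction x' with
        | top => exact ⟨fun h => absurd h.2.symm hxv, fun h => absurd h top_notMem_starHalf⟩
        | coe σ =>
          rw [hS, coe_mem_starMeet, coe_mem_starHalf, hkey]
          constructor
          · rintro ⟨⟨hτσ, -⟩, hσ⟩
            have hσn := hnear σ
            rw [hσ] at hσn
            have hτ'σ : τ' ≤ σ := (hτ' σ).1 hσn.mem.1
            refine ⟨hτ'σ, fun x hx => ?_⟩
            obtain ⟨h, hh, s, hs', rfl⟩ := Submodule.mem_sup.1 (htop ▸ Submodule.mem_top (x := x))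
            rw [map_add, hwτ' s hs', add_zero, hwH h hh]
            obtain ⟨e, he, hmem⟩ := hτ'.exists_pos hs hs'
            have h1 := hσn.le (y + e • h) ⟨by
              rw [show y + e • h = (y + (-e) • s) + e • (h + s) by rw [neg_smul, smul_add]; abel]
              exact σ.1.add_mem (hτ'σ (hmem _ (by rw [abs_neg, abs_of_pos he])))
                (PointedCone.smul_mem _ he.le hx), H.add_mem hyH (H.smul_mem _ hh)⟩
            rw [dotProduct_add, hyn.orthogonal, dotProduct_smul, smul_eq_mul, zero_add] at h1
            by_contra hcon
            nlinarith
          · rintro ⟨hτ'σ, hle⟩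
            have hyσ : y ∈ σ.1 := (hτ' σ).2 hτ'σ
            refine ⟨⟨hττ'.trans hτ'σ, y, hyσ, hyH, hvy⟩, (hnear σ).unique
              ⟨⟨hyσ, hyH⟩, hyn.orthogonal, fun x hx => ?_⟩⟩
            rw [← hwH x hx.2]
            exact hle x hx.1

end Acyclicity

end KoszulFan
end

noncomputable section

namespace KoszulFan

section Acyclicity

variable {n : ℕ} {Δ : Fan n}

lemma Transversal.exists_cut (τ : Δ.Cone) {H : Submodule ℝ (Fin n → ℝ)} (hLH : τ.span ≤ H)
    (hne : H ≠ τ.span) (hT : Transversal τ H) :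
    ∃ v ∈ H, v ∈ dotPerp τ.span ∧ v ≠ 0 ∧ Transversal τ (H ⊓ LinearMap.ker (dotDual v)) ∧
      ∀ τ' : Δ.Cone, ∀ x ∈ H, x ∈ τ'.span → x ∉ τ.span →
        ∃ u ∈ H, u ∈ τ'.span ∧ v ⬝ᵥ u ≠ 0 := by
  classical
  have hex : ∀ u ∈ H, u ∉ τ.span → ∃ v ∈ H ⊓ dotPerp τ.span, v ⬝ᵥ u ≠ 0 := by
    intro u hu huL
    obtain ⟨l, hl, hul⟩ := exists_sub_mem_dotPerp τ.span u
    refine ⟨u - l, ⟨H.sub_mem hu (hLH hl), hul⟩, ?_⟩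
    have h1 : (u - l) ⬝ᵥ u = (u - l) ⬝ᵥ (u - l) := by
      rw [dotProduct_sub (u - l) u l, hul l hl, sub_zero]
    rw [h1]
    exact (dotProduct_self_pos (sub_ne_zero.2 fun h : u = l => huL (h.symm ▸ hl))).ne'
  obtain ⟨u₀, hu₀, hu₀L⟩ : ∃ u ∈ H, u ∉ τ.span := by
    by_contra! hcon
    exact hne (le_antisymm hcon hLH)
  let ι := {τ' : Δ.Cone // ∃ u ∈ H, u ∈ τ'.span ∧ u ∉ τ.span}
  choose u huH hu huL using fun i : ι => i.2
  let f : Option ι → Module.Dual ℝ (Fin n → ℝ) := fun i => i.elim (dotDual u₀) fun j => dotDual (u j)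
  obtain ⟨v, hv, hvf⟩ := Module.Dual.exists_forall_mem_ne_zero_of_forall_exists
    (H ⊓ dotPerp τ.span) f (by
      rintro (_ | j)
      · obtain ⟨v, hv, h⟩ := hex u₀ hu₀ hu₀L
        exact ⟨v, hv, by rwa [dotProduct_comm] at h⟩
      · obtain ⟨v, hv, h⟩ := hex (u j) (huH j) (huL j)
        exact ⟨v, hv, by rwa [dotProduct_comm] at h⟩)
  have hcut : ∀ τ' : Δ.Cone, ∀ x ∈ H, x ∈ τ'.span → x ∉ τ.span →
      ∃ u ∈ H, u ∈ τ'.span ∧ v ⬝ᵥ u ≠ 0 := by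
    intro τ' x hx hx' hxL
    let j : ι := ⟨τ', x, hx, hx', hxL⟩
    refine ⟨u j, huH j, hu j, ?_⟩
    rw [dotProduct_comm]
    exact hvf (some j)
  refine ⟨v, hv.1, hv.2, ?_, fun τ' hττ' => ?_, hcut⟩
  · rintro rfl
    exact hvf none (map_zero _)
  · by_cases h : H ⊓ τ'.span ≤ τ.span
    · exact Or.inl ((inf_le_inf_right _ inf_le_left).trans h)
    · right
      obtain ⟨x, hx, hxL⟩ := SetLike.not_le_iff_exists.1 h
      obtain ⟨w, hwH, hw, hvw⟩ := hcut τ' x hx.1 hx.2 hxL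
      rw [eq_top_iff, ← (hT τ' hττ').resolve_left h]
      refine sup_le (fun h hh => ?_) le_sup_right
      have h1 : h = (h - (v ⬝ᵥ h / v ⬝ᵥ w) • w) + (v ⬝ᵥ h / v ⬝ᵥ w) • w := by abel
      rw [h1]
      refine Submodule.add_mem_sup ⟨H.sub_mem hh (H.smul_mem _ hwH), ?_⟩ (Submodule.smul_mem _ _ hw)
      show v ⬝ᵥ _ = 0
      rw [dotProduct_sub, dotProduct_smul, smul_eq_mul, div_mul_cancel₀ _ hvw, sub_self]

lemma isExtension_of_diff {S S'' : Set (WithTop Δ.Cone)} (o : Δ.Orientations) (hsub : S'' ⊆ S)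
    (hup : IsUpperSet S'') : IsExtension (bdry o) S (S \ S'') S'' where
  mem_iff x := by
    constructor
    · intro hx
      by_cases h : x ∈ S''
      · exact Or.inr h
      · exact Or.inl ⟨hx, h⟩
    · rintro (h | h)
      · exact h.1
      · exact hsub h
  disjoint x hx := hx.2
  sub x hx y hy := by
    by_contra hne
    exact hx.2 (hup (bdry_lt o hne).le hy)

/-- A transversal subspace meets the star of `τ` in a complex with at most one-dimensional homology. -/
lemma exists_spannedBy_starMeet (hs : Δ.IsSmooth) (hc : Δ.IsComplete) (o : Δ.Orientations) (τ : Δ.Cone)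
    (hA : ∀ τ' : Δ.Cone, τ < τ' → AcyclicOn (bdry o) (Set.Ici (τ' : WithTop Δ.Cone)))
    (hB : ∀ τ' : Δ.Cone, τ < τ' → ∀ w : Module.Dual ℝ (Fin n → ℝ), (∀ x ∈ τ'.span, w x = 0) → w ≠ 0 →
      AcyclicOn (bdry o) (starHalf τ' w))
    (H : Submodule ℝ (Fin n → ℝ)) (hLH : τ.span ≤ H) (hT : Transversal τ H) :
    ∃ z, SpannedBy (bdry o) (starMeet τ H (· ∉ τ.span)) z := by
  classical
  induction hd : Module.finrank ℝ H using Nat.strong_induction_on generalizing H with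
  | _ d ih =>
    by_cases hne : H = τ.span
    · refine ⟨Pi.single ⊤ 1, fun f hf _ => ⟨f ⊤, 0, ?_⟩⟩
      ext x
      rw [map_zero, add_zero, Pi.smul_apply, smul_eq_mul]
      induction x with
      | top => simp
      | coe σ =>
        rw [Pi.single_eq_of_ne WithTop.coe_ne_top, mul_zero]
        refine hf _ fun hmem => ?_
        obtain ⟨-, u, -, h1, h2⟩ := coe_mem_starMeet.1 hmem
        exact h2 (hne ▸ h1)
    · obtain ⟨v, hvH, hvL, hv0, hT', hcut⟩ := Transversal.exists_cut τ hLH hne hT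
      set H' := H ⊓ LinearMap.ker (dotDual v) with hH'
      have hLH' : τ.span ≤ H' := le_inf hLH fun x hx => hvL x hx
      have hlt : Module.finrank ℝ H' < d := by
        rw [← hd]
        refine Submodule.finrank_lt_finrank_of_lt (lt_of_le_of_ne inf_le_left fun h => ?_)
        have : v ∈ H' := h ▸ hvH
        exact (dotProduct_self_pos hv0).ne' this.2
      obtain ⟨z, hz⟩ := ih _ hlt H' hLH' hT' rfl
      set X := starMeet τ H (· ∉ τ.span) with hX
      set X' := starMeet τ H' (· ∉ τ.span) with hX'
      set Xp := starMeet τ H (fun u => 0 < v ⬝ᵥ u) with hXp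
      set Xm := starMeet τ H (fun u => 0 < (-v) ⬝ᵥ u) with hXm
      have hap : AcyclicOn (bdry o) Xp := acyclicOn_starMeet_pos hs hc o τ hA hB hLH hT hvH hvL hv0
      have ham : AcyclicOn (bdry o) Xm := acyclicOn_starMeet_pos hs hc o τ hA hB hLH hT
        (H.neg_mem hvH) ((dotPerp _).neg_mem hvL) (neg_ne_zero.2 hv0)
      obtain ⟨t, ht⟩ := τ.exists_relInt_point hs
      have hsides : ∀ σ : Δ.Cone, τ ≤ σ → ∀ x ∈ σ.1, x ∈ H → x ∉ τ.span → v ⬝ᵥ x = 0 →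
          (∃ u ∈ σ.1, u ∈ H ∧ 0 < v ⬝ᵥ u) ∧ (∃ u ∈ σ.1, u ∈ H ∧ 0 < (-v) ⬝ᵥ u) := by
        intro σ hτσ x hx hxH hxL hvx
        obtain ⟨τ', hτ'⟩ := exists_relInt_of_mem hx
        obtain ⟨u, huH, hu, hvu⟩ := hcut τ' x hxH (τ'.le_span hτ'.mem) hxL
        have hτ'σ := (hτ' σ).1 hx
        obtain ⟨e, he, hmem⟩ := hτ'.exists_pos hs hu
        have h1 := hτ'σ (hmem e (by rw [abs_of_pos he]))
        have h2 := hτ'σ (hmem (-e) (by rw [abs_neg, abs_of_pos he]))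
        have h1H := H.add_mem hxH (H.smul_mem e huH)
        have h2H := H.add_mem hxH (H.smul_mem (-e) huH)
        rcases lt_or_gt_of_ne hvu with h | h
        · refine ⟨⟨_, h2, h2H, ?_⟩, _, h1, h1H, ?_⟩ <;>
          · simp only [neg_dotProduct, dotProduct_add, hvx, dotProduct_smul, smul_eq_mul]
            nlinarith
        · refine ⟨⟨_, h1, h1H, ?_⟩, _, h2, h2H, ?_⟩ <;>
          · simp only [neg_dotProduct, dotProduct_add, hvx, dotProduct_smul, smul_eq_mul]
            nlinarith
      have hpX : Xp ⊆ X := by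
        intro x hx
        refine ⟨hx.1, fun σ hσ => ?_⟩
        obtain ⟨u, hu, huH, h⟩ := hx.2 σ hσ
        exact ⟨u, hu, huH, fun hL => h.ne' (hvL u hL)⟩
      have hmX : Xm ⊆ X := by
        intro x hx
        refine ⟨hx.1, fun σ hσ => ?_⟩
        obtain ⟨u, hu, huH, h⟩ := hx.2 σ hσ
        refine ⟨u, hu, huH, fun hL => h.ne' ?_⟩
        rw [neg_dotProduct, hvL u hL, neg_zero]
      have hX'p : X' ⊆ Xp := by
        intro x hx
        refine ⟨hx.1, fun σ hσ => ?_⟩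
        obtain ⟨u, hu, huH, h⟩ := hx.2 σ hσ
        subst hσ
        exact (hsides σ (WithTop.coe_le_coe.1 hx.1) u hu huH.1 h huH.2).1
      have hdiff : X \ Xm = Xp \ X' := by
        ext x
        induction x with
        | top => simp only [Set.mem_sdiff, hX, hX', hXp, hXm, top_mem_starMeet, not_true, and_false]
        | coe σ =>
          constructor
          · rintro ⟨h1, h2⟩
            obtain ⟨hτσ, u, hu, huH, huL⟩ := coe_mem_starMeet.1 h1
            have h3 : ∀ u ∈ σ.1, u ∈ H → 0 ≤ v ⬝ᵥ u := by
              intro u hu huH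
              by_contra hcon
              exact h2 (coe_mem_starMeet.2 ⟨hτσ, u, hu, huH, by rw [neg_dotProduct]; linarith⟩)
            have h4 : ∀ u ∈ σ.1, u ∈ H → u ∉ τ.span → v ⬝ᵥ u ≠ 0 := by
              intro u hu huH huL h0
              obtain ⟨w, hw, hwH, hpos⟩ := (hsides σ hτσ u hu huH huL h0).2
              have := h3 w hw hwH
              rw [neg_dotProduct] at hpos
              linarith
            refine ⟨coe_mem_starMeet.2 ⟨hτσ, u, hu, huH,
              lt_of_le_of_ne (h3 u hu huH) (h4 u hu huH huL).symm⟩, fun hmem => ?_⟩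
            obtain ⟨-, w, hw, hwH, hwL⟩ := coe_mem_starMeet.1 hmem
            exact h4 w hw hwH.1 hwL hwH.2
          · rintro ⟨h1, h2⟩
            refine ⟨hpX h1, fun hmem => h2 ?_⟩
            obtain ⟨hτσ, a, ha, haH, hapos⟩ := coe_mem_starMeet.1 h1
            obtain ⟨-, b, hb, hbH, hbpos⟩ := coe_mem_starMeet.1 hmem
            rw [neg_dotProduct] at hbpos
            refine coe_mem_starMeet.2 ⟨hτσ, (-(v ⬝ᵥ b)) • a + (v ⬝ᵥ a) • b,
              σ.1.add_mem (PointedCone.smul_mem _ hbpos.le ha) (PointedCone.smul_mem _ hapos.le hb),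
              ⟨H.add_mem (H.smul_mem _ haH) (H.smul_mem _ hbH), ?_⟩, fun hL => ?_⟩
            · show v ⬝ᵥ _ = 0
              rw [dotProduct_add, dotProduct_smul, dotProduct_smul, smul_eq_mul, smul_eq_mul]
              ring
            · have hmemτ := Fan.Cone.mem_of_mem_span hs hτσ (σ.1.add_mem
                (PointedCone.smul_mem _ hbpos.le ha) (PointedCone.smul_mem _ hapos.le hb)) hL
              have := (Fan.Cone.isFaceOf hτσ).mem_of_smul_add_mem ha
                (PointedCone.smul_mem _ hapos.le hb) hbpos hmemτ
              exact hapos.ne' (hvL a (τ.le_span this))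
      have hup : ∀ (H : Submodule ℝ (Fin n → ℝ)) (P : (Fin n → ℝ) → Prop),
          SquareZero (bdry o) (starMeet τ H P) := fun H P =>
        squareZero_of_ordConnected hs hc o (starMeet_upper τ H P).ordConnected
      obtain ⟨z', hz', -⟩ := (isExtension_of_diff o hX'p (starMeet_upper _ _ _)).spannedBy_sub
        (hup _ _) hap hz
      rw [← hdiff] at hz'
      exact ⟨z', (isExtension_of_diff o hmX (starMeet_upper _ _ _)).spannedBy_of_sub (hup _ _) ham hz'⟩

lemma transversal_top (τ : Δ.Cone) : Transversal τ ⊤ := fun _ _ => Or.inr (top_sup_eq _)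

/-- The augmented star complexes of a smooth complete fan are acyclic, and so are their subcomplexes
consisting of the cones in a closed half-space. -/
lemma acyclicOn_Ici_and_starHalf (hs : Δ.IsSmooth) (hc : Δ.IsComplete) (o : Δ.Orientations)
    (τ : Δ.Cone) : AcyclicOn (bdry o) (Set.Ici (τ : WithTop Δ.Cone)) ∧
      ∀ w : Module.Dual ℝ (Fin n → ℝ), (∀ x ∈ τ.span, w x = 0) → w ≠ 0 →
        AcyclicOn (bdry o) (starHalf τ w) := by
  classical
  induction τ using WellFoundedGT.induction with
  | _ τ ih =>
    have hA := fun τ' h => (ih τ' h).1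
    have hB := fun τ' h => (ih τ' h).2
    have hsq : ∀ {S : Set (WithTop Δ.Cone)}, S.OrdConnected → SquareZero (bdry o) S :=
      squareZero_of_ordConnected hs hc o
    have hAτ : AcyclicOn (bdry o) (Set.Ici (τ : WithTop Δ.Cone)) := by
      obtain ⟨z, hz⟩ := exists_spannedBy_starMeet hs hc o τ hA hB ⊤ le_top (transversal_top τ)
      have hmem : ∀ σ : Δ.Cone, (σ : WithTop Δ.Cone) ∈ starMeet τ ⊤ (· ∉ τ.span) ↔ τ < σ := by
        intro σ
        rw [coe_mem_starMeet]
        constructor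
        · rintro ⟨h1, u, hu, -, huL⟩
          exact lt_of_le_of_ne h1 fun h => huL (h ▸ σ.le_span hu)
        · intro h
          refine ⟨h.le, ?_⟩
          by_contra! hcon
          exact h.not_ge fun x hx => Fan.Cone.mem_of_mem_span hs h.le hx (hcon x hx Submodule.mem_top)
      have hext : IsExtension (bdry o) (Set.Ici (τ : WithTop Δ.Cone)) {(τ : WithTop Δ.Cone)}
          (starMeet τ ⊤ (· ∉ τ.span)) := by
        convert isExtension_of_diff o (S := Set.Ici (τ : WithTop Δ.Cone))
          (S'' := starMeet τ ⊤ (· ∉ τ.span)) (fun x hx => hx.1) (starMeet_upper _ _ _) using 1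
        ext x
        induction x with
        | top => simp [top_mem_starMeet]
        | coe σ =>
          rw [Set.mem_sdiff, hmem, Set.mem_Ici, Set.mem_singleton_iff, WithTop.coe_eq_coe,
            WithTop.coe_le_coe]
          constructor
          · rintro rfl
            exact ⟨le_rfl, lt_irrefl _⟩
          · rintro ⟨h1, h2⟩
            by_contra hne
            exact h2 (lt_of_le_of_ne h1 (Ne.symm hne))
      by_cases hd : τ.dim = n
      · refine acyclicOn_insert hext (hsq Set.ordConnected_Ici) hz top_mem_starMeet (s := ⊤) ?_ ?_
        · rw [bdry_top_coe, if_pos hd]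
          exact_mod_cast topSign_ne_zero o τ
        · intro y hy
          induction y with
          | top => simp
          | coe σ =>
            have h1 := Fan.Cone.dim_lt hs ((hmem σ).1 hy)
            have h2 := σ.dim_le
            omega
      · obtain ⟨σ, hσ⟩ : ∃ σ : Δ.Cone, τ < σ := by
          by_contra! hcon
          apply hd
          have htop : τ.span = ⊤ := by
            rw [eq_top_iff]
            intro w _
            obtain ⟨t, ht⟩ := τ.exists_relInt_point hs
            obtain ⟨r, hr, hball⟩ := ht.exists_ball hs
            have hcont : Filter.Tendsto (fun a : ℝ => (t + a • w - t) ⬝ᵥ (t + a • w - t))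
                (nhdsWithin 0 (Set.Ioi 0)) (nhds 0) := by
              have : Continuous fun a : ℝ => (t + a • w - t) ⬝ᵥ (t + a • w - t) := by
                simp only [add_sub_cancel_left, smul_dotProduct, dotProduct_smul]
                fun_prop
              have h1 := (this.tendsto 0).mono_left (nhdsWithin_le_nhds (s := Set.Ioi 0))
              simpa using h1
            obtain ⟨a, ha, ha'⟩ := ((hcont.eventually (gt_mem_nhds hr)).and self_mem_nhdsWithin).exists
            obtain ⟨σ, hσ, hmem⟩ := hc (t + a • w)
            have h1 : τ ≤ ⟨σ, hσ⟩ := hball _ ha ⟨σ, hσ⟩ hmem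
            have h2 : (⟨σ, hσ⟩ : Δ.Cone) = τ := by
              by_contra hne
              exact hcon ⟨σ, hσ⟩ (lt_of_le_of_ne h1 (Ne.symm hne))
            have h3 : t + a • w ∈ τ.span := τ.le_span (h2 ▸ hmem)
            have h4 := τ.span.sub_mem h3 (τ.le_span ht.mem)
            rw [add_sub_cancel_left] at h4
            exact (Submodule.smul_mem_iff _ (ne_of_gt ha')).1 h4
          unfold Fan.Cone.dim
          rw [htop, finrank_top, Module.finrank_fin_fun]
        obtain ⟨ρ, hτρ, -, hρ⟩ := Fan.Cone.exists_dim_succ hs hσ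
        have hτρ' : τ < ρ := lt_of_le_of_ne hτρ fun h => by rw [h] at hρ; omega
        refine acyclicOn_insert hext (hsq Set.ordConnected_Ici) hz (s := ρ) ((hmem ρ).2 hτρ') ?_ ?_
        · rw [bdry_coe_coe, if_pos ⟨hτρ, hρ⟩]
          exact_mod_cast incidence_ne_zero o ρ τ
        · intro y hy
          induction y with
          | top => simp
          | coe ξ =>
            have h1 := Fan.Cone.dim_lt hs ((hmem ξ).1 hy)
            rw [bdry_coe_coe, if_neg]
            rintro ⟨-, h2⟩
            omega
    refine ⟨hAτ, fun w hw hw0 => ?_⟩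
    obtain ⟨v, rfl⟩ := exists_dotDual_eq w
    have hv0 : v ≠ 0 := by
      rintro rfl
      apply hw0
      ext x
      simp
    have hac := acyclicOn_starMeet_pos hs hc o τ hA hB le_top (transversal_top τ) (v := v)
      Submodule.mem_top hw hv0
    have := (isExtension_of_diff o (S := Set.Ici (τ : WithTop Δ.Cone)) (fun x hx => hx.1)
      (starMeet_upper τ ⊤ (fun u => 0 < v ⬝ᵥ u))).acyclicOn_sub (hsq Set.ordConnected_Ici) hAτ hac
    convert this using 1
    ext x
    induction x with
    | top => simp [top_notMem_starHalf, top_mem_starMeet]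
    | coe σ =>
      rw [coe_mem_starHalf, Set.mem_sdiff, coe_mem_starMeet, Set.mem_Ici, WithTop.coe_le_coe]
      constructor
      · rintro ⟨h1, h2⟩
        exact ⟨h1, fun ⟨_, u, hu, _, hpos⟩ => absurd (h2 u hu) (not_le.2 hpos)⟩
      · rintro ⟨h1, h2⟩
        refine ⟨h1, fun u hu => ?_⟩
        by_contra hcon
        exact h2 ⟨h1, u, hu, Submodule.mem_top, not_le.1 hcon⟩

end Acyclicity

end KoszulFan
end

noncomputable section

namespace KoszulFan

section QuasiIsoCriteria

/-- A linear map with prescribed values on a free module. -/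
lemma exists_epi_lift {A X Y : ModuleCat.{0} ℂ} (f : A ⟶ Y) (g : X ⟶ Y)
    (h : ∀ a : A, ∃ x : X, g.hom x = f.hom a) :
    ∃ (A' : ModuleCat.{0} ℂ) (π : A' ⟶ A) (_ : Epi π) (x : A' ⟶ X), π ≫ f = x ≫ g := by
  choose s hs using h
  refine ⟨ModuleCat.of ℂ (A →₀ ℂ), ModuleCat.ofHom (Finsupp.linearCombination ℂ id), ?_,
    ModuleCat.ofHom (Finsupp.linearCombination ℂ s), ?_⟩
  · rw [ModuleCat.epi_iff_surjective]
    intro a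
    exact ⟨Finsupp.single a 1, by simp⟩
  · apply ModuleCat.hom_ext
    apply Finsupp.lhom_ext
    intro a c
    simp [hs]

/-- An elementwise criterion for a morphism of complexes of vector spaces to be a quasi-isomorphism. -/
lemma quasiIso_moduleCat {X Y : CochainComplex (ModuleCat.{0} ℂ) ℤ} (f : X ⟶ Y)
    (h : ∀ (k : ℤ) (x : X.X (k + 1)) (y : Y.X k), (X.d (k + 1) (k + 1 + 1)).hom x = 0 →
      (f.f (k + 1)).hom x = (Y.d k (k + 1)).hom y →
      (∃ (x' : X.X k), (X.d k (k + 1)).hom x' = x) ∧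
      ((x = 0) → ∃ (x' : X.X k) (y' : Y.X (k - 1)), (X.d k (k + 1)).hom x' = 0 ∧
        y = (f.f k).hom x' + (Y.d (k - 1) k).hom y')) : QuasiIso f := by
  rw [quasiIso_iff]
  intro k
  rw [quasiIsoAt_iff_isIso_homologyMap]
  have hm : Mono (HomologicalComplex.homologyMap f k) := by
    obtain ⟨k, rfl⟩ : ∃ l, k = l + 1 := ⟨k - 1, by ring⟩
    rw [HomologicalComplex.mono_homologyMap_iff_up_to_refinements f k (k + 1) (k + 1 + 1)
      (by simp) (by simp)]
    intro A x₂ hx₂ y₁ hy₁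
    refine exists_epi_lift x₂ (X.d k (k + 1)) fun a => ?_
    refine (h k (x₂.hom a) (y₁.hom a) ?_ ?_).1
    · exact congrArg (fun t => t.hom a) hx₂
    · exact congrArg (fun t => t.hom a) hy₁
  have he : Epi (HomologicalComplex.homologyMap f k) := by
    rw [HomologicalComplex.epi_homologyMap_iff_up_to_refinements f (k - 1) k (k + 1)
      (by simp) (by simp)]
    intro A y₂ hy₂
    have key : ∀ a : A, ∃ z : ModuleCat.of ℂ (LinearMap.ker (X.d k (k + 1)).hom × Y.X (k - 1)),
        ((f.f k).hom.comp ((LinearMap.ker (X.d k (k + 1)).hom).subtype)).coprod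
          (Y.d (k - 1) k).hom z = y₂.hom a := by
      intro a
      obtain ⟨x', y', h1, h2⟩ := (h k 0 (y₂.hom a) (by simp) (by
        rw [map_zero]
        exact (congrArg (fun t => t.hom a) hy₂).symm)).2 rfl
      exact ⟨⟨⟨x', h1⟩, y'⟩, h2.symm⟩
    obtain ⟨A', π, hπ, x, hx⟩ := exists_epi_lift y₂ (ModuleCat.ofHom _) key
    refine ⟨A', π, hπ, x ≫ ModuleCat.ofHom ((LinearMap.ker (X.d k (k + 1)).hom).subtype ∘ₗ
      LinearMap.fst ℂ _ _), ?_, x ≫ ModuleCat.ofHom (LinearMap.snd ℂ _ _), ?_⟩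
    · ext a
      exact (x.hom a).1.2
    · rw [hx]
      ext a
      simp
      rfl
  exact isIso_of_mono_of_epi _

/-- An elementwise criterion for quasi-isomorphisms of complexes of functors. -/
lemma quasiIso_functor {D : Type} [Preorder D] {X Y : CochainComplex (D ⥤ ModuleCat.{0} ℂ) ℤ}
    (f : X ⟶ Y)
    (h : ∀ (p : D) (k : ℤ) (x : (X.X (k + 1)).obj p) (y : (Y.X k).obj p),
      ((X.d (k + 1) (k + 1 + 1)).app p).hom x = 0 →
      ((f.f (k + 1)).app p).hom x = ((Y.d k (k + 1)).app p).hom y →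
      (∃ (x' : (X.X k).obj p), ((X.d k (k + 1)).app p).hom x' = x) ∧
      (x = 0 → ∃ (x' : (X.X k).obj p) (y' : (Y.X (k - 1)).obj p),
        ((X.d k (k + 1)).app p).hom x' = 0 ∧
        y = ((f.f k).app p).hom x' + ((Y.d (k - 1) k).app p).hom y')) : QuasiIso f := by
  rw [HomologicalComplex.quasiIso_iff_evaluation]
  exact fun p => quasiIso_moduleCat _ (h p)

end QuasiIsoCriteria

section Biproducts

instance {D : Type} [Preorder D] : HasFiniteBiproducts (D ⥤ ModuleCat.{0} ℂ) :=
  HasFiniteBiproducts.of_hasFiniteProducts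

variable {D : Type} [Preorder D] {J : Type} [Finite J] (F : J → D ⥤ ModuleCat.{0} ℂ) (p : D)

/-- The coordinates of an element of a finite direct sum of functors. -/
def coord (j : J) : (⨁ F).obj p →ₗ[ℂ] (F j).obj p :=
  ((biproduct.π F j).app p).hom

/-- The summands of a finite direct sum of functors. -/
def summand (j : J) : (F j).obj p →ₗ[ℂ] (⨁ F).obj p :=
  ((biproduct.ι F j).app p).hom

variable {F p}

lemma coord_summand_self (j : J) (x : (F j).obj p) : coord F p j (summand F p j x) = x := by
  have := congrArg (fun t => (t.app p).hom x) (biproduct.ι_π_self F j)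
  exact this

lemma coord_summand_ne {i j : J} (h : i ≠ j) (x : (F i).obj p) :
    coord F p j (summand F p i x) = 0 := by
  have := congrArg (fun t => (t.app p).hom x) (biproduct.ι_π_ne F h)
  exact this

lemma sum_summand_coord [Fintype J] (x : (⨁ F).obj p) :
    ∑ j, summand F p j (coord F p j x) = x := by
  have := congrArg (fun t => (t.app p).hom x) (biproduct.total (f := F))
  simp only [NatTrans.app_sum, ModuleCat.hom_sum, LinearMap.sum_apply] at this
  exact this

lemma biproduct_ext {x y : (⨁ F).obj p}
    (h : ∀ j, coord F p j x = coord F p j y) : x = y := by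
  have := Fintype.ofFinite J
  rw [← sum_summand_coord x, ← sum_summand_coord y]
  simp [h]

lemma exists_coord (c : ∀ j, (F j).obj p) :
    ∃ x : (⨁ F).obj p, ∀ j, coord F p j x = c j := by
  classical
  have := Fintype.ofFinite J
  refine ⟨∑ j, summand F p j (c j), fun j => ?_⟩
  rw [map_sum, Finset.sum_eq_single j, coord_summand_self]
  · intro i _ hi
    exact coord_summand_ne hi _
  · simp

lemma coord_matrix {J' : Type} [Finite J'] [Fintype J] {G : J' → D ⥤ ModuleCat.{0} ℂ}
    (m : ∀ i j, F i ⟶ G j) (x : (⨁ F).obj p) (j : J') :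
    coord G p j (((biproduct.matrix m).app p).hom x) = ∑ i, ((m i j).app p).hom (coord F p i x) := by
  conv_lhs => rw [← sum_summand_coord x]
  rw [map_sum, map_sum]
  refine Finset.sum_congr rfl fun i _ => ?_
  have := congrArg (fun t => (t.app p).hom (coord F p i x)) (biproduct.ι_matrix_assoc m i
    (biproduct.π G j))
  rw [biproduct.lift_π] at this
  exact this

lemma coord_map {G : J → D ⥤ ModuleCat.{0} ℂ}
    (m : ∀ i, F i ⟶ G i) (x : (⨁ F).obj p) (j : J) :
    coord G p j (((biproduct.map m).app p).hom x) = ((m j).app p).hom (coord F p j x) := by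
  have := congrArg (fun t => (t.app p).hom x) (biproduct.map_π m j)
  exact this

lemma desc_eq_sum [Fintype J] {G : D ⥤ ModuleCat.{0} ℂ}
    (m : ∀ i, F i ⟶ G) (x : (⨁ F).obj p) :
    ((biproduct.desc m).app p).hom x = ∑ i, ((m i).app p).hom (coord F p i x) := by
  conv_lhs => rw [← sum_summand_coord x]
  rw [map_sum]
  refine Finset.sum_congr rfl fun i _ => ?_
  have := congrArg (fun t => (t.app p).hom (coord F p i x)) (biproduct.ι_desc m i)
  exact this

lemma coord_lift {G : D ⥤ ModuleCat.{0} ℂ}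
    (m : ∀ i, G ⟶ F i) (x : G.obj p) (j : J) :
    coord F p j (((biproduct.lift m).app p).hom x) = ((m j).app p).hom x := by
  have := congrArg (fun t => (t.app p).hom x) (biproduct.lift_π m j)
  exact this

end Biproducts

end KoszulFan
end

noncomputable section

namespace KoszulFan

section Line

variable {D : Type} [Preorder D]

/-- The line `ℂ` if `q ≤ p`, and `0` otherwise. -/
def lineAt (q p : D) : Submodule ℂ ℂ where
  carrier := {c | c ≠ 0 → q ≤ p}
  zero_mem' h := absurd rfl h
  add_mem' {a b} ha hb h := by
    by_cases h0 : a = 0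
    · exact hb (fun h1 => h (by rw [h0, h1, add_zero]))
    · exact ha h0
  smul_mem' c x hx h := hx (fun h1 => h (by rw [h1, smul_zero]))

lemma lineAt_mono (q : D) {p p' : D} (h : p ≤ p') : lineAt q p ≤ lineAt q p' :=
  fun _ hc h0 => (hc h0).trans h

/-- The free functor on a generator at `q`. -/
def line (q : D) : D ⥤ ModuleCat.{0} ℂ where
  obj p := ModuleCat.of ℂ (lineAt q p)
  map f := ModuleCat.ofHom (Submodule.inclusion (lineAt_mono q (leOfHom f)))

/-- The element `1` of the free functor at `q`. -/
def lineOne {q p : D} (h : q ≤ p) : (line q).obj p := ⟨1, fun _ => h⟩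

lemma eq_smul_lineOne {q p : D} (h : q ≤ p) (x : (line q).obj p) :
    x = (show lineAt q p from x).1 • lineOne h :=
  Subtype.ext (mul_one _).symm

lemma eq_zero_of_not_le {q p : D} (h : ¬ q ≤ p) (x : (line q).obj p) : x = 0 := by
  by_contra hx
  exact h ((show lineAt q p from x).2 fun h0 => hx (Subtype.ext h0))

open Classical in
/-- The components of `lineDesc`. -/
def lineDescApp {q : D} {F : D ⥤ ModuleCat.{0} ℂ} (x : F.obj q) (p : D) :
    lineAt q p →ₗ[ℂ] F.obj p :=
  if h : q ≤ p then
    (LinearMap.toSpanSingleton ℂ _ ((F.map (homOfLE h)).hom x)) ∘ₗ (lineAt q p).subtype else 0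

lemma lineDescApp_apply {q : D} {F : D ⥤ ModuleCat.{0} ℂ} (x : F.obj q) {p : D} (h : q ≤ p)
    (y : lineAt q p) : lineDescApp x p y = y.1 • (F.map (homOfLE h)).hom x := by
  unfold lineDescApp
  rw [dif_pos h]
  rfl

/-- The morphism from the free functor on a generator at `q` given by an element of `F q`. -/
def lineDesc {q : D} {F : D ⥤ ModuleCat.{0} ℂ} (x : F.obj q) : line q ⟶ F where
  app p := ModuleCat.ofHom (lineDescApp x p)
  naturality p p' f := by
    apply ModuleCat.hom_ext
    refine LinearMap.ext fun (y : lineAt q p) => ?_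
    show lineDescApp x p' (Submodule.inclusion (lineAt_mono q (leOfHom f)) y) =
      (F.map f).hom (lineDescApp x p y)
    by_cases h : q ≤ p
    · rw [lineDescApp_apply x h, lineDescApp_apply x (h.trans (leOfHom f)), map_smul]
      exact congrArg (fun t => y.1 • t.hom x) (F.map_comp (homOfLE h) f)
    · have : y = 0 := eq_zero_of_not_le h y
      rw [this, map_zero, map_zero, map_zero, map_zero]

lemma lineDesc_lineOne {q : D} {F : D ⥤ ModuleCat.{0} ℂ} (x : F.obj q) {p : D} (h : q ≤ p) :
    ((lineDesc x).app p).hom (lineOne h) = (F.map (homOfLE h)).hom x :=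
  (lineDescApp_apply x h ⟨1, fun _ => h⟩).trans (one_smul _ _)

lemma line_hom_ext {q : D} {F : D ⥤ ModuleCat.{0} ℂ} {f g : line q ⟶ F}
    (h : (f.app q).hom (lineOne le_rfl) = (g.app q).hom (lineOne le_rfl)) : f = g := by
  ext p x
  by_cases hp : q ≤ p
  · rw [eq_smul_lineOne hp x, map_smul, map_smul]
    congr 1
    have hf := congrArg (fun t => t.hom (lineOne le_rfl)) (f.naturality (homOfLE hp))
    have hg := congrArg (fun t => t.hom (lineOne le_rfl)) (g.naturality (homOfLE hp))
    refine (show _ = (F.map (homOfLE hp)).hom ((f.app q).hom (lineOne le_rfl)) from hf).trans ?_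
    rw [h]
    exact hg.symm
  · rw [eq_zero_of_not_le hp x, map_zero, map_zero]

instance projective_line (q : D) : Projective (line q) where
  factors {E X} f e he := by
    have hs : Function.Surjective (e.app q).hom := by
      rw [← ModuleCat.epi_iff_surjective]
      infer_instance
    obtain ⟨x, hx⟩ := hs ((f.app q).hom (lineOne le_rfl))
    refine ⟨lineDesc x, line_hom_ext ?_⟩
    refine Eq.trans ?_ hx
    refine congrArg (e.app q).hom ((lineDesc_lineOne x le_rfl).trans ?_)
    exact congrArg (fun t => t.hom x) (E.map_id q)

lemma projective_of_dualBasis {C : Type 1} [Category.{0} C] [Preadditive C] {P : C} {J : Type}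
    [Fintype J] {L : J → C} [∀ j, Projective (L j)] (a : ∀ j, P ⟶ L j) (b : ∀ j, L j ⟶ P)
    (h : ∑ j, a j ≫ b j = 𝟙 P) : Projective P where
  factors {E X} f e he :=
    ⟨∑ j, a j ≫ Projective.factorThru (b j ≫ f) e, by
      rw [Preadditive.sum_comp]
      simp only [Category.assoc, Projective.factorThru_comp]
      simp only [← Category.assoc]
      rw [← Preadditive.sum_comp, h, Category.id_comp]⟩

/-- A functor is a retract of a finite direct sum of free functors. -/
def IsFreeRetract (P : D ⥤ ModuleCat.{0} ℂ) : Prop :=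
  ∃ (J : Type) (_ : Fintype J) (q : J → D) (a : ∀ j, P ⟶ line (q j)) (b : ∀ j, line (q j) ⟶ P),
    ∑ j, a j ≫ b j = 𝟙 P

lemma isFreeRetract_of_generators {P : D ⥤ ModuleCat.{0} ℂ} [Projective P] {J : Type} [Fintype J]
    (q : J → D) (x : ∀ j, P.obj (q j))
    (h : ∀ p, Submodule.span ℂ {y | ∃ j, ∃ hj : q j ≤ p, y = (P.map (homOfLE hj)).hom (x j)} = ⊤) :
    IsFreeRetract P := by
  let d : (⨁ fun j => line (q j)) ⟶ P := biproduct.desc fun j => lineDesc (x j)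
  have : Epi d := by
    rw [NatTrans.epi_iff_epi_app]
    intro p
    rw [ModuleCat.epi_iff_surjective, ← LinearMap.range_eq_top, eq_top_iff, ← h p,
      Submodule.span_le]
    rintro _ ⟨j, hj, rfl⟩
    refine ⟨summand (fun j => line (q j)) p j (lineOne hj), ?_⟩
    have := congrArg (fun t => (t.app p).hom (lineOne hj))
      (biproduct.ι_desc (fun j => lineDesc (x j)) j)
    exact Eq.trans this (lineDesc_lineOne (x j) hj)
  refine ⟨J, inferInstance, q, fun j => Projective.factorThru (𝟙 P) d ≫ biproduct.π _ j,
    fun j => lineDesc (x j), ?_⟩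
  simp only [Category.assoc]
  rw [← Preadditive.comp_sum, ← biproduct.desc_eq, Projective.factorThru_comp]

/-- The restriction of a free functor along a monotone map is projective, if the map pulls back principal upper
sets to principal upper sets or the empty set. -/
lemma projective_comp_line {D' : Type} [Preorder D'] (φ : D' ⥤ D) (q : D)
    (h : (∃ q', ∀ p', q ≤ φ.obj p' ↔ q' ≤ p') ∨ ∀ p', ¬ q ≤ φ.obj p') :
    Projective (φ ⋙ line q) := by
  rcases h with ⟨q', h⟩ | h
  · have heq : ∀ p', lineAt q' p' = lineAt q (φ.obj p') := by
      intro p'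
      ext c
      exact forall_congr' fun _ => (h p').symm
    exact Projective.of_iso (NatIso.ofComponents
      (fun p' => (LinearEquiv.ofEq _ _ (heq p')).toModuleIso) (fun f => rfl) :
        line q' ≅ φ ⋙ line q) inferInstance
  · constructor
    intro E X f e he
    refine ⟨0, ?_⟩
    rw [zero_comp]
    ext p' x
    rw [eq_zero_of_not_le (h p') x, map_zero, map_zero]

end Line

section FiniteGeneration

variable {M : Type} [AddCommGroup M] {S : AddSubmonoid M}

lemma GrMod.single_smul (X : GrMod S) (a : S) (c : ℂ) (z : X.Total) :
    (AddMonoidAlgebra.single a c : AddMonoidAlgebra ℂ S) • z = c • X.monomialEnd a z := by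
  show X.action (AddMonoidAlgebra.single a c) z = _
  unfold GrMod.action
  rw [AddMonoidAlgebra.lift_single]
  rfl

lemma GrMod.mulMonomial_eq_map (X : GrMod S) (a : S) (m m' : M) (h : m + a = m')
    (hle : (⟨m⟩ : Deg S) ≤ ⟨m'⟩) (x : X.obj ⟨m⟩) :
    X.ofDeg (m + a) (X.mulMonomial a m x) = X.ofDeg m' ((X.map (homOfLE hle)).hom x) :=
  X.ofDeg_map h _ _ x

open Classical in
/-- The homogeneous component of degree `m`. -/
def GrMod.component (X : GrMod S) (m : M) : X.Total →ₗ[ℂ] X.obj ⟨m⟩ :=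
  DirectSum.component ℂ M (fun m => X.obj ⟨m⟩) m

lemma GrMod.component_ofDeg_self (X : GrMod S) (m : M) (x : X.obj ⟨m⟩) :
    X.component m (X.ofDeg m x) = x := by
  classical
  exact DirectSum.component.lof_self (R := ℂ) (M := fun m => X.obj (⟨m⟩ : Deg S)) m x

lemma GrMod.component_ofDeg_ne (X : GrMod S) {m m' : M} (h : m ≠ m') (x : X.obj ⟨m⟩) :
    X.component m' (X.ofDeg m x) = 0 := by
  classical
  exact (DirectSum.component.of (R := ℂ) (M := fun m => X.obj (⟨m⟩ : Deg S)) _ _ x).trans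
    (dif_neg h)

open Classical in
lemma GrMod.exists_sum (X : GrMod S) (z : X.Total) :
    ∃ s : Finset M, z = ∑ m ∈ s, X.ofDeg m (X.component m z) :=
  ⟨DFinsupp.support z, (DirectSum.sum_support_of z).symm⟩

lemma GrMod.induction {X : GrMod S} {P : X.Total → Prop} (h0 : P 0)
    (hadd : ∀ x y, P x → P y → P (x + y)) (hdeg : ∀ m x, P (X.ofDeg m x)) (z : X.Total) : P z := by
  classical
  obtain ⟨s, hs⟩ := X.exists_sum z
  rw [hs]
  exact Finset.sum_induction _ P hadd h0 fun m _ => hdeg m _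

lemma GrMod.exists_generators (X : GrMod S)
    (h : Module.Finite (AddMonoidAlgebra ℂ S) X.Total) :
    ∃ (J : Type) (_ : Fintype J) (q : J → Deg S) (x : ∀ j, X.obj (q j)), ∀ p,
      Submodule.span ℂ {y | ∃ j, ∃ hj : q j ≤ p, y = (X.map (homOfLE hj)).hom (x j)} = ⊤ := by
  classical
  obtain ⟨T, hT⟩ := h
  choose s hs using X.exists_sum
  refine ⟨Σ t : T, s t.1, inferInstance, fun j => ⟨j.2.1⟩, fun j => X.component j.2.1 j.1.1,
    fun p => ?_⟩
  set N : ∀ m : M, Submodule ℂ (X.obj ⟨m⟩) := fun m =>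
    Submodule.span ℂ {y | ∃ j : Σ t : T, s t.1, ∃ hj : (⟨j.2.1⟩ : Deg S) ≤ ⟨m⟩,
      y = (X.map (homOfLE hj)).hom (X.component j.2.1 j.1.1)} with hN
  have hmap : ∀ (m m' : M) (hle : (⟨m⟩ : Deg S) ≤ ⟨m'⟩) (x : X.obj ⟨m⟩), x ∈ N m →
      (X.map (homOfLE hle)).hom x ∈ N m' := by
    intro m m' hle x hx
    have : N m ≤ (N m').comap (X.map (homOfLE hle)).hom := by
      rw [hN, Submodule.span_le]
      rintro _ ⟨j, hj, rfl⟩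
      refine Submodule.subset_span ⟨j, hj.trans hle, ?_⟩
      exact congrArg (fun t => t.hom (X.component j.2.1 j.1.1))
        (X.map_comp (homOfLE hj) (homOfLE hle)).symm
    exact this hx
  let W : Submodule (AddMonoidAlgebra ℂ S) X.Total :=
    { carrier := {z | ∀ m, X.component m z ∈ N m}
      add_mem' := fun {x y} hx hy m => by
        rw [map_add]
        exact (N m).add_mem (hx m) (hy m)
      zero_mem' := fun m => by
        rw [map_zero]
        exact (N m).zero_mem
      smul_mem' := fun r z hz m => by
        induction r using AddMonoidAlgebra.induction_linear with
        | zero => rw [zero_smul, map_zero]; exact (N m).zero_mem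
        | add f g hf hg => rw [add_smul, map_add]; exact (N m).add_mem hf hg
        | single a c =>
          rw [X.single_smul, map_smul]
          refine (N m).smul_mem _ ?_
          rw [hs z, map_sum, map_sum]
          refine (N m).sum_mem fun m' _ => ?_
          rw [X.monomialEnd_ofDeg]
          by_cases hm : m' + a = m
          · subst hm
            rw [X.component_ofDeg_self]
            exact hmap _ _ _ _ (hz m')
          · rw [X.component_ofDeg_ne hm]
            exact (N m).zero_mem }
  have hW : W = ⊤ := by
    rw [eq_top_iff, ← hT, Submodule.span_le]
    intro t ht m
    by_cases hm : m ∈ s t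
    · refine Submodule.subset_span ⟨⟨⟨t, ht⟩, ⟨m, hm⟩⟩, le_rfl, ?_⟩
      exact (congrArg (fun u => u.hom (X.component m t)) (X.map_id ⟨m⟩)).symm
    · rw [hs t, map_sum, Finset.sum_eq_zero]
      · exact (N m).zero_mem
      · intro m' hm'
        refine X.component_ofDeg_ne ?_ _
        rintro rfl
        exact hm hm'
  rw [eq_top_iff]
  intro x _
  have : X.ofDeg p.deg x ∈ W := by rw [hW]; trivial
  have := this p.deg
  rwa [X.component_ofDeg_self] at this

lemma GrMod.finite_of_generators (X : GrMod S) {J : Type} [Finite J] (q : J → Deg S)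
    (x : ∀ j, X.obj (q j)) (h : ∀ p,
      Submodule.span ℂ {y | ∃ j, ∃ hj : q j ≤ p, y = (X.map (homOfLE hj)).hom (x j)} = ⊤) :
    Module.Finite (AddMonoidAlgebra ℂ S) X.Total := by
  classical
  have := Fintype.ofFinite J
  refine ⟨⟨Finset.univ.image fun j => X.ofDeg (q j).deg (x j), ?_⟩⟩
  set W := Submodule.span (AddMonoidAlgebra ℂ S)
    ((Finset.univ.image fun j => X.ofDeg (q j).deg (x j) : Finset X.Total) : Set X.Total) with hW
  have hsmul : ∀ (c : ℂ) (z : X.Total), z ∈ W → c • z ∈ W := by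
    intro c z hz
    have h1 := X.single_smul 0 c z
    rw [X.monomialEnd_zero] at h1
    rw [LinearMap.id_apply] at h1
    rw [← h1]
    exact W.smul_mem _ hz
  refine eq_top_iff.2 fun z _ => ?_
  show z ∈ W
  clear * - h hsmul hW
  induction z using GrMod.induction with
  | h0 => exact W.zero_mem
  | hadd x y hx hy => exact W.add_mem hx hy
  | hdeg m y =>
    have hy : y ∈ (⊤ : Submodule ℂ (X.obj ⟨m⟩)) := trivial
    rw [← h ⟨m⟩] at hy
    induction hy using Submodule.span_induction with
    | zero => rw [map_zero]; exact W.zero_mem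
    | add y y' _ _ hy hy' => rw [map_add]; exact W.add_mem (hy) (hy')
    | smul c y _ hy => rw [map_smul]; exact hsmul _ _ hy
    | mem y hy =>
      obtain ⟨j, hj, rfl⟩ := hy
      rw [← X.mulMonomial_eq_map ⟨m - (q j).deg, hj⟩ (q j).deg m (by simp) hj,
        ← X.monomialEnd_ofDeg]
      have h1 := X.single_smul ⟨m - (q j).deg, hj⟩ 1 (X.ofDeg (q j).deg (x j))
      rw [one_smul] at h1
      rw [← h1]
      exact W.smul_mem _ (Submodule.subset_span (by simp))

end FiniteGeneration

section Sheaves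

variable {n : ℕ} {Δ : Fan n}

lemma Sheaf.IsFG.isFreeRetract {P : Sheaf Δ} (h : P.IsFG) [Projective P] : IsFreeRetract P := by
  choose J hJ q x hx using fun σ => (P.stalk σ).exists_generators (h σ)
  refine isFreeRetract_of_generators (J := Σ σ, J σ) (fun j => ⟨j.1, (q j.1 j.2).deg⟩)
    (fun j => x j.1 j.2) fun p => ?_
  refine eq_top_iff.2 ((hx p.cone ⟨p.deg⟩).ge.trans (Submodule.span_mono ?_))
  rintro _ ⟨j, hj, rfl⟩
  exact ⟨⟨p.cone, j⟩, ⟨le_rfl, hj⟩, rfl⟩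

lemma isFG_of_generators {F : Sheaf Δ} {J : Type} [Finite J] (q : J → SheafIdx Δ)
    (x : ∀ j, F.obj (q j)) (h : ∀ p,
      Submodule.span ℂ {y | ∃ j, ∃ hj : q j ≤ p, y = (F.map (homOfLE hj)).hom (x j)} = ⊤) :
    F.IsFG := by
  intro σ
  refine (F.stalk σ).finite_of_generators (J := {j : J // σ ≤ (q j).cone})
    (fun j => ⟨(q j.1).deg⟩)
    (fun j => (F.map (homOfLE (show q j.1 ≤ ⟨σ, (q j.1).deg⟩ from ⟨j.2, by simp⟩))).hom (x j.1))
    fun p => ?_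
  refine eq_top_iff.2 ((h ⟨σ, p.deg⟩).ge.trans (Submodule.span_mono ?_))
  rintro _ ⟨j, hj, rfl⟩
  refine ⟨⟨j, hj.1⟩, hj.2, ?_⟩
  have h1 : q j ≤ (⟨σ, (q j).deg⟩ : SheafIdx Δ) := ⟨hj.1, by simp⟩
  have h2 : (⟨σ, (q j).deg⟩ : SheafIdx Δ) ≤ ⟨σ, p.deg⟩ := ⟨le_rfl, hj.2⟩
  exact congrArg (fun t => t.hom (x j)) (F.map_comp (homOfLE h1) (homOfLE h2))

/-- The stalk functor. -/
def stalkFunctor (σ : Δ.Cone) : Sheaf Δ ⥤ GrMod σ.semigroup :=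
  (Functor.whiskeringLeft _ _ _).obj
    (Monotone.functor (f := fun d : Deg σ.semigroup => (⟨σ, d.deg⟩ : SheafIdx Δ))
      (fun _ _ h => And.intro (le_refl σ) h))

instance (σ : Δ.Cone) : (stalkFunctor σ).Additive where

instance (σ : Δ.Cone) (q : SheafIdx Δ) : Projective ((stalkFunctor σ).obj (line q)) := by
  refine projective_comp_line _ q ?_
  by_cases h : σ ≤ q.cone
  · exact Or.inl ⟨⟨q.deg⟩, fun p' => ⟨fun h' => h'.2, fun h' => ⟨h, h'⟩⟩⟩
  · exact Or.inr fun p' h' => h h'.1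

lemma IsFreeRetract.projective_stalk {P : Sheaf Δ} (h : IsFreeRetract P) (σ : Δ.Cone) :
    Projective ((stalkFunctor σ).obj P) := by
  obtain ⟨J, _, q, a, b, hab⟩ := h
  refine projective_of_dualBasis (fun j => (stalkFunctor σ).map (a j))
    (fun j => (stalkFunctor σ).map (b j)) ?_
  rw [← CategoryTheory.Functor.map_id, ← hab, Functor.map_sum]
  simp only [Functor.map_comp]

end Sheaves

end KoszulFan
end

noncomputable section

namespace KoszulFan

section Transpose

variable {X K : Type} [Fintype X] [Field K] {A : X → X → K} {S : Set X}

lemma sum_mul_resD (f g : X → K) : ∑ y, g y * resD A S f y =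
    ∑ x, resD (fun x y => A y x) S g x * f x := by
  classical
  have h1 : ∀ y, g y * resD A S f y = ∑ x, if x ∈ S ∧ y ∈ S then g y * f x * A x y else 0 := by
    intro y
    rw [resD_apply]
    by_cases hy : y ∈ S
    · simp only [hy, if_true, and_true, Finset.mul_sum]
      refine Finset.sum_congr rfl fun x _ => ?_
      split_ifs <;> ring
    · simp [hy]
  have h2 : ∀ x, resD (fun x y => A y x) S g x * f x =
      ∑ y, if x ∈ S ∧ y ∈ S then g y * f x * A x y else 0 := by
    intro x
    rw [resD_apply]
    by_cases hx : x ∈ S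
    · simp only [hx, if_true, true_and, Finset.sum_mul]
      refine Finset.sum_congr rfl fun y _ => ?_
      split_ifs <;> ring
    · simp [hx]
  simp only [h1, h2]
  exact Finset.sum_comm

open Classical in
lemma AcyclicOn.transpose (h : AcyclicOn A S) : AcyclicOn (fun x y => A y x) S := by
  intro f hf hd
  let D := resD A S
  let φ : Module.Dual K (X → K) := ∑ x, f x • LinearMap.proj x
  have hφ : ∀ u, φ u = ∑ x, f x * u x := fun u => by simp [φ]
  have hmem : φ ∈ (LinearMap.ker D).dualAnnihilator := by
    rw [Submodule.mem_dualAnnihilator]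
    intro u hu
    let u' : X → K := fun x => if x ∈ S then u x else 0
    have hu' : resD A S u' = 0 := by
      rw [← LinearMap.mem_ker.1 hu]
      exact resD_congr fun x hx => if_pos hx
    obtain ⟨v, hv⟩ := h.exists (f := u') (fun x hx => if_neg hx) hu'
    rw [hφ]
    have : ∀ x, f x * u x = f x * resD A S v x := by
      intro x
      rw [hv]
      by_cases hx : x ∈ S
      · simp [u', hx]
      · simp [hf x hx]
    simp only [this]
    rw [sum_mul_resD, hd]
    simp
  rw [← LinearMap.range_dualMap_eq_dualAnnihilator_ker] at hmem
  obtain ⟨ψ, hψ⟩ := hmem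
  let g : X → K := fun y => ψ (Pi.single y 1)
  have hg : ∀ u, ψ u = ∑ y, g y * u y := by
    intro u
    conv_lhs => rw [pi_eq_sum_univ' u]
    rw [map_sum]
    refine Finset.sum_congr rfl fun y _ => ?_
    rw [map_smul, smul_eq_mul, mul_comm]
  refine ⟨0, g, ?_⟩
  rw [zero_smul, zero_add]
  ext x
  have h1 : φ (Pi.single x 1) = f x := by
    rw [hφ, Finset.sum_eq_single x]
    · simp
    · intro y _ hy; simp [hy]
    · simp
  have h2 : φ (Pi.single x 1) = ∑ y, g y * resD A S (Pi.single x 1) y := by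
    rw [← hψ, LinearMap.dualMap_apply, hg]
  rw [← h1, h2, sum_mul_resD, Finset.sum_eq_single x]
  · simp
  · intro y _ hy; simp [hy]
  · simp

/-- In a graded acyclic matrix complex every homogeneous cycle is a homogeneous boundary. -/
lemma AcyclicOn.exists_graded (h : AcyclicOn A S) {deg : X → ℤ} {e : ℤ}
    (hA : ∀ x y, A x y ≠ 0 → deg y = deg x + e) (k : ℤ) {f : X → K}
    (hf : ∀ x, f x ≠ 0 → x ∈ S ∧ deg x = k) (hd : ∀ y ∈ S, ∑ x, f x * A x y = 0) :
    ∃ g : X → K, (∀ x, g x ≠ 0 → x ∈ S ∧ deg x = k - e) ∧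
      ∀ y ∈ S, ∑ x, g x * A x y = f y := by
  classical
  have hsum : ∀ (u : X → K), (∀ x, u x ≠ 0 → x ∈ S) → ∀ y ∈ S,
      resD A S u y = ∑ x, u x * A x y := by
    intro u hu y hy
    rw [resD_apply, if_pos hy]
    refine Finset.sum_congr rfl fun x _ => ?_
    split_ifs with hx
    · rfl
    · rw [not_imp_comm.1 (hu x) hx, zero_mul]
  obtain ⟨g, hg⟩ := h.exists (f := f) (fun x hx => by
      by_contra h0
      exact hx (hf x h0).1) (by
    ext y
    by_cases hy : y ∈ S
    · rw [hsum f (fun x hx => (hf x hx).1) y hy, hd y hy]; rfl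
    · rw [resD_of_notMem _ hy]; rfl)
  refine ⟨fun x => if x ∈ S ∧ deg x = k - e then g x else 0, fun x hx => ?_, fun y hy => ?_⟩
  · by_contra h0
    exact hx (if_neg h0)
  · by_cases hk : deg y = k
    · rw [← hg, resD_apply, if_pos hy]
      refine Finset.sum_congr rfl fun x _ => ?_
      by_cases hx : x ∈ S
      · by_cases hA0 : A x y = 0
        · simp [hA0]
        · have := hA x y hA0
          beta_reduce
          rw [if_pos hx, if_pos (show x ∈ S ∧ deg x = k - e from ⟨hx, by omega⟩)]
      · simp [hx]
    · rw [Finset.sum_eq_zero]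
      · by_contra h0
        exact hk (hf y (Ne.symm h0)).2
      · intro x _
        by_cases hA0 : A x y = 0
        · simp [hA0]
        · have := hA x y hA0
          beta_reduce
          rw [if_neg, zero_mul]
          rintro ⟨-, h1⟩
          omega

end Transpose

section Chains

variable {n : ℕ} {Δ : Fan n}

/-- The degree of a generator of the augmented cellular complex. -/
def coneDeg : WithTop Δ.Cone → ℤ
  | none => n + 1
  | some σ => σ.dim

lemma coneDeg_coe (σ : Δ.Cone) : coneDeg (σ : WithTop Δ.Cone) = σ.dim := rfl

lemma coneDeg_top : coneDeg (⊤ : WithTop Δ.Cone) = n + 1 := rfl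

lemma coneDeg_of_bdry_ne_zero (o : Δ.Orientations) {x y : WithTop Δ.Cone} (h : bdry o x y ≠ 0) :
    coneDeg x = coneDeg y + 1 := by
  classical
  induction y with
  | top => simp at h
  | coe τ =>
    induction x with
    | top =>
      rw [bdry_top_coe] at h
      have := (ite_ne_right_iff.1 h).1
      rw [coneDeg_coe, coneDeg_top]; omega
    | coe σ =>
      rw [bdry_coe_coe] at h
      have := (ite_ne_right_iff.1 h).1.2
      rw [coneDeg_coe, coneDeg_coe]; omega

lemma exists_boundary (hs : Δ.IsSmooth) (hc : Δ.IsComplete) (o : Δ.Orientations) (τ : Δ.Cone)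
    (k : ℤ) {f : WithTop Δ.Cone → ℂ} (hf : ∀ x, f x ≠ 0 → τ ≤ x ∧ coneDeg x = k)
    (hd : ∀ y : WithTop Δ.Cone, τ ≤ y → ∑ x, f x * bdry o x y = 0) :
    ∃ g : WithTop Δ.Cone → ℂ, (∀ x, g x ≠ 0 → τ ≤ x ∧ coneDeg x = k + 1) ∧
      ∀ y : WithTop Δ.Cone, τ ≤ y → ∑ x, g x * bdry o x y = f y := by
  obtain ⟨g, h1, h2⟩ := (acyclicOn_Ici_and_starHalf hs hc o τ).1.exists_graded (deg := coneDeg)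
    (e := -1) (fun x y h => by have := coneDeg_of_bdry_ne_zero o h; omega) k hf hd
  exact ⟨g, fun x hx => by rw [← sub_neg_eq_add]; exact h1 x hx, h2⟩

lemma exists_coboundary (hs : Δ.IsSmooth) (hc : Δ.IsComplete) (o : Δ.Orientations) (τ : Δ.Cone)
    (k : ℤ) {f : WithTop Δ.Cone → ℂ} (hf : ∀ x, f x ≠ 0 → τ ≤ x ∧ coneDeg x = k)
    (hd : ∀ y : WithTop Δ.Cone, τ ≤ y → ∑ x, f x * bdry o y x = 0) :
    ∃ g : WithTop Δ.Cone → ℂ, (∀ x, g x ≠ 0 → τ ≤ x ∧ coneDeg x = k - 1) ∧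
      ∀ y : WithTop Δ.Cone, τ ≤ y → ∑ x, g x * bdry o y x = f y :=
  (acyclicOn_Ici_and_starHalf hs hc o τ).1.transpose.exists_graded (deg := coneDeg)
    (e := 1) (fun _ _ h => coneDeg_of_bdry_ne_zero o h) k hf hd

open Classical in
/-- Extension by zero of a function on the cones of a given dimension. -/
def extendCones {j : ℤ} (c : Δ.ConesOfDim j → ℂ) : WithTop Δ.Cone → ℂ
  | none => 0
  | some σ => if h : (σ.dim : ℤ) = -j then c ⟨σ, h⟩ else 0

lemma extendCones_coe {j : ℤ} (c : Δ.ConesOfDim j → ℂ) (σ : Δ.ConesOfDim j) :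
    extendCones c (σ.1 : WithTop Δ.Cone) = c σ := dif_pos σ.2

lemma exists_of_extendCones_ne_zero {j : ℤ} (c : Δ.ConesOfDim j → ℂ) {x : WithTop Δ.Cone}
    (h : extendCones c x ≠ 0) : ∃ σ : Δ.ConesOfDim j, x = (σ.1 : WithTop Δ.Cone) ∧ c σ ≠ 0 := by
  classical
  induction x with
  | top => exact absurd rfl h
  | coe σ =>
    by_cases hσ : (σ.dim : ℤ) = -j
    · exact ⟨⟨σ, hσ⟩, rfl, by rwa [← extendCones_coe c ⟨σ, hσ⟩]⟩
    · exact absurd (dif_neg hσ) h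

lemma sum_extendCones {j : ℤ} [Fintype (Δ.ConesOfDim j)] (c : Δ.ConesOfDim j → ℂ)
    (b : WithTop Δ.Cone → ℂ) :
    ∑ x, extendCones c x * b x = ∑ σ : Δ.ConesOfDim j, c σ * b (σ.1 : WithTop Δ.Cone) := by
  classical
  have hinj : Function.Injective
      (fun σ : Δ.ConesOfDim j => ((σ.1 : Δ.Cone) : WithTop Δ.Cone)) :=
    fun σ τ h => Subtype.ext (WithTop.coe_injective h)
  rw [← Finset.sum_subset (Finset.subset_univ (Finset.univ.image
    (fun σ : Δ.ConesOfDim j => ((σ.1 : Δ.Cone) : WithTop Δ.Cone)))), Finset.sum_image]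
  · simp only [extendCones_coe]
  · exact fun σ _ τ _ h => hinj h
  · intro x _ hx
    by_contra h0
    obtain ⟨σ, rfl, -⟩ := exists_of_extendCones_ne_zero c (left_ne_zero_of_mul h0)
    exact hx (Finset.mem_image_of_mem _ (Finset.mem_univ σ))

end Chains

end KoszulFan
end

noncomputable section

namespace KoszulFan

section Values

variable {n : ℕ} {Δ : Fan n}

/-- The coefficient of an element of a free functor. -/
def lineVal {D : Type} [Preorder D] {q p : D} : (line q).obj p →ₗ[ℂ] ℂ := (lineAt q p).subtype

lemma lineVal_injective {D : Type} [Preorder D] {q p : D} :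
    Function.Injective (lineVal : (line q).obj p →ₗ[ℂ] ℂ) := Subtype.val_injective

lemma le_of_lineVal_ne_zero {D : Type} [Preorder D] {q p : D} {x : (line q).obj p}
    (h : lineVal x ≠ 0) : q ≤ p := (show lineAt q p from x).2 h

lemma exists_lineVal_eq {D : Type} [Preorder D] {q p : D} {c : ℂ} (h : c ≠ 0 → q ≤ p) :
    ∃ x : (line q).obj p, lineVal x = c := ⟨⟨c, h⟩, rfl⟩

lemma lineVal_lineDesc {D : Type} [Preorder D] {q q' p : D} (y : (line q').obj q)
    (x : (line q).obj p) : lineVal (((lineDesc y).app p).hom x) = lineVal x * lineVal y := by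
  by_cases h : q ≤ p
  · exact congrArg lineVal (lineDescApp_apply y h x)
  · rw [eq_zero_of_not_le h x, map_zero, map_zero, map_zero, zero_mul]

/-- The coefficient of an element of an extension by zero of the structure sheaf. -/
def pieceVal {U : LowerSet Δ.Cone} {p : SheafIdx Δ} : (extZero U).obj p →ₗ[ℂ] ℂ := (piece U p).subtype

lemma pieceVal_injective {U : LowerSet Δ.Cone} {p : SheafIdx Δ} :
    Function.Injective (pieceVal : (extZero U).obj p →ₗ[ℂ] ℂ) := Subtype.val_injective

lemma pieceVal_lineDesc {U : LowerSet Δ.Cone} {q p : SheafIdx Δ} (y : (extZero U).obj q)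
    (x : (line q).obj p) : pieceVal (((lineDesc y).app p).hom x) = lineVal x * pieceVal y := by
  by_cases h : q ≤ p
  · exact congrArg pieceVal (lineDescApp_apply y h x)
  · rw [eq_zero_of_not_le h x, map_zero, map_zero, map_zero, zero_mul]

end Values

section Resolution

variable {n : ℕ} {Δ : Fan n}

instance (j : ℤ) : Finite (Δ.ConesOfDim j) := Subtype.finite

instance (j : ℤ) : Fintype (Δ.ConesOfDim j) := Fintype.ofFinite _

/-- The generator of the free functor `𝒜_[σ]`. -/
def vertex (σ : Δ.Cone) : SheafIdx Δ := ⟨σ, 0⟩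

lemma vertex_le_iff {σ : Δ.Cone} {p : SheafIdx Δ} :
    vertex σ ≤ p ↔ p.cone ≤ σ ∧ p.deg ∈ p.cone.semigroup := by
  show p.cone ≤ σ ∧ p.deg - 0 ∈ p.cone.semigroup ↔ _
  rw [sub_zero]

lemma vertex_le_vertex {τ σ : Δ.Cone} (h : τ ≤ σ) : vertex σ ≤ vertex τ := ⟨h, by simp [vertex]⟩

/-- The entry `𝒜_[σ] → 𝒜_[τ]` of the coboundary. -/
def coEntry (o : Δ.Orientations) (σ τ : Δ.Cone) : line (vertex σ) ⟶ line (vertex τ) :=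
  lineDesc (⟨bdry o τ σ, fun h => vertex_le_vertex (WithTop.coe_lt_coe.1 (bdry_lt o h)).le⟩ :
    lineAt (vertex τ) (vertex σ))

lemma lineVal_coEntry (o : Δ.Orientations) (σ τ : Δ.Cone) {p : SheafIdx Δ}
    (x : (line (vertex σ)).obj p) :
    lineVal (((coEntry o σ τ).app p).hom x) = lineVal x * bdry o τ σ := lineVal_lineDesc _ _

/-- The sum of the sheaves `𝒜_[σ]` over the cones of a given dimension. -/
abbrev lineSum (Δ : Fan n) (j : ℤ) : Sheaf Δ := ⨁ fun σ : Δ.ConesOfDim j => line (vertex σ.1)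

/-- The chain of coefficients of an element of `lineSum`. -/
def lineChain {j : ℤ} {p : SheafIdx Δ} (x : (lineSum Δ j).obj p) : WithTop Δ.Cone → ℂ :=
  extendCones fun σ : Δ.ConesOfDim j => lineVal (coord _ p σ x)

lemma lineChain_injective {j : ℤ} {p : SheafIdx Δ} {x y : (lineSum Δ j).obj p}
    (h : ∀ z : WithTop Δ.Cone, p.cone ≤ z → lineChain x z = lineChain y z) : x = y := by
  refine biproduct_ext fun σ => lineVal_injective ?_
  by_cases hσ : p.cone ≤ σ.1
  · have := h (σ.1 : WithTop Δ.Cone) (WithTop.coe_le_coe.2 hσ)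
    unfold lineChain at this
    rwa [extendCones_coe, extendCones_coe] at this
  · have : ∀ z : (line (vertex σ.1)).obj p, z = 0 := eq_zero_of_not_le fun h' => hσ h'.1
    rw [this (coord _ p σ x), this (coord _ p σ y)]

lemma lineChain_ne_zero {j : ℤ} {p : SheafIdx Δ} {x : (lineSum Δ j).obj p} {z : WithTop Δ.Cone}
    (h : lineChain x z ≠ 0) : p.cone ≤ z ∧ coneDeg z = -j ∧ p.deg ∈ p.cone.semigroup := by
  obtain ⟨σ, rfl, hσ⟩ := exists_of_extendCones_ne_zero _ h
  have := vertex_le_iff.1 (le_of_lineVal_ne_zero hσ)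
  exact ⟨WithTop.coe_le_coe.2 this.1, σ.2, this.2⟩

lemma exists_lineChain {j : ℤ} {p : SheafIdx Δ} (hp : p.deg ∈ p.cone.semigroup)
    {f : WithTop Δ.Cone → ℂ} (hf : ∀ z, f z ≠ 0 → p.cone ≤ z ∧ coneDeg z = -j) (htop : f ⊤ = 0) :
    ∃ x : (lineSum Δ j).obj p, lineChain x = f := by
  have : ∀ σ : Δ.ConesOfDim j, ∃ y : (line (vertex σ.1)).obj p, lineVal y = f σ.1 := fun σ =>
    exists_lineVal_eq fun h => vertex_le_iff.2 ⟨WithTop.coe_le_coe.1 (hf _ h).1, hp⟩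
  choose y hy using this
  obtain ⟨x, hx⟩ := exists_coord (F := fun σ : Δ.ConesOfDim j => line (vertex σ.1)) (p := p) y
  refine ⟨x, funext fun z => ?_⟩
  unfold lineChain
  simp only [hx, hy]
  induction z with
  | top => exact htop.symm
  | coe σ =>
    by_cases hσ : (σ.dim : ℤ) = -j
    · exact extendCones_coe (fun σ : Δ.ConesOfDim j => f σ.1) ⟨σ, hσ⟩
    · have h1 : f σ = 0 := by
        by_contra h0
        exact hσ (hf _ h0).2
      rw [h1]
      exact dif_neg hσ

/-- The cellular coboundary. -/
def lineD (o : Δ.Orientations) (j j' : ℤ) : lineSum Δ j ⟶ lineSum Δ j' :=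
  biproduct.matrix fun σ τ => coEntry o σ.1 τ.1

lemma lineChain_lineD (o : Δ.Orientations) {j j' : ℤ} (hj : j' + 1 = j) {p : SheafIdx Δ}
    (x : (lineSum Δ j).obj p) (y : WithTop Δ.Cone) (hy : y ≠ ⊤) :
    lineChain (((lineD o j j').app p).hom x) y = ∑ z, lineChain x z * bdry o y z := by
  induction y with
  | top => exact absurd rfl hy
  | coe τ =>
    unfold lineChain
    rw [sum_extendCones]
    by_cases hτ : (τ.dim : ℤ) = -j'
    · rw [show (τ : WithTop Δ.Cone) = ((⟨τ, hτ⟩ : Δ.ConesOfDim j').1 : WithTop Δ.Cone) from rfl,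
        extendCones_coe]
      unfold lineD
      rw [coord_matrix, map_sum]
      exact Finset.sum_congr rfl fun σ _ => lineVal_coEntry o σ.1 τ _
    · have h1 : extendCones (fun σ : Δ.ConesOfDim j' =>
        lineVal (coord _ p σ (((lineD o j j').app p).hom x))) (τ : WithTop Δ.Cone) = 0 :=
        dif_neg hτ
      rw [h1, Finset.sum_eq_zero]
      intro σ _
      by_cases h0 : bdry o τ σ.1 = 0
      · rw [h0, mul_zero]
      · have := coneDeg_of_bdry_ne_zero o h0
        rw [coneDeg_coe, coneDeg_coe, σ.2] at this
        omega

lemma sum_lineChain_lineD (hs : Δ.IsSmooth) (hc : Δ.IsComplete) (o : Δ.Orientations) {j j' : ℤ}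
    (hj : j' + 1 = j) {p : SheafIdx Δ} (x : (lineSum Δ j).obj p) (z : WithTop Δ.Cone) :
    ∑ y, lineChain (((lineD o j j').app p).hom x) y * bdry o z y = 0 := by
  have : ∀ y, lineChain (((lineD o j j').app p).hom x) y * bdry o z y =
      ∑ w, lineChain x w * (bdry o z y * bdry o y w) := by
    intro y
    by_cases hy : y = ⊤
    · subst hy
      simp
    · rw [lineChain_lineD o hj _ y hy, Finset.sum_mul]
      exact Finset.sum_congr rfl fun w _ => by ring
  simp only [this]
  rw [Finset.sum_comm]
  refine Finset.sum_eq_zero fun w _ => ?_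
  rw [← Finset.mul_sum, bdry_bdry hs hc, mul_zero]

lemma lineChain_zero {j : ℤ} {p : SheafIdx Δ} (z : WithTop Δ.Cone) :
    lineChain (0 : (lineSum Δ j).obj p) z = 0 := by
  by_contra h
  obtain ⟨σ, -, hσ⟩ := exists_of_extendCones_ne_zero _ h
  exact hσ (by rw [map_zero, map_zero])

lemma lineD_lineD (hs : Δ.IsSmooth) (hc : Δ.IsComplete) (o : Δ.Orientations) {j j' j'' : ℤ}
    (hj : j' + 1 = j) (hj' : j'' + 1 = j') : lineD o j j' ≫ lineD o j' j'' = 0 := by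
  refine NatTrans.ext (funext fun p => ModuleCat.hom_ext (LinearMap.ext fun x => ?_))
  refine lineChain_injective fun z _ => Eq.trans ?_ (lineChain_zero z).symm
  show lineChain (((lineD o j' j'').app p).hom (((lineD o j j').app p).hom x)) z = 0
  by_cases hz : z = ⊤
  · subst hz; rfl
  rw [lineChain_lineD o hj' _ z hz, sum_lineChain_lineD hs hc o hj]

/-- The augmentation `⨁ 𝒜_[σ] → 𝒜`, over the cones of full dimension. -/
def lineAug (o : Δ.Orientations) (j : ℤ) : lineSum Δ j ⟶ structureSheaf Δ :=
  biproduct.desc fun σ => lineDesc (show (extZero ⊤).obj (vertex σ.1) from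
    (⟨bdry o ⊤ σ.1, fun _ => ⟨trivial, zero_mem _⟩⟩ : piece ⊤ (vertex σ.1)))

lemma pieceVal_lineAug (o : Δ.Orientations) (j : ℤ) {p : SheafIdx Δ} (x : (lineSum Δ j).obj p) :
    pieceVal (((lineAug o j).app p).hom x) = ∑ z, lineChain x z * bdry o ⊤ z := by
  unfold lineChain
  rw [sum_extendCones]
  refine (congrArg pieceVal (desc_eq_sum _ x)).trans ((map_sum _ _ _).trans ?_)
  exact Finset.sum_congr rfl fun σ _ => pieceVal_lineDesc _ _

lemma lineD_lineAug (hs : Δ.IsSmooth) (hc : Δ.IsComplete) (o : Δ.Orientations) {j j' : ℤ}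
    (hj : j' + 1 = j) : lineD o j j' ≫ lineAug o j' = 0 := by
  refine NatTrans.ext (funext fun p => ModuleCat.hom_ext (LinearMap.ext fun x => ?_))
  refine pieceVal_injective (Eq.trans ?_ (map_zero _).symm)
  show pieceVal (((lineAug o j').app p).hom (((lineD o j j').app p).hom x)) = 0
  rw [pieceVal_lineAug, sum_lineChain_lineD hs hc o hj]

/-- The cellular resolution of the structure sheaf by the sheaves `𝒜_[σ]`. -/
def lineComplex (hs : Δ.IsSmooth) (hc : Δ.IsComplete) (o : Δ.Orientations) :
    CochainComplex (Sheaf Δ) ℤ where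
  X i := lineSum Δ (-n - i)
  d i i' := if i + 1 = i' then lineD o (-n - i) (-n - i') else 0
  shape i i' h := if_neg h
  d_comp_d' i j k hij hjk := by
    have hij : i + 1 = j := hij
    have hjk : j + 1 = k := hjk
    rw [if_pos hij, if_pos hjk]
    exact lineD_lineD hs hc o (by omega) (by omega)

lemma lineComplex_d (hs : Δ.IsSmooth) (hc : Δ.IsComplete) (o : Δ.Orientations) {i i' : ℤ}
    (h : i + 1 = i') : (lineComplex hs hc o).d i i' = lineD o (-n - i) (-n - i') := if_pos h

/-- The augmentation of the cellular resolution. -/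
def lineComplexπ (hs : Δ.IsSmooth) (hc : Δ.IsComplete) (o : Δ.Orientations) :
    lineComplex hs hc o ⟶ (CochainComplex.singleFunctor (Sheaf Δ) 0).obj (structureSheaf Δ) :=
  HomologicalComplex.mkHomToSingle (lineAug o (-n - 0)) (fun i hi => by
    rw [lineComplex_d hs hc o hi]
    exact lineD_lineAug hs hc o (by have : i + 1 = 0 := hi; omega))

lemma eq_zero_of_lineSum {j : ℤ} (hj : j < -n) {p : SheafIdx Δ} (x : (lineSum Δ j).obj p) : x = 0 := by
  refine biproduct_ext fun σ => ?_
  have := σ.1.dim_le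
  have := σ.2
  omega

lemma exists_lineD_eq (hs : Δ.IsSmooth) (hc : Δ.IsComplete) (o : Δ.Orientations) {j j' j'' : ℤ}
    (hj : j' + 1 = j) (hj' : j'' + 1 = j') {p : SheafIdx Δ} (x : (lineSum Δ j').obj p)
    (hx : ((lineD o j' j'').app p).hom x = 0)
    (hx' : ∑ z, lineChain x z * bdry o ⊤ z = 0) :
    ∃ x' : (lineSum Δ j).obj p, ((lineD o j j').app p).hom x' = x := by
  by_cases hn : j' < -n
  · exact ⟨0, by rw [eq_zero_of_lineSum hn x, map_zero]⟩
  by_cases hp : p.deg ∈ p.cone.semigroup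
  · obtain ⟨g, hg, hg'⟩ := exists_coboundary hs hc o p.cone (-j') (f := lineChain x)
      (fun z hz => ⟨(lineChain_ne_zero hz).1, (lineChain_ne_zero hz).2.1⟩) (fun y hy => by
        by_cases hy' : y = ⊤
        · rw [hy', hx']
        · rw [← lineChain_lineD o hj' x y hy', hx, lineChain_zero])
    have htop : g ⊤ = 0 := by
      by_contra h0
      have h1 := (hg ⊤ h0).2
      rw [coneDeg_top] at h1
      omega
    obtain ⟨x', rfl⟩ := exists_lineChain (j := j) hp
      (fun z hz => ⟨(hg z hz).1, by rw [(hg z hz).2]; omega⟩) htop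
    refine ⟨x', lineChain_injective fun z hz => ?_⟩
    by_cases hz' : z = ⊤
    · subst hz'; rfl
    · rw [lineChain_lineD o hj _ z hz', hg' z hz]
  · refine ⟨0, lineChain_injective fun z _ => ?_⟩
    rw [map_zero]
    by_contra h0
    rw [lineChain_zero] at h0
    exact hp (lineChain_ne_zero (Ne.symm h0)).2.2

lemma exists_lineAug_eq (hs : Δ.IsSmooth) (hc : Δ.IsComplete) (o : Δ.Orientations) {j : ℤ}
    (hj : j = -n) {p : SheafIdx Δ} (y : (structureSheaf Δ).obj p) :
    ∃ x : (lineSum Δ j).obj p, ((lineAug o j).app p).hom x = y := by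
  classical
  by_cases hp : p.deg ∈ p.cone.semigroup
  · obtain ⟨g, hg, hg'⟩ := exists_coboundary hs hc o p.cone (n + 1)
      (f := Pi.single ⊤ (pieceVal y))
      (fun z hz => by
        by_cases h : z = ⊤
        · subst h; exact ⟨le_top, coneDeg_top⟩
        · exact absurd (Pi.single_eq_of_ne h _) hz)
      (fun z _ => by
        refine Finset.sum_eq_zero fun x _ => ?_
        by_cases h : x = ⊤
        · subst h; rw [bdry_top, mul_zero]
        · rw [Pi.single_eq_of_ne h, zero_mul])
    have htop : g ⊤ = 0 := by
      by_contra h0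
      have h1 := (hg ⊤ h0).2
      rw [coneDeg_top] at h1
      omega
    obtain ⟨x', rfl⟩ := exists_lineChain (j := j) hp
      (fun z hz => ⟨(hg z hz).1, by rw [(hg z hz).2]; omega⟩) htop
    refine ⟨x', pieceVal_injective ?_⟩
    rw [pieceVal_lineAug, hg' ⊤ le_top, Pi.single_eq_same]
  · have hy : pieceVal (U := ⊤) y = 0 := by
      by_contra h0
      exact hp ((show piece ⊤ p from y).2 h0).2
    exact ⟨0, pieceVal_injective
      (((congrArg pieceVal (map_zero _)).trans (map_zero _)).trans hy.symm)⟩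

lemma quasiIso_lineComplexπ (hs : Δ.IsSmooth) (hc : Δ.IsComplete) (o : Δ.Orientations) :
    QuasiIso (lineComplexπ hs hc o) := by
  have hπ : (lineComplexπ hs hc o).f 0 = lineAug o (-n - 0) ≫
      (HomologicalComplex.singleObjXSelf (ComplexShape.up ℤ) 0 (structureSheaf Δ)).inv :=
    HomologicalComplex.mkHomToSingle_f _ _
  refine quasiIso_functor _ fun p k x y hx hxy => ⟨?_, fun hx0 => ?_⟩
  · rw [lineComplex_d hs hc o rfl] at hx ⊢
    refine exists_lineD_eq hs hc o (by omega) (by omega) x hx ?_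
    rcases lt_trichotomy (k + 1) 0 with hk | hk | hk
    · refine Finset.sum_eq_zero fun z _ => ?_
      by_contra h0
      have h1 := coneDeg_of_bdry_ne_zero o (right_ne_zero_of_mul h0)
      rw [(lineChain_ne_zero (left_ne_zero_of_mul h0)).2.1, coneDeg_top] at h1
      omega
    · obtain rfl : k = -1 := by omega
      refine (pieceVal_lineAug o _ x).symm.trans ?_
      have h1 : (((HomologicalComplex.singleObjXSelf (ComplexShape.up ℤ) 0
          (structureSheaf Δ)).inv.app p).hom (((lineAug o (-n - 0)).app p).hom x)) = 0 := by
        refine Eq.trans ?_ (hxy.trans ?_)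
        · exact congrArg (fun t => (t.app p).hom x) hπ.symm
        · rfl
      have h2 := congrArg (((HomologicalComplex.singleObjXSelf (ComplexShape.up ℤ) 0
          (structureSheaf Δ)).hom.app p).hom) h1
      rw [map_zero] at h2
      have h3 := congrArg (fun t => (t.app p).hom (((lineAug o (-n - 0)).app p).hom x))
        (HomologicalComplex.singleObjXSelf (ComplexShape.up ℤ) 0 (structureSheaf Δ)).inv_hom_id
      refine (congrArg pieceVal (h3.symm.trans h2)).trans (map_zero _)
    · have : x = 0 := eq_zero_of_lineSum (by omega) x
      refine Finset.sum_eq_zero fun z _ => ?_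
      rw [show lineChain x z = 0 from (congrArg (lineChain · z) this).trans (lineChain_zero z),
        zero_mul]
  · by_cases hk : k = 0
    · subst hk
      obtain ⟨x', hx'⟩ := exists_lineAug_eq hs hc o (j := -n - 0) (by omega)
        (((HomologicalComplex.singleObjXSelf (ComplexShape.up ℤ) 0
          (structureSheaf Δ)).hom.app p).hom y)
      refine ⟨x', 0, eq_zero_of_lineSum (by omega) _, ?_⟩
      rw [map_zero, add_zero, hπ]
      refine Eq.trans ?_ (congrArg (((HomologicalComplex.singleObjXSelf (ComplexShape.up ℤ) 0
          (structureSheaf Δ)).inv.app p).hom) hx').symm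
      exact (congrArg (fun t => (t.app p).hom y) (HomologicalComplex.singleObjXSelf
        (ComplexShape.up ℤ) 0 (structureSheaf Δ)).hom_inv_id).symm
    · refine ⟨0, 0, map_zero _, ?_⟩
      have h0 : IsZero ((((CochainComplex.singleFunctor (Sheaf Δ) 0).obj
          (structureSheaf Δ)).X k)) := HomologicalComplex.isZero_single_obj_X _ _ _ _ hk
      have h1 := congrArg (fun t => (t.app p).hom y) (h0.eq_of_src (𝟙 _) 0)
      exact h1.trans (by rw [map_zero, map_zero, add_zero]; rfl)

lemma isFG_lineSum (j : ℤ) : (lineSum Δ j).IsFG := by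
  refine isFG_of_generators (J := Δ.ConesOfDim j) (fun σ => vertex σ.1)
    (fun σ => summand (fun σ : Δ.ConesOfDim j => line (vertex σ.1)) _ σ (lineOne le_rfl)) fun p => ?_
  rw [eq_top_iff]
  intro x _
  rw [← sum_summand_coord x]
  refine Submodule.sum_mem _ fun σ _ => ?_
  by_cases h : vertex σ.1 ≤ p
  · rw [eq_smul_lineOne h (coord _ p σ x), map_smul]
    refine Submodule.smul_mem _ _ (Submodule.subset_span ⟨σ, h, ?_⟩)
    exact congrArg (fun t => t.hom (lineOne le_rfl))
      ((biproduct.ι (fun σ : Δ.ConesOfDim j => line (vertex σ.1)) σ).naturality (homOfLE h))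
  · rw [eq_zero_of_not_le h (coord _ p σ x), map_zero]
    exact Submodule.zero_mem _

instance {i : ℤ} : Projective (lineSum Δ i) := by
  exact projective_of_dualBasis
    (fun σ => biproduct.π (fun σ : Δ.ConesOfDim i => line (vertex σ.1)) σ)
    (fun σ => biproduct.ι (fun σ : Δ.ConesOfDim i => line (vertex σ.1)) σ) biproduct.total

/-- The cellular resolution is a finite projective resolution. -/
def lineResolution (hs : Δ.IsSmooth) (hc : Δ.IsComplete) (o : Δ.Orientations) :
    FiniteProjectiveResolution
      ((CochainComplex.singleFunctor (Sheaf Δ) 0).obj (structureSheaf Δ)) where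
  complex := lineComplex hs hc o
  bounded := by
    refine ⟨-n, 0, fun i hi => ?_⟩
    have : ∀ p, ∀ x : (lineSum Δ (-n - i)).obj p, x = 0 := by
      intro p x
      refine biproduct_ext fun σ => ?_
      have := σ.1.dim_le
      have := σ.2
      omega
    rw [IsZero.iff_id_eq_zero]
    exact NatTrans.ext (funext fun p => ModuleCat.hom_ext (LinearMap.ext fun x =>
      (this p _).trans (this p _).symm))
  fg i := isFG_lineSum _
  projective i := inferInstanceAs (Projective (lineSum Δ _))
  π := lineComplexπ hs hc o
  quasiIso := quasiIso_lineComplexπ hs hc o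

end Resolution

end KoszulFan
end

noncomputable section

namespace KoszulFan

section ExtendScalars

open ModuleCat
open scoped ChangeOfRings

variable {R R' : Type} [CommRing R] [CommRing R'] (f : R →+* R') (N : ModuleCat.{0} R)

/-- The element `r ⊗ x` of the extension of scalars. -/
def extendScalarsMk (r : R') (x : N) : (extendScalars f).obj N := r ⊗ₜ[R,f] x

lemma smul_extendScalarsMk (r s : R') (x : N) :
    r • extendScalarsMk f N s x = extendScalarsMk f N (r * s) x := ExtendScalars.smul_tmul f r s x

/-- The map `x ↦ 1 ⊗ x` from a module to its extension of scalars. -/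
def extendScalarsι : N →+ (extendScalars f).obj N where
  toFun x := extendScalarsMk f N 1 x
  map_zero' := TensorProduct.tmul_zero _ _
  map_add' _ _ := TensorProduct.tmul_add _ _ _

lemma smul_extendScalarsι (r : R') (x : N) :
    r • extendScalarsι f N x = extendScalarsMk f N r x :=
  (smul_extendScalarsMk f N r 1 x).trans (by rw [mul_one])

lemma tmul_smul_eq {A B : Type} [AddCommGroup A] [AddCommGroup B] [Module R A] [Module R B] (r : R)
    (a : A) (b : B) : a ⊗ₜ[R] (r • b) = (r • a) ⊗ₜ[R] b := (TensorProduct.smul_tmul r a b).symm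

lemma extendScalarsι_smul (r : R) (x : N) :
    extendScalarsι f N (r • x) = f r • extendScalarsι f N x := by
  rw [smul_extendScalarsι]
  refine (tmul_smul_eq (A := (restrictScalars f).obj (ModuleCat.of R' R')) r (1 : R') x).trans ?_
  exact congrArg (fun t => extendScalarsMk f N t x) (mul_one (f r))

variable {f} in
lemma extendScalarsι_surjective (hf : Function.Surjective f) :
    Function.Surjective (extendScalarsι f N) := by
  intro z
  refine TensorProduct.induction_on (motive := fun z => ∃ x, extendScalarsι f N x = z) z ?_ ?_ ?_
  · exact ⟨0, map_zero _⟩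
  · intro r' x
    obtain ⟨r, rfl⟩ := hf r'
    exact ⟨r • x, (extendScalarsι_smul f N r x).trans (smul_extendScalarsι f N _ x)⟩
  · rintro _ _ ⟨x, rfl⟩ ⟨y, rfl⟩
    exact ⟨x + y, map_add _ _ _⟩

lemma span_pow_le {G : Set R} (A : ℕ → Set R) (h1 : 1 ∈ A 0)
    (h : ∀ k, ∀ a ∈ A k, ∀ g ∈ G, a * g ∈ A (k + 1)) (k : ℕ) :
    Ideal.span G ^ k ≤ Ideal.span (A k) := by
  induction k with
  | zero =>
    rw [pow_zero, Ideal.one_eq_top, top_le_iff, Ideal.eq_top_iff_one]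
    exact Ideal.subset_span h1
  | succ k ih =>
    rw [pow_succ]
    refine (Ideal.mul_mono_left ih).trans ?_
    rw [Ideal.span_mul_span', Ideal.span_le]
    rintro _ ⟨a, ha, g, hg, rfl⟩
    exact Ideal.subset_span (h k a ha g hg)

variable {f} in
lemma exists_extendScalars_lift (hf : Function.Surjective f) {V : Type} [AddCommGroup V]
    (χ : N →+ V) (h : ∀ r x, f r = 0 → χ (r • x) = 0) :
    ∃ ψ : (extendScalars f).obj N →+ V, ∀ x, ψ (extendScalarsι f N x) = χ x := by
  have key : ∀ r r' x, f r = f r' → χ (r • x) = χ (r' • x) := by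
    intro r r' x hr
    rw [← sub_eq_zero, ← map_sub, ← sub_smul]
    exact h _ _ (by rw [map_sub, hr, sub_self])
  let s := Function.surjInv hf
  have hs : ∀ r', f (s r') = r' := Function.surjInv_eq hf
  let B : (restrictScalars f).obj (ModuleCat.of R' R') →+ N →+ V :=
    { toFun := fun r' =>
        { toFun := fun x => χ (s r' • x)
          map_zero' := by rw [smul_zero, map_zero]
          map_add' := fun x y => by rw [smul_add, map_add] }
      map_zero' := by
        ext x
        exact h _ _ (hs 0)
      map_add' := fun r₁ r₂ => by
        ext x
        show χ (s (r₁ + r₂) • x) = χ (s r₁ • x) + χ (s r₂ • x)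
        rw [← map_add, ← add_smul]
        refine key _ _ _ ?_
        rw [map_add]
        exact (hs _).trans (congrArg₂ (· + ·) (hs _).symm (hs _).symm) }
  refine ⟨TensorProduct.liftAddHom B fun r r' x => ?_, fun x => ?_⟩
  · show χ (s (r • r') • x) = χ (s r' • r • x)
    rw [smul_smul]
    refine key _ _ _ ?_
    rw [map_mul, mul_comm]
    exact (hs _).trans (congrArg (f r * ·) (hs _).symm)
  · refine (show _ = χ (s 1 • x) from rfl).trans ?_
    have := key (s 1) 1 x (by rw [hs, map_one])
    rw [one_smul] at this
    exact this

end ExtendScalars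

section Height

variable {n : ℕ} {Δ : Fan n}

lemma Fan.IsSmooth.exists_height (hs : Δ.IsSmooth) (τ : Δ.Cone) : ∃ ht : (Fin n → ℤ) →+ ℤ,
    (∀ s ∈ τ.semigroup, 0 ≤ ht s) ∧ (∀ s ∈ τ.semigroup, ht s = 0 → s ∈ τ.perp) ∧
      ∀ s ∈ τ.perp, ht s = 0 := by
  obtain ⟨b, I, hI⟩ := hs τ.1 τ.2
  let t : Fin n → ℤ := ∑ i ∈ I, b i
  have hb : ∀ i ∈ I, latticeVec (b i) ∈ τ.1 := fun i hi => by
    rw [hI]; exact Submodule.subset_span ⟨i, hi, rfl⟩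
  have hpair : ∀ (m v : Fin n → ℤ), Fan.pairing m (latticeVec v) = ((∑ i, m i * v i : ℤ) : ℝ) := by
    intro m v
    simp [Fan.pairing, latticeVec]
  let ht : (Fin n → ℤ) →+ ℤ :=
    { toFun := fun m => ∑ j ∈ I, ∑ i, m i * b j i
      map_zero' := by simp
      map_add' := fun m m' => by simp [add_mul, Finset.sum_add_distrib] }
  have hpos : ∀ s ∈ τ.semigroup, ∀ j ∈ I, 0 ≤ ∑ i, s i * b j i := by
    intro s hs j hj
    have := hs _ (hb j hj)
    rw [hpair] at this
    exact_mod_cast this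
  refine ⟨ht, fun s hs => Finset.sum_nonneg (hpos s hs), fun s hs h0 v hv => ?_, fun s hs => ?_⟩
  · have h1 := (Finset.sum_eq_zero_iff_of_nonneg (hpos s hs)).1 h0
    rw [hI] at hv
    induction hv using Submodule.span_induction with
    | mem v hv =>
      obtain ⟨j, hj, rfl⟩ := hv
      rw [hpair, h1 j hj, Int.cast_zero]
    | zero => simp [Fan.pairing]
    | add x y _ _ hx hy =>
      have : Fan.pairing s (x + y) = Fan.pairing s x + Fan.pairing s y := by
        simp [Fan.pairing, mul_add, Finset.sum_add_distrib]
      rw [this, hx, hy, add_zero]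
    | smul c x _ hx =>
      have : Fan.pairing s (c • x) = c * Fan.pairing s x := by
        simp only [Fan.pairing, Finset.mul_sum]
        refine Finset.sum_congr rfl fun i _ => ?_
        show (s i : ℝ) * (c * x i) = _
        ring
      rw [this, hx, mul_zero]
  · refine Finset.sum_eq_zero fun j hj => ?_
    have := hs _ (hb j hj)
    rw [hpair] at this
    exact_mod_cast this

lemma Fan.Cone.perp_le (τ : Δ.Cone) {s : Fin n → ℤ} (h : s ∈ τ.perp) : s ∈ τ.semigroup :=
  fun v hv => (h v hv).ge

end Height

section Desc

variable {M : Type} [AddCommGroup M] {S : AddSubmonoid M} {V : Type} [AddCommGroup V] [Module ℂ V]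

open Classical in
/-- The linear map on the total space of a graded module given by linear maps on the components. -/
def GrMod.desc (X : GrMod S) (f : ∀ m, X.obj ⟨m⟩ →ₗ[ℂ] V) : X.Total →ₗ[ℂ] V :=
  DirectSum.toModule ℂ M V f

lemma GrMod.desc_ofDeg (X : GrMod S) (f : ∀ m, X.obj ⟨m⟩ →ₗ[ℂ] V) (m : M) (c : X.obj ⟨m⟩) :
    X.desc f (X.ofDeg m c) = f m c := by
  classical
  exact DirectSum.toModule_lof (R := ℂ) (M := fun m => X.obj (⟨m⟩ : Deg S)) (N := V) (φ := f) m c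

end Desc

section TorsionCofinite

variable {n : ℕ} {Δ : Fan n} {τ : Δ.Cone}

lemma red_surjective (τ : Δ.Cone) : Function.Surjective τ.red := by
  intro f
  induction f using AddMonoidAlgebra.induction_linear with
  | zero => exact ⟨0, map_zero _⟩
  | add f g hf hg =>
    obtain ⟨x, rfl⟩ := hf
    obtain ⟨y, rfl⟩ := hg
    exact ⟨x + y, map_add _ _ _⟩
  | single s c =>
    obtain ⟨_, s, hs, rfl⟩ := s
    exact ⟨AddMonoidAlgebra.single ⟨s, hs⟩ c, AddMonoidAlgebra.mapDomain_single⟩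

/-- The reduction of a monomial. -/
def redMk (τ : Δ.Cone) : τ.semigroup →+ τ.redSemigroup :=
  (QuotientAddGroup.mk' τ.perp).addSubmonoidMap τ.semigroup

lemma red_single (τ : Δ.Cone) (s : τ.semigroup) (c : ℂ) :
    τ.red (AddMonoidAlgebra.single s c) = AddMonoidAlgebra.single (redMk τ s) c :=
  AddMonoidAlgebra.mapDomain_single

/-- A grading group homomorphism `M → ℤ` which is positive on the nonunits of `M ∩ τ^∨`. -/
structure IsHeight (τ : Δ.Cone) (ht : (Fin n → ℤ) →+ ℤ) : Prop where
  nonneg : ∀ s ∈ τ.semigroup, 0 ≤ ht s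
  mem_perp : ∀ s ∈ τ.semigroup, ht s = 0 → s ∈ τ.perp
  eq_zero : ∀ s ∈ τ.perp, ht s = 0

lemma maxIdeal_pow_le {ht : (Fin n → ℤ) →+ ℤ} (hht : IsHeight τ ht) (k : ℕ) :
    τ.maxIdeal ^ k ≤ Ideal.span {f | ∃ s : τ.semigroup, (k : ℤ) ≤ ht s ∧
      f = AddMonoidAlgebra.single (redMk τ s) 1} := by
  refine span_pow_le (fun k : ℕ => {f : τ.redRing | ∃ s : τ.semigroup, (k : ℤ) ≤ ht s ∧
      f = AddMonoidAlgebra.single (redMk τ s) 1}) ⟨0, by simp, ?_⟩ ?_ k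
  · rw [map_zero]
    rfl
  · rintro k _ ⟨s, hs, rfl⟩ _ ⟨t, ht0, rfl⟩
    obtain ⟨_, t, htm, rfl⟩ := t
    refine ⟨s + ⟨t, htm⟩, ?_, ?_⟩
    · have h1 : 0 ≤ ht t := hht.nonneg t htm
      have h2 : ht t ≠ 0 := fun h => ht0 (Subtype.ext
        ((QuotientAddGroup.eq_zero_iff t).2 (hht.mem_perp t htm h)))
      push_cast
      rw [map_add]
      have : 1 ≤ ht t := by omega
      omega
    · refine (AddMonoidAlgebra.single_mul_single _ _ _ _).trans ?_
      rw [one_mul, map_add]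
      rfl

/-- The graded form of torsion cofiniteness. -/
structure IsGradedTcf (X : GrMod τ.semigroup) : Prop where
  torsion : ∀ ht, IsHeight τ ht → ∀ (p : Deg τ.semigroup) (c : X.obj p), ∃ k : ℕ,
    ∀ (q : Deg τ.semigroup) (h : p ≤ q), (k : ℤ) ≤ ht (q.deg - p.deg) → (X.map (homOfLE h)).hom c = 0
  finite : ∀ p, Module.Finite ℂ (X.obj p)
  exists_socle : ∃ Φ : Finset (Fin n → ℤ), ∀ (p : Deg τ.semigroup) (c : X.obj p), c ≠ 0 →
    (∀ (q : Deg τ.semigroup) (h : p ≤ q), q.deg - p.deg ∉ τ.perp → (X.map (homOfLE h)).hom c = 0) →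
      ∃ φ ∈ Φ, p.deg - φ ∈ τ.perp

/-- The extension of scalars of a graded module to the reduced ring. -/
abbrev redObj (X : GrMod τ.semigroup) : ModuleCat.{0} τ.redRing :=
  (ModuleCat.extendScalars τ.red).obj (ModuleCat.of (AddMonoidAlgebra ℂ τ.semigroup) X.Total)

/-- The element `1 ⊗ x`. -/
def redι (X : GrMod τ.semigroup) : X.Total →+ redObj X :=
  extendScalarsι τ.red (ModuleCat.of (AddMonoidAlgebra ℂ τ.semigroup) X.Total)

lemma redι_surjective (X : GrMod τ.semigroup) : Function.Surjective (redι X) :=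
  extendScalarsι_surjective _ (red_surjective τ)

lemma redι_smul (X : GrMod τ.semigroup) (r : AddMonoidAlgebra ℂ τ.semigroup) (x : X.Total) :
    redι X (r • x) = τ.red r • redι X x := 
  extendScalarsι_smul τ.red (ModuleCat.of (AddMonoidAlgebra ℂ τ.semigroup) X.Total) r x

lemma redι_single_smul (X : GrMod τ.semigroup) (s : τ.semigroup) {p q : Deg τ.semigroup} (h : p ≤ q)
    (hs : p.deg + s = q.deg) (c : X.obj p) :
    (AddMonoidAlgebra.single (redMk τ s) 1 : τ.redRing) • redι X (X.ofDeg p.deg c) =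
      redι X (X.ofDeg q.deg ((X.map (homOfLE h)).hom c)) := by
  rw [← red_single, ← redι_smul, X.single_smul, one_smul, X.monomialEnd_ofDeg]
  exact congrArg (redι X) (X.mulMonomial_eq_map s p.deg q.deg hs h c)

lemma redι_map_perp (X : GrMod τ.semigroup) {p q : Deg τ.semigroup} (h : p ≤ q)
    (hs : q.deg - p.deg ∈ τ.perp) (c : X.obj p) :
    redι X (X.ofDeg q.deg ((X.map (homOfLE h)).hom c)) = redι X (X.ofDeg p.deg c) := by
  rw [← redι_single_smul X ⟨_, h⟩ h (add_sub_cancel _ _) c]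
  have : redMk τ ⟨_, h⟩ = 0 := Subtype.ext ((QuotientAddGroup.eq_zero_iff _).2 hs)
  rw [this]
  exact one_smul _ _

open Classical in
/-- The map `X^q → X^p` if `p - q ∈ M ∩ τ^∨`, and zero otherwise. -/
def mapOrZero (X : GrMod τ.semigroup) (q p : Deg τ.semigroup) : X.obj q →ₗ[ℂ] X.obj p :=
  if h : q ≤ p then (X.map (homOfLE h)).hom else 0

lemma mapOrZero_comp (X : GrMod τ.semigroup) {q r p : Deg τ.semigroup} (h : q ≤ r) (h' : r ≤ p)
    (c : X.obj q) : mapOrZero X r p ((X.map (homOfLE h)).hom c) = mapOrZero X q p c := by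
  unfold mapOrZero
  rw [dif_pos h', dif_pos (h.trans h')]
  exact congrArg (fun t => t.hom c) (X.map_comp (homOfLE h) (homOfLE h')).symm

open Classical in
/-- The sum of the components whose degrees are congruent to `p` modulo `τ^⊥`, moved to degree `p`. -/
def collect (X : GrMod τ.semigroup) (p : Deg τ.semigroup) : X.Total →ₗ[ℂ] X.obj p :=
  X.desc fun m => if p.deg - m ∈ τ.perp then mapOrZero X ⟨m⟩ p else 0

open Classical in
lemma collect_ofDeg (X : GrMod τ.semigroup) (p : Deg τ.semigroup) (m : Fin n → ℤ) (c : X.obj ⟨m⟩) :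
    collect X p (X.ofDeg m c) = if p.deg - m ∈ τ.perp then mapOrZero X ⟨m⟩ p c else 0 := by
  unfold collect
  rw [X.desc_ofDeg]
  split_ifs <;> rfl

lemma collect_smul_eq_zero (X : GrMod τ.semigroup) (p : Deg τ.semigroup)
    (r : AddMonoidAlgebra ℂ τ.semigroup) (x : X.Total) (hr : τ.red r = 0) :
    collect X p (r • x) = 0 := by
  classical
  induction x using GrMod.induction with
  | h0 => rw [smul_zero, map_zero]
  | hadd x y hx hy => rw [smul_add, map_add, hx, hy, add_zero]
  | hdeg m c =>
    let g : τ.redSemigroup → X.obj p := fun s =>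
      if QuotientAddGroup.mk' τ.perp (p.deg - m) = s.1 then mapOrZero X ⟨m⟩ p c else 0
    have key : ∀ r : AddMonoidAlgebra ℂ τ.semigroup, collect X p (r • X.ofDeg m c) =
        Finsupp.linearCombination ℂ g (τ.red r).coeff := by
      intro r
      induction r using AddMonoidAlgebra.induction_linear with
      | zero => rw [zero_smul, map_zero, map_zero]; simp
      | add f g hf hg => rw [add_smul, map_add, hf, hg, map_add, AddMonoidAlgebra.coeff_add, map_add]
      | single s a =>
        rw [X.single_smul, map_smul, X.monomialEnd_ofDeg, collect_ofDeg, red_single,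
          AddMonoidAlgebra.coeff_single, Finsupp.linearCombination_single]
        congr 1
        have h1 : QuotientAddGroup.mk' τ.perp (p.deg - m) = (redMk τ s).1 ↔
            p.deg - (m + s) ∈ τ.perp := by
          show QuotientAddGroup.mk' τ.perp (p.deg - m) = QuotientAddGroup.mk' τ.perp s ↔ _
          rw [← sub_eq_zero, ← map_sub]
          refine (QuotientAddGroup.eq_zero_iff _).trans ?_
          rw [sub_sub]
        simp only [g, h1]
        split_ifs with h2
        · exact mapOrZero_comp X _ (τ.perp_le h2) c
        · rfl
    rw [key, hr]
    simp

lemma exists_redCollect (X : GrMod τ.semigroup) (p : Deg τ.semigroup) :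
    ∃ ψ : redObj X →+ X.obj p, ∀ x, ψ (redι X x) = collect X p x :=
  exists_extendScalars_lift (ModuleCat.of (AddMonoidAlgebra ℂ τ.semigroup) X.Total)
    (red_surjective τ) (collect X p).toAddMonoidHom (collect_smul_eq_zero X p)

/-- The component of degree `p` modulo `τ^⊥`. -/
def redCollect (X : GrMod τ.semigroup) (p : Deg τ.semigroup) : redObj X →+ X.obj p :=
  (exists_redCollect X p).choose

lemma redCollect_redι (X : GrMod τ.semigroup) (p : Deg τ.semigroup) (x : X.Total) :
    redCollect X p (redι X x) = collect X p x := (exists_redCollect X p).choose_spec x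

lemma map_redCollect (X : GrMod τ.semigroup) {p q : Deg τ.semigroup} (h : p ≤ q) (z : redObj X) :
    (X.map (homOfLE h)).hom (redCollect X p z) =
      redCollect X q ((AddMonoidAlgebra.single (redMk τ ⟨_, h⟩) 1 : τ.redRing) • z) := by
  classical
  obtain ⟨x, rfl⟩ := redι_surjective X z
  induction x using GrMod.induction with
  | h0 => rw [map_zero, smul_zero, map_zero, map_zero, map_zero]
  | hadd x y hx hy => rw [map_add, smul_add, map_add, map_add, map_add, hx, hy]
  | hdeg m c =>
    have hle : (⟨m⟩ : Deg τ.semigroup) ≤ ⟨m + (q.deg - p.deg)⟩ := by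
      show m + (q.deg - p.deg) - m ∈ τ.semigroup
      rw [add_sub_cancel_left]; exact h
    rw [redι_single_smul X ⟨_, h⟩ (p := ⟨m⟩) (q := ⟨m + (q.deg - p.deg)⟩) hle rfl c,
      redCollect_redι, redCollect_redι, collect_ofDeg, collect_ofDeg]
    have h1 : q.deg - (m + (q.deg - p.deg)) = p.deg - m := by abel
    rw [h1]
    split_ifs with h2
    · have h3 : (⟨m⟩ : Deg τ.semigroup) ≤ p := τ.perp_le h2
      rw [mapOrZero_comp X hle (show _ ∈ τ.semigroup by rw [h1]; exact τ.perp_le h2)]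
      unfold mapOrZero
      rw [dif_pos h3, dif_pos (h3.trans h)]
      exact congrArg (fun t => t.hom c) (X.map_comp (homOfLE h3) (homOfLE h)).symm
    · rw [map_zero]

lemma exists_eq_sum_redCollect (X : GrMod τ.semigroup) (z : redObj X) :
    ∃ F : Finset ((Fin n → ℤ) ⧸ τ.perp), ∀ F', F ⊆ F' →
      z = ∑ κ ∈ F', redι X (X.ofDeg κ.out (redCollect X ⟨κ.out⟩ z)) := by
  classical
  obtain ⟨x, rfl⟩ := redι_surjective X z
  induction x using GrMod.induction with
  | h0 => exact ⟨∅, fun F' _ => by simp⟩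
  | hadd x y hx hy =>
    obtain ⟨F₁, h₁⟩ := hx
    obtain ⟨F₂, h₂⟩ := hy
    refine ⟨F₁ ∪ F₂, fun F' hF' => ?_⟩
    simp only [map_add, Finset.sum_add_distrib]
    rw [← h₁ F' (Finset.union_subset_left hF'), ← h₂ F' (Finset.union_subset_right hF')]
  | hdeg m c =>
    refine ⟨{QuotientAddGroup.mk' τ.perp m}, fun F' hF' => ?_⟩
    have hmem : ∀ κ : (Fin n → ℤ) ⧸ τ.perp, κ.out - m ∈ τ.perp ↔ κ = QuotientAddGroup.mk' τ.perp m := by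
      intro κ
      have h1 : QuotientAddGroup.mk' τ.perp κ.out = κ := Quotient.out_eq κ
      conv_rhs => rw [← h1, ← sub_eq_zero, ← map_sub]
      exact (QuotientAddGroup.eq_zero_iff _).symm
    rw [Finset.sum_eq_single (QuotientAddGroup.mk' τ.perp m)]
    · have h2 := (hmem _).2 (rfl : QuotientAddGroup.mk' τ.perp m = _)
      rw [redCollect_redι, collect_ofDeg, if_pos h2]
      unfold mapOrZero
      have h3 : (⟨m⟩ : Deg τ.semigroup) ≤ ⟨(QuotientAddGroup.mk' τ.perp m).out⟩ := τ.perp_le h2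
      rw [dif_pos h3]
      exact (redι_map_perp X h3 h2 c).symm
    · intro κ _ hκ
      rw [redCollect_redι, collect_ofDeg, if_neg (fun h => hκ ((hmem κ).1 h)), map_zero, map_zero]
    · intro h
      exact absurd (hF' (Finset.mem_singleton_self _)) h

lemma redCollect_algebraMap_smul (X : GrMod τ.semigroup) (p : Deg τ.semigroup) (c : ℂ) (z : redObj X) :
    redCollect X p (algebraMap ℂ τ.redRing c • z) = c • redCollect X p z := by
  obtain ⟨x, rfl⟩ := redι_surjective X z
  have h1 : algebraMap ℂ τ.redRing c = τ.red (AddMonoidAlgebra.single 0 c) := by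
    rw [red_single, map_zero]; rfl
  rw [h1, ← redι_smul, X.single_smul, X.monomialEnd_zero, redCollect_redι, redCollect_redι]
  exact map_smul _ _ _

lemma IsGradedTcf.isTorsionCofinite {X : GrMod τ.semigroup} (h : IsGradedTcf X)
    {ht : (Fin n → ℤ) →+ ℤ} (hht : IsHeight τ ht) :
    IsTorsionCofinite τ.maxIdeal (redObj X) := by
  refine ⟨fun z => ?_, ?_⟩
  · obtain ⟨x, rfl⟩ := redι_surjective X z
    induction x using GrMod.induction with
    | h0 => exact ⟨0, fun a _ => by rw [map_zero, smul_zero]⟩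
    | hadd x y hx hy =>
      obtain ⟨k, hk⟩ := hx
      obtain ⟨l, hl⟩ := hy
      refine ⟨max k l, fun a ha => ?_⟩
      rw [map_add, smul_add, hk a (Ideal.pow_le_pow_right (le_max_left k l) ha),
        hl a (Ideal.pow_le_pow_right (le_max_right k l) ha), add_zero]
    | hdeg m c =>
      obtain ⟨k, hk⟩ := h.torsion ht hht ⟨m⟩ c
      refine ⟨k, fun a ha0 => ?_⟩
      have ha1 := maxIdeal_pow_le hht k ha0
      clear ha0
      induction ha1 using Submodule.span_induction with
      | zero => rw [zero_smul]
      | add a b _ _ ha hb => rw [add_smul, ha, hb, add_zero]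
      | smul r a _ ha => rw [smul_assoc, ha, smul_zero]
      | mem a ha =>
        obtain ⟨s, hs, rfl⟩ := ha
        have hle : (⟨m⟩ : Deg τ.semigroup) ≤ ⟨m + s⟩ := by
          show m + s - m ∈ τ.semigroup
          rw [add_sub_cancel_left]; exact s.2
        rw [redι_single_smul X s (p := ⟨m⟩) (q := ⟨m + s⟩) hle rfl c,
          hk _ hle (by simpa using hs), map_zero, map_zero]
  · obtain ⟨Φ, hΦ⟩ := h.exists_socle
    have := h.finite
    let ψ : RestrictScalars ℂ τ.redRing (socle τ.maxIdeal (redObj X)) →ₗ[ℂ]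
        ((φ : Φ) → X.obj ⟨φ.1⟩) :=
      { toFun := fun z φ => redCollect X ⟨φ.1⟩ (show socle τ.maxIdeal (redObj X) from z).1
        map_add' := fun z w => funext fun φ => map_add _ _ _
        map_smul' := fun c z => funext fun φ => redCollect_algebraMap_smul X _ c _ }
    refine Module.Finite.of_injective ψ ((injective_iff_map_eq_zero ψ).2 fun z hz => ?_)
    have key : ∀ w : socle τ.maxIdeal (redObj X), (∀ φ ∈ Φ, redCollect X ⟨φ⟩ w.1 = 0) → w = 0 := ?_
    · exact key z fun φ hφ => congrFun hz ⟨φ, hφ⟩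
    rintro ⟨z, hzs⟩ hz
    refine Subtype.ext (?_ : z = 0)
    have hall : ∀ p, redCollect X p z = 0 := by
      intro p
      by_contra h0
      obtain ⟨φ, hφ, hp⟩ := hΦ p (redCollect X p z) h0 fun q hq hqp => by
        rw [map_redCollect, hzs, map_zero]
        refine Ideal.subset_span ⟨_, fun h1 => hqp ?_, rfl⟩
        exact (QuotientAddGroup.eq_zero_iff _).1 (congrArg Subtype.val h1)
      have hle : (⟨φ⟩ : Deg τ.semigroup) ≤ p := τ.perp_le hp
      have h1 := map_redCollect X hle z
      rw [hz φ hφ, map_zero, show redMk τ ⟨_, hle⟩ = 0 from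
        Subtype.ext ((QuotientAddGroup.eq_zero_iff _).2 hp)] at h1
      exact h0 (by rw [← one_smul τ.redRing z]; exact h1.symm)
    obtain ⟨F, hF⟩ := exists_eq_sum_redCollect X z
    rw [hF F subset_rfl]
    refine Finset.sum_eq_zero fun κ _ => ?_
    rw [hall, map_zero, map_zero]

end TorsionCofinite

end KoszulFan
end

noncomputable section

namespace KoszulFan

section GradedTcf

variable {n : ℕ} {Δ : Fan n} {τ : Δ.Cone}

lemma IsGradedTcf.of_injective {X : GrMod τ.semigroup} {J : Type} [Finite J]
    {Y : J → GrMod τ.semigroup} (f : ∀ j, X ⟶ Y j) (hY : ∀ j, IsGradedTcf (Y j))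
    (hf : ∀ p (c : X.obj p), (∀ j, ((f j).app p).hom c = 0) → c = 0) : IsGradedTcf X := by
  classical
  have := Fintype.ofFinite J
  have hnat : ∀ j {p q : Deg τ.semigroup} (h : p ≤ q) (c : X.obj p),
      ((f j).app q).hom ((X.map (homOfLE h)).hom c) =
        ((Y j).map (homOfLE h)).hom (((f j).app p).hom c) := fun j p q h c =>
    congrArg (fun t => t.hom c) ((f j).naturality (homOfLE h))
  refine ⟨fun ht hht p c => ?_, fun p => ?_, ?_⟩
  · choose k hk using fun j => (hY j).torsion ht hht p (((f j).app p).hom c)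
    refine ⟨Finset.univ.sup k, fun q h hq => hf _ _ fun j => ?_⟩
    rw [hnat]
    refine hk j q h (le_trans ?_ hq)
    exact_mod_cast Finset.le_sup (f := k) (Finset.mem_univ j)
  · have := fun j => (hY j).finite p
    refine Module.Finite.of_injective (LinearMap.pi fun j => ((f j).app p).hom)
      ((injective_iff_map_eq_zero _).2 fun c hc => hf p c fun j => congrFun hc j)
  · choose Φ hΦ using fun j => (hY j).exists_socle
    refine ⟨Finset.univ.biUnion Φ, fun p c hc hs => ?_⟩
    obtain ⟨j, hj⟩ : ∃ j, ((f j).app p).hom c ≠ 0 := by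
      by_contra! h
      exact hc (hf p c h)
    obtain ⟨φ, h1, h2⟩ := hΦ j p _ hj fun q h hq => by
      rw [← hnat, hs q h hq, map_zero]
    exact ⟨φ, Finset.mem_biUnion.2 ⟨j, Finset.mem_univ j, h1⟩, h2⟩

/-- A graded module whose components are at most one-dimensional, and which is dual to a free module. -/
lemma isGradedTcf_of_coords {X : GrMod τ.semigroup} (a : Fin n → ℤ)
    (v : ∀ p, X.obj p →ₗ[ℂ] ℂ) (hinj : ∀ p, Function.Injective (v p))
    (hdeg : ∀ p c, v p c ≠ 0 → a - p.deg ∈ τ.semigroup)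
    (hmap : ∀ p q (h : p ≤ q), a - q.deg ∈ τ.semigroup → ∀ c,
      v q ((X.map (homOfLE h)).hom c) = v p c) : IsGradedTcf X where
  torsion ht hht p c := by
    refine ⟨(ht (a - p.deg)).toNat + 1, fun q h hq => ?_⟩
    by_contra h0
    have h1 : v q ((X.map (homOfLE h)).hom c) ≠ 0 := fun h2 =>
      h0 (hinj q (h2.trans (map_zero _).symm))
    have h2 := hdeg _ _ h1
    have h3 := hht.nonneg _ h2
    have h4 : ht (a - p.deg) = ht (a - q.deg) + ht (q.deg - p.deg) := by
      rw [← map_add, sub_add_sub_cancel]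
    push_cast at hq
    have := Int.self_le_toNat (ht (a - p.deg))
    omega
  finite p := Module.Finite.of_injective (v p) (hinj p)
  exists_socle := by
    refine ⟨{a}, fun p c hc hs => ⟨a, Finset.mem_singleton_self a, ?_⟩⟩
    have h1 : v p c ≠ 0 := fun h2 => hc (hinj p (h2.trans (map_zero _).symm))
    by_contra hp
    have hle : p ≤ ⟨a⟩ := hdeg p c h1
    have h2 := hs ⟨a⟩ hle fun h => hp (by rw [← neg_sub]; exact τ.perp.neg_mem h)
    have h3 := hmap p ⟨a⟩ hle (by rw [sub_self]; exact zero_mem _) c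
    rw [h2, map_zero] at h3
    exact h1 h3.symm

lemma Cosheaf.isTcf_of_stalks (hs : Δ.IsSmooth) {C : Cosheaf Δ} (h : ∀ τ, IsGradedTcf (C.stalk τ)) :
    C.IsTcf := fun τ => by
  obtain ⟨ht, h1, h2, h3⟩ := hs.exists_height τ
  exact (h τ).isTorsionCofinite ⟨h1, h2, h3⟩

/-- All stalks of a cosheaf are torsion cofinite in the graded sense. -/
def Cosheaf.IsGradedTcf (C : Cosheaf Δ) : Prop := ∀ τ, KoszulFan.IsGradedTcf (C.stalk τ)

lemma Cosheaf.IsGradedTcf.of_injective {C : Cosheaf Δ} {J : Type} [Finite J] {E : J → Cosheaf Δ}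
    (f : ∀ j, C ⟶ E j) (hE : ∀ j, (E j).IsGradedTcf)
    (hf : ∀ p (c : C.obj p), (∀ j, ((f j).app p).hom c = 0) → c = 0) : C.IsGradedTcf := fun τ =>
  KoszulFan.IsGradedTcf.of_injective (Y := fun j => (E j).stalk τ)
    (fun j => Functor.whiskerLeft _ (f j)) (fun j => hE j τ) fun _ c hc => hf _ c hc

end GradedTcf

section DualValues

variable {n : ℕ} {Δ : Fan n}

/-- The condition for the component `p` of the dual of `𝒜_U` to be nonzero. -/
def DualSupp (U : LowerSet Δ.Cone) (p : CosheafIdx Δ) : Prop :=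
  p.cone ∈ U ∧ -p.deg ∈ p.cone.semigroup

lemma one_mem_piece {U : LowerSet Δ.Cone} {p : CosheafIdx Δ} (h : DualSupp U p) :
    (1 : ℂ) ∈ piece U p.neg := fun _ => h

open Classical in
/-- The coordinate on the dual of a component of `𝒜_U`. -/
def pieceDualVal (U : LowerSet Δ.Cone) (p : CosheafIdx Δ) : Module.Dual ℂ (piece U p.neg) →ₗ[ℂ] ℂ :=
  if h : DualSupp U p then LinearMap.applyₗ (R := ℂ) (M₂ := ℂ) (⟨1, one_mem_piece h⟩ : piece U p.neg)
    else 0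

lemma pieceDualVal_eq {U : LowerSet Δ.Cone} {p : CosheafIdx Δ} (h : DualSupp U p)
    (φ : Module.Dual ℂ (piece U p.neg)) : pieceDualVal U p φ = φ ⟨1, one_mem_piece h⟩ := by
  unfold pieceDualVal
  rw [dif_pos h]
  rfl

lemma pieceDualVal_eq_zero {U : LowerSet Δ.Cone} {p : CosheafIdx Δ} (h : ¬ DualSupp U p)
    (φ : Module.Dual ℂ (piece U p.neg)) : pieceDualVal U p φ = 0 := by
  unfold pieceDualVal
  rw [dif_neg h]
  rfl

lemma pieceDualVal_injective (U : LowerSet Δ.Cone) (p : CosheafIdx Δ) :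
    Function.Injective (pieceDualVal U p) := by
  refine (injective_iff_map_eq_zero _).2 fun φ hφ => LinearMap.ext fun x => ?_
  rw [LinearMap.zero_apply]
  by_cases h : DualSupp U p
  · rw [pieceDualVal_eq h] at hφ
    have : x = x.1 • (⟨1, one_mem_piece h⟩ : piece U p.neg) := Subtype.ext (mul_one _).symm
    rw [this, map_smul, hφ, smul_zero]
  · have : x = 0 := Subtype.ext (by
      by_contra h0
      exact h (x.2 h0))
    rw [this, map_zero]

/-- The coordinate on a component of the dual of `𝒜_U`. -/
def dualVal (U : LowerSet Δ.Cone) (p : CosheafIdx Δ) : (dual (extZero U)).obj p →ₗ[ℂ] ℂ :=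
  pieceDualVal U p

lemma dualVal_eq {U : LowerSet Δ.Cone} {p : CosheafIdx Δ} (h : DualSupp U p)
    (φ : Module.Dual ℂ (piece U p.neg)) : dualVal U p φ = φ ⟨1, one_mem_piece h⟩ :=
  pieceDualVal_eq h φ

lemma dualVal_eq_zero {U : LowerSet Δ.Cone} {p : CosheafIdx Δ} (h : ¬ DualSupp U p)
    (φ : (dual (extZero U)).obj p) : dualVal U p φ = 0 :=
  pieceDualVal_eq_zero h φ

lemma dualVal_injective (U : LowerSet Δ.Cone) (p : CosheafIdx Δ) :
    Function.Injective (dualVal U p) :=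
  pieceDualVal_injective U p

lemma exists_dualVal_eq {U : LowerSet Δ.Cone} {p : CosheafIdx Δ} {c : ℂ}
    (h : c ≠ 0 → DualSupp U p) : ∃ φ, dualVal U p φ = c := by
  by_cases hc : c = 0
  · exact ⟨0, by rw [map_zero, hc]⟩
  · refine ⟨c • (piece U p.neg).subtype, ?_⟩
    refine (dualVal_eq (h hc) _).trans ?_
    exact mul_one c

lemma dualVal_map {U U' : LowerSet Δ.Cone} {p q : CosheafIdx Δ} (hp : DualSupp U p)
    (hq : DualSupp U' q) (φ : Module.Dual ℂ (piece U p.neg))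
    (ψ : Module.Dual ℂ (piece U' q.neg)) (h : ∀ x : piece U' q.neg, ∀ y : piece U p.neg,
      x.1 = y.1 → ψ x = φ y) : dualVal U' q ψ = dualVal U p φ := by
  rw [dualVal_eq hp, dualVal_eq hq]
  exact h _ _ rfl

lemma DualSupp.anti {U U' : LowerSet Δ.Cone} (hU : U' ≤ U) {p q : CosheafIdx Δ} (hpq : p ≤ q)
    (h : DualSupp U' q) : DualSupp U p := by
  refine ⟨hU (U'.lower hpq.1 h.1), ?_⟩
  have := p.cone.semigroup.add_mem (Fan.Cone.semigroup_anti hpq.1 h.2) hpq.2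
  rwa [show -q.deg + (q.deg - p.deg) = -p.deg by abel] at this

lemma dualVal_dual_map {U : LowerSet Δ.Cone} {p q : CosheafIdx Δ} (hpq : p ≤ q) (hq : DualSupp U q)
    (φ : (dual (extZero U)).obj p) :
    dualVal U q (((dual (extZero U)).map (homOfLE hpq)).hom φ) = dualVal U p φ :=
  dualVal_map (hq.anti le_rfl hpq) hq _ _ fun _ _ h =>
    congrArg (show Module.Dual ℂ (piece U p.neg) from φ) (Subtype.ext h)

lemma dualVal_kernelBimap {ρ σ : Δ.Cone} (h : ρ ≤ σ) {p q : CosheafIdx Δ} (hpq : p ≤ q)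
    (hq : DualSupp (LowerSet.Iic ρ) q) (k : (kernel σ).obj p) :
    dualVal (LowerSet.Iic ρ) q (kernelBimap h hpq k) = dualVal (LowerSet.Iic σ) p k :=
  dualVal_map (hq.anti (LowerSet.Iic_le.2 h) hpq) hq _ _ fun _ _ h =>
    congrArg (show Module.Dual ℂ (piece (LowerSet.Iic σ) p.neg) from k) (Subtype.ext h)

lemma dualVal_kernelAct {σ τ : Δ.Cone} {i i' : Fin n → ℤ} (h : i' - i ∈ σ.semigroup)
    (h' : DualSupp (LowerSet.Iic σ) ⟨τ, i'⟩) (k : (kernel σ).obj ⟨τ, i⟩) :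
    dualVal (LowerSet.Iic σ) ⟨τ, i'⟩ (kernelAct σ τ h k) = dualVal (LowerSet.Iic σ) ⟨τ, i⟩ k := by
  have hp : DualSupp (LowerSet.Iic σ) (⟨τ, i⟩ : CosheafIdx Δ) :=
    h'.anti le_rfl (show (⟨τ, i⟩ : CosheafIdx Δ) ≤ ⟨τ, i'⟩ from
      ⟨le_rfl, Fan.Cone.semigroup_anti h'.1 h⟩)
  exact dualVal_map hp h' _ _ fun _ _ h =>
    congrArg (show Module.Dual ℂ (piece (LowerSet.Iic σ) (CosheafIdx.neg ⟨τ, i⟩)) from k)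
      (Subtype.ext h)

lemma isGradedTcf_dual_extZero (U : LowerSet Δ.Cone) : (dual (extZero U)).IsGradedTcf := fun τ => by
  by_cases hτ : τ ∈ U
  · refine isGradedTcf_of_coords 0 (fun p => dualVal U ⟨τ, p.deg⟩) (fun p => dualVal_injective U _)
      (fun p c h => ?_) (fun p q h hq c => ?_)
    · rw [zero_sub]
      by_contra h0
      exact h (dualVal_eq_zero (fun h1 => h0 h1.2) c)
    · rw [zero_sub] at hq
      exact dualVal_dual_map (U := U) (p := ⟨τ, p.deg⟩) (q := ⟨τ, q.deg⟩) ⟨le_rfl, h⟩ ⟨hτ, hq⟩ c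
  · refine isGradedTcf_of_coords 0 (fun p => dualVal U ⟨τ, p.deg⟩) (fun p => dualVal_injective U _)
      (fun p c h => ?_) (fun p q h hq c => ?_)
    · exact absurd (dualVal_eq_zero (fun h1 => hτ h1.1) c) h
    · exact (dualVal_eq_zero (fun h1 => hτ h1.1) _).trans (dualVal_eq_zero (fun h1 => hτ h1.1) c).symm

end DualValues

section TensorValues

variable {n : ℕ} {Δ : Fan n}

/-- The stalk `N_σ` is free on a generator of degree `a`, with coordinates `c`. -/
structure IsFreeStalk (N : Sheaf Δ) (σ : Δ.Cone) (a : Fin n → ℤ)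
    (c : ∀ j, N.obj ⟨σ, j⟩ →ₗ[ℂ] ℂ) : Prop where
  inj : ∀ j, Function.Injective (c j)
  map : ∀ j j' (h : (⟨σ, j⟩ : SheafIdx Δ) ≤ ⟨σ, j'⟩) y, c j' ((N.map (homOfLE h)).hom y) = c j y
  deg : ∀ j y, c j y ≠ 0 → j - a ∈ σ.semigroup
  exists_gen : ∃ e, c a e = 1

/-- The condition for the component `p` of `𝒦_σ ⊗ N_σ` to be nonzero. -/
def TensorSupp (σ : Δ.Cone) (a : Fin n → ℤ) (p : CosheafIdx Δ) : Prop :=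
  p.cone ≤ σ ∧ a - p.deg ∈ p.cone.semigroup

lemma TensorSupp.dualSupp {σ : Δ.Cone} {a : Fin n → ℤ} {p : CosheafIdx Δ} (h : TensorSupp σ a p)
    {j : Fin n → ℤ} (hj : j - a ∈ σ.semigroup) :
    DualSupp (LowerSet.Iic σ) (⟨p.cone, p.deg - j⟩ : CosheafIdx Δ) := by
  refine ⟨h.1, ?_⟩
  have := p.cone.semigroup.add_mem h.2 (Fan.Cone.semigroup_anti h.1 hj)
  rwa [show a - p.deg + (j - a) = -(p.deg - j) by abel] at this

variable {N : Sheaf Δ} {σ : Δ.Cone} {a : Fin n → ℤ} {c : ∀ j, N.obj ⟨σ, j⟩ →ₗ[ℂ] ℂ}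

/-- The pairing `k ⊗ y ↦ k(1) c(y)`. -/
def tensorSumVal (c : ∀ j, N.obj ⟨σ, j⟩ →ₗ[ℂ] ℂ) (p : CosheafIdx Δ) : TensorSum σ N p →ₗ[ℂ] ℂ :=
  DirectSum.toModule ℂ _ _ fun j => TensorProduct.lift ((LinearMap.mul ℂ ℂ).compl₁₂
    (dualVal (LowerSet.Iic σ) ⟨p.cone, p.deg - j⟩) (c j))

lemma tensorSumVal_of (c : ∀ j, N.obj ⟨σ, j⟩ →ₗ[ℂ] ℂ) (p : CosheafIdx Δ) (j : Fin n → ℤ)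
    (k : (kernel σ).obj ⟨p.cone, p.deg - j⟩) (y : N.obj ⟨σ, j⟩) :
    tensorSumVal c p (tensorOf σ N p j (k ⊗ₜ y)) = dualVal (LowerSet.Iic σ) _ k * c j y := by
  unfold tensorSumVal tensorOf
  rw [DirectSum.toModule_lof]
  rfl

open Classical in
lemma tensorRel_le_ker (h : IsFreeStalk N σ a c) (p : CosheafIdx Δ) :
    tensorRel σ N p ≤ LinearMap.ker
      (if TensorSupp σ a p then tensorSumVal c p else 0) := by
  by_cases hp : TensorSupp σ a p
  · rw [if_pos hp]
    refine Submodule.span_le.2 ?_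
    rintro _ ⟨j, j', hj, k, y, rfl⟩
    show tensorSumVal c p _ = 0
    rw [map_sub, tensorSumVal_of, tensorSumVal_of, h.map, ← sub_mul]
    by_cases hy : c j y = 0
    · rw [hy, mul_zero]
    · rw [dualVal_kernelAct (tensor_deg hj) (hp.dualSupp (h.deg j y hy)), sub_self, zero_mul]
  · rw [if_neg hp, LinearMap.ker_zero]
    exact le_top

open Classical in
/-- The coordinate on a component of `𝒦_σ ⊗ N_σ`, for `N_σ` free of rank one. -/
def tensorVal (h : IsFreeStalk N σ a c) (p : CosheafIdx Δ) : TensorObj σ N p →ₗ[ℂ] ℂ :=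
  (tensorRel σ N p).liftQ _ (tensorRel_le_ker h p)

lemma tensorVal_of (h : IsFreeStalk N σ a c) {p : CosheafIdx Δ} (hp : TensorSupp σ a p)
    (j : Fin n → ℤ) (k : (kernel σ).obj ⟨p.cone, p.deg - j⟩) (y : N.obj ⟨σ, j⟩) :
    tensorVal h p ((tensorRel σ N p).mkQ (tensorOf σ N p j (k ⊗ₜ y))) =
      dualVal (LowerSet.Iic σ) _ k * c j y := by
  classical
  refine (Submodule.liftQ_apply (tensorRel σ N p) _ _).trans ?_
  rw [if_pos hp, tensorSumVal_of]

lemma tensorVal_eq_zero (h : IsFreeStalk N σ a c) {p : CosheafIdx Δ} (hp : ¬ TensorSupp σ a p)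
    (z : TensorObj σ N p) : tensorVal h p z = 0 := by
  classical
  obtain ⟨z, rfl⟩ := Submodule.mkQ_surjective _ z
  refine (Submodule.liftQ_apply (tensorRel σ N p) _ _).trans ?_
  rw [if_neg hp]
  rfl

lemma exists_eq_tensorOf (h : IsFreeStalk N σ a c) {e : N.obj ⟨σ, a⟩} (he : c a e = 1)
    (p : CosheafIdx Δ) (z : TensorObj σ N p) :
    ∃ k, z = (tensorRel σ N p).mkQ (tensorOf σ N p a (k ⊗ₜ e)) := by
  let f : (kernel σ).obj ⟨p.cone, p.deg - a⟩ →ₗ[ℂ] TensorObj σ N p :=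
    (tensorRel σ N p).mkQ ∘ₗ tensorOf σ N p a ∘ₗ (TensorProduct.mk ℂ _ _).flip e
  suffices hf : LinearMap.range f = ⊤ by
    obtain ⟨k, hk⟩ := LinearMap.range_eq_top.1 hf z
    exact ⟨k, hk.symm⟩
  rw [← Submodule.ker_mkQ (LinearMap.range f)]
  have : (LinearMap.range f).mkQ = 0 := by
    refine tensorObj_hom_ext fun j k y => ?_
    rw [LinearMap.zero_apply, Submodule.mkQ_apply, Submodule.Quotient.mk_eq_zero]
    by_cases hy : c j y = 0
    · have : y = 0 := h.inj j (hy.trans (map_zero _).symm)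
      rw [this, TensorProduct.tmul_zero, map_zero, map_zero]
      exact Submodule.zero_mem _
    · have hj := h.deg j y hy
      have hle : (⟨σ, a⟩ : SheafIdx Δ) ≤ ⟨σ, j⟩ := ⟨le_rfl, hj⟩
      have h1 : y = c j y • (N.map (homOfLE hle)).hom e := by
        refine h.inj j ?_
        rw [map_smul, h.map, he, smul_eq_mul, mul_one]
      rw [h1, TensorProduct.tmul_smul, map_smul, map_smul]
      refine Submodule.smul_mem _ _ ⟨kernelAct σ p.cone (tensor_deg hj) k, ?_⟩
      show (tensorRel σ N p).mkQ _ = (tensorRel σ N p).mkQ _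
      rw [← sub_eq_zero, ← map_sub, Submodule.mkQ_apply, Submodule.Quotient.mk_eq_zero]
      exact Submodule.subset_span ⟨a, j, hj, k, e, rfl⟩
  rw [this, LinearMap.ker_zero]

lemma tensorVal_injective (h : IsFreeStalk N σ a c) (p : CosheafIdx Δ) :
    Function.Injective (tensorVal h p) := by
  refine (injective_iff_map_eq_zero _).2 fun z hz => ?_
  obtain ⟨e, he⟩ := h.exists_gen
  obtain ⟨k, rfl⟩ := exists_eq_tensorOf h he p z
  have hk : k = 0 := by
    refine dualVal_injective (LowerSet.Iic σ) ⟨p.cone, p.deg - a⟩ (Eq.trans ?_ (map_zero _).symm)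
    by_cases hp : TensorSupp σ a p
    · rwa [tensorVal_of h hp, he, mul_one] at hz
    · refine dualVal_eq_zero (fun h1 => hp ⟨h1.1, ?_⟩) k
      have h2 : -(p.deg - a) ∈ p.cone.semigroup := h1.2
      rwa [neg_sub] at h2
  rw [hk, TensorProduct.zero_tmul, map_zero, map_zero]

lemma exists_tensorVal_eq (h : IsFreeStalk N σ a c) {p : CosheafIdx Δ} {x : ℂ}
    (hx : x ≠ 0 → TensorSupp σ a p) : ∃ z, tensorVal h p z = x := by
  by_cases hx0 : x = 0
  · exact ⟨0, by rw [map_zero, hx0]⟩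
  · obtain ⟨e, he⟩ := h.exists_gen
    obtain ⟨k, hk⟩ := exists_dualVal_eq (U := LowerSet.Iic σ) (p := ⟨p.cone, p.deg - a⟩) (c := x)
      fun h0 => (hx h0).dualSupp (by rw [sub_self]; exact zero_mem _)
    exact ⟨_, (tensorVal_of h (hx hx0) a k e).trans (by rw [hk, he, mul_one])⟩

lemma TensorSupp.anti {ρ : Δ.Cone} (hρ : ρ ≤ σ) {p q : CosheafIdx Δ} (hpq : p ≤ q)
    (h : TensorSupp ρ a q) : TensorSupp σ a p := by
  refine ⟨hpq.1.trans (h.1.trans hρ), ?_⟩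
  have := p.cone.semigroup.add_mem (Fan.Cone.semigroup_anti hpq.1 h.2) hpq.2
  rwa [show a - q.deg + (q.deg - p.deg) = a - p.deg by abel] at this

lemma tensorVal_tensorMap {N' : Sheaf Δ} {ρ : Δ.Cone} {c' : ∀ j, N'.obj ⟨ρ, j⟩ →ₗ[ℂ] ℂ}
    (h : IsFreeStalk N σ a c) (h' : IsFreeStalk N' ρ a c') (hρ : ρ ≤ σ) (g : N ⟶ N')
    (hg : ∀ j y, c' j (sheafBimap hρ g j y) = c j y) {p q : CosheafIdx Δ} (hpq : p ≤ q)
    (hq : TensorSupp ρ a q) (z : TensorObj σ N p) :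
    tensorVal h' q (tensorMap hρ g hpq z) = tensorVal h p z := by
  suffices hh : tensorVal h' q ∘ₗ tensorMap hρ g hpq = tensorVal h p from
    congrArg (fun t => t z) hh
  refine tensorObj_hom_ext fun j k y => ?_
  rw [LinearMap.comp_apply, tensorMap_of, tensorVal_of h' hq, tensorVal_of h (hq.anti hρ hpq), hg]
  by_cases hy : c j y = 0
  · rw [hy, mul_zero, mul_zero]
  · congr 1
    exact dualVal_kernelBimap hρ (shift_le hpq j)
      (hq.dualSupp (Fan.Cone.semigroup_anti hρ (h.deg j y hy))) k

lemma IsFreeStalk.isGradedTcf (h : IsFreeStalk N σ a c) : (tensorCosheaf σ N).IsGradedTcf := fun τ => by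
  refine isGradedTcf_of_coords a (fun p => tensorVal h ⟨τ, p.deg⟩) (fun p => tensorVal_injective h _)
    (fun p z hz => ?_) (fun p q hpq hq z => ?_)
  · by_contra h0
    exact hz (tensorVal_eq_zero h (fun h1 => h0 h1.2) z)
  · by_cases hτ : τ ≤ σ
    · refine tensorVal_tensorMap h h le_rfl (𝟙 N) (fun j y => ?_) (p := ⟨τ, p.deg⟩)
        (q := ⟨τ, q.deg⟩) ⟨le_rfl, hpq⟩ ⟨hτ, hq⟩ z
      exact h.map j j _ y
    · exact (tensorVal_eq_zero h (fun h1 => hτ h1.1) _).trans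
        (tensorVal_eq_zero h (fun h1 => hτ h1.1) z).symm

/-- The stalks of a free sheaf. -/
lemma isFreeStalk_line {q : SheafIdx Δ} (hσ : σ ≤ q.cone) :
    IsFreeStalk (line q) σ q.deg (fun _ => lineVal) where
  inj _ := lineVal_injective
  map _ _ _ _ := rfl
  deg j y h := (le_of_lineVal_ne_zero h).2
  exists_gen := ⟨lineOne ⟨hσ, by simp⟩, rfl⟩

lemma isGradedTcf_tensor_line (σ : Δ.Cone) (q : SheafIdx Δ) :
    (tensorCosheaf σ (line q)).IsGradedTcf := by
  by_cases hσ : σ ≤ q.cone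
  · exact (isFreeStalk_line hσ).isGradedTcf
  · refine Cosheaf.IsGradedTcf.of_injective (J := Empty) (E := fun _ => tensorCosheaf σ (line q))
      (fun j => j.elim) (fun j => j.elim) fun p z _ => ?_
    have : (LinearMap.id : TensorObj σ (line q) p →ₗ[ℂ] _) = 0 := by
      refine tensorObj_hom_ext fun j k y => ?_
      rw [eq_zero_of_not_le (fun h : q ≤ ⟨σ, j⟩ => hσ h.1) y, TensorProduct.tmul_zero, map_zero, map_zero, map_zero,
        map_zero]
    exact congrArg (fun t => t z) this

lemma tensorMap_add {ρ : Δ.Cone} (h : ρ ≤ σ) {N' : Sheaf Δ} (g g' : N ⟶ N') {p q : CosheafIdx Δ}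
    (hpq : p ≤ q) : tensorMap h (g + g') hpq = tensorMap h g hpq + tensorMap h g' hpq := by
  refine tensorObj_hom_ext fun j k y => ?_
  rw [LinearMap.add_apply, tensorMap_of, tensorMap_of, tensorMap_of, ← map_add, ← map_add,
    ← TensorProduct.tmul_add]
  congr 3
  exact map_add ((N'.map _).hom) _ _

lemma tensorMap_sum {ρ : Δ.Cone} (h : ρ ≤ σ) {N' : Sheaf Δ} {J : Type} (s : Finset J)
    (g : J → (N ⟶ N')) {p q : CosheafIdx Δ} (hpq : p ≤ q) :
    tensorMap h (∑ j ∈ s, g j) hpq = ∑ j ∈ s, tensorMap h (g j) hpq :=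
  map_sum (AddMonoidHom.mk' (fun g : N ⟶ N' => tensorMap h g hpq)
    fun g g' => tensorMap_add h g g' hpq) g s

lemma IsFreeRetract.isGradedTcf_tensor {P : Sheaf Δ} (h : IsFreeRetract P) (σ : Δ.Cone) :
    (tensorCosheaf σ P).IsGradedTcf := by
  obtain ⟨J, _, q, a, b, hab⟩ := h
  refine Cosheaf.IsGradedTcf.of_injective (E := fun j => tensorCosheaf σ (line (q j)))
    (fun j => tensorCosheafMap le_rfl (a j)) (fun j => isGradedTcf_tensor_line σ (q j))
    fun p z hz => ?_
  have h1 : (LinearMap.id : TensorObj σ P p →ₗ[ℂ] _) =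
      ∑ j, tensorMap (le_refl σ) (a j ≫ b j) (le_refl p) := by
    rw [← tensorMap_sum, hab, tensorMap_id]
  refine (congrArg (fun t => t z) h1).trans ((LinearMap.sum_apply _ _ _).trans ?_)
  refine (Finset.sum_eq_zero fun j _ => ?_)
  rw [show tensorMap (le_refl σ) (a j ≫ b j) (le_refl p) = _ from
    tensorMap_comp (le_refl σ) (le_refl σ) (a j) (b j) (le_refl p) (le_refl p)]
  exact (congrArg (tensorMap (le_refl σ) (b j) (le_refl p)) (hz j)).trans (map_zero _)

end TensorValues

end KoszulFan
end

noncomputable section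

namespace KoszulFan

section Total

variable {D : Type} [Preorder D]

/-- Bicomplexes of functors to vector spaces. -/
abbrev FunctorBicomplex (D : Type) [Preorder D] : Type 1 :=
  HomologicalComplex₂ (D ⥤ ModuleCat.{0} ℂ) (ComplexShape.up ℤ) (ComplexShape.up ℤ)

variable (K : FunctorBicomplex D)

/-- The total complex. -/
abbrev tot : CochainComplex (D ⥤ ModuleCat.{0} ℂ) ℤ :=
  HomologicalComplex₂.total K (ComplexShape.up ℤ)

/-- The inclusion of a summand in the total complex. -/
def totι {i j k : ℤ} (h : i + j = k) : (K.X i).X j ⟶ (tot K).X k :=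
  K.ιTotal (ComplexShape.up ℤ) i j k h

lemma tot_hom_ext {k : ℤ} {A : D ⥤ ModuleCat.{0} ℂ} {f g : (tot K).X k ⟶ A}
    (H : ∀ i j (h : i + j = k), totι K h ≫ f = totι K h ≫ g) : f = g :=
  HomologicalComplex₂.total.hom_ext _ H

lemma totι_d {i i' j j' k k' : ℤ} (h : i + j = k) (hi : i + 1 = i') (hj : j + 1 = j')
    (h₁ : i' + j = k') (h₂ : i + j' = k') :
    totι K h ≫ (tot K).d k k' = (K.d i i').f j ≫ totι K h₁ +
      ComplexShape.ε₂ (ComplexShape.up ℤ) (ComplexShape.up ℤ) (ComplexShape.up ℤ) (i, j) •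
        ((K.X i).d j j' ≫ totι K h₂) := by
  unfold totι
  rw [HomologicalComplex₂.total_d, Preadditive.comp_add, HomologicalComplex₂.ι_D₁,
    HomologicalComplex₂.ι_D₂, K.d₁_eq _ hi _ _ h₁, K.d₂_eq _ _ hj _ h₂]
  congr 1
  exact one_smul _ _

/-- The projection from the total complex to a summand. -/
def totπ {i j k : ℤ} (h : i + j = k) : (tot K).X k ⟶ (K.X i).X j :=
  HomologicalComplex₂.totalDesc K fun i' j' h' =>
    if hj : j' = j then
      eqToHom (by
        have h' : i' + j' = k := h'
        obtain rfl : i' = i := by omega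
        subst hj
        rfl)
    else 0

lemma totι_totπ_self {i j k : ℤ} (h : i + j = k) : totι K h ≫ totπ K h = 𝟙 _ := by
  unfold totι totπ
  rw [HomologicalComplex₂.ι_totalDesc, dif_pos rfl, eqToHom_refl]

lemma totι_totπ_ne {i j i' j' k : ℤ} (h : i + j = k) (h' : i' + j' = k) (hj : j ≠ j') :
    totι K h ≫ totπ K h' = 0 := by
  unfold totι totπ
  rw [HomologicalComplex₂.ι_totalDesc, dif_neg hj]

lemma d_totπ {i i' j j' k k' : ℤ} (hi : i + 1 = i') (hj : j' + 1 = j) (hk : k + 1 = k')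
    (h : i + j = k) (h₁ : i' + j = k') (h₂ : i' + j' = k) :
    (tot K).d k k' ≫ totπ K h₁ = totπ K h ≫ (K.d i i').f j +
      totπ K h₂ ≫ (ComplexShape.ε₂ (ComplexShape.up ℤ) (ComplexShape.up ℤ) (ComplexShape.up ℤ)
        (i', j') • (K.X i').d j' j) := by
  refine tot_hom_ext K fun a b hab => ?_
  rw [Preadditive.comp_add, ← Category.assoc, totι_d K hab rfl rfl (by omega) (by omega),
    Preadditive.add_comp, Category.assoc, Linear.units_smul_comp, Category.assoc]
  by_cases hb : b = j
  · subst hb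
    obtain rfl : a = i := by omega
    subst hi
    rw [totι_totπ_self, totι_totπ_ne K _ _ (by omega), comp_zero, smul_zero, ← Category.assoc,
      totι_totπ_self, ← Category.assoc, totι_totπ_ne K _ _ (by omega), zero_comp, Category.id_comp,
      Category.comp_id]
  · by_cases hb' : b = j'
    · subst hb'
      obtain rfl : a = i' := by omega
      subst hj
      rw [totι_totπ_self, totι_totπ_ne K _ _ (by omega), comp_zero, ← Category.assoc,
        totι_totπ_ne K _ _ (by omega), ← Category.assoc, totι_totπ_self, zero_comp,
        Category.id_comp, Category.comp_id]
    · rw [totι_totπ_ne K _ _ (by omega), totι_totπ_ne K _ _ (by omega), comp_zero, comp_zero,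
        smul_zero, ← Category.assoc, totι_totπ_ne K _ _ (by omega), ← Category.assoc,
        totι_totπ_ne K _ _ (by omega), zero_comp, zero_comp]

variable {K} {a b : ℤ}

lemma id_tot (hK : ∀ i j, (j < a ∨ b < j) → IsZero ((K.X i).X j)) (k : ℤ) :
    𝟙 ((tot K).X k) = ∑ j ∈ Finset.Icc a b,
      totπ K (sub_add_cancel k j) ≫ totι K (sub_add_cancel k j) := by
  refine tot_hom_ext K fun i j h => ?_
  by_cases hj : j < a ∨ b < j
  · exact (hK i j hj).eq_of_src _ _
  · rw [Category.comp_id, Preadditive.comp_sum, Finset.sum_eq_single j]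
    · obtain rfl : i = k - j := by omega
      rw [← Category.assoc, totι_totπ_self, Category.id_comp]
    · intro j' _ hj'
      rw [← Category.assoc, totι_totπ_ne K _ _ hj'.symm, zero_comp]
    · intro hj'
      rw [Finset.mem_Icc] at hj'
      omega

lemma tot_eq_sum (hK : ∀ i j, (j < a ∨ b < j) → IsZero ((K.X i).X j)) {k : ℤ} {p : D}
    (x : ((tot K).X k).obj p) : x = ∑ j ∈ Finset.Icc a b,
      ((totι K (sub_add_cancel k j)).app p).hom (((totπ K (sub_add_cancel k j)).app p).hom x) := by
  have h := congrArg (fun t => (t.app p).hom x) (id_tot hK k)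
  simp only [NatTrans.app_sum, ModuleCat.hom_sum, LinearMap.sum_apply] at h
  exact h

lemma tot_eq_zero (hK : ∀ i j, (j < a ∨ b < j) → IsZero ((K.X i).X j)) {k : ℤ} {p : D}
    (x : ((tot K).X k).obj p)
    (hx : ∀ i j (h : i + j = k), j ≤ b → ((totπ K h).app p).hom x = 0) : x = 0 := by
  rw [tot_eq_sum hK x]
  refine Finset.sum_eq_zero fun j hj => ?_
  rw [hx _ _ _ (Finset.mem_Icc.1 hj).2, map_zero]

variable (K) in
/-- A chain map from the total complex supported on the column of degree `0`. -/
structure TotAug (Y : CochainComplex (D ⥤ ModuleCat.{0} ℂ) ℤ) where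
  app : ∀ {i j k : ℤ}, i + j = k → ((K.X i).X j ⟶ Y.X k)
  eq_zero : ∀ {i j k : ℤ} (h : i + j = k), i ≠ 0 → app h = 0
  comm₁ : ∀ {i i' j k : ℤ} (_ : i + 1 = i') (h : i' + j = k), (K.d i i').f j ≫ app h = 0
  comm₂ : ∀ {i j j' k k' : ℤ} (_ : j + 1 = j') (h : i + j = k) (h' : i + j' = k'),
    (K.X i).d j j' ≫ app h' = app h ≫ Y.d k k'

variable {Y : CochainComplex (D ⥤ ModuleCat.{0} ℂ) ℤ} (q : TotAug K Y)

/-- The associated morphism of complexes. -/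
def TotAug.hom : tot K ⟶ Y where
  f k := HomologicalComplex₂.totalDesc K fun _ _ h => q.app h
  comm' k k' hk := by
    refine tot_hom_ext K fun i j h => ?_
    have hk : k + 1 = k' := hk
    have hι : ∀ {i j k : ℤ} (h : i + j = k), totι K h ≫ HomologicalComplex₂.totalDesc K
        (fun _ _ h => q.app h) = q.app h := fun h => HomologicalComplex₂.ι_totalDesc _ _ _ _ _
    rw [← Category.assoc, ← Category.assoc, hι, totι_d K h rfl rfl (by omega) (by omega),
      Preadditive.add_comp, Category.assoc, Linear.units_smul_comp, Category.assoc, hι, hι,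
      q.comm₁ rfl, zero_add, q.comm₂ rfl h]
    by_cases hi : i = 0
    · subst hi
      exact (one_smul _ _).symm
    · rw [q.eq_zero h hi, zero_comp, smul_zero]

lemma TotAug.ι_hom {i j k : ℤ} (h : i + j = k) : totι K h ≫ q.hom.f k = q.app h :=
  HomologicalComplex₂.ι_totalDesc K (fun _ _ h => q.app h) i j h

/-- If the rows are exact then so is the cone of the map from the total complex. -/
lemma TotAug.exists_of_rows (hK : ∀ i j, (j < a ∨ b < j) → IsZero ((K.X i).X j))
    (hY : ∀ j, b < j → IsZero (Y.X j)) {p : D}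
    (hrow : ∀ {i i' j k k' : ℤ} (_ : i + 1 = i') (h : i + j = k) (h' : i' + j = k')
      (x : ((K.X i').X j).obj p) (y : (Y.X k).obj p), (((K.d i' (i' + 1)).f j).app p).hom x = 0 →
      ((q.app h').app p).hom x = 0 → (i ≠ 0 → y = 0) →
      ∃ u : ((K.X i).X j).obj p, (((K.d i i').f j).app p).hom u = x ∧
        ((q.app h).app p).hom u = y)
    {k : ℤ} (m : ℕ) : ∀ (J : ℤ) (_ : b + 1 ≤ J + m) (x : ((tot K).X (k + 1)).obj p) (y : (Y.X k).obj p),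
    (((tot K).d (k + 1) (k + 1 + 1)).app p).hom x = 0 →
    ((q.hom.f (k + 1)).app p).hom x = ((Y.d k (k + 1)).app p).hom y →
    (∀ i j (h : i + j = k + 1), j < J → ((totπ K h).app p).hom x = 0) →
    (k < J → y = 0) →
    ∃ x' : ((tot K).X k).obj p, (((tot K).d k (k + 1)).app p).hom x' = x ∧
      ((q.hom.f k).app p).hom x' = y := by
  induction m with
  | zero =>
    intro J hJ x y _ _ hx hy
    refine ⟨0, ?_, ?_⟩
    · rw [map_zero]
      exact (tot_eq_zero hK x fun i j h hj => hx i j h (by push_cast at hJ; omega)).symm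
    · rw [map_zero]
      by_cases hk : k < J
      · exact (hy hk).symm
      · have := (hY k (by push_cast at hJ; omega)).eq_of_src (𝟙 _) 0
        exact (congrArg (fun t => (t.app p).hom y) this).symm
  | succ m ih =>
    intro J hJ x y hdx hxy hx hy
    have e₁ : k - J + J = k := by omega
    have e₂ : k + 1 - J + J = k + 1 := by omega
    have e₃ : k + 1 + 1 - J + J = k + 1 + 1 := by omega
    have e₄ : k + 1 + 1 - J + (J - 1) = k + 1 := by omega
    set xJ := ((totπ K e₂).app p).hom x with hxJ
    have h1 : (((K.d (k + 1 - J) (k + 1 - J + 1)).f J).app p).hom xJ = 0 := by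
      rw [show k + 1 - J + 1 = k + 1 + 1 - J by omega]
      have h2 := congrArg (fun t => (t.app p).hom x)
        (d_totπ K (i := k + 1 - J) (i' := k + 1 + 1 - J) (j := J) (j' := J - 1)
          (by omega) (by omega) rfl e₂ e₃ e₄)
      have h3 : ((totπ K e₄).app p).hom x = 0 := hx _ _ _ (by omega)
      have h4 : (((totπ K e₃).app p).hom ((((tot K).d (k + 1) (k + 1 + 1)).app p).hom x)) = 0 := by
        rw [hdx, map_zero]
      have h5 : ((((ComplexShape.ε₂ (ComplexShape.up ℤ) (ComplexShape.up ℤ) (ComplexShape.up ℤ)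
        (k + 1 + 1 - J, J - 1) • (K.X (k + 1 + 1 - J)).d (J - 1) J)).app p).hom
          (((totπ K e₄).app p).hom x)) = 0 := by
        rw [h3, map_zero]
      have h6 := h4.symm.trans h2
      refine Eq.trans ?_ h6.symm
      exact (add_zero _).symm.trans (congrArg _ h5.symm)
    have h2 : ((q.app e₂).app p).hom xJ = 0 := by
      by_cases hi : k + 1 - J = 0
      · have h3 : ((q.hom.f (k + 1)).app p).hom x = 0 := by
          rw [hxy, hy (by omega), map_zero]
        rw [tot_eq_sum hK x, map_sum] at h3
        by_cases hJ' : J ∈ Finset.Icc a b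
        · rw [Finset.sum_eq_single_of_mem J hJ'] at h3
          · exact (congrArg (fun t => (t.app p).hom xJ) (q.ι_hom e₂)).symm.trans h3
          · intro j _ hj
            have h4 := congrArg (fun t => (t.app p).hom
              (((totπ K (sub_add_cancel (k + 1) j)).app p).hom x))
              ((q.ι_hom (sub_add_cancel (k + 1) j)).trans (q.eq_zero _ (by omega)))
            exact h4
        · have := (hK (k + 1 - J) J (by rw [Finset.mem_Icc] at hJ'; omega)).eq_of_src (q.app e₂) 0
          exact congrArg (fun t => (t.app p).hom xJ) this
      · exact congrArg (fun t => (t.app p).hom xJ) (q.eq_zero e₂ hi)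
    obtain ⟨u, hu, hqu⟩ := hrow (i := k - J) (i' := k + 1 - J) (by omega) e₁ e₂ xJ
      (if k - J = 0 then y else 0) h1 h2 (fun h => if_neg h)
    set w := ((totι K e₁).app p).hom u
    have hfw : ((q.hom.f k).app p).hom w = if k - J = 0 then y else 0 :=
      (congrArg (fun t => (t.app p).hom u) (q.ι_hom e₁)).trans hqu
    have hdw : ∀ i j (h : i + j = k + 1), j ≤ J →
        ((totπ K h).app p).hom ((((tot K).d k (k + 1)).app p).hom w) =
          ((totπ K h).app p).hom x := by
      intro i j h hj
      have e₅ : k - J + (J + 1) = k + 1 := by omega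
      have h3 := totι_d K e₁ (i' := k + 1 - J) (j' := J + 1) (by omega) rfl e₂ e₅
      have h4 : totι K e₁ ≫ (tot K).d k (k + 1) ≫ totπ K h =
          (K.d (k - J) (k + 1 - J)).f J ≫ totι K e₂ ≫ totπ K h := by
        rw [← Category.assoc, h3, Preadditive.add_comp, Linear.units_smul_comp, Category.assoc,
          Category.assoc, totι_totπ_ne K e₅ h (by omega), comp_zero, smul_zero, add_zero]
      have h5 := congrArg (fun t => (t.app p).hom u) h4
      refine h5.trans ?_
      rcases hj.lt_or_eq with hj | rfl
      · rw [hx i j h hj, totι_totπ_ne K e₂ h (by omega), comp_zero]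
        rfl
      · obtain rfl : i = k + 1 - j := by omega
        rw [totι_totπ_self, Category.comp_id]
        exact hu
    have hdd : (((tot K).d (k + 1) (k + 1 + 1)).app p).hom
        ((((tot K).d k (k + 1)).app p).hom w) = 0 :=
      congrArg (fun t => (t.app p).hom w) ((tot K).d_comp_d k (k + 1) (k + 1 + 1))
    have hcomm : ((q.hom.f (k + 1)).app p).hom ((((tot K).d k (k + 1)).app p).hom w) =
        ((Y.d k (k + 1)).app p).hom (((q.hom.f k).app p).hom w) :=
      (congrArg (fun t => (t.app p).hom w) (q.hom.comm k (k + 1))).symm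
    obtain ⟨x', hx', hy'⟩ := ih (J + 1) (by push_cast at hJ; omega)
      (x - (((tot K).d k (k + 1)).app p).hom w) (y - ((q.hom.f k).app p).hom w)
      (by rw [map_sub, hdx, hdd, sub_zero])
      (by rw [map_sub, map_sub, hxy, hcomm])
      (fun i j h hj => by rw [map_sub, hdw i j h (by omega), sub_self])
      (fun hk => by
        rw [hfw]
        by_cases hk' : k - J = 0
        · rw [if_pos hk', sub_self]
        · rw [if_neg hk', sub_zero, hy (by omega)])
    exact ⟨x' + w, by rw [map_add, hx', sub_add_cancel], by rw [map_add, hy', sub_add_cancel]⟩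

lemma TotAug.quasiIso_of_rows (hK : ∀ i j, (j < a ∨ b < j) → IsZero ((K.X i).X j))
    (hY : ∀ j, (j < a ∨ b < j) → IsZero (Y.X j))
    (hrow : ∀ (p : D) {i i' j k k' : ℤ} (_ : i + 1 = i') (h : i + j = k) (h' : i' + j = k')
      (x : ((K.X i').X j).obj p) (y : (Y.X k).obj p), (((K.d i' (i' + 1)).f j).app p).hom x = 0 →
      ((q.app h').app p).hom x = 0 → (i ≠ 0 → y = 0) →
      ∃ u : ((K.X i).X j).obj p, (((K.d i i').f j).app p).hom u = x ∧
        ((q.app h).app p).hom u = y) : QuasiIso q.hom := by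
  refine quasiIso_functor _ fun p k x y hx hxy => ?_
  set J := min a k
  obtain ⟨x', h1, h2⟩ := q.exists_of_rows hK (fun j hj => hY j (Or.inr hj)) (hrow p)
    (b + 1 - J).toNat J (by have := Int.self_le_toNat (b + 1 - J); omega) x y hx hxy
    (fun i j h hj => by
      have := (hK i j (Or.inl (by omega))).eq_of_tgt (totπ K h) 0
      exact congrArg (fun t => (t.app p).hom x) this)
    (fun hk => by omega)
  refine ⟨⟨x', h1⟩, fun hx0 => ⟨x', 0, by rw [h1, hx0], ?_⟩⟩
  rw [h2, map_zero, add_zero]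

end Total

end KoszulFan
end

noncomputable section

namespace KoszulFan

section QuasiIsoElements

/-- Elementwise exactness of the cone of a quasi-isomorphism of complexes of vector spaces. -/
lemma exists_of_quasiIso {X Y : CochainComplex (ModuleCat.{0} ℂ) ℤ} (f : X ⟶ Y) [QuasiIso f]
    {k : ℤ} (x : X.X (k + 1)) (y : Y.X k) (hx : (X.d (k + 1) (k + 1 + 1)).hom x = 0)
    (hxy : (f.f (k + 1)).hom x = (Y.d k (k + 1)).hom y) :
    ∃ (x' : X.X k) (y' : Y.X (k - 1)), (X.d k (k + 1)).hom x' = x ∧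
      (f.f k).hom x' = y + (Y.d (k - 1) k).hom y' := by
  have h1 : ∃ x₀ : X.X k, (X.d k (k + 1)).hom x₀ = x := by
    have hm : Mono (HomologicalComplex.homologyMap f (k + 1)) := inferInstance
    rw [HomologicalComplex.mono_homologyMap_iff_up_to_refinements f k (k + 1) (k + 1 + 1)
      (by simp) (by simp)] at hm
    obtain ⟨A', π, _, x₁, h⟩ := hm (A := ModuleCat.of ℂ ℂ)
      (ModuleCat.ofHom (LinearMap.toSpanSingleton ℂ _ x))
      (by
        apply ModuleCat.hom_ext
        apply LinearMap.ext_ring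
        simpa using hx)
      (ModuleCat.ofHom (LinearMap.toSpanSingleton ℂ _ y))
      (by
        apply ModuleCat.hom_ext
        apply LinearMap.ext_ring
        simpa using hxy)
    obtain ⟨a, ha⟩ := (ModuleCat.epi_iff_surjective π).1 inferInstance (1 : ℂ)
    refine ⟨x₁.hom a, ?_⟩
    have h2 := congrArg (fun t => t.hom a) h
    refine h2.symm.trans ?_
    refine (congrArg (LinearMap.toSpanSingleton ℂ _ x) ha).trans ?_
    simp
  obtain ⟨x₀, hx₀⟩ := h1
  have he : Epi (HomologicalComplex.homologyMap f k) := inferInstance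
  rw [HomologicalComplex.epi_homologyMap_iff_up_to_refinements f (k - 1) k (k + 1)
      (by simp) (by simp)] at he
  have hcomm : (Y.d k (k + 1)).hom ((f.f k).hom x₀) = (f.f (k + 1)).hom ((X.d k (k + 1)).hom x₀) :=
    congrArg (fun t => t.hom x₀) (f.comm k (k + 1))
  obtain ⟨A', π, _, x₁, h, y₁, h'⟩ := he (A := ModuleCat.of ℂ ℂ)
    (ModuleCat.ofHom (LinearMap.toSpanSingleton ℂ _ (y - (f.f k).hom x₀)))
    (by
      apply ModuleCat.hom_ext
      apply LinearMap.ext_ring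
      simp [hcomm, hx₀, hxy])
  obtain ⟨a, ha⟩ := (ModuleCat.epi_iff_surjective π).1 inferInstance (1 : ℂ)
  have h2 := congrArg (fun t => t.hom a) h'
  have h3 : (f.f k).hom (x₁.hom a) + (Y.d (k - 1) k).hom (y₁.hom a) = y - (f.f k).hom x₀ := by
    refine h2.symm.trans ?_
    refine (congrArg (LinearMap.toSpanSingleton ℂ _ (y - (f.f k).hom x₀)) ha).trans ?_
    simp
  have h4 : (X.d k (k + 1)).hom (x₁.hom a) = 0 := congrArg (fun t => t.hom a) h
  refine ⟨x₀ + x₁.hom a, -y₁.hom a, by rw [map_add, h4, add_zero, hx₀], ?_⟩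
  rw [map_add, map_neg, ← sub_eq_add_neg, eq_sub_iff_add_eq, add_assoc, h3, add_sub_cancel]

end QuasiIsoElements

section StalkTensor

variable {n : ℕ} {Δ : Fan n} {σ : Δ.Cone}

/-- `⨁_j 𝒦_{σ,τ}^(m-j) ⊗ X^j` for a graded module `X` and `p = (τ, m)`. -/
abbrev StalkTensorSum (X : GrMod σ.semigroup) (p : CosheafIdx Δ) : Type :=
  ⨁ j : Fin n → ℤ, ((kernel σ).obj ⟨p.cone, p.deg - j⟩ ⊗[ℂ] X.obj ⟨j⟩)

/-- The summand of index `j`. -/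
def stalkTensorOf (X : GrMod σ.semigroup) (p : CosheafIdx Δ) (j : Fin n → ℤ) :
    ((kernel σ).obj ⟨p.cone, p.deg - j⟩ ⊗[ℂ] X.obj ⟨j⟩) →ₗ[ℂ] StalkTensorSum X p :=
  DirectSum.lof ℂ (Fin n → ℤ) (fun j => ((kernel σ).obj ⟨p.cone, p.deg - j⟩ ⊗[ℂ] X.obj ⟨j⟩)) j

/-- The relations `(x^a k) ⊗ y = k ⊗ (x^a y)`. -/
def stalkTensorRel (X : GrMod σ.semigroup) (p : CosheafIdx Δ) : Submodule ℂ (StalkTensorSum X p) :=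
  Submodule.span ℂ {z | ∃ (j j' : Fin n → ℤ) (h : j' - j ∈ σ.semigroup)
    (k : (kernel σ).obj ⟨p.cone, p.deg - j'⟩) (y : X.obj ⟨j⟩),
    z = stalkTensorOf X p j (kernelAct σ p.cone (tensor_deg h) k ⊗ₜ y) -
      stalkTensorOf X p j' (k ⊗ₜ (X.map (homOfLE (show (⟨j⟩ : Deg σ.semigroup) ≤ ⟨j'⟩ from h))).hom y)}

/-- A component of the graded tensor product of `𝒦_σ` with a graded module. -/
abbrev StalkTensorObj (X : GrMod σ.semigroup) (p : CosheafIdx Δ) : Type :=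
  StalkTensorSum X p ⧸ stalkTensorRel X p

lemma stalkTensorObj_hom_ext {X : GrMod σ.semigroup} {p : CosheafIdx Δ} {V : Type} [AddCommGroup V]
    [Module ℂ V] {f g : StalkTensorObj X p →ₗ[ℂ] V}
    (h : ∀ j k y, f ((stalkTensorRel X p).mkQ (stalkTensorOf X p j (k ⊗ₜ y))) =
      g ((stalkTensorRel X p).mkQ (stalkTensorOf X p j (k ⊗ₜ y)))) : f = g := by
  apply Submodule.linearMap_qext
  apply DirectSum.linearMap_ext
  intro j
  apply TensorProduct.ext'
  intro k y
  exact h j k y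

/-- The map induced on `⨁_j 𝒦_{σ,τ}^(m-j) ⊗ X^j` by a morphism of graded modules. -/
def stalkTensorSumMap {X X' : GrMod σ.semigroup} (g : X ⟶ X') (p : CosheafIdx Δ) :
    StalkTensorSum X p →ₗ[ℂ] StalkTensorSum X' p :=
  DirectSum.toModule ℂ _ _ fun j => stalkTensorOf X' p j ∘ₗ
    TensorProduct.map LinearMap.id (g.app ⟨j⟩).hom

lemma stalkTensorSumMap_of {X X' : GrMod σ.semigroup} (g : X ⟶ X') (p : CosheafIdx Δ)
    (j : Fin n → ℤ) (k : (kernel σ).obj ⟨p.cone, p.deg - j⟩) (y : X.obj ⟨j⟩) :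
    stalkTensorSumMap g p (stalkTensorOf X p j (k ⊗ₜ y)) =
      stalkTensorOf X' p j (k ⊗ₜ (g.app ⟨j⟩).hom y) := by
  unfold stalkTensorSumMap
  conv_lhs => enter [2]; unfold stalkTensorOf
  rw [DirectSum.toModule_lof]
  simp

lemma stalkTensorRel_le {X X' : GrMod σ.semigroup} (g : X ⟶ X') (p : CosheafIdx Δ) :
    stalkTensorRel X p ≤ (stalkTensorRel X' p).comap (stalkTensorSumMap g p) := by
  refine Submodule.span_le.2 ?_
  rintro _ ⟨j, j', hj, k, y, rfl⟩
  refine Submodule.subset_span ⟨j, j', hj, k, (g.app ⟨j⟩).hom y, ?_⟩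
  rw [map_sub, stalkTensorSumMap_of, stalkTensorSumMap_of]
  congr 3
  exact congrArg (fun t => t.hom y)
    (g.naturality (homOfLE (show (⟨j⟩ : Deg σ.semigroup) ≤ ⟨j'⟩ from hj)))

/-- Functoriality of `StalkTensorObj` in the graded module. -/
def stalkTensorMap {X X' : GrMod σ.semigroup} (g : X ⟶ X') (p : CosheafIdx Δ) :
    StalkTensorObj X p →ₗ[ℂ] StalkTensorObj X' p :=
  Submodule.mapQ _ _ (stalkTensorSumMap g p) (stalkTensorRel_le g p)

lemma stalkTensorMap_of {X X' : GrMod σ.semigroup} (g : X ⟶ X') (p : CosheafIdx Δ)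
    (j : Fin n → ℤ) (k : (kernel σ).obj ⟨p.cone, p.deg - j⟩) (y : X.obj ⟨j⟩) :
    stalkTensorMap g p ((stalkTensorRel X p).mkQ (stalkTensorOf X p j (k ⊗ₜ y))) =
      (stalkTensorRel X' p).mkQ (stalkTensorOf X' p j (k ⊗ₜ (g.app ⟨j⟩).hom y)) := by
  show (stalkTensorRel X' p).mkQ (stalkTensorSumMap g p _) = _
  rw [stalkTensorSumMap_of]

/-- The component of index `p` of `𝒦_σ ⊗ X`, as a functor in the graded module `X`. -/
def stalkTensor (σ : Δ.Cone) (p : CosheafIdx Δ) : GrMod σ.semigroup ⥤ ModuleCat.{0} ℂ where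
  obj X := ModuleCat.of ℂ (StalkTensorObj X p)
  map g := ModuleCat.ofHom (stalkTensorMap g p)
  map_id X := by
    apply ModuleCat.hom_ext
    refine stalkTensorObj_hom_ext fun j k y => ?_
    exact stalkTensorMap_of _ _ _ _ _
  map_comp g g' := by
    apply ModuleCat.hom_ext
    refine stalkTensorObj_hom_ext fun j k y => ?_
    refine (stalkTensorMap_of _ _ _ _ _).trans ?_
    refine Eq.trans ?_ (congrArg (stalkTensorMap g' p) (stalkTensorMap_of g p j k y)).symm
    exact (stalkTensorMap_of g' p j k _).symm

instance (p : CosheafIdx Δ) : (stalkTensor σ p).Additive where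
  map_add {X X' g g'} := by
    apply ModuleCat.hom_ext
    refine stalkTensorObj_hom_ext fun j k y => ?_
    refine (stalkTensorMap_of _ _ _ _ _).trans ?_
    refine Eq.trans ?_ (congrArg₂ (· + ·) (stalkTensorMap_of g p j k y)
      (stalkTensorMap_of g' p j k y)).symm
    rw [← map_add, ← map_add, ← TensorProduct.tmul_add]
    rfl

lemma stalkTensorMap_eq {N N' : Sheaf Δ} (g : N ⟶ N') (p : CosheafIdx Δ) (z : TensorObj σ N p) :
    ((stalkTensor σ p).map ((stalkFunctor σ).map g)).hom z = tensorMap le_rfl g le_rfl z := by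
  let f : TensorObj σ N p →ₗ[ℂ] TensorObj σ N' p := stalkTensorMap ((stalkFunctor σ).map g) p
  suffices h : f = tensorMap le_rfl g le_rfl from congrArg (fun t => t z) h
  refine tensorObj_hom_ext fun j k y => ?_
  refine (stalkTensorMap_of ((stalkFunctor σ).map g) p j k y).trans ?_
  refine Eq.trans ?_ (tensorMap_of le_rfl g le_rfl j k y).symm
  have : sheafBimap (le_refl σ) g j y = (g.app ⟨σ, j⟩).hom y := by
    unfold sheafBimap
    rw [show homOfLE _ = 𝟙 (⟨σ, j⟩ : SheafIdx Δ) from rfl, N'.map_id]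
    rfl
  rw [this]
  rfl

/-- The stalks of the structure sheaf are projective. -/
instance projective_stalk_structureSheaf (σ : Δ.Cone) :
    Projective ((stalkFunctor σ).obj (structureSheaf Δ)) := by
  have hle : ∀ p : Deg σ.semigroup, piece ⊤ (⟨σ, p.deg⟩ : SheafIdx Δ) ≤ lineAt ⟨0⟩ p :=
    fun p c hc h0 => by
      show p.deg - 0 ∈ σ.semigroup
      rw [sub_zero]
      exact (hc h0).2
  have hge : ∀ p : Deg σ.semigroup, lineAt ⟨0⟩ p ≤ piece ⊤ (⟨σ, p.deg⟩ : SheafIdx Δ) :=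
    fun p c hc h0 => by
      have h : p.deg - 0 ∈ σ.semigroup := hc h0
      rw [sub_zero] at h
      exact ⟨trivial, h⟩
  let a : (stalkFunctor σ).obj (structureSheaf Δ) ⟶ line (⟨0⟩ : Deg σ.semigroup) :=
    { app := fun p => ModuleCat.ofHom (Submodule.inclusion (hle p))
      naturality := fun _ _ _ => rfl }
  let b : line (⟨0⟩ : Deg σ.semigroup) ⟶ (stalkFunctor σ).obj (structureSheaf Δ) :=
    { app := fun p => ModuleCat.ofHom (Submodule.inclusion (hge p))
      naturality := fun _ _ _ => rfl }
  refine projective_of_dualBasis (J := Unit) (fun _ => a) (fun _ => b) ?_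
  rw [Fintype.sum_unique]
  rfl

end StalkTensor

section Rows

variable {n : ℕ} {Δ : Fan n}

instance (σ : Δ.Cone) : PreservesFiniteLimits (stalkFunctor σ) := by
  unfold stalkFunctor; infer_instance

instance (σ : Δ.Cone) : PreservesFiniteColimits (stalkFunctor σ) := by
  unfold stalkFunctor; infer_instance

/-- A quasi-isomorphism of bounded above complexes with projective stalks remains one after applying
`𝒦_σ ⊗ -`. -/
lemma quasiIso_stalkTensor {P Q : CochainComplex (Sheaf Δ) ℤ} (f : P ⟶ Q) [QuasiIso f] {d : ℤ}
    (hP : ∀ i, d < i → IsZero (P.X i)) (hQ : ∀ i, d < i → IsZero (Q.X i)) (σ : Δ.Cone)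
    (hP' : ∀ i, Projective ((stalkFunctor σ).obj (P.X i)))
    (hQ' : ∀ i, Projective ((stalkFunctor σ).obj (Q.X i))) (p : CosheafIdx Δ) :
    QuasiIso (((stalkTensor σ p).mapHomologicalComplex (ComplexShape.up ℤ)).map
      (((stalkFunctor σ).mapHomologicalComplex (ComplexShape.up ℤ)).map f)) := by
  set g := ((stalkFunctor σ).mapHomologicalComplex (ComplexShape.up ℤ)).map f
  have hg : QuasiIso g := inferInstance
  have h1 : ∀ {R : CochainComplex (Sheaf Δ) ℤ}, (∀ i, d < i → IsZero (R.X i)) →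
      (∀ i, Projective ((stalkFunctor σ).obj (R.X i))) →
      CochainComplex.IsKProjective
        (((stalkFunctor σ).mapHomologicalComplex (ComplexShape.up ℤ)).obj R) := by
    intro R h h'
    have : CochainComplex.IsStrictlyLE
        (((stalkFunctor σ).mapHomologicalComplex (ComplexShape.up ℤ)).obj R) d := by
      rw [CochainComplex.isStrictlyLE_iff]
      exact fun i hi => (stalkFunctor σ).map_isZero (h i hi)
    have : ∀ i, Projective
        ((((stalkFunctor σ).mapHomologicalComplex (ComplexShape.up ℤ)).obj R).X i) := h'
    exact CochainComplex.isKProjective_of_projective _ d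
  have := h1 hP hP'
  have := h1 hQ hQ'
  rw [CochainComplex.IsKProjective.quasiIso_iff] at hg
  obtain ⟨e, he⟩ := hg
  rw [← he]
  exact ((stalkTensor σ p).mapHomotopyEquiv e).quasiIso_hom

end Rows

end KoszulFan
end

noncomputable section

namespace KoszulFan

section Augmented

variable {n : ℕ} {Δ : Fan n}

/-- The term of degree `0` of a complex concentrated in degree `0`. -/
def singleXIso (A : Sheaf Δ) {i : ℤ} (hi : i = 0) :
    ((CochainComplex.singleFunctor (Sheaf Δ) 0).obj A).X i ≅ A :=
  HomologicalComplex.singleObjXIsoOfEq (ComplexShape.up ℤ) 0 A i hi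

/-- The component of degree `0` of a morphism to a complex concentrated in degree `0`. -/
def augment {P : CochainComplex (Sheaf Δ) ℤ} {A : Sheaf Δ}
    (π : P ⟶ (CochainComplex.singleFunctor (Sheaf Δ) 0).obj A) {i : ℤ} (hi : i = 0) : P.X i ⟶ A :=
  π.f i ≫ (singleXIso A hi).hom

lemma singleFunctor_d (A : Sheaf Δ) (i j : ℤ) :
    ((CochainComplex.singleFunctor (Sheaf Δ) 0).obj A).d i j = 0 := rfl

lemma d_augment {P : CochainComplex (Sheaf Δ) ℤ} {A : Sheaf Δ}
    (π : P ⟶ (CochainComplex.singleFunctor (Sheaf Δ) 0).obj A) {i i' : ℤ} (hi : i' = 0) :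
    P.d i i' ≫ augment π hi = 0 := by
  unfold augment
  rw [← Category.assoc, ← π.comm, singleFunctor_d, comp_zero, zero_comp]

lemma eq_zero_of_isZero {D : Type} [Preorder D] {F : D ⥤ ModuleCat.{0} ℂ} (h : IsZero F) {p : D}
    (x : F.obj p) : x = 0 :=
  congrArg (fun t => (t.app p).hom x) (h.eq_of_src (𝟙 F) 0)

lemma isZero_singleFunctor (A : Sheaf Δ) {i : ℤ} (hi : i ≠ 0) :
    IsZero (((CochainComplex.singleFunctor (Sheaf Δ) 0).obj A).X i) :=
  HomologicalComplex.isZero_single_obj_X _ _ _ _ hi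

lemma exists_map_eq {P : CochainComplex (Sheaf Δ) ℤ} {A : Sheaf Δ}
    (π : P ⟶ (CochainComplex.singleFunctor (Sheaf Δ) 0).obj A) (T : Sheaf Δ ⥤ ModuleCat.{0} ℂ)
    [T.PreservesZeroMorphisms]
    (hq : QuasiIso ((T.mapHomologicalComplex (ComplexShape.up ℤ)).map π)) {i : ℤ}
    (x : T.obj (P.X (i + 1))) (y : T.obj A)
    (hx : (T.map (P.d (i + 1) (i + 1 + 1))).hom x = 0)
    (hx' : ∀ h : i + 1 = 0, (T.map (augment π h)).hom x = 0) :
    ∃ u : T.obj (P.X i), (T.map (P.d i (i + 1))).hom u = x ∧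
      ∀ h : i = 0, (T.map (augment π h)).hom u = y := by
  have hd : ∀ i j, T.map (((CochainComplex.singleFunctor (Sheaf Δ) 0).obj A).d i j) = 0 :=
    fun i j => by rw [singleFunctor_d, T.map_zero]
  have hzero : (T.map (π.f (i + 1))).hom x = 0 := by
    by_cases h : i + 1 = 0
    · have h1 : T.map (π.f (i + 1)) = T.map (augment π h) ≫ T.map (singleXIso A h).inv := by
        rw [← T.map_comp]
        unfold augment
        rw [Category.assoc, Iso.hom_inv_id, Category.comp_id]
      rw [h1, ModuleCat.hom_comp, LinearMap.comp_apply, hx' h, map_zero]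
    · have h1 := (isZero_singleFunctor A h).eq_of_tgt (π.f (i + 1)) 0
      rw [h1, T.map_zero, ModuleCat.hom_zero, LinearMap.zero_apply]
  obtain ⟨y', hy'⟩ : ∃ y' : T.obj (((CochainComplex.singleFunctor (Sheaf Δ) 0).obj A).X i),
      ∀ h : i = 0, (T.map (singleXIso A h).hom).hom y' = y := by
    by_cases h : i = 0
    · refine ⟨(T.map (singleXIso A h).inv).hom y, fun _ => ?_⟩
      rw [← LinearMap.comp_apply, ← ModuleCat.hom_comp, ← T.map_comp, Iso.inv_hom_id, T.map_id]
      rfl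
    · exact ⟨0, fun h' => absurd h' h⟩
  obtain ⟨u, v, hu, hv⟩ := exists_of_quasiIso
    ((T.mapHomologicalComplex (ComplexShape.up ℤ)).map π) (k := i) x y' hx
    (hzero.trans (congrArg (fun t => t.hom y') (hd i (i + 1))).symm)
  refine ⟨u, hu, fun h => ?_⟩
  have hv' : (T.map (π.f i)).hom u = y' := by
    refine hv.trans ?_
    refine (congrArg (y' + ·) (congrArg (fun t => t.hom v) (hd (i - 1) i))).trans (add_zero _)
  unfold augment
  rw [T.map_comp]
  exact (congrArg (T.map (singleXIso A h).hom).hom hv').trans (hy' h)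

/-- The functor `N ↦ 𝒦_σ ⊗ N_σ`, in a fixed component. -/
abbrev sheafTensor (σ : Δ.Cone) (p : CosheafIdx Δ) : Sheaf Δ ⥤ ModuleCat.{0} ℂ :=
  stalkFunctor σ ⋙ stalkTensor σ p

lemma quasiIso_sheafTensor {P : CochainComplex (Sheaf Δ) ℤ}
    (π : P ⟶ (CochainComplex.singleFunctor (Sheaf Δ) 0).obj (structureSheaf Δ)) [QuasiIso π] {d : ℤ}
    (hP : ∀ i, d < i → IsZero (P.X i)) (σ : Δ.Cone)
    (hP' : ∀ i, Projective ((stalkFunctor σ).obj (P.X i))) (p : CosheafIdx Δ) :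
    QuasiIso (((sheafTensor σ p).mapHomologicalComplex (ComplexShape.up ℤ)).map π) := by
  refine quasiIso_stalkTensor π (d := max d 0) (fun i hi => hP i (by omega))
    (fun i hi => isZero_singleFunctor _ (by omega)) σ hP' (fun i => ?_) p
  by_cases hi : i = 0
  · exact Projective.of_iso ((stalkFunctor σ).mapIso (singleXIso (structureSheaf Δ) hi)).symm
      inferInstance
  · have := ((stalkFunctor σ).map_isZero (isZero_singleFunctor (structureSheaf Δ) hi))
    exact Projective.of_iso this.isoZero.symm inferInstance

lemma exists_tensorMap_eq {P : CochainComplex (Sheaf Δ) ℤ}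
    (π : P ⟶ (CochainComplex.singleFunctor (Sheaf Δ) 0).obj (structureSheaf Δ)) [QuasiIso π] {d : ℤ}
    (hP : ∀ i, d < i → IsZero (P.X i)) (σ : Δ.Cone)
    (hP' : ∀ i, Projective ((stalkFunctor σ).obj (P.X i))) (p : CosheafIdx Δ) {i : ℤ}
    (x : TensorObj σ (P.X (i + 1)) p) (y : TensorObj σ (structureSheaf Δ) p)
    (hx : tensorMap le_rfl (P.d (i + 1) (i + 1 + 1)) le_rfl x = 0)
    (hx' : ∀ h : i + 1 = 0, tensorMap (le_refl σ) (augment π h) (le_refl p) x = 0) :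
    ∃ u : TensorObj σ (P.X i) p, tensorMap le_rfl (P.d i (i + 1)) le_rfl u = x ∧
      ∀ h : i = 0, tensorMap (le_refl σ) (augment π h) (le_refl p) u = y := by
  obtain ⟨u, hu, hu'⟩ := exists_map_eq π (sheafTensor σ p)
    (quasiIso_sheafTensor π hP σ hP' p) (i := i) x y
    ((stalkTensorMap_eq (P.d (i + 1) (i + 1 + 1)) p x).trans hx)
    (fun h => (stalkTensorMap_eq (augment π h) p x).trans (hx' h))
  exact ⟨u, (stalkTensorMap_eq (P.d i (i + 1)) p u).symm.trans hu,
    fun h => (stalkTensorMap_eq (augment π h) p u).symm.trans (hu' h)⟩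

variable (hs : Δ.IsSmooth) (o : Δ.Orientations)

/-- The double complex `C^•(𝒦 ⊗ P^•)`. -/
abbrev koszulBicomplex (P : CochainComplex (Sheaf Δ) ℤ) : FunctorBicomplex (CosheafIdx Δ) :=
  ((koszulFunctor hs o).mapHomologicalComplex (ComplexShape.up ℤ)).obj P

lemma isZero_koszulFunctor (N : Sheaf Δ) {j : ℤ} (hj : j < -n ∨ 0 < j) :
    IsZero (((koszulFunctor hs o).obj N).X j) := by
  rw [IsZero.iff_id_eq_zero]
  refine NatTrans.ext (funext fun p => ModuleCat.hom_ext (LinearMap.ext fun x => ?_))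
  refine biproduct_ext (F := fun σ : Δ.ConesOfDim j => tensorCosheaf σ.1 N) (p := p) fun σ => ?_
  have := σ.1.dim_le
  have := σ.2
  omega

/-- The components of the augmentation of the double complex. -/
def koszulAugApp {P : CochainComplex (Sheaf Δ) ℤ}
    (π : P ⟶ (CochainComplex.singleFunctor (Sheaf Δ) 0).obj (structureSheaf Δ)) {i j k : ℤ}
    (h : i + j = k) :
    ((koszulFunctor hs o).obj (P.X i)).X j ⟶ ((koszulFunctor hs o).obj (structureSheaf Δ)).X k :=
  if hi : i = 0 then ((koszulFunctor hs o).map (augment π hi)).f j ≫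
    (((koszulFunctor hs o).obj (structureSheaf Δ)).XIsoOfEq (show j = k by omega)).hom else 0

lemma koszulAugApp_eq {P : CochainComplex (Sheaf Δ) ℤ}
    (π : P ⟶ (CochainComplex.singleFunctor (Sheaf Δ) 0).obj (structureSheaf Δ)) {i j : ℤ}
    (h : i + j = j) (hi : i = 0) :
    koszulAugApp hs o π h = ((koszulFunctor hs o).map (augment π hi)).f j := by
  refine (dif_pos hi).trans ?_
  rw [HomologicalComplex.XIsoOfEq_rfl, Iso.refl_hom, Category.comp_id]

lemma koszulAugApp_eq_zero {P : CochainComplex (Sheaf Δ) ℤ}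
    (π : P ⟶ (CochainComplex.singleFunctor (Sheaf Δ) 0).obj (structureSheaf Δ)) {i j k : ℤ}
    (h : i + j = k) (hi : i ≠ 0) : koszulAugApp hs o π h = 0 := dif_neg hi

lemma koszulAugApp_comm₁ {P : CochainComplex (Sheaf Δ) ℤ}
    (π : P ⟶ (CochainComplex.singleFunctor (Sheaf Δ) 0).obj (structureSheaf Δ)) {i i' j k : ℤ}
    (h : i' + j = k) :
    ((koszulFunctor hs o).map (P.d i i')).f j ≫ koszulAugApp hs o π h = 0 := by
  by_cases hi : i' = 0
  · obtain rfl : j = k := by omega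
    rw [koszulAugApp_eq hs o π h hi]
    have h2 := congrArg (fun t => ((koszulFunctor hs o).map t).f j) (d_augment π hi (i := i))
    rw [Functor.map_comp, Functor.map_zero] at h2
    exact h2
  · rw [koszulAugApp_eq_zero hs o π h hi, comp_zero]

lemma koszulAugApp_comm₂ {P : CochainComplex (Sheaf Δ) ℤ}
    (π : P ⟶ (CochainComplex.singleFunctor (Sheaf Δ) 0).obj (structureSheaf Δ)) {i j j' k k' : ℤ}
    (h : i + j = k) (h' : i + j' = k') :
    ((koszulFunctor hs o).obj (P.X i)).d j j' ≫ koszulAugApp hs o π h' =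
      koszulAugApp hs o π h ≫ ((koszulFunctor hs o).obj (structureSheaf Δ)).d k k' := by
  by_cases hi : i = 0
  · obtain rfl : j = k := by omega
    obtain rfl : j' = k' := by omega
    rw [koszulAugApp_eq hs o π h hi, koszulAugApp_eq hs o π h' hi]
    exact (((koszulFunctor hs o).map (augment π hi)).comm j j').symm
  · rw [koszulAugApp_eq_zero hs o π h hi, koszulAugApp_eq_zero hs o π h' hi, comp_zero, zero_comp]

/-- The augmentation of the double complex. -/
def koszulAug {P : CochainComplex (Sheaf Δ) ℤ}
    (π : P ⟶ (CochainComplex.singleFunctor (Sheaf Δ) 0).obj (structureSheaf Δ)) :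
    TotAug (koszulBicomplex hs o P) ((koszulFunctor hs o).obj (structureSheaf Δ)) where
  app h := koszulAugApp hs o π h
  eq_zero h hi := koszulAugApp_eq_zero hs o π h hi
  comm₁ _ h := koszulAugApp_comm₁ hs o π h
  comm₂ _ h h' := koszulAugApp_comm₂ hs o π h h'

lemma koszulAug_app {P : CochainComplex (Sheaf Δ) ℤ}
    (π : P ⟶ (CochainComplex.singleFunctor (Sheaf Δ) 0).obj (structureSheaf Δ)) {i j : ℤ}
    (h : i + j = j) (hi : i = 0) :
    (koszulAug hs o π).app h = ((koszulFunctor hs o).map (augment π hi)).f j :=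
  koszulAugApp_eq hs o π h hi

lemma coord_koszulFunctor_map {N N' : Sheaf Δ} (g : N ⟶ N') {j : ℤ} {p : CosheafIdx Δ}
    (x : (((koszulFunctor hs o).obj N).X j).obj p) (σ : Δ.ConesOfDim j) :
    coord (fun σ : Δ.ConesOfDim j => tensorCosheaf σ.1 N') p σ
      ((((koszulFunctor hs o).map g).f j).app p |>.hom x) =
      tensorMap (le_refl σ.1) g (le_refl p)
        (coord (fun σ : Δ.ConesOfDim j => tensorCosheaf σ.1 N) p σ x) :=
  coord_map (F := fun σ : Δ.ConesOfDim j => tensorCosheaf σ.1 N)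
    (G := fun σ : Δ.ConesOfDim j => tensorCosheaf σ.1 N')
    (fun σ => tensorCosheafMap (le_refl σ.1) g) x σ

/-- The augmentation is a quasi-isomorphism. -/
lemma quasiIso_koszulAug {P : CochainComplex (Sheaf Δ) ℤ}
    (π : P ⟶ (CochainComplex.singleFunctor (Sheaf Δ) 0).obj (structureSheaf Δ)) [QuasiIso π] {d : ℤ}
    (hP : ∀ i, d < i → IsZero (P.X i))
    (hP' : ∀ i σ, Projective ((stalkFunctor σ).obj (P.X i))) : QuasiIso (koszulAug hs o π).hom := by
  refine TotAug.quasiIso_of_rows (a := -n) (b := 0) _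
    (fun i j hj => isZero_koszulFunctor hs o (P.X i) hj)
    (fun j hj => isZero_koszulFunctor hs o (structureSheaf Δ) hj) ?_
  intro p i i' j k k' hi h h' x y hx hqx hy
  subst hi
  by_cases hi0 : i = 0
  · have hi1 : i + 1 ≠ 0 := by omega
    obtain rfl : j = k := by omega
    choose u hu hu' using fun σ : Δ.ConesOfDim j => exists_tensorMap_eq π hP σ.1
      (fun i => hP' i σ.1) p (coord (fun σ : Δ.ConesOfDim j => tensorCosheaf σ.1 (P.X (i + 1))) p σ x)
      (coord (fun σ : Δ.ConesOfDim j => tensorCosheaf σ.1 (structureSheaf Δ)) p σ y)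
      ((coord_koszulFunctor_map hs o (P.d (i + 1) (i + 1 + 1)) x σ).symm.trans
        ((congrArg (coord _ p σ) hx).trans (map_zero _))) (fun h => absurd h hi1)
    obtain ⟨w, hw⟩ := exists_coord (F := fun σ : Δ.ConesOfDim j => tensorCosheaf σ.1 (P.X i))
      (p := p) u
    refine ⟨w, ?_, ?_⟩
    · refine biproduct_ext (F := fun σ : Δ.ConesOfDim j => tensorCosheaf σ.1 (P.X (i + 1)))
        (p := p) fun σ => ?_
      refine (coord_koszulFunctor_map hs o (P.d i (i + 1)) w σ).trans ?_
      rw [hw]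
      exact hu σ
    · rw [koszulAug_app hs o π h hi0]
      refine biproduct_ext (F := fun σ : Δ.ConesOfDim j => tensorCosheaf σ.1 (structureSheaf Δ))
        (p := p) fun σ => ?_
      refine (coord_koszulFunctor_map hs o (augment π hi0) w σ).trans ?_
      rw [hw]
      exact hu' σ hi0
  · have hx' : ∀ (h : i + 1 = 0) (σ : Δ.ConesOfDim j), tensorMap (le_refl σ.1) (augment π h)
        (le_refl p) (coord (fun σ : Δ.ConesOfDim j => tensorCosheaf σ.1 (P.X (i + 1))) p σ x) = 0 := by
      intro hi1 σ
      obtain rfl : j = k' := by omega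
      rw [koszulAug_app hs o π h' hi1] at hqx
      exact (coord_koszulFunctor_map hs o (augment π hi1) x σ).symm.trans
        ((congrArg (coord _ p σ) hqx).trans (map_zero _))
    choose u hu hu' using fun σ : Δ.ConesOfDim j => exists_tensorMap_eq π hP σ.1
      (fun i => hP' i σ.1) p (coord (fun σ : Δ.ConesOfDim j => tensorCosheaf σ.1 (P.X (i + 1))) p σ x)
      0 ((coord_koszulFunctor_map hs o (P.d (i + 1) (i + 1 + 1)) x σ).symm.trans
        ((congrArg (coord _ p σ) hx).trans (map_zero _))) (fun h => hx' h σ)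
    obtain ⟨w, hw⟩ := exists_coord (F := fun σ : Δ.ConesOfDim j => tensorCosheaf σ.1 (P.X i))
      (p := p) u
    refine ⟨w, ?_, ?_⟩
    · refine biproduct_ext (F := fun σ : Δ.ConesOfDim j => tensorCosheaf σ.1 (P.X (i + 1)))
        (p := p) fun σ => ?_
      refine (coord_koszulFunctor_map hs o (P.d i (i + 1)) w σ).trans ?_
      rw [hw]
      exact hu σ
    · rw [hy hi0]
      exact congrArg (fun t => (t.app p).hom w) ((koszulAug hs o π).eq_zero h hi0)

end Augmented

end KoszulFan
end

noncomputable section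

namespace KoszulFan

section DualComparison

variable {n : ℕ} {Δ : Fan n}

lemma isFreeStalk_structureSheaf (σ : Δ.Cone) :
    IsFreeStalk (structureSheaf Δ) σ 0 (fun _ => pieceVal (U := ⊤)) where
  inj _ := pieceVal_injective
  map _ _ _ _ := rfl
  deg j y h := by
    rw [sub_zero]
    exact ((show piece ⊤ (⟨σ, j⟩ : SheafIdx Δ) from y).2 h).2
  exists_gen := ⟨(⟨1, fun _ => ⟨trivial, zero_mem _⟩⟩ : piece ⊤ (⟨σ, 0⟩ : SheafIdx Δ)), rfl⟩

/-- The coordinate on a component of `𝒦_σ ⊗ 𝒜_σ`. -/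
abbrev kosVal (σ : Δ.Cone) (p : CosheafIdx Δ) : TensorObj σ (structureSheaf Δ) p →ₗ[ℂ] ℂ :=
  tensorVal (isFreeStalk_structureSheaf σ) p

lemma tensorSupp_zero_iff {σ : Δ.Cone} {p : CosheafIdx Δ} :
    TensorSupp σ 0 p ↔ p.cone ≤ σ ∧ -p.deg ∈ p.cone.semigroup := by
  unfold TensorSupp
  rw [zero_sub]

open Classical in
lemma exists_kosVal_indicator (σ : Δ.Cone) (p : CosheafIdx Δ) :
    ∃ z, kosVal σ p z = if TensorSupp σ 0 p then 1 else 0 :=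
  exists_tensorVal_eq _ fun h => by
    by_contra h0
    exact h (if_neg h0)

/-- The components of the map `𝒜^∨ → 𝒦_σ ⊗ 𝒜_σ`. -/
def dualToTensorApp (σ : Δ.Cone) (p : CosheafIdx Δ) :
    (dual (structureSheaf Δ)).obj p →ₗ[ℂ] TensorObj σ (structureSheaf Δ) p :=
  (LinearMap.toSpanSingleton ℂ _ (exists_kosVal_indicator σ p).choose) ∘ₗ dualVal ⊤ p

lemma kosVal_dualToTensorApp {σ : Δ.Cone} {p : CosheafIdx Δ} (h : TensorSupp σ 0 p)
    (φ : (dual (structureSheaf Δ)).obj p) :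
    kosVal σ p (dualToTensorApp σ p φ) = dualVal ⊤ p φ := by
  have h1 := (exists_kosVal_indicator σ p).choose_spec.trans (if_pos h)
  refine (map_smul (kosVal σ p) _ _).trans ?_
  exact (congrArg (dualVal ⊤ p φ • ·) h1).trans (mul_one _)

/-- The map `𝒜^∨ → 𝒦_σ ⊗ 𝒜_σ`. -/
def dualToTensor (σ : Δ.Cone) : dual (structureSheaf Δ) ⟶ tensorCosheaf σ (structureSheaf Δ) where
  app p := ModuleCat.ofHom (dualToTensorApp σ p)
  naturality p q f := by
    refine ModuleCat.hom_ext (LinearMap.ext fun φ => ?_)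
    refine tensorVal_injective (isFreeStalk_structureSheaf σ) q ?_
    show kosVal σ q (dualToTensorApp σ q (((dual (structureSheaf Δ)).map f).hom φ)) =
      kosVal σ q (tensorMap le_rfl (𝟙 _) (leOfHom f) (dualToTensorApp σ p φ))
    by_cases hq : TensorSupp σ 0 q
    · have hp := hq.anti le_rfl (leOfHom f)
      rw [kosVal_dualToTensorApp hq]
      refine Eq.trans ?_ (tensorVal_tensorMap (isFreeStalk_structureSheaf σ)
        (isFreeStalk_structureSheaf σ) le_rfl (𝟙 _) (fun _ _ => rfl) (leOfHom f) hq _).symm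
      refine Eq.trans ?_ (kosVal_dualToTensorApp hp φ).symm
      exact dualVal_dual_map (U := ⊤) (leOfHom f) ⟨trivial, (tensorSupp_zero_iff.1 hq).2⟩ φ
    · exact (tensorVal_eq_zero _ hq _).trans (tensorVal_eq_zero _ hq _).symm

/-- The chain of coefficients of an element of `⨁_σ 𝒦_σ ⊗ 𝒜_σ`. -/
def kosChain {i : ℤ} {p : CosheafIdx Δ}
    (x : (⨁ fun σ : Δ.ConesOfDim i => tensorCosheaf σ.1 (structureSheaf Δ)).obj p) :
    WithTop Δ.Cone → ℂ :=
  extendCones fun σ : Δ.ConesOfDim i => kosVal σ.1 p (coord _ p σ x)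

variable {i : ℤ} {p : CosheafIdx Δ}

lemma kosChain_coe (x : (⨁ fun σ : Δ.ConesOfDim i => tensorCosheaf σ.1 (structureSheaf Δ)).obj p)
    (σ : Δ.ConesOfDim i) : kosChain x (σ.1 : WithTop Δ.Cone) = kosVal σ.1 p (coord _ p σ x) :=
  extendCones_coe _ _

lemma kosChain_ne_zero {x : (⨁ fun σ : Δ.ConesOfDim i => tensorCosheaf σ.1 (structureSheaf Δ)).obj p}
    {z : WithTop Δ.Cone} (h : kosChain x z ≠ 0) :
    p.cone ≤ z ∧ coneDeg z = -i ∧ -p.deg ∈ p.cone.semigroup := by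
  obtain ⟨σ, rfl, hσ⟩ := exists_of_extendCones_ne_zero _ h
  have h1 : TensorSupp σ.1 0 p := by
    by_contra h0
    exact hσ (tensorVal_eq_zero _ h0 _)
  have h2 := tensorSupp_zero_iff.1 h1
  exact ⟨WithTop.coe_le_coe.2 h2.1, σ.2, h2.2⟩

lemma kosChain_injective
    {x y : (⨁ fun σ : Δ.ConesOfDim i => tensorCosheaf σ.1 (structureSheaf Δ)).obj p}
    (h : ∀ z : WithTop Δ.Cone, p.cone ≤ z → kosChain x z = kosChain y z) : x = y := by
  refine biproduct_ext fun σ => tensorVal_injective (isFreeStalk_structureSheaf σ.1) p ?_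
  by_cases hσ : TensorSupp σ.1 0 p
  · exact ((kosChain_coe x σ).symm.trans (h σ.1 (WithTop.coe_le_coe.2 hσ.1))).trans (kosChain_coe y σ)
  · exact (tensorVal_eq_zero _ hσ _).trans (tensorVal_eq_zero _ hσ _).symm

lemma kosChain_zero (z : WithTop Δ.Cone) :
    kosChain (0 : (⨁ fun σ : Δ.ConesOfDim i => tensorCosheaf σ.1 (structureSheaf Δ)).obj p) z = 0 := by
  by_contra h
  obtain ⟨σ, -, hσ⟩ := exists_of_extendCones_ne_zero _ h
  exact hσ ((congrArg (kosVal σ.1 p) (map_zero _)).trans (map_zero _))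

lemma exists_kosChain (hp : -p.deg ∈ p.cone.semigroup) {f : WithTop Δ.Cone → ℂ}
    (hf : ∀ z, f z ≠ 0 → p.cone ≤ z ∧ coneDeg z = -i) (htop : f ⊤ = 0) :
    ∃ x : (⨁ fun σ : Δ.ConesOfDim i => tensorCosheaf σ.1 (structureSheaf Δ)).obj p,
      kosChain x = f := by
  have : ∀ σ : Δ.ConesOfDim i, ∃ y : TensorObj σ.1 (structureSheaf Δ) p, kosVal σ.1 p y = f σ.1 :=
    fun σ => exists_tensorVal_eq _ fun h =>
      tensorSupp_zero_iff.2 ⟨WithTop.coe_le_coe.1 (hf _ h).1, hp⟩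
  choose y hy using this
  obtain ⟨x, hx⟩ := exists_coord (F := fun σ : Δ.ConesOfDim i => tensorCosheaf σ.1 (structureSheaf Δ))
    (p := p) y
  refine ⟨x, funext fun z => ?_⟩
  induction z with
  | top => exact htop.symm
  | coe σ =>
    by_cases hσ : (σ.dim : ℤ) = -i
    · have h1 : coord (fun σ : Δ.ConesOfDim i => tensorCosheaf σ.1 (structureSheaf Δ)) p ⟨σ, hσ⟩ x =
          y ⟨σ, hσ⟩ := hx ⟨σ, hσ⟩
      exact (kosChain_coe x ⟨σ, hσ⟩).trans ((congrArg (kosVal σ p) h1).trans (hy ⟨σ, hσ⟩))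
    · have h1 : f σ = 0 := by
        by_contra h0
        exact hσ (hf _ h0).2
      rw [h1]
      exact dif_neg hσ

lemma kosVal_cellularEntry (o : Δ.Orientations) {σ τ : Δ.Cone} (hdim : σ.dim = τ.dim + 1)
    (hp : TensorSupp τ 0 p) (x : TensorObj σ (structureSheaf Δ) p) :
    kosVal τ p (((cellularEntry o (tensorDiagram.obj (structureSheaf Δ)) σ τ).app p).hom x) =
      kosVal σ p x * bdry o σ τ := by
  classical
  unfold cellularEntry
  rw [bdry_coe_coe]
  by_cases h : τ ≤ σ
  · rw [dif_pos h, if_pos ⟨h, hdim⟩]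
    refine (map_zsmul (kosVal τ p) _ (tensorMap h (𝟙 _) le_rfl x)).trans ?_
    rw [tensorVal_tensorMap (isFreeStalk_structureSheaf σ) (isFreeStalk_structureSheaf τ) h (𝟙 _)
      (fun _ _ => rfl) le_rfl hp, zsmul_eq_mul, mul_comm]
  · rw [dif_neg h, if_neg (fun h' => h h'.1), mul_zero]
    exact map_zero (kosVal τ p)

variable (hs : Δ.IsSmooth) (o : Δ.Orientations)

/-- The complex `C^•(𝒦 ⊗ 𝒜)`. -/
abbrev kosComplex : CochainComplex (Cosheaf Δ) ℤ := (koszulFunctor hs o).obj (structureSheaf Δ)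

lemma kosChain_d {i' : ℤ} (hi : i + 1 = i') (hp : -p.deg ∈ p.cone.semigroup)
    (x : (⨁ fun σ : Δ.ConesOfDim i => tensorCosheaf σ.1 (structureSheaf Δ)).obj p)
    (z : WithTop Δ.Cone) (hz : p.cone ≤ z) (hz' : z ≠ ⊤) :
    kosChain (i := i') ((((kosComplex hs o).d i i').app p).hom x) z =
      ∑ w, kosChain x w * bdry o w z := by
  classical
  induction z with
  | top => exact absurd rfl hz'
  | coe τ =>
    by_cases hτ : (τ.dim : ℤ) = -i'
    · refine (kosChain_coe _ ⟨τ, hτ⟩).trans ?_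
      have h1 : (kosComplex hs o).d i i' = biproduct.matrix (fun (σ : Δ.ConesOfDim i)
          (τ : Δ.ConesOfDim i') => cellularEntry o (tensorDiagram.obj (structureSheaf Δ)) σ.1 τ.1) :=
        if_pos hi
      rw [h1]
      refine (congrArg (kosVal τ p) (coord_matrix _ x (⟨τ, hτ⟩ : Δ.ConesOfDim i'))).trans ?_
      unfold kosChain
      rw [sum_extendCones]
      refine (map_sum (kosVal τ p) _ _).trans (Finset.sum_congr rfl fun σ _ => ?_)
      have := σ.2
      exact kosVal_cellularEntry o (by omega)
        (tensorSupp_zero_iff.2 ⟨WithTop.coe_le_coe.1 hz, hp⟩) _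
    · refine Eq.trans (dif_neg hτ) (Finset.sum_eq_zero fun w _ => ?_).symm
      by_contra h0
      have h1 := coneDeg_of_bdry_ne_zero o (right_ne_zero_of_mul h0)
      rw [(kosChain_ne_zero (left_ne_zero_of_mul h0)).2.1, coneDeg_coe] at h1
      omega

/-- The map from `𝒜^∨` to the terms of `C^•(𝒦 ⊗ 𝒜)`. -/
def dualToKos (i : ℤ) : dual (structureSheaf Δ) ⟶ (kosComplex hs o).X i :=
  biproduct.lift fun σ : Δ.ConesOfDim i => bdry o ⊤ σ.1 • dualToTensor σ.1

lemma kosChain_dualToKos (i : ℤ) (hp : -p.deg ∈ p.cone.semigroup)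
    (φ : (dual (structureSheaf Δ)).obj p) (z : WithTop Δ.Cone) (hz : p.cone ≤ z)
    (hzi : coneDeg z = -i) (hz' : z ≠ ⊤) :
    kosChain (i := i) (((dualToKos hs o i).app p).hom φ) z = dualVal ⊤ p φ * bdry o ⊤ z := by
  induction z with
  | top => exact absurd rfl hz'
  | coe τ =>
    refine (kosChain_coe _ ⟨τ, hzi⟩).trans ?_
    refine (congrArg (kosVal τ p) (coord_lift _ φ _)).trans ?_
    refine (map_smul (kosVal τ p) (bdry o ⊤ τ) (dualToTensorApp τ p φ)).trans ?_
    rw [kosVal_dualToTensorApp (tensorSupp_zero_iff.2 ⟨WithTop.coe_le_coe.1 hz, hp⟩), smul_eq_mul,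
      mul_comm]

lemma kos_eq_zero (hp : ¬ -p.deg ∈ p.cone.semigroup)
    (x : (⨁ fun σ : Δ.ConesOfDim i => tensorCosheaf σ.1 (structureSheaf Δ)).obj p) : x = 0 := by
  refine kosChain_injective fun z _ => ?_
  by_contra h0
  rw [kosChain_zero] at h0
  exact hp (kosChain_ne_zero h0).2.2

lemma dualToKos_d (hc : Δ.IsComplete) {i i' : ℤ} (hi : i + 1 = i') (hi' : i = -n) :
    dualToKos hs o i ≫ (kosComplex hs o).d i i' = 0 := by
  refine NatTrans.ext (funext fun p => ModuleCat.hom_ext (LinearMap.ext fun φ => ?_))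
  by_cases hp : -p.deg ∈ p.cone.semigroup
  · refine kosChain_injective (i := i') fun z hz => Eq.trans ?_ (kosChain_zero z).symm
    by_cases hz' : z = ⊤
    · subst hz'; rfl
    refine (kosChain_d hs o hi hp (((dualToKos hs o i).app p).hom φ) z hz hz').trans ?_
    have h1 : ∀ w, kosChain (i := i) (((dualToKos hs o i).app p).hom φ) w * bdry o w z =
        dualVal ⊤ p φ * (bdry o ⊤ w * bdry o w z) := by
      intro w
      by_cases h0 : bdry o w z = 0
      · rw [h0, mul_zero, mul_zero, mul_zero]
      by_cases hw : w = ⊤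
      · subst hw
        rw [bdry_top, zero_mul, mul_zero]
        exact zero_mul _
      have hzw : z ≤ w := (bdry_lt o h0).le
      by_cases hwi : coneDeg w = -i
      · rw [kosChain_dualToKos hs o i hp φ w (hz.trans hzw) hwi hw, mul_assoc]
      · have h2 : bdry o ⊤ w = 0 := by
          by_contra h3
          have := coneDeg_of_bdry_ne_zero o h3
          rw [coneDeg_top] at this
          omega
        have h3 : kosChain (i := i) (((dualToKos hs o i).app p).hom φ) w = 0 := by
          by_contra h3
          exact hwi (kosChain_ne_zero h3).2.1
        rw [h2, h3, zero_mul]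
        exact (mul_zero _).symm
    rw [Finset.sum_congr rfl fun w _ => h1 w, ← Finset.mul_sum, bdry_bdry hs hc, mul_zero]
  · exact kos_eq_zero (i := i') hp _

/-- The cochains are exact in degrees above `-n`, and the cocycles of degree `-n` come from `𝒜^∨`. -/
lemma exists_kos_eq (hc : Δ.IsComplete) {k : ℤ}
    (y : ((kosComplex hs o).X k).obj p) (hy : (((kosComplex hs o).d k (k + 1)).app p).hom y = 0) :
    (k = -n → ∃ φ, ((dualToKos hs o k).app p).hom φ = y) ∧
      (k ≠ -n → ∃ y', (((kosComplex hs o).d (k - 1) k).app p).hom y' = y) := by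
  by_cases hp : -p.deg ∈ p.cone.semigroup
  · obtain ⟨g, hg, hg'⟩ := exists_boundary hs hc o p.cone (-k) (f := kosChain (i := k) y)
      (fun x hx => ⟨(kosChain_ne_zero hx).1, (kosChain_ne_zero hx).2.1⟩) (fun z hz => by
        by_cases hz' : z = ⊤
        · subst hz'
          exact Finset.sum_eq_zero fun w _ => by rw [bdry_top, mul_zero]
        · refine (kosChain_d hs o rfl hp y z hz hz').symm.trans ?_
          rw [hy]
          exact kosChain_zero (i := k + 1) z)
    refine ⟨fun hk' => ?_, fun hk' => ?_⟩
    · obtain ⟨φ, hφ⟩ := exists_dualVal_eq (U := ⊤) (p := p) (c := g ⊤) fun _ => ⟨trivial, hp⟩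
      refine ⟨φ, kosChain_injective (i := k) fun z hz => ?_⟩
      by_cases hz' : z = ⊤
      · subst hz'; rfl
      by_cases hzk : coneDeg z = -k
      · rw [kosChain_dualToKos hs o k hp φ z hz hzk hz', hφ, ← hg' z hz,
          Finset.sum_eq_single ⊤]
        · intro w _ hw
          have : g w = 0 := by
            by_contra h0
            have h1 := (hg w h0).2
            induction w with
            | top => exact hw rfl
            | coe σ =>
              rw [coneDeg_coe] at h1
              have := σ.dim_le
              omega
          rw [this, zero_mul]
        · simp
      · have h1 : ∀ x : ((kosComplex hs o).X k).obj p, kosChain (i := k) x z = 0 := fun x => by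
          by_contra h0
          exact hzk (kosChain_ne_zero h0).2.1
        exact (h1 _).trans (h1 _).symm
    · have htop : g ⊤ = 0 := by
        by_contra h0
        have := (hg ⊤ h0).2
        rw [coneDeg_top] at this
        omega
      obtain ⟨y', hy'⟩ := exists_kosChain (i := k - 1) hp (f := g)
        (fun z hz => ⟨(hg z hz).1, by rw [(hg z hz).2]; ring⟩) htop
      refine ⟨y', kosChain_injective (i := k) fun z hz => ?_⟩
      by_cases hz' : z = ⊤
      · subst hz'; rfl
      rw [← hg' z hz, ← hy']
      exact kosChain_d hs o (by omega) hp y' z hz hz'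
  · have h : y = 0 := kos_eq_zero (i := k) hp y
    exact ⟨fun _ => ⟨0, by rw [map_zero, h]⟩, fun _ => ⟨0, by rw [map_zero, h]⟩⟩

lemma dualToKos_injective (hc : Δ.IsComplete) {k : ℤ} (hk : k = -n)
    (φ : (dual (structureSheaf Δ)).obj p) (h : ((dualToKos hs o k).app p).hom φ = 0) : φ = 0 := by
  classical
  refine dualVal_injective ⊤ p (Eq.trans ?_ (map_zero _).symm)
  by_cases hp : -p.deg ∈ p.cone.semigroup
  · obtain ⟨g, hg, hg'⟩ := exists_boundary hs hc o p.cone (n + 1)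
      (f := Pi.single ⊤ (dualVal ⊤ p φ))
      (fun x hx => by
        by_cases hx' : x = ⊤
        · subst hx'; exact ⟨le_top, coneDeg_top⟩
        · exact absurd (Pi.single_eq_of_ne hx' _) hx) (fun z hz => by
        rw [Finset.sum_eq_single ⊤ (fun w _ hw => by rw [Pi.single_eq_of_ne hw, zero_mul])
          (by simp), Pi.single_eq_same]
        by_cases hz' : z = ⊤
        · subst hz'; rw [bdry_top, mul_zero]
        by_cases hzk : coneDeg z = -k
        · rw [← kosChain_dualToKos hs o k hp φ z hz hzk hz', h]
          exact kosChain_zero (i := k) z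
        · have : bdry o ⊤ z = 0 := by
            by_contra h3
            have := coneDeg_of_bdry_ne_zero o h3
            rw [coneDeg_top] at this
            omega
          rw [this, mul_zero])
    have h1 := hg' ⊤ le_top
    rw [Pi.single_eq_same] at h1
    rw [← h1]
    exact Finset.sum_eq_zero fun w _ => by rw [bdry_top, mul_zero]
  · exact dualVal_eq_zero (fun h => hp h.2) φ

/-- `𝒜^∨[n]`. -/
abbrev shiftedDual (Δ : Fan n) : CochainComplex (Cosheaf Δ) ℤ :=
  ((CochainComplex.singleFunctor (Cosheaf Δ) 0).obj (dual (structureSheaf Δ)))⟦(n : ℤ)⟧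

lemma shiftedDual_d (i j : ℤ) : (shiftedDual Δ).d i j = 0 := by
  refine (CochainComplex.shiftFunctor_obj_d' _ _ _ _).trans ?_
  exact smul_zero (A := (shiftedDual Δ).X i ⟶ (shiftedDual Δ).X j) _

/-- The term of degree `-n` of `𝒜^∨[n]`. -/
def shiftedDualXIso {i : ℤ} (hi : i = -n) : (shiftedDual Δ).X i ≅ dual (structureSheaf Δ) :=
  HomologicalComplex.singleObjXIsoOfEq (ComplexShape.up ℤ) 0 (dual (structureSheaf Δ)) (i + n)
    (by omega)

lemma isZero_shiftedDual {i : ℤ} (hi : i ≠ -n) : IsZero ((shiftedDual Δ).X i) :=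
  HomologicalComplex.isZero_single_obj_X (ComplexShape.up ℤ) 0 (dual (structureSheaf Δ)) (i + n)
    (by omega)

/-- The components of the comparison map. -/
def shiftedDualToKosApp (i : ℤ) : (shiftedDual Δ).X i ⟶ (kosComplex hs o).X i :=
  if hi : i = -n then (shiftedDualXIso hi).hom ≫ dualToKos hs o i else 0

/-- The comparison map `𝒜^∨[n] → C^•(𝒦 ⊗ 𝒜)`. -/
def shiftedDualToKos (hc : Δ.IsComplete) : shiftedDual Δ ⟶ kosComplex hs o where
  f i := shiftedDualToKosApp hs o i
  comm' i i' hi := by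
    rw [shiftedDual_d, zero_comp]
    unfold shiftedDualToKosApp
    by_cases h : i = -n
    · rw [dif_pos h, Category.assoc, dualToKos_d hs o hc hi h, comp_zero]
    · rw [dif_neg h, zero_comp]

lemma quasiIso_shiftedDualToKos (hc : Δ.IsComplete) : QuasiIso (shiftedDualToKos hs o hc) := by
  have hf : ∀ {i : ℤ} (hi : i = -n) {p : CosheafIdx Δ} (x : ((shiftedDual Δ).X i).obj p),
      (((shiftedDualToKos hs o hc).f i).app p).hom x =
        ((dualToKos hs o i).app p).hom (((shiftedDualXIso hi).hom.app p).hom x) := by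
    intro i hi p x
    have : (shiftedDualToKos hs o hc).f i = (shiftedDualXIso hi).hom ≫ dualToKos hs o i := dif_pos hi
    rw [this]
    rfl
  have hinv : ∀ {i : ℤ} (hi : i = -n) {p : CosheafIdx Δ} (x : ((shiftedDual Δ).X i).obj p),
      ((shiftedDualXIso hi).inv.app p).hom (((shiftedDualXIso hi).hom.app p).hom x) = x :=
    fun hi p x => congrArg (fun t => (t.app p).hom x) (shiftedDualXIso hi).hom_inv_id
  have hinv' : ∀ {i : ℤ} (hi : i = -n) {p : CosheafIdx Δ} (x : (dual (structureSheaf Δ)).obj p),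
      ((shiftedDualXIso hi).hom.app p).hom (((shiftedDualXIso hi).inv.app p).hom x) = x :=
    fun hi p x => congrArg (fun t => (t.app p).hom x) (shiftedDualXIso hi).inv_hom_id
  have hd : ∀ {i j : ℤ} {p : CosheafIdx Δ} (x : ((shiftedDual Δ).X i).obj p),
      (((shiftedDual Δ).d i j).app p).hom x = 0 := fun x => by
    rw [shiftedDual_d]; rfl
  refine quasiIso_functor _ fun p k x y hx hxy => ⟨⟨0, ?_⟩, fun hx0 => ?_⟩
  · rw [map_zero]
    symm
    by_cases hk : k + 1 = -n
    · have hy : y = 0 := eq_zero_of_isZero (isZero_koszulFunctor hs o _ (Or.inl (by omega))) y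
      rw [hy, map_zero, hf hk] at hxy
      rw [← hinv hk x, dualToKos_injective hs o hc hk _ hxy, map_zero]
    · exact eq_zero_of_isZero (isZero_shiftedDual hk) x
  · rw [hx0, map_zero] at hxy
    by_cases hk : -n ≤ k
    · obtain ⟨h1, h2⟩ := exists_kos_eq hs o hc y hxy.symm
      by_cases hk' : k = -n
      · obtain ⟨φ, hφ⟩ := h1 hk'
        refine ⟨((shiftedDualXIso hk').inv.app p).hom φ, 0, hd _, ?_⟩
        rw [hf hk', hinv', hφ, map_zero, add_zero]
      · obtain ⟨y', hy'⟩ := h2 hk'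
        exact ⟨0, y', hd _, by rw [map_zero, zero_add, hy']⟩
    · have hy : y = 0 := eq_zero_of_isZero (isZero_koszulFunctor hs o _ (Or.inl (by omega))) y
      exact ⟨0, 0, hd _, by rw [map_zero, map_zero, add_zero, hy]⟩

end DualComparison

end KoszulFan
end

noncomputable section

namespace KoszulFan

section BoundedTcf

variable {n : ℕ} {Δ : Fan n}

lemma boundedTcf_kosComplex (hs : Δ.IsSmooth) (o : Δ.Orientations) : boundedTcf Δ (kosComplex hs o) := by
  refine ⟨⟨-n, 0, fun i hi => isZero_koszulFunctor hs o _ hi⟩, fun i =>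
    Cosheaf.isTcf_of_stalks hs (Cosheaf.IsGradedTcf.of_injective (J := Δ.ConesOfDim i)
      (E := fun σ => tensorCosheaf σ.1 (structureSheaf Δ))
      (fun σ => biproduct.π (fun σ : Δ.ConesOfDim i => tensorCosheaf σ.1 (structureSheaf Δ)) σ)
      (fun σ => (isFreeStalk_structureSheaf σ.1).isGradedTcf) fun p c hc => ?_)⟩
  exact biproduct_ext (F := fun σ : Δ.ConesOfDim i => tensorCosheaf σ.1 (structureSheaf Δ))
    fun σ => (hc σ).trans (map_zero _).symm

lemma boundedTcf_shiftedDual (hs : Δ.IsSmooth) : boundedTcf Δ (shiftedDual Δ) := by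
  refine ⟨⟨-n, -n, fun i hi => isZero_shiftedDual (by omega)⟩, fun i =>
    Cosheaf.isTcf_of_stalks hs ?_⟩
  by_cases hi : i = -n
  · refine Cosheaf.IsGradedTcf.of_injective (J := Unit) (fun _ => (shiftedDualXIso hi).hom)
      (fun _ => isGradedTcf_dual_extZero ⊤) fun p c hc => ?_
    refine (congrArg (fun t => (t.app p).hom c) (shiftedDualXIso hi).hom_inv_id).symm.trans ?_
    exact (congrArg (((shiftedDualXIso hi).inv.app p).hom) (hc ())).trans (map_zero _)
  · exact Cosheaf.IsGradedTcf.of_injective (J := Empty) (E := fun _ => (shiftedDual Δ).X i)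
      (fun j => j.elim) (fun j => j.elim) fun p c _ => eq_zero_of_isZero (isZero_shiftedDual hi) c

lemma boundedTcf_koszulComplex (hs : Δ.IsSmooth) (o : Δ.Orientations)
    {P : CochainComplex (Sheaf Δ) ℤ} (hP : IsBounded P)
    (hP' : ∀ i, IsFreeRetract (P.X i)) : boundedTcf Δ (koszulComplex hs o P) := by
  have hK : ∀ i j, (j < -(n : ℤ) ∨ 0 < j) → IsZero (((koszulBicomplex hs o P).X i).X j) :=
    fun i j hj => isZero_koszulFunctor hs o (P.X i) hj
  obtain ⟨a, b, hab⟩ := hP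
  refine ⟨⟨a - n, b, fun k hk => ?_⟩, fun k => Cosheaf.isTcf_of_stalks hs ?_⟩
  · rw [IsZero.iff_id_eq_zero]
    refine tot_hom_ext (koszulBicomplex hs o P) fun i j h => IsZero.eq_of_src ?_ _ _
    by_cases hj : j < -(n : ℤ) ∨ 0 < j
    · exact hK i j hj
    · have h1 := (koszulFunctor hs o).map_isZero (hab i (by omega))
      exact (HomologicalComplex.eval _ _ j).map_isZero h1
  · refine Cosheaf.IsGradedTcf.of_injective
      (J := Σ j : Finset.Icc (-(n : ℤ)) 0, Δ.ConesOfDim j.1)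
      (E := fun s => tensorCosheaf s.2.1 (P.X (k - s.1.1)))
      (fun s => totπ (koszulBicomplex hs o P) (sub_add_cancel k s.1.1) ≫
        biproduct.π (fun σ : Δ.ConesOfDim s.1.1 => tensorCosheaf σ.1 (P.X (k - s.1.1))) s.2)
      (fun s => (hP' _).isGradedTcf_tensor s.2.1) fun p c hc => ?_
    refine tot_eq_zero hK c fun i j h hj => ?_
    obtain rfl : i = k - j := by omega
    by_cases hj' : j < -(n : ℤ)
    · exact eq_zero_of_isZero (hK _ j (Or.inl hj')) _
    · exact biproduct_ext (F := fun σ : Δ.ConesOfDim j => tensorCosheaf σ.1 (P.X (k - j)))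
        fun σ => (hc ⟨⟨j, Finset.mem_Icc.2 ⟨by omega, hj⟩⟩, σ⟩).trans (map_zero _).symm

/-- A quasi-isomorphism of bounded complexes of torsion cofinite cosheaves induces an isomorphism in
the derived category. -/
lemma nonempty_iso_of_quasiIso {K L : CochainComplex (Cosheaf Δ) ℤ} (f : K ⟶ L) [QuasiIso f]
    (hK : boundedTcf Δ K) (hL : boundedTcf Δ L) : Nonempty (toDbTcf K hK ≅ toDbTcf L hL) := by
  let g : (⟨K, hK⟩ : (boundedTcf Δ).FullSubcategory) ⟶ ⟨L, hL⟩ := ObjectProperty.homMk f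
  have hg : tcfQuasiIso Δ g := by
    show HomologicalComplex.quasiIso (Cosheaf Δ) (ComplexShape.up ℤ) f
    rw [HomologicalComplex.mem_quasiIso_iff]
    infer_instance
  exact ⟨Localization.isoOfHom (tcfQuasiIso Δ).Q (tcfQuasiIso Δ) g hg⟩

end BoundedTcf

end KoszulFan
end

theorem proposition3p7 (n : ℕ) (Δ : KoszulFan.Fan n) (hs : Δ.IsSmooth) (hc : Δ.IsComplete)
    (o : Δ.Orientations) :
    Nonempty (KoszulFan.FiniteProjectiveResolution
      ((CochainComplex.singleFunctor (KoszulFan.Sheaf Δ) 0).obj (KoszulFan.structureSheaf Δ))) ∧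
    ∀ P : KoszulFan.FiniteProjectiveResolution
        ((CochainComplex.singleFunctor (KoszulFan.Sheaf Δ) 0).obj (KoszulFan.structureSheaf Δ)),
      ∃ (h₁ : KoszulFan.boundedTcf Δ (KoszulFan.koszulComplex hs o P.complex))
        (h₂ : KoszulFan.boundedTcf Δ
          (((CochainComplex.singleFunctor (KoszulFan.Cosheaf Δ) 0).obj
            (KoszulFan.dual (KoszulFan.structureSheaf Δ)))⟦(n : ℤ)⟧)),
        Nonempty (KoszulFan.toDbTcf _ h₁ ≅ KoszulFan.toDbTcf _ h₂) := by
  refine ⟨⟨KoszulFan.lineResolution hs hc o⟩, fun P => ?_⟩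
  have hfree : ∀ i, KoszulFan.IsFreeRetract (P.complex.X i) := fun i =>
    have := P.projective i
    (P.fg i).isFreeRetract
  obtain ⟨a, b, hab⟩ := P.bounded
  have := P.quasiIso
  have hq := KoszulFan.quasiIso_koszulAug hs o P.π (d := b) (fun i hi => hab i (Or.inr hi))
    (fun i σ => (hfree i).projective_stalk σ)
  have hq' := KoszulFan.quasiIso_shiftedDualToKos hs o hc
  refine ⟨KoszulFan.boundedTcf_koszulComplex hs o P.bounded hfree,
    KoszulFan.boundedTcf_shiftedDual hs, ?_⟩
  obtain ⟨e⟩ := KoszulFan.nonempty_iso_of_quasiIso (KoszulFan.koszulAug hs o P.π).hom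
    (KoszulFan.boundedTcf_koszulComplex hs o P.bounded hfree)
    (KoszulFan.boundedTcf_kosComplex hs o)
  obtain ⟨e'⟩ := KoszulFan.nonempty_iso_of_quasiIso (KoszulFan.shiftedDualToKos hs o hc)
    (KoszulFan.boundedTcf_shiftedDual hs) (KoszulFan.boundedTcf_kosComplex hs o)
  exact ⟨e ≪≫ e'.symm⟩
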